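/- **Data.** Let $N\ge 0$, let $A\in\mathbb{Q}^{N\times N}$, $b\in\mathbb{Q}^N$, $c\in\mathbb{Q}$, $d\in\mathbb{Z}_{>0}^N$, put $D=\mathrm{diag}(d_1,\dots,d_N)$ and assume that $AD$ is symmetric positive definite. Write $Q=(A,b,c,d)$, $Q(n)=\tfrac12 n^{\mathsf T}ADn+n^{\mathsf T}b+c$, $\mathbf e(x)=e^{2\pi i x}$, $(x;q)_n=\prod_{j=0}^{n-1}(1-q^jx)$, $\mathrm{Li}_r(w)=\sum_{k\ge1}w^k/k^r$, and for $\Im\tau>0$ $$\tilde f_Q(\tau)=\sum_{n\in\mathbb{Z}_{\ge0}^N}\frac{\mathbf e(\tau Q(n))}{\prod_{i=1}^N(q^{d_i};q^{d_i})_{n_i}},\qquad q=\mathbf e(\tau).$$ A positive integer $\delta$ is a *strong denominator* of $Q$ if $Q(k)$ modulo $1$, for $k\in\mathbb{Z}^N$, depends only on $k$ modulo $\delta$. **Theorem.** Let $\delta$ be a strong denominator of $Q$, and let $\alpha\in\mathbb{Q}$ have denominator $m$ prime to $\delta$ and to $d_1,\dots,d_N$, and also to the denominators of $c$ and of the $b_i$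 (this is what makes the class of $Q(k)$ modulo $m$ well defined for $k\in(\mathbb{Z}/m\mathbb{Z})^N$). Put $\zeta=\mathbf e(\alpha)$ and $\zeta_i=\zeta^{d_i}$. The series $\tilde f_Q(\tau)$ converges absolutely for $\Im\tau>0$. The equations $1-z_i=\prod_{j}z_j^{A_{ij}}$ $(1\le i\le N)$ have a unique solution $z\in(0,1)^N$. Let $\theta_i=z_i^{1/m}\in(0,1)$, $\mathrm L(x)=\mathrm{Li}_2(x)+\frac12\log x\log(1-x)-\frac{\pi^2}{6}$, and $\Lambda=-\sum_i d_i^{-1}\mathrm L(z_i)$. Then there is $\eta\in(0,\pi/2)$ such that $$e^{-\frac{\Lambda}{m\varepsilon}}\,\tilde f_Q\Bigl(\alpha+\frac{i\varepsilon}{2\pi m}\Bigr)\sim m^{-N/2}\,\chi(d,\alpha)\,c(Q)\,G(Q,\alpha)\,S_{Q,\zeta}(\varepsilon)$$ as $\varepsilon\to0$ in the sector $|\arg\varepsilon|\le\eta$ (in particular radially, as $\varepsilon\to0^+$), in the sense that for every $K\ge 0$ the left-hand side differs from the sum of the terms of degree $<K$ of the power series on the right by $O(\varepsilon^K)$. Here: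 * $\chi(d,\alpha)=\prod_i\mathbf e\bigl(\tfrac12 s(p_i,q_i)\bigr)$ with $p_i/q_i=\alpha d_i$ in lowest terms, where $s(p,q)=\sum_{r\bmod q}((\tfrac rq))((\tfrac{pr}q))$, $((x))=x-\lfloor x\rfloor-\frac12$ for $x\notin\mathbb{Z}$ and $((x))=0$ for $x\in\mathbb{Z}$. * $c(Q)=(\det\widetilde A)^{-1/2}\prod_i\theta_i^{b_i/d_i}(1-z_i)^{\frac12-\frac1m}$ with $\widetilde A=A+\mathrm{diag}\bigl(\tfrac{z_i}{1-z_i}\bigr)$. * $G(Q,\alpha)=\delta^{-N}\sum_{k\in(\mathbb{Z}/\delta\mathbb{Z})^N}\mathbf e(\bar\alpha Q(k))$, where $\bar\alpha\in\mathbb{Z}$ is congruent to $\alpha$ modulo $\delta^2\,\mathrm{den}(c)$, a common denominator of the values of $Q$ on $\mathbb{Z}^N$ (if $\delta Q(\mathbb{Z}^N)\subseteq\mathbb{Z}$, only $\bar\alpha$ modulo $\delta$ matters). * $$S_{Q,\zeta}(\varepsilon)=\Bigl(\prod_i D_{\zeta_i}(\zeta_i\theta_i)^{-\frac1m}\Bigr)\sum_{k\in(\mathbb{Z}/m\mathbb{Z})^N}\zeta^{\overline{Q(k)}}\Bigl(\prod_i\frac{\theta_i^{(k^{\mathsf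 T}A)_i}}{(\zeta_i\theta_i;\zeta_i)_{k_i}}\Bigr)I_{Q,\zeta}(k,\varepsilon),$$ where $k_i$ is represented in $\{0,\dots,m-1\}$, $\overline{Q(k)}$ is the reduction of $Q(k)$ modulo $m$, and $D_\zeta(x)^{-1/m}=\prod_{t=1}^{m-1}(1-\zeta^tx)^{-t/m}$ with principal powers, which is the branch, holomorphic in $|x|<1$ and equal to $1$ at $x=0$, of the $(-1/m)$th power of $D_\zeta(x)=\prod_{t=1}^{m-1}(1-\zeta^tx)^t$. * $I_{Q,\zeta}(k,\varepsilon)\in\mathbb{C}[[\varepsilon]]$ is the formal Gaussian integral $$I_{Q,\zeta}(k,\varepsilon)=\mathbf I_{\frac1m\widetilde AD}\Bigl[e^{-\frac1mx^{\mathsf T}b\,\varepsilon^{1/2}-\frac1m(c+\frac{\mathrm{tr}D}{24})\varepsilon}\prod_{i=1}^N\exp\Bigl(\psi_{\zeta_i^{k_i}\theta_i,\zeta_i}(x_i\varepsilon^{-1/2},d_i\varepsilon)\Bigr)\Bigr],\quad \mathbf I_M[f]=\frac{\int_{\mathbb{R}^N}e^{-\frac12x^{\mathsf T}Mx}f(x)\,dx}{\int_{\mathbb{R}^N}e^{-\frac12x^{\mathsf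 T}Mx}\,dx},$$ obtained by expanding the integrand as a power series in $\varepsilon^{1/2}$ with coefficients in $\mathbb{C}[x_1,\dots,x_N]$ and integrating coefficientwise (the odd powers of $\varepsilon^{1/2}$ integrate to $0$), where, with the Bernoulli polynomials $B_r$ and the Kronecker symbol $\delta_{2,r}$, $$\psi_{w,\zeta}(\nu,\varepsilon)=-\sum_{r\ge2}\sum_{t=1}^m\Bigl(B_r\Bigl(1-\frac{t+\nu}m\Bigr)-\delta_{2,r}\frac{\nu^2}{m^2}\Bigr)\mathrm{Li}_{2-r}(\zeta^tw)\frac{\varepsilon^{r-1}}{r!}.$$ -/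

import Mathlib

open Filter Topology MeasureTheory Asymptotics
open scoped Real

noncomputable section

namespace Nahm

/-! ### Elementary special functions -/

/-- `𝐞(x) = exp(2πix)`. -/
def expi (x : ℂ) : ℂ := Complex.exp (2 * π * Complex.I * x)

/-- The finite `q`-Pochhammer symbol `(x; q)_n = ∏_{0 ≤ j < n} (1 - q ^ j x)`. -/
def qPoch (x q : ℂ) (n : ℕ) : ℂ := ∏ j ∈ Finset.range n, (1 - q ^ j * x)

/-- The polylogarithm `Li_r(w) = ∑_{k ≥ 1} w ^ k / k ^ r`, `|w| < 1`, for an integer `r`. -/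
def polylog {𝕜 : Type*} [NormedField 𝕜] (r : ℤ) (w : 𝕜) : 𝕜 :=
  ∑' k : ℕ, w ^ (k + 1) / ((k + 1 : ℕ) : 𝕜) ^ r

/-- The Rogers dilogarithm shifted by `π² / 6`. -/
def rogersL (z : ℝ) : ℝ :=
  polylog 2 z + 1 / 2 * Real.log z * Real.log (1 - z) - π ^ 2 / 6

/-- The saw wave function `((x))`. -/
def saw (x : ℚ) : ℚ := if x.den = 1 then 0 else x - ⌊x⌋ - 1 / 2

/-- The Dedekind sum `s(p, q)`. -/
def dedekindSum (p : ℤ) (q : ℕ) : ℚ :=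
  ∑ r ∈ Finset.range q, saw ((r : ℚ) / q) * saw ((p : ℚ) * r / q)

/-- The cyclic quantum dilogarithm `D_ζ(x) = ∏_{1 ≤ t ≤ m - 1} (1 - ζ ^ t x) ^ t`. -/
def cyclicDilog (m : ℕ) (ζ x : ℂ) : ℂ := ∏ t ∈ Finset.Ico 1 m, (1 - ζ ^ t * x) ^ t

/-- The power `D_ζ(x) ^ (-1/m)` for `|x| < 1`, `|ζ| = 1`, on the branch that is holomorphic in the
unit disc and equal to `1` at `x = 0`: each `1 - ζ ^ t x` has positive real part and its powers are
principal. -/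
def cyclicDilogInvRoot (m : ℕ) (ζ x : ℂ) : ℂ :=
  ∏ t ∈ Finset.Ico 1 m, (1 - ζ ^ t * x) ^ (-(t / m : ℂ))

theorem cyclicDilogInvRoot_pow {m : ℕ} (hm : m ≠ 0) (ζ x : ℂ) :
    cyclicDilogInvRoot m ζ x ^ m = (cyclicDilog m ζ x)⁻¹ := by
  rw [cyclicDilogInvRoot, cyclicDilog, ← Finset.prod_pow, ← Finset.prod_inv_distrib]
  refine Finset.prod_congr rfl fun t _ => ?_
  have hm' : (m : ℂ) ≠ 0 := Nat.cast_ne_zero.2 hm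
  rw [← Complex.cpow_nat_mul, mul_neg, mul_div_cancel₀ _ hm', Complex.cpow_neg,
    Complex.cpow_natCast]

/-- The reduction modulo `M` of a rational number whose denominator is prime to `M`. -/
def ratMod (M : ℕ) (x : ℚ) : ZMod M := (x.num : ZMod M) * (x.den : ZMod M)⁻¹

/-! ### Nahm sums -/

/-- A quadruple `Q = (A, b, c, d)` with `A D` symmetric positive definite, `D = diag(d)`. -/
structure Datum (N : ℕ) where
  A : Matrix (Fin N) (Fin N) ℚ
  b : Fin N → ℚ
  c : ℚ
  d : Fin N → ℕ
  d_pos : ∀ i, 0 < d i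
  posDef : ((A * Matrix.diagonal fun i => (d i : ℚ)).map fun a => (a : ℝ)).PosDef

namespace Datum

variable {N : ℕ} (Q : Datum N)

/-- `D = diag(d₁, …, d_N)`. -/
def D : Matrix (Fin N) (Fin N) ℚ := Matrix.diagonal fun i => (Q.d i : ℚ)

/-- `Q(n) = ½ nᵀ A D n + nᵀ b + c`. -/
def quad (n : Fin N → ℤ) : ℚ :=
  let x : Fin N → ℚ := fun i => n i
  1 / 2 * (x ⬝ᵥ ((Q.A * Q.D).mulVec x)) + x ⬝ᵥ Q.b + Q.c

/-- The term of index `n` of the Nahm sum at `q = exp(2πiτ)`, where `q ^ λ = exp(2πiτλ)`. -/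
def nahmTerm (τ : ℂ) (n : Fin N → ℕ) : ℂ :=
  expi (τ * (Q.quad fun i => (n i : ℤ))) /
    ∏ i, qPoch (expi (τ * Q.d i)) (expi (τ * Q.d i)) (n i)

/-- The Nahm sum as a function of `τ` in the upper half-plane. -/
def nahmSum (τ : ℂ) : ℂ := ∑' n : Fin N → ℕ, Q.nahmTerm τ n

/-- `z ∈ (0, 1)^N` is a solution of Nahm's equation `1 - z_i = ∏_j z_j ^ A_{ij}`. -/
def IsNahmSolution (z : Fin N → ℝ) : Prop :=
  (∀ i, 0 < z i ∧ z i < 1) ∧ ∀ i, 1 - z i = ∏ j, z j ^ (Q.A i j : ℝ)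

/-- `Λ = -∑ d_i⁻¹ L(z_i)`. -/
def Lam (z : Fin N → ℝ) : ℝ := -∑ i, (Q.d i : ℝ)⁻¹ * rogersL (z i)

/-- `δ ≥ 1` is a strong denominator if `Q(k)` modulo `1` depends only on `k` modulo `δ`. -/
def IsStrongDenominator (δ : ℕ) : Prop :=
  0 < δ ∧ ∀ k l : Fin N → ℤ, (∀ i, k i ≡ l i [ZMOD δ]) → ∃ n : ℤ, Q.quad k - Q.quad l = n

/-- The Gauss sum `G(Q, α) = δ^{-N} ∑_{k mod δ} 𝐞(ᾱ Q(k))`. Here `ᾱ` is an integer congruent to `α`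
modulo `δ² · den(c)`, which is a common denominator of all values `Q(k)` if `δ` is a strong
denominator; if already `δ Q(k) ∈ ℤ` for all `k`, only the class of `ᾱ` modulo `δ` matters. -/
def gaussSum (δ : ℕ) (α : ℚ) : ℂ :=
  ((δ : ℂ) ^ N)⁻¹ * ∑ k : Fin N → Fin δ,
    expi (((ratMod (δ ^ 2 * Q.c.den) α).val : ℂ) * (Q.quad fun i => ((k i : ℕ) : ℤ)))

/-- `χ(d, α) = ∏_i 𝐞(s(p_i, q_i) / 2)` with `p_i / q_i = α d_i` in lowest terms. -/
def chi (α : ℚ) : ℂ :=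
  ∏ i, expi ((dedekindSum (α * Q.d i).num (α * Q.d i).den / 2 : ℚ) : ℂ)

/-- `Ã = A + diag(z / (1 - z))`. -/
def Atilde (z : Fin N → ℝ) : Matrix (Fin N) (Fin N) ℝ :=
  Q.A.map (fun a => (a : ℝ)) + Matrix.diagonal fun i => z i / (1 - z i)

/-- `c(Q) = (det Ã)^{-1/2} ∏_i θ_i^{b_i/d_i} (1 - z_i)^{1/2 - 1/m}`, `θ_i = z_i^{1/m}`. -/
def cConst (m : ℕ) (z : Fin N → ℝ) : ℝ :=
  (Q.Atilde z).det ^ (-(1 / 2) : ℝ) *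
    ∏ i, (z i ^ (1 / m : ℝ)) ^ ((Q.b i : ℝ) / Q.d i) * (1 - z i) ^ (1 / 2 - 1 / m : ℝ)

end Datum

/-! ### Formal Gaussian integrals -/

/-- `𝐈_M[f] = ∫ exp(-½ xᵀ M x) f(x) dx / ∫ exp(-½ xᵀ M x) dx`. -/
def gaussAvg {N : ℕ} (M : Matrix (Fin N) (Fin N) ℝ) (f : (Fin N → ℝ) → ℂ) : ℂ :=
  (∫ x : Fin N → ℝ, (Real.exp (-(1 / 2) * (x ⬝ᵥ M.mulVec x)) : ℂ) * f x) /
    ∫ x : Fin N → ℝ, (Real.exp (-(1 / 2) * (x ⬝ᵥ M.mulVec x)) : ℂ)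

/-- The exponential `∑_j F ^ j / j!` of a formal power series without constant term (so that
`F ^ j` contributes to the coefficient of degree `n` only for `j ≤ n`). -/
def formalExp {R : Type*} [CommRing R] [Algebra ℚ R] (F : PowerSeries R) : PowerSeries R :=
  PowerSeries.mk fun n =>
    ∑ j ∈ Finset.range (n + 1), algebraMap ℚ R (1 / j.factorial) * PowerSeries.coeff n (F ^ j)

/-- The coefficient of `ε ^ (r - 1)` in `ψ_{w,ζ}(ν, ε)`, as a polynomial in `ν`:
`-∑_{t=1}^m (B_r(1 - (t + ν)/m) - δ_{2,r} ν²/m²) Li_{2-r}(ζ^t w) / r!`. -/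
def psiCoeff (m : ℕ) (w ζ : ℂ) (r : ℕ) : Polynomial ℂ :=
  -∑ t ∈ Finset.Icc 1 m,
    (((Polynomial.bernoulli r).map (algebraMap ℚ ℂ)).comp
        (1 - Polynomial.C (1 / m : ℂ) * (Polynomial.C (t : ℂ) + Polynomial.X)) -
      if r = 2 then Polynomial.C (1 / m ^ 2 : ℂ) * Polynomial.X ^ 2 else 0) *
    Polynomial.C (polylog (2 - r : ℤ) (ζ ^ t * w) / r.factorial)

/-- The formal power series `ψ_{w,ζ}(ν, ε)` in `ε`, with coefficients in `ℂ[ν]`. -/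
def psi (m : ℕ) (w ζ : ℂ) : PowerSeries (Polynomial ℂ) :=
  PowerSeries.mk fun n => if n = 0 then 0 else psiCoeff m w ζ (n + 1)

/-- For `F(ν, ε) = ∑_n F_n(ν) ε ^ n` with `deg F_n ≤ n + 1` for all `n`, the series
`F(x_i s⁻¹, d s²)` in `s` (that is, `s = ε^{1/2}`) with coefficients in `ℂ[x₁, …, x_N]`. The
monomial `ν ^ j ε ^ n` becomes `d ^ n x_i ^ j s ^ (2n - j)`, so the coefficient of `s ^ e` collects
the pairs `(n, j)` with `2 n = e + j`, and `j ≤ n + 1` forces `n ≤ e + 1`; the only monomial of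
negative degree in `s` that the bound on the degrees allows is `n = 0`, `j = 1`, which does not
occur in `ψ`. -/
def rescale {N : ℕ} (F : PowerSeries (Polynomial ℂ)) (d : ℕ) (i : Fin N) :
    PowerSeries (MvPolynomial (Fin N) ℂ) :=
  PowerSeries.mk fun e => ∑ n ∈ Finset.range (e + 2),
    if e ≤ 2 * n then
      MvPolynomial.C ((PowerSeries.coeff n F).coeff (2 * n - e) * (d : ℂ) ^ n) *
        MvPolynomial.X i ^ (2 * n - e)
    else 0

namespace Datum

variable {N : ℕ} (Q : Datum N)

/-- The integrand of `I_{Q,ζ}(k, ε)` as a power series in `s = ε^{1/2}` with coefficients in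
`ℂ[x₁, …, x_N]`. -/
def integrand (m : ℕ) (ζ : ℂ) (z : Fin N → ℝ) (k : Fin N → ℕ) :
    PowerSeries (MvPolynomial (Fin N) ℂ) :=
  formalExp
      (-PowerSeries.monomial 1
          (∑ i, MvPolynomial.C (1 / m * Q.b i : ℂ) * MvPolynomial.X i) -
        PowerSeries.monomial 2
          (MvPolynomial.C (1 / m * (Q.c + (∑ i, (Q.d i : ℂ)) / 24) : ℂ))) *
    ∏ i, formalExp
      (rescale (psi m ((ζ ^ Q.d i) ^ k i * ((z i ^ (1 / m : ℝ) : ℝ) : ℂ)) (ζ ^ Q.d i)) (Q.d i) i)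

/-- The formal Gaussian integral `I_{Q,ζ}(k, ε) ∈ ℂ⟦ε⟧`, taken coefficientwise. The coefficient of
`s ^ e` in the integrand has the parity of `e` as a polynomial in `x`, so that only the even powers
`s ^ (2j) = ε ^ j` have a non-zero Gaussian integral. -/
def gaussI (m : ℕ) (ζ : ℂ) (z : Fin N → ℝ) (k : Fin N → ℕ) : PowerSeries ℂ :=
  PowerSeries.mk fun j =>
    gaussAvg ((1 / m : ℝ) • (Q.Atilde z * Q.D.map fun a => (a : ℝ))) fun x =>
      MvPolynomial.eval (fun i => (x i : ℂ)) (PowerSeries.coeff (2 * j) (Q.integrand m ζ z k))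

/-- The power series `S_{Q,ζ}(ε)`; residues modulo `m` are represented by `0, …, m - 1`. -/
def S (m : ℕ) (ζ : ℂ) (z : Fin N → ℝ) : PowerSeries ℂ :=
  (∏ i, cyclicDilogInvRoot m (ζ ^ Q.d i) (ζ ^ Q.d i * ((z i ^ (1 / m : ℝ) : ℝ) : ℂ))) •
    ∑ k : Fin N → Fin m,
      (ζ ^ (ratMod m (Q.quad fun i => ((k i : ℕ) : ℤ))).val *
        ∏ i, (((z i ^ (1 / m : ℝ)) ^ (∑ j, ((k j : ℕ) : ℝ) * (Q.A j i : ℝ)) : ℝ) : ℂ) /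
          qPoch (ζ ^ Q.d i * ((z i ^ (1 / m : ℝ) : ℝ) : ℂ)) (ζ ^ Q.d i) (k i)) •
      Q.gaussI m ζ z fun i => (k i : ℕ)

end Datum

/-! ### Asymptotic expansions -/

/-- `g(ε) ~ ∑_j a_j ε ^ j` along the filter `l`: every truncation error is `O(ε ^ K)`. -/
def HasAsymptoticExpansion (g : ℂ → ℂ) (l : Filter ℂ) (a : PowerSeries ℂ) : Prop :=
  ∀ K : ℕ, (fun ε => g ε - ∑ j ∈ Finset.range K, PowerSeries.coeff j a * ε ^ j) =O[l]
    fun ε => ε ^ K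

/-- The closed sector `|arg ε| ≤ η` without its vertex. -/
def sector (η : ℝ) : Set ℂ := {ε | ε ≠ 0 ∧ |ε.arg| ≤ η}

end Nahm

end

open Finset (Icc Ico abs_sum_le_sum_abs card_univ induction_on inf'_le mem_Ico mem_range mem_sigma
  mem_univ mul_sum prod_congr prod_const prod_div_distrib prod_mul_distrib range range_one
  sum_Ico_eq_sum_range sum_add_distrib sum_bij' sum_comm sum_congr sum_const sum_div sum_eq_zero
  sum_insert sum_le_sum sum_mul sum_neg_distrib sum_nonneg sum_range_add_sum_Ico sum_range_succ
  sum_range_succ' sum_range_zero sum_sigma' sum_singleton sum_sub_distrib univ)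
open Real (add_one_le_exp cos cos_le_one exp_add exp_le_exp exp_log exp_lt_one_iff exp_nat_mul
  exp_neg exp_pos exp_sum exp_zero log log_neg norm_eq_abs norm_of_nonneg pi_pos rpow_def_of_pos
  rpow_mul rpow_neg sin sq_sqrt sqrt sqrt_eq_rpow sqrt_mul)
open Complex (I_im I_re I_sq abs_im_le_norm add_im add_re conj_im conj_re continuous_im
  div_natCast_re div_re exp_mul_I exp_sub im_ofReal_mul inv_re log_im mul_im natCast_im natCast_re
  neg_re normSq norm_conj norm_exp norm_exp_ofReal_mul_I norm_exp_sub_one_le norm_real ofReal_add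
  ofReal_cos ofReal_exp ofReal_im ofReal_inv ofReal_log ofReal_mul ofReal_natCast ofReal_neg
  ofReal_one ofReal_pow ofReal_prod ofReal_ratCast ofReal_re ofReal_sin ofReal_sub ofReal_sum
  ofReal_tsum one_re re_le_norm re_ofReal_mul real_smul slitPlane sub_im sub_re)
open PowerSeries (coeff coeff_C_mul coeff_mk coeff_monomial coeff_one coeff_smul monomial)
open scoped Complex

namespace Nahm

/-! ### The logarithm of the infinite Pochhammer symbol -/

/-- `-log (x; q)_∞ = ∑_{k ≥ 1} x ^ k / (k (1 - q ^ k))`. -/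
noncomputable def lq (q x : ℂ) : ℂ := ∑' k : ℕ, x ^ (k + 1) / (((k + 1 : ℕ) : ℂ) * (1 - q ^ (k + 1)))

theorem one_sub_norm_le_norm_one_sub_pow {q : ℂ} (hq : ‖q‖ < 1) (k : ℕ) :
    1 - ‖q‖ ≤ ‖1 - q ^ (k + 1)‖ := by
  have h1 : ‖q ^ (k + 1)‖ ≤ ‖q‖ := by
    rw [norm_pow]; exact pow_le_of_le_one (norm_nonneg _) hq.le (by omega)
  have h2 := norm_sub_norm_le (1 : ℂ) (q ^ (k + 1))
  rw [norm_one] at h2; linarith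

theorem one_sub_pow_ne_zero {q : ℂ} (hq : ‖q‖ < 1) (k : ℕ) : 1 - q ^ (k + 1) ≠ 0 := by
  have := one_sub_norm_le_norm_one_sub_pow hq k
  exact norm_pos_iff.1 (by linarith)

theorem norm_lq_term_le {q x : ℂ} (hq : ‖q‖ < 1) (k : ℕ) :
    ‖x ^ (k + 1) / (((k + 1 : ℕ) : ℂ) * (1 - q ^ (k + 1)))‖ ≤ ‖x‖ ^ (k + 1) / (1 - ‖q‖) := by
  have h0 : 0 < 1 - ‖q‖ := by linarith
  rw [norm_div, norm_mul, norm_pow, Complex.norm_natCast]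
  have h1 : (1 : ℝ) ≤ ((k + 1 : ℕ) : ℝ) := by push_cast; linarith [k.cast_nonneg (α := ℝ)]
  gcongr
  calc 1 - ‖q‖ = 1 * (1 - ‖q‖) := by ring
    _ ≤ _ := mul_le_mul h1 (one_sub_norm_le_norm_one_sub_pow hq k) h0.le (by positivity)

theorem summable_lq {q x : ℂ} (hq : ‖q‖ < 1) (hx : ‖x‖ < 1) :
    Summable fun k : ℕ => x ^ (k + 1) / (((k + 1 : ℕ) : ℂ) * (1 - q ^ (k + 1))) := by
  refine Summable.of_norm_bounded (g := fun k => ‖x‖ ^ (k + 1) / (1 - ‖q‖)) ?_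
    fun k => norm_lq_term_le hq k
  exact ((summable_nat_add_iff 1).2 (summable_geometric_of_lt_one (norm_nonneg _) hx)).div_const _

theorem norm_lq_le {q x : ℂ} (hq : ‖q‖ < 1) (hx : ‖x‖ < 1) :
    ‖lq q x‖ ≤ ‖x‖ / (1 - ‖x‖) / (1 - ‖q‖) := by
  have h : HasSum (fun k : ℕ => ‖x‖ ^ (k + 1) / (1 - ‖q‖)) (‖x‖ / (1 - ‖x‖) / (1 - ‖q‖)) := by
    have := ((hasSum_geometric_of_lt_one (norm_nonneg _) hx).mul_left ‖x‖).div_const (1 - ‖q‖)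
    simpa only [pow_succ', div_eq_mul_inv] using this
  exact tsum_of_norm_bounded h fun k => norm_lq_term_le hq k

theorem tendsto_lq_zero {q : ℂ} (hq : ‖q‖ < 1) : Tendsto (lq q) (𝓝 0) (𝓝 0) := by
  rw [tendsto_zero_iff_norm_tendsto_zero]
  have h1 : Tendsto (fun x : ℂ => ‖x‖ / (1 - ‖x‖) / (1 - ‖q‖)) (𝓝 0) (𝓝 0) := by
    have : ContinuousAt (fun x : ℂ => ‖x‖ / (1 - ‖x‖) / (1 - ‖q‖)) 0 := by
      refine ContinuousAt.div_const (ContinuousAt.div ?_ ?_ ?_) _ <;> first | fun_prop | simp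
    simpa [ContinuousAt] using this
  refine squeeze_zero' (Eventually.of_forall fun _ => norm_nonneg _) ?_ h1
  filter_upwards [Metric.ball_mem_nhds (0 : ℂ) one_pos] with x hx
  exact norm_lq_le hq (by simpa using hx)

theorem lq_sub_lq_mul {q x : ℂ} (hq : ‖q‖ < 1) (hx : ‖x‖ < 1) :
    lq q x - lq q (q * x) = -Complex.log (1 - x) := by
  have hqx : ‖q * x‖ < 1 := by
    rw [norm_mul]; nlinarith [norm_nonneg q, norm_nonneg x]
  rw [lq, lq, ← (summable_lq hq hx).tsum_sub (summable_lq hq hqx)]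
  have h := Complex.hasSum_taylorSeries_neg_log hx
  rw [← hasSum_nat_add_iff' 1] at h
  simp only [range_one, sum_singleton, pow_zero, CharP.cast_eq_zero, div_zero,
    sub_zero] at h
  rw [← h.tsum_eq]
  refine tsum_congr fun k => ?_
  have h1 := one_sub_pow_ne_zero hq k
  have h2 : ((k + 1 : ℕ) : ℂ) ≠ 0 := Nat.cast_ne_zero.2 (by omega)
  rw [mul_pow, ← sub_div, div_eq_div_iff (mul_ne_zero h2 h1) h2]
  ring

theorem one_sub_ne_zero_of_norm_lt_one {x : ℂ} (hx : ‖x‖ < 1) : 1 - x ≠ 0 := by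
  intro h; rw [sub_eq_zero] at h; rw [← h] at hx; simp at hx

theorem exp_lq_mul {q x : ℂ} (hq : ‖q‖ < 1) (hx : ‖x‖ < 1) :
    cexp (lq q (q * x)) = (1 - x) * cexp (lq q x) := by
  have h := lq_sub_lq_mul hq hx
  rw [show lq q (q * x) = Complex.log (1 - x) + lq q x by linear_combination -h, Complex.exp_add,
    Complex.exp_log (one_sub_ne_zero_of_norm_lt_one hx)]

theorem qPoch_succ (x q : ℂ) (n : ℕ) : qPoch x q (n + 1) = qPoch x q n * (1 - q ^ n * x) :=
  Finset.prod_range_succ _ _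

@[simp] theorem qPoch_zero (x q : ℂ) : qPoch x q 0 = 1 := rfl

theorem norm_pow_mul_lt_one {q x : ℂ} (hq : ‖q‖ < 1) (hx : ‖x‖ < 1) (n : ℕ) : ‖q ^ n * x‖ < 1 := by
  rw [norm_mul, norm_pow]
  have := pow_le_one₀ (n := n) (norm_nonneg q) hq.le
  nlinarith [norm_nonneg x, pow_nonneg (norm_nonneg q) n]

theorem exp_lq_pow_mul {q x : ℂ} (hq : ‖q‖ < 1) (hx : ‖x‖ < 1) (n : ℕ) :
    cexp (lq q (q ^ n * x)) = qPoch x q n * cexp (lq q x) := by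
  induction n with
  | zero => simp
  | succ n ih =>
    rw [pow_succ', mul_assoc, exp_lq_mul hq (norm_pow_mul_lt_one hq hx n), ih, qPoch_succ]; ring

theorem qPoch_ne_zero {q x : ℂ} (hq : ‖q‖ < 1) (hx : ‖x‖ < 1) (n : ℕ) : qPoch x q n ≠ 0 :=
  Finset.prod_ne_zero_iff.2 fun j _ => one_sub_ne_zero_of_norm_lt_one (norm_pow_mul_lt_one hq hx j)

theorem inv_qPoch_self {q : ℂ} (hq : ‖q‖ < 1) (n : ℕ) :
    (qPoch q q n)⁻¹ = cexp (lq q q) * cexp (-lq q (q ^ n * q)) := by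
  rw [Complex.exp_neg, exp_lq_pow_mul hq hq]
  have := qPoch_ne_zero hq hq n
  field_simp

theorem qPoch_self_succ (q : ℂ) (n : ℕ) : qPoch q q (n + 1) = qPoch q q n * (1 - q ^ (n + 1)) := by
  rw [qPoch_succ, pow_succ]

/-! ### The `q`-binomial theorem -/

theorem summable_norm_pow_div_qPoch {q x : ℂ} (hq : ‖q‖ < 1) (hx : ‖x‖ < 1) :
    Summable fun n : ℕ => ‖x ^ n / qPoch q q n‖ := by
  by_cases hx0 : x = 0
  · refine summable_of_ne_finset_zero (s := {0}) fun n hn => ?_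
    simp [hx0, show n ≠ 0 by simpa using hn]
  have hlim : Tendsto (fun n : ℕ => ‖x / (1 - q ^ (n + 1))‖) atTop (𝓝 ‖x‖) := by
    have h1 : Tendsto (fun n : ℕ => q ^ (n + 1)) atTop (𝓝 0) :=
      (tendsto_pow_atTop_nhds_zero_of_norm_lt_one hq).comp (tendsto_add_atTop_nat 1)
    have h2 := ((tendsto_const_nhds (x := x)).div ((tendsto_const_nhds (x := (1 : ℂ))).sub h1)
      (by simp)).norm
    simpa using h2
  have hne : ∀ n : ℕ, x ^ n / qPoch q q n ≠ 0 := fun n =>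
    div_ne_zero (pow_ne_zero _ hx0) (qPoch_ne_zero hq hq n)
  refine (summable_of_ratio_test_tendsto_lt_one (α := ℂ) hx (Eventually.of_forall hne) ?_).norm
  refine hlim.congr fun n => ?_
  rw [← norm_div]
  congr 1
  have h1 := one_sub_pow_ne_zero hq n
  have h2 := qPoch_ne_zero hq hq n
  have h3 : x ^ n ≠ 0 := pow_ne_zero _ hx0
  rw [qPoch_self_succ, pow_succ x n]
  field_simp

theorem qBinomial_mul {q x : ℂ} (hq : ‖q‖ < 1) (hx : ‖x‖ < 1) :
    ∑' n : ℕ, (q * x) ^ n / qPoch q q n = (1 - x) * ∑' n : ℕ, x ^ n / qPoch q q n := by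
  have hs := (summable_norm_pow_div_qPoch hq hx).of_norm
  have hqx : ‖q * x‖ < 1 := by
    rw [norm_mul]; nlinarith [norm_nonneg q, norm_nonneg x]
  have hs' := (summable_norm_pow_div_qPoch hq hqx).of_norm
  have h1 : ∑' n : ℕ, (x ^ n / qPoch q q n - (q * x) ^ n / qPoch q q n)
      = x * ∑' n : ℕ, x ^ n / qPoch q q n := by
    rw [(hs.sub hs').tsum_eq_zero_add, ← tsum_mul_left]
    simp only [pow_zero, sub_self, zero_add]
    refine tsum_congr fun n => ?_
    have h1 := one_sub_pow_ne_zero hq n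
    have h2 := qPoch_ne_zero hq hq n
    rw [qPoch_self_succ]
    field_simp
    ring
  rw [hs.tsum_sub hs'] at h1
  linear_combination -h1

theorem tsum_pow_div_qPoch {q x : ℂ} (hq : ‖q‖ < 1) (hx : ‖x‖ < 1) :
    ∑' n : ℕ, x ^ n / qPoch q q n = cexp (lq q x) := by
  set P : ℂ → ℂ := fun x => ∑' n : ℕ, x ^ n / qPoch q q n with hP
  have hiter : ∀ M : ℕ, P (q ^ M * x) = qPoch x q M * P x := by
    intro M
    induction M with
    | zero => simp
    | succ M ih =>
      rw [pow_succ', mul_assoc, hP]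
      simp only
      rw [qBinomial_mul hq (norm_pow_mul_lt_one hq hx M)]
      change _ * P (q ^ M * x) = _
      rw [ih, qPoch_succ]; ring
  have hz : Tendsto (fun M : ℕ => q ^ M * x) atTop (𝓝 0) := by
    simpa using (tendsto_pow_atTop_nhds_zero_of_norm_lt_one hq).mul_const x
  have hPc : Tendsto P (𝓝 0) (𝓝 1) := by
    have hh : Summable fun n : ℕ => ‖(1 / 2 : ℂ) ^ n / qPoch q q n‖ :=
      summable_norm_pow_div_qPoch hq (by norm_num)
    have : ContinuousOn P (Metric.ball 0 (1 / 2)) := by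
      refine continuousOn_tsum (fun n => by fun_prop) hh fun n y hy => ?_
      rw [norm_div, norm_div, norm_pow, norm_pow]
      have : ‖y‖ ≤ ‖(1 / 2 : ℂ)‖ := by
        have := mem_ball_zero_iff.1 hy
        norm_num at this ⊢; linarith
      gcongr
    have h0 := (this.continuousAt (Metric.ball_mem_nhds 0 (by norm_num))).tendsto
    have hP0 : P 0 = 1 := by
      simp only [hP]
      rw [tsum_eq_single 0 (fun n hn => by simp [hn])]; simp
    rwa [hP0] at h0
  have l1 := hPc.comp hz
  have l2 := (Complex.continuous_exp.tendsto 0).comp ((tendsto_lq_zero hq).comp hz)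
  have hne : ∀ M : ℕ, P (q ^ M * x) = cexp (lq q (q ^ M * x)) *
      (P x / cexp (lq q x)) := fun M => by
    rw [hiter, exp_lq_pow_mul hq hx]
    field_simp
  have l3 : Tendsto (fun M : ℕ => P (q ^ M * x)) atTop (𝓝 (1 * (P x / cexp (lq q x)))) := by
    have := (l2.mul_const (P x / cexp (lq q x)))
    simp only [Complex.exp_zero] at this
    exact this.congr fun M => (hne M).symm
  have := tendsto_nhds_unique l1 l3
  field_simp at this
  exact this.symm

/-! ### Coefficient extraction with roots of unity -/

theorem expi_add (x y : ℂ) : expi (x + y) = expi x * expi y := by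
  simp only [expi, mul_add, Complex.exp_add]

theorem expi_int (n : ℤ) : expi n = 1 := by
  rw [expi, mul_comm, Complex.exp_int_mul_two_pi_mul_I]

theorem expi_nat_mul (n : ℕ) (x : ℂ) : expi (n * x) = expi x ^ n := by
  rw [expi, expi, ← Complex.exp_nat_mul]; congr 1; ring

theorem expi_neg (x : ℂ) : expi (-x) = (expi x)⁻¹ := by
  rw [expi, expi, ← Complex.exp_neg]; congr 1; ring

theorem norm_expi_real (x : ℝ) : ‖expi x‖ = 1 := by
  rw [expi, show 2 * π * Complex.I * x = ((2 * π * x : ℝ) : ℂ) * Complex.I by push_cast; ring,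
    norm_exp_ofReal_mul_I]

theorem norm_expi_rat (x : ℚ) : ‖expi x‖ = 1 := by
  simpa using norm_expi_real (x : ℝ)

theorem expi_ne_zero (x : ℂ) : expi x ≠ 0 := Complex.exp_ne_zero _

theorem expi_zero : expi 0 = 1 := by simp [expi]

theorem expi_eq_one_iff_int (x : ℚ) : expi x = 1 ↔ ∃ n : ℤ, x = n := by
  rw [expi, Complex.exp_eq_one_iff]
  constructor
  · rintro ⟨n, hn⟩
    refine ⟨n, ?_⟩
    have h : (2 * π * Complex.I : ℂ) ≠ 0 := Complex.two_pi_I_ne_zero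
    have : (x : ℂ) = n := mul_left_cancel₀ h (by linear_combination hn)
    exact_mod_cast this
  · rintro ⟨n, rfl⟩
    exact ⟨n, by push_cast; ring⟩

theorem expi_eq_of_sub_int {x y : ℚ} (h : ∃ n : ℤ, x - y = n) : expi x = expi y := by
  obtain ⟨n, hn⟩ := h
  rw [show (x : ℂ) = y + (n : ℤ) by exact_mod_cast (by linarith : x = y + n), expi_add, expi_int,
    mul_one]

/-- Orthogonality of the characters of `ℤ/L`. -/
theorem sum_expi_div (L : ℕ) (hL : 0 < L) (a : ℤ) :
    ∑ l ∈ range L, expi ((l * a / L : ℚ) : ℂ) = if (L : ℤ) ∣ a then (L : ℂ) else 0 := by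
  have hL' : (L : ℚ) ≠ 0 := by positivity
  have hpow : ∀ l : ℕ, expi ((l * a / L : ℚ) : ℂ) = expi ((a / L : ℚ) : ℂ) ^ l := fun l => by
    rw [← expi_nat_mul]; congr 1; push_cast; ring
  simp_rw [hpow]
  split_ifs with h
  · have : expi ((a / L : ℚ) : ℂ) = 1 := by
      rw [expi_eq_one_iff_int]
      obtain ⟨b, rfl⟩ := h
      exact ⟨b, by push_cast; field_simp⟩
    rw [this]; simp
  · have hne : expi ((a / L : ℚ) : ℂ) ≠ 1 := by
      rw [Ne, expi_eq_one_iff_int]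
      rintro ⟨n, hn⟩
      apply h
      refine ⟨n, ?_⟩
      field_simp at hn
      exact_mod_cast hn
    rw [geom_sum_eq hne, ← hpow]
    have : expi ((L * a / L : ℚ) : ℂ) = 1 := by
      rw [expi_eq_one_iff_int]; exact ⟨a, by field_simp⟩
    rw [this]; simp

/-- The part of a power series with exponents in a residue class. -/
theorem tsum_residue_class {a : ℕ → ℂ} {x : ℂ} (L : ℕ) (hL : 0 < L) (k : ℤ)
    (hs : Summable fun n => ‖x ^ n * a n‖) :
    ∑' n : ℕ, (if (L : ℤ) ∣ n - k then x ^ n * a n else 0) =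
      (L : ℂ)⁻¹ * ∑ l ∈ range L, expi (-(l * k / L : ℚ) : ℚ) *
        ∑' n : ℕ, (expi ((l / L : ℚ) : ℂ) * x) ^ n * a n := by
  have hL' : (L : ℂ) ≠ 0 := by exact_mod_cast hL.ne'
  have hn : ∀ l n : ℕ, ‖(expi ((l / L : ℚ) : ℂ) * x) ^ n * a n‖ = ‖x ^ n * a n‖ := fun l n => by
    rw [mul_pow, mul_assoc, norm_mul, norm_pow, norm_expi_rat, one_pow, one_mul]
  have hs' : ∀ l : ℕ, Summable fun n => (expi ((l / L : ℚ) : ℂ) * x) ^ n * a n := fun l =>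
    Summable.of_norm (by simpa only [hn] using hs)
  simp_rw [← tsum_mul_left]
  rw [← Summable.tsum_finsetSum fun l _ => (hs' l).mul_left _, ← tsum_mul_left]
  refine tsum_congr fun n => ?_
  have := sum_expi_div L hL (n - k)
  have h2 : ∀ l ∈ range L, expi (-(l * k / L : ℚ) : ℚ) *
      ((expi ((l / L : ℚ) : ℂ) * x) ^ n * a n) =
      expi ((l * ((n - k : ℤ) : ℚ) / L : ℚ) : ℂ) * (x ^ n * a n) := fun l _ => by
    rw [mul_pow, ← expi_nat_mul, ← mul_assoc, ← mul_assoc, ← expi_add]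
    rw [mul_assoc]
    congr 2
    push_cast; ring
  rw [sum_congr rfl h2, ← sum_mul, this]
  split_ifs
  · field_simp
  · simp

/-- The Cauchy estimate for the coefficients of an absolutely convergent power series. -/
theorem norm_coeff_le_of_norm_tsum_le {a : ℕ → ℂ} {r C : ℝ} (hr : 0 < r)
    (hs : Summable fun n => ‖(r : ℂ) ^ n * a n‖)
    (hC : ∀ x : ℂ, ‖x‖ = r → ‖∑' n : ℕ, x ^ n * a n‖ ≤ C) (n : ℕ) : ‖a n‖ ≤ C * (r ^ n)⁻¹ := by
  have hnorm : ∀ l L : ℕ, ‖expi ((l / L : ℚ) : ℂ) * (r : ℂ)‖ = r := fun l L => by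
    rw [norm_mul, norm_expi_rat, one_mul, norm_real, norm_of_nonneg hr.le]
  have hbd : ∀ L : ℕ, 0 < L →
      ‖∑' j : ℕ, (if (L : ℤ) ∣ j - (n : ℤ) then (r : ℂ) ^ j * a j else 0)‖ ≤ C := by
    intro L hL
    have hL' : (0 : ℝ) < L := by exact_mod_cast hL
    rw [tsum_residue_class L hL n hs, norm_mul, norm_inv, Complex.norm_natCast]
    have : ‖∑ l ∈ range L, expi (-(l * (n : ℤ) / L : ℚ) : ℚ) *
        ∑' j : ℕ, (expi ((l / L : ℚ) : ℂ) * (r : ℂ)) ^ j * a j‖ ≤ ∑ l ∈ range L, C := by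
      refine norm_sum_le_of_le _ fun l _ => ?_
      rw [norm_mul, norm_expi_rat, one_mul]
      exact hC _ (hnorm l L)
    rw [sum_const, Finset.card_range, nsmul_eq_mul] at this
    rw [inv_mul_le_iff₀ hL']
    exact this
  have hlim : Tendsto (fun L : ℕ => ∑' j : ℕ, (if (L : ℤ) ∣ j - (n : ℤ) then (r : ℂ) ^ j * a j
      else 0)) atTop (𝓝 (∑' j : ℕ, if j = n then (r : ℂ) ^ j * a j else 0)) := by
    refine tendsto_tsum_of_dominated_convergence hs (fun j => ?_) (Eventually.of_forall fun L j => ?_)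
    · refine tendsto_const_nhds.congr' ?_
      filter_upwards [eventually_gt_atTop (j + n)] with L hL
      by_cases h : j = n
      · simp [h]
      · have : ¬ (L : ℤ) ∣ j - n := fun hd => by
          have := Int.eq_zero_of_abs_lt_dvd hd (by rw [abs_lt]; constructor <;> omega)
          omega
        simp [h, this]
    · split_ifs <;> simp only [le_refl, norm_zero, norm_nonneg]
  rw [tsum_ite_eq] at hlim
  have h := le_of_tendsto hlim.norm (by
    filter_upwards [eventually_gt_atTop 0] with L hL using hbd L hL)
  rw [norm_mul, norm_pow, norm_real, norm_of_nonneg hr.le] at h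
  have hrn : 0 < r ^ n := pow_pos hr n
  rw [← div_eq_mul_inv, le_div_iff₀ hrn]
  linarith

theorem norm_inv_qPoch_le {q : ℂ} (hq : ‖q‖ < 1) {r C : ℝ} (hr : 0 < r) (hr1 : r < 1)
    (hC : ∀ x : ℂ, ‖x‖ = r → ‖cexp (lq q x)‖ ≤ C) (n : ℕ) :
    ‖(qPoch q q n)⁻¹‖ ≤ C * (r ^ n)⁻¹ := by
  have hr' : ‖(r : ℂ)‖ < 1 := by rwa [norm_real, norm_of_nonneg hr.le]
  refine norm_coeff_le_of_norm_tsum_le (a := fun n => (qPoch q q n)⁻¹) hr ?_ (fun x hx => ?_) n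
  · simpa only [div_eq_mul_inv] using summable_norm_pow_div_qPoch hq hr'
  · have := tsum_pow_div_qPoch hq (x := x) (by rwa [hx])
    simp only [div_eq_mul_inv] at this
    rw [this]
    exact hC x hx

/-! ### Polylogarithms -/

theorem summable_norm_polylog {𝕜 : Type*} [RCLike 𝕜] (r : ℤ) {w : 𝕜} (hw : ‖w‖ < 1) :
    Summable fun k : ℕ => ‖w ^ (k + 1) / ((k + 1 : ℕ) : 𝕜) ^ r‖ := by
  have h := (summable_nat_add_iff 1).2
    (summable_norm_pow_mul_geometric_of_norm_lt_one (R := 𝕜) r.natAbs hw)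
  refine Summable.of_nonneg_of_le (fun _ => norm_nonneg _) (fun k => ?_) h
  have h1 : (1 : ℝ) ≤ ((k + 1 : ℕ) : ℝ) := by push_cast; linarith [k.cast_nonneg (α := ℝ)]
  rw [norm_div, norm_zpow, norm_mul, norm_pow, norm_pow, RCLike.norm_natCast, div_eq_mul_inv,
    mul_comm, ← zpow_neg]
  have h2 : ((k + 1 : ℕ) : ℝ) ^ (-r) ≤ ((k + 1 : ℕ) : ℝ) ^ r.natAbs := by
    rw [← zpow_natCast]; exact zpow_le_zpow_right₀ h1 (by omega)
  gcongr

theorem summable_polylog {𝕜 : Type*} [RCLike 𝕜] (r : ℤ) {w : 𝕜} (hw : ‖w‖ < 1) :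
    Summable fun k : ℕ => w ^ (k + 1) / ((k + 1 : ℕ) : 𝕜) ^ r :=
  (summable_norm_polylog r hw).of_norm

theorem polylog_ofReal (r : ℤ) (z : ℝ) : ((polylog r z : ℝ) : ℂ) = polylog r (z : ℂ) := by
  rw [polylog, polylog, ofReal_tsum]
  refine tsum_congr fun k => ?_
  push_cast; rfl

theorem polylog_one {w : ℂ} (hw : ‖w‖ < 1) : polylog 1 w = -Complex.log (1 - w) := by
  have h := Complex.hasSum_taylorSeries_neg_log hw
  rw [← hasSum_nat_add_iff' 1] at h
  simp only [range_one, sum_singleton, pow_zero, CharP.cast_eq_zero, div_zero,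
    sub_zero] at h
  rw [← h.tsum_eq, polylog]
  simp

theorem polylog_zero {w : ℂ} (hw : ‖w‖ < 1) : polylog 0 w = w / (1 - w) := by
  have h := (hasSum_geometric_of_norm_lt_one hw).mul_left w
  rw [polylog, div_eq_mul_inv, ← h.tsum_eq]
  simp [pow_succ']

theorem tsum_dvd_succ {m : ℕ} (hm : 0 < m) (f : ℕ → ℂ) :
    ∑' k : ℕ, (if m ∣ k + 1 then f (k + 1) else 0) = ∑' j : ℕ, f (m * (j + 1)) := by
  have hinj : Function.Injective fun j : ℕ => m * (j + 1) - 1 := fun a b hab => by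
    have h1 : 0 < m * (a + 1) := by positivity
    have h2 : 0 < m * (b + 1) := by positivity
    have : m * (a + 1) = m * (b + 1) := by simp only at hab; omega
    have := Nat.eq_of_mul_eq_mul_left hm this
    omega
  rw [← hinj.tsum_eq]
  · refine tsum_congr fun j => ?_
    have h1 : 0 < m * (j + 1) := by positivity
    simp only [Nat.sub_add_cancel h1, dvd_mul_right, if_true]
  · intro k hk
    rw [Function.mem_support] at hk
    have hd : m ∣ k + 1 := by by_contra h; simp [h] at hk
    obtain ⟨j, hj⟩ := hd
    have hj0 : j ≠ 0 := fun h => by simp [h] at hj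
    exact ⟨j - 1, by simp only; rw [Nat.sub_add_cancel (Nat.pos_of_ne_zero hj0), ← hj]; simp⟩

/-- Distribution relation for polylogarithms. -/
theorem sum_polylog_rootsOfUnity {m : ℕ} (hm : 0 < m) {ζ : ℂ} (hζ : IsPrimitiveRoot ζ m) (r : ℤ)
    {w : ℂ} (hw : ‖w‖ < 1) :
    ∑ t ∈ Icc 1 m, polylog r (ζ ^ t * w) = (m : ℂ) ^ (1 - r) * polylog r (w ^ m) := by
  have hζn : ‖ζ‖ = 1 := hζ.norm'_eq_one hm.ne'
  have hm' : (m : ℂ) ≠ 0 := by exact_mod_cast hm.ne'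
  have hs : ∀ t ∈ Icc 1 m, Summable fun k : ℕ =>
      (ζ ^ t * w) ^ (k + 1) / ((k + 1 : ℕ) : ℂ) ^ r := fun t _ =>
    summable_polylog r (by rw [norm_mul, norm_pow, hζn]; simpa using hw)
  simp only [polylog]
  rw [← Summable.tsum_finsetSum hs]
  have h1 : ∀ k : ℕ, ∑ t ∈ Icc 1 m, (ζ ^ t * w) ^ (k + 1) / ((k + 1 : ℕ) : ℂ) ^ r =
      if m ∣ k + 1 then (m : ℂ) * (w ^ (k + 1) / ((k + 1 : ℕ) : ℂ) ^ r) else 0 := by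
    intro k
    have e1 : ∀ t ∈ Icc 1 m, (ζ ^ t * w) ^ (k + 1) / ((k + 1 : ℕ) : ℂ) ^ r =
        (ζ ^ (k + 1)) ^ t * (w ^ (k + 1) / ((k + 1 : ℕ) : ℂ) ^ r) := fun t _ => by
      rw [mul_pow, ← pow_mul, ← pow_mul, mul_comm t, mul_div_assoc]
    rw [sum_congr rfl e1, ← sum_mul]
    have e2 : ∑ t ∈ Icc 1 m, (ζ ^ (k + 1)) ^ t =
        ζ ^ (k + 1) * ∑ t ∈ range m, (ζ ^ (k + 1)) ^ t := by
      rw [mul_sum, ← Finset.Ico_add_one_right_eq_Icc, sum_Ico_eq_sum_range]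
      refine sum_congr (by simp) fun t _ => by rw [pow_add, pow_one]
    rw [e2]
    split_ifs with h
    · rw [(hζ.pow_eq_one_iff_dvd _).2 h]; simp
    · have hne : ζ ^ (k + 1) ≠ 1 := fun h' => h ((hζ.pow_eq_one_iff_dvd _).1 h')
      rw [geom_sum_eq hne, ← pow_mul, mul_comm (k + 1), pow_mul, hζ.pow_eq_one]; simp
  simp_rw [h1]
  rw [tsum_dvd_succ hm fun k => (m : ℂ) * (w ^ k / (k : ℂ) ^ r), ← tsum_mul_left]
  refine tsum_congr fun j => ?_
  rw [← pow_mul, Nat.cast_mul, mul_zpow, zpow_sub₀ hm', zpow_one]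
  have : ((j + 1 : ℕ) : ℂ) ≠ 0 := Nat.cast_ne_zero.2 (by omega)
  field_simp

/-! ### The dilogarithm -/

theorem norm_polylog_two_term_le {x : ℝ} (hx : |x| ≤ 1) (k : ℕ) :
    ‖x ^ (k + 1) / ((k + 1 : ℕ) : ℝ) ^ (2 : ℤ)‖ ≤ 1 / ((k + 1 : ℕ) : ℝ) ^ 2 := by
  rw [norm_div, norm_pow, norm_eq_abs, zpow_ofNat, norm_pow, Real.norm_natCast]
  gcongr
  exact pow_le_one₀ (abs_nonneg _) hx

theorem summable_one_div_succ_sq : Summable fun k : ℕ => 1 / ((k + 1 : ℕ) : ℝ) ^ 2 :=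
  (summable_nat_add_iff 1).2 (Real.summable_one_div_nat_pow.2 one_lt_two)

theorem continuousOn_dilog : ContinuousOn (polylog 2 : ℝ → ℝ) (Set.Icc (-1) 1) := by
  refine continuousOn_tsum (fun k => by fun_prop) summable_one_div_succ_sq fun k x hx => ?_
  exact norm_polylog_two_term_le (abs_le.2 hx) k

theorem dilog_zero : polylog 2 (0 : ℝ) = 0 := by simp [polylog]

theorem dilog_one : polylog 2 (1 : ℝ) = π ^ 2 / 6 := by
  have h := hasSum_zeta_two
  rw [← hasSum_nat_add_iff' 1] at h
  simp only [range_one, sum_singleton, CharP.cast_eq_zero, ne_eq, OfNat.ofNat_ne_zero,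
    not_false_eq_true, zero_pow, div_zero, sub_zero] at h
  rw [← h.tsum_eq, polylog]
  simp only [one_pow, zpow_ofNat]

theorem hasDerivAt_dilog {x : ℝ} (hx : x ∈ Set.Ioo (0 : ℝ) 1) :
    HasDerivAt (polylog 2 : ℝ → ℝ) (-log (1 - x) / x) x := by
  obtain ⟨r, hr, hr1⟩ := exists_between hx.2
  have hr0 : 0 < r := hx.1.trans hr
  have h := hasDerivAt_tsum_of_isPreconnected (𝕜 := ℝ) (F := ℝ) (t := Set.Ioo 0 r)
    (u := fun k : ℕ => r ^ k)
    (g := fun (k : ℕ) (x : ℝ) => x ^ (k + 1) / ((k + 1 : ℕ) : ℝ) ^ (2 : ℤ))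
    (g' := fun (k : ℕ) (x : ℝ) => x ^ k / ((k + 1 : ℕ) : ℝ)) (y₀ := x) (y := x)
    (summable_geometric_of_lt_one hr0.le hr1) isOpen_Ioo isPreconnected_Ioo
    (fun k y _ => ?_) (fun k y hy => ?_) ⟨hx.1, hr⟩
    (summable_polylog 2 (by rw [norm_of_nonneg hx.1.le]; exact hx.2)) ⟨hx.1, hr⟩
  · have hlog := Real.hasSum_pow_div_log_of_abs_lt_one
      (show |x| < 1 by rw [abs_of_pos hx.1]; exact hx.2)
    have : ∑' k : ℕ, x ^ k / ((k + 1 : ℕ) : ℝ) = -log (1 - x) / x := by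
      rw [← hlog.tsum_eq, ← tsum_div_const]
      refine tsum_congr fun k => ?_
      have := hx.1.ne'
      push_cast
      rw [pow_succ]; field_simp
    rwa [this] at h
  · have := (hasDerivAt_pow (k + 1) y).div_const (((k + 1 : ℕ) : ℝ) ^ (2 : ℤ))
    refine this.congr_deriv ?_
    have : ((k + 1 : ℕ) : ℝ) ≠ 0 := Nat.cast_ne_zero.2 (by omega)
    rw [zpow_ofNat]; field_simp; simp
  · rw [norm_div, norm_pow, Real.norm_natCast, norm_of_nonneg hy.1.le]
    have h1 : (1 : ℝ) ≤ ((k + 1 : ℕ) : ℝ) := by push_cast; linarith [k.cast_nonneg (α := ℝ)]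
    calc y ^ k / ((k + 1 : ℕ) : ℝ) ≤ y ^ k := div_le_self (pow_nonneg hy.1.le _) h1
      _ ≤ r ^ k := pow_le_pow_left₀ hy.1.le hy.2.le _

theorem tendsto_log_mul_log_one_sub :
    Tendsto (fun x : ℝ => log x * log (1 - x)) (𝓝[>] 0) (𝓝 0) := by
  have h1 : Tendsto (fun x : ℝ => log x * x) (𝓝[>] 0) (𝓝 0) := by
    simpa using tendsto_log_mul_rpow_nhdsGT_zero one_pos
  have h2 : Tendsto (fun x : ℝ => 2 * |log x * x|) (𝓝[>] 0) (𝓝 0) := by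
    simpa using h1.abs.const_mul 2
  refine squeeze_zero_norm' ?_ h2
  filter_upwards [Ioo_mem_nhdsGT (show (0 : ℝ) < 1 / 2 by norm_num)] with x hx
  rw [norm_eq_abs, abs_mul, abs_mul, abs_of_pos hx.1]
  have hb : |log (1 - x)| ≤ 2 * x := by
    have hpos : 0 < 1 - x := by linarith [hx.2]
    rw [abs_of_nonpos (Real.log_nonpos hpos.le (by linarith [hx.1]))]
    have := Real.one_sub_inv_le_log_of_pos hpos
    have h3 : (1 - x)⁻¹ ≤ 1 + 2 * x := by
      rw [inv_le_comm₀ hpos (by linarith [hx.1]), inv_le_iff_one_le_mul₀ (by linarith [hx.1])]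
      nlinarith [hx.1, hx.2]
    linarith
  nlinarith [abs_nonneg (log x)]

/-- Euler's reflection formula for the dilogarithm. -/
theorem dilog_add_dilog_one_sub {z : ℝ} (hz : z ∈ Set.Ioo (0 : ℝ) 1) :
    polylog 2 z + polylog 2 (1 - z) = π ^ 2 / 6 - log z * log (1 - z) := by
  set E : ℝ → ℝ := fun z => polylog 2 z + polylog 2 (1 - z) + log z * log (1 - z) with hE
  have hd : ∀ x ∈ Set.Ioo (0 : ℝ) 1, HasDerivAt E 0 x := fun x hx => by
    have hx' : 1 - x ∈ Set.Ioo (0 : ℝ) 1 := ⟨by linarith [hx.2], by linarith [hx.1]⟩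
    have hsub : HasDerivAt (fun x : ℝ => 1 - x) (-1) x := by
      simpa using (hasDerivAt_id x).const_sub 1
    have h1 := hasDerivAt_dilog hx
    have h2 := (hasDerivAt_dilog hx').comp x hsub
    have h3 := (Real.hasDerivAt_log hx.1.ne').mul (hsub.log hx'.1.ne')
    refine ((h1.add h2).add h3).congr_deriv ?_
    have e1 := hx.1.ne'
    have e2 := hx'.1.ne'
    rw [sub_sub_cancel]
    field_simp
    ring
  have hconst : ∀ x ∈ Set.Ioo (0 : ℝ) 1, E x = E z := fun x hx =>
    isOpen_Ioo.is_const_of_deriv_eq_zero isPreconnected_Ioo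
      (fun y hy => (hd y hy).differentiableAt.differentiableWithinAt)
      (fun y hy => (hd y hy).deriv) hx hz
  have hlim : Tendsto E (𝓝[>] 0) (𝓝 (π ^ 2 / 6)) := by
    have hin : ∀ᶠ x : ℝ in 𝓝[>] 0, x ∈ Set.Ioo (0 : ℝ) 1 := Ioo_mem_nhdsGT one_pos
    have t0 : Tendsto (fun x : ℝ => x) (𝓝[>] 0) (𝓝[Set.Icc (-1) 1] 0) := by
      refine tendsto_nhdsWithin_iff.2 ⟨tendsto_nhdsWithin_of_tendsto_nhds tendsto_id, ?_⟩
      filter_upwards [hin] with x hx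
      exact ⟨by linarith [hx.1], hx.2.le⟩
    have t1 : Tendsto (fun x : ℝ => 1 - x) (𝓝[>] 0) (𝓝[Set.Icc (-1) 1] 1) := by
      refine tendsto_nhdsWithin_iff.2 ⟨?_, ?_⟩
      · have : Tendsto (fun x : ℝ => 1 - x) (𝓝 0) (𝓝 (1 - 0)) := tendsto_const_nhds.sub tendsto_id
        rw [sub_zero] at this
        exact tendsto_nhdsWithin_of_tendsto_nhds this
      · filter_upwards [hin] with x hx
        exact ⟨by linarith [hx.2], by linarith [hx.1]⟩
    have a0 := (continuousOn_dilog 0 (by norm_num)).tendsto.comp t0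
    have a1 := (continuousOn_dilog 1 (by norm_num)).tendsto.comp t1
    rw [dilog_zero] at a0
    rw [dilog_one] at a1
    have := (a0.add a1).add tendsto_log_mul_log_one_sub
    simpa using this
  have hlim' : Tendsto E (𝓝[>] 0) (𝓝 (E z)) := by
    refine tendsto_const_nhds.congr' ?_
    filter_upwards [Ioo_mem_nhdsGT one_pos] with x hx
    exact (hconst x hx).symm
  have := tendsto_nhds_unique hlim hlim'
  rw [hE] at this
  linarith

theorem neg_rogersL {z : ℝ} (hz : z ∈ Set.Ioo (0 : ℝ) 1) :
    -rogersL z = polylog 2 (1 - z) + 1 / 2 * log z * log (1 - z) := by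
  have := dilog_add_dilog_one_sub hz
  rw [rogersL]; linarith

/-! ### Quadratic forms -/

theorem exists_mul_norm_sq_le_of_posDef {N : ℕ} {M : Matrix (Fin N) (Fin N) ℝ} (hM : M.PosDef) :
    ∃ c : ℝ, 0 < c ∧ ∀ x : Fin N → ℝ, c * ‖x‖ ^ 2 ≤ x ⬝ᵥ M.mulVec x := by
  have hcont : Continuous fun x : Fin N → ℝ => x ⬝ᵥ M.mulVec x := by fun_prop
  have hpos : ∀ x : Fin N → ℝ, x ≠ 0 → 0 < x ⬝ᵥ M.mulVec x := fun x hx => by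
    simpa using hM.dotProduct_mulVec_pos hx
  by_cases hne : (Metric.sphere (0 : Fin N → ℝ) 1).Nonempty
  · obtain ⟨x₀, hx₀, hmin⟩ := (isCompact_sphere (0 : Fin N → ℝ) 1).exists_isMinOn hne
      hcont.continuousOn
    have hx₀' : x₀ ≠ 0 := fun h => by simp [h] at hx₀
    refine ⟨_, hpos x₀ hx₀', fun x => ?_⟩
    by_cases hx : x = 0
    · simp [hx]
    have hn : ‖x‖ ≠ 0 := norm_ne_zero_iff.2 hx
    have := hmin (show ‖x‖⁻¹ • x ∈ Metric.sphere (0 : Fin N → ℝ) 1 by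
      simp [norm_smul, hn])
    simp only [Set.mem_ofPred_eq] at this
    rw [Matrix.mulVec_smul, dotProduct_smul, smul_dotProduct, smul_eq_mul, smul_eq_mul,
      ← mul_assoc, ← mul_inv, inv_mul_eq_div, le_div_iff₀ (by positivity)] at this
    rw [pow_two]; exact this
  · refine ⟨1, one_pos, fun x => ?_⟩
    have hx : x = 0 := by
      by_contra hx
      exact hne ⟨‖x‖⁻¹ • x, by simp [norm_smul, norm_ne_zero_iff.2 hx]⟩
    simp [hx]

namespace Datum

variable {N : ℕ} (Q : Datum N)

/-- The real matrix `A D`. -/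
noncomputable def B : Matrix (Fin N) (Fin N) ℝ := (Q.A * Q.D).map fun a => (a : ℝ)

theorem B_posDef : Q.B.PosDef := Q.posDef

theorem B_apply (i j : Fin N) : Q.B i j = Q.A i j * Q.d j := by
  simp [B, D, Matrix.mul_diagonal]

theorem B_symm (i j : Fin N) : Q.B i j = Q.B j i := by
  have := Q.B_posDef.isHermitian.apply i j
  simpa using this.symm

theorem d_pos' (i : Fin N) : (0 : ℝ) < Q.d i := by exact_mod_cast Q.d_pos i

/-! ### Nahm's equation -/

theorem B_mulVec_dotProduct_comm (x y : Fin N → ℝ) : x ⬝ᵥ Q.B.mulVec y = y ⬝ᵥ Q.B.mulVec x := by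
  rw [Matrix.dotProduct_mulVec, dotProduct_comm]
  congr 1
  ext i
  simp only [Matrix.vecMul, Matrix.mulVec, dotProduct]
  exact sum_congr rfl fun j _ => by rw [Q.B_symm, mul_comm]

theorem quadForm_add (x y : Fin N → ℝ) : (x + y) ⬝ᵥ Q.B.mulVec (x + y) =
    x ⬝ᵥ Q.B.mulVec x + 2 * (y ⬝ᵥ Q.B.mulVec x) + y ⬝ᵥ Q.B.mulVec y := by
  rw [Matrix.mulVec_add, dotProduct_add, add_dotProduct, add_dotProduct,
    Q.B_mulVec_dotProduct_comm x y]
  ring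

/-- The additive form of Nahm's equation. -/
def IsSaddle (y : Fin N → ℝ) : Prop :=
  (∀ i, 0 < y i) ∧ ∀ i, Q.B.mulVec y i = -log (1 - rexp (-(Q.d i * y i)))

theorem one_sub_exp_pos {a : ℝ} (ha : 0 < a) : 0 < 1 - rexp (-a) := by
  have : rexp (-a) < 1 := Real.exp_lt_one_iff.2 (by linarith)
  linarith

theorem IsSaddle.isNahmSolution {y : Fin N → ℝ} (hy : Q.IsSaddle y) :
    Q.IsNahmSolution fun i => rexp (-(Q.d i * y i)) := by
  have hp : ∀ i, 0 < Q.d i * y i := fun i => mul_pos (Q.d_pos' i) (hy.1 i)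
  refine ⟨fun i => ⟨exp_pos _, by linarith [one_sub_exp_pos (hp i)]⟩, fun i => ?_⟩
  rw [← exp_log (one_sub_exp_pos (hp i)), ← neg_neg (log _), ← hy.2 i, Matrix.mulVec,
    dotProduct, ← sum_neg_distrib, exp_sum]
  refine prod_congr rfl fun j _ => ?_
  rw [← Real.exp_mul, B_apply]
  congr 1; ring

theorem IsNahmSolution.isSaddle {z : Fin N → ℝ} (hz : Q.IsNahmSolution z) :
    Q.IsSaddle fun i => -log (z i) / Q.d i := by
  refine ⟨fun i => div_pos (by linarith [log_neg (hz.1 i).1 (hz.1 i).2]) (Q.d_pos' i),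
    fun i => ?_⟩
  have h1 : rexp (-(Q.d i * (-log (z i) / Q.d i))) = z i := by
    rw [mul_div_cancel₀ _ (Q.d_pos' i).ne', neg_neg, exp_log (hz.1 i).1]
  rw [h1, hz.2 i, Real.log_prod fun j _ => (Real.rpow_pos_of_pos (hz.1 j).1 _).ne', Matrix.mulVec,
    dotProduct, ← sum_neg_distrib]
  refine sum_congr rfl fun j _ => ?_
  rw [Real.log_rpow (hz.1 j).1, B_apply]
  have := (Q.d_pos' j).ne'
  field_simp

theorem IsSaddle.unique {y y' : Fin N → ℝ} (hy : Q.IsSaddle y) (hy' : Q.IsSaddle y') : y = y' := by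
  by_contra hne
  have h := Q.B_posDef.dotProduct_mulVec_pos (sub_ne_zero.2 hne)
  simp only [star_trivial] at h
  rw [Matrix.mulVec_sub, dotProduct] at h
  refine h.not_ge (Finset.sum_nonpos fun i _ => ?_)
  rw [Pi.sub_apply, Pi.sub_apply, hy.2 i, hy'.2 i]
  have hd := Q.d_pos' i
  have key : ∀ a b : ℝ, 0 < a → a ≤ b →
      -log (1 - rexp (-(Q.d i * b))) ≤ -log (1 - rexp (-(Q.d i * a))) := by
    intro a b ha hab
    have h1 := one_sub_exp_pos (mul_pos hd ha)
    refine neg_le_neg (Real.log_le_log h1 ?_)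
    have : rexp (-(Q.d i * b)) ≤ rexp (-(Q.d i * a)) :=
      Real.exp_le_exp.2 (neg_le_neg (mul_le_mul_of_nonneg_left hab hd.le))
    linarith
  rcases le_total (y i) (y' i) with hle | hle
  · have := key _ _ (hy.1 i) hle
    nlinarith
  · have := key _ _ (hy'.1 i) hle
    nlinarith

/-- The potential `u ↦ Li₂(e^{-du}) / d`. -/
noncomputable def pot (d : ℕ) (u : ℝ) : ℝ := polylog 2 (rexp (-(d * u))) / d

theorem hasDerivAt_pot {d : ℕ} (hd : 0 < d) {u : ℝ} (hu : 0 < u) :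
    HasDerivAt (pot d) (log (1 - rexp (-(d * u)))) u := by
  have hd' : (0 : ℝ) < d := by exact_mod_cast hd
  have hp := mul_pos hd' hu
  have h1 : HasDerivAt (fun u : ℝ => rexp (-(d * u))) (rexp (-(d * u)) * -d) u := by
    have := ((hasDerivAt_id u).const_mul (d : ℝ)).neg.exp
    simpa using this
  have h2 := (hasDerivAt_dilog ⟨exp_pos (-(d * u)), by linarith [one_sub_exp_pos hp]⟩).comp u h1
  refine (h2.div_const (d : ℝ)).congr_deriv ?_
  have := Real.exp_ne_zero (-(d * u))
  field_simp

theorem continuousOn_pot (d : ℕ) : ContinuousOn (pot d) (Set.Ici 0) := by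
  refine ContinuousOn.div_const (continuousOn_dilog.comp (by fun_prop) fun u hu => ?_) _
  have : rexp (-(d * u)) ≤ 1 := Real.exp_le_one_iff.2 (by
    have := mul_nonneg (Nat.cast_nonneg (α := ℝ) d) hu; linarith)
  exact ⟨by linarith [exp_pos (-(d * u))], this⟩

theorem dilog_nonneg {x : ℝ} (hx : 0 ≤ x) : 0 ≤ polylog 2 x :=
  tsum_nonneg fun k => by rw [zpow_ofNat]; positivity

theorem pot_nonneg (d : ℕ) (u : ℝ) : 0 ≤ pot d u :=
  div_nonneg (dilog_nonneg (exp_pos _).le) (Nat.cast_nonneg _)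

/-- The slope of the potential at `0` is `-∞`. -/
theorem exists_pot_lt {d : ℕ} (hd : 0 < d) (K : ℝ) :
    ∃ t : ℝ, 0 < t ∧ t < 1 ∧ pot d t - pot d 0 < -K * t := by
  have hd' : (0 : ℝ) < d := by exact_mod_cast hd
  have hlim : Tendsto (fun t : ℝ => 1 - rexp (-(d * t))) (𝓝[>] 0) (𝓝[>] 0) := by
    refine tendsto_nhdsWithin_iff.2 ⟨?_, ?_⟩
    · have : Continuous fun t : ℝ => 1 - rexp (-(d * t)) := by fun_prop
      have h := this.tendsto 0
      simp only [mul_zero, neg_zero, exp_zero, sub_self] at h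
      exact tendsto_nhdsWithin_of_tendsto_nhds h
    · filter_upwards [self_mem_nhdsWithin] with t ht
      exact one_sub_exp_pos (mul_pos hd' ht)
  have hlog := Real.tendsto_log_nhdsGT_zero.comp hlim
  have hev := hlog.eventually (eventually_lt_atBot (-K))
  obtain ⟨δ, hδ, hδ'⟩ := mem_nhdsGT_iff_exists_Ioo_subset.1 hev
  refine ⟨min δ 1 / 2, ?_, ?_, ?_⟩
  · have := lt_min (Set.mem_Ioi.1 hδ) one_pos; linarith
  · linarith [min_le_right δ 1]
  · set t := min δ 1 / 2 with ht
    have ht0 : 0 < t := by have := lt_min (Set.mem_Ioi.1 hδ) one_pos; rw [ht]; linarith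
    obtain ⟨ξ, hξ, he⟩ := exists_hasDerivAt_eq_slope (pot d)
      (fun u => log (1 - rexp (-(d * u)))) ht0
      ((continuousOn_pot d).mono fun x hx => hx.1) fun x hx => hasDerivAt_pot hd hx.1
    have hξ' : log (1 - rexp (-(d * ξ))) < -K := hδ' ⟨hξ.1, by
      have := hξ.2; rw [ht] at this; linarith [min_le_left δ 1, Set.mem_Ioi.1 hδ]⟩
    rw [he, sub_zero, div_lt_iff₀ ht0] at hξ'
    exact hξ'

theorem exists_isSaddle : ∃ y, Q.IsSaddle y := by
  obtain ⟨c, hc, hcB⟩ := exists_mul_norm_sq_le_of_posDef Q.B_posDef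
  set φ : (Fin N → ℝ) → ℝ := fun y => 1 / 2 * (y ⬝ᵥ Q.B.mulVec y) + ∑ i, pot (Q.d i) (y i) with hφ
  set s : Set (Fin N → ℝ) := {y | ∀ i, 0 ≤ y i} with hs
  have hclosed : IsClosed s := by
    rw [hs, Set.ofPred_forall]
    exact isClosed_iInter fun i => isClosed_le continuous_const (continuous_apply i)
  have hcont : ContinuousOn φ s := by
    refine ContinuousOn.add (by fun_prop) (continuousOn_finsetSum _ fun i _ => ?_)
    exact (continuousOn_pot (Q.d i)).comp (continuous_apply i).continuousOn fun y hy => hy i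
  have hmin : ∃ y ∈ s, IsMinOn φ s y := by
    refine hcont.exists_isMinOn' hclosed (x₀ := 0) (fun i => le_rfl) ?_
    have h1 : Tendsto (fun y : Fin N → ℝ => c / 2 * ‖y‖ ^ 2) (cocompact _) atTop :=
      ((tendsto_pow_atTop two_ne_zero).comp (tendsto_norm_cocompact_atTop (E := Fin N → ℝ))).const_mul_atTop
        (by positivity)
    refine Filter.Eventually.filter_mono inf_le_left ?_
    filter_upwards [h1.eventually_ge_atTop (φ 0)] with y hy
    refine hy.trans ?_
    have := hcB y
    have h2 : 0 ≤ ∑ i, pot (Q.d i) (y i) := sum_nonneg fun i _ => pot_nonneg _ _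
    simp only [hφ]; linarith
  obtain ⟨y, hys, hymin⟩ := hmin
  have hline : ∀ (i : Fin N) (t : ℝ), φ (y + Pi.single i t) - φ y =
      t * Q.B.mulVec y i + 1 / 2 * Q.B i i * t ^ 2 + (pot (Q.d i) (y i + t) - pot (Q.d i) (y i)) := by
    intro i t
    have hsum : ∑ j, pot (Q.d j) ((y + Pi.single i t : Fin N → ℝ) j) - ∑ j, pot (Q.d j) (y j) =
        pot (Q.d i) (y i + t) - pot (Q.d i) (y i) := by
      rw [← sum_sub_distrib, Finset.sum_eq_single i]
      · simp
      · intro j _ hj; simp [hj]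
      · simp
    have hq : (Pi.single i t : Fin N → ℝ) ⬝ᵥ Q.B.mulVec (Pi.single i t) = Q.B i i * t ^ 2 := by
      rw [single_dotProduct, Matrix.mulVec_single]; simp; ring
    simp only [hφ]
    rw [Q.quadForm_add, hq, single_dotProduct]
    linarith
  have hge : ∀ (i : Fin N) (t : ℝ), 0 ≤ y i + t → 0 ≤ φ (y + Pi.single i t) - φ y := by
    intro i t ht
    refine sub_nonneg.2 (hymin fun j => ?_)
    by_cases hj : j = i
    · subst hj; simpa using ht
    · simpa [hj] using hys j
  have hpos : ∀ i, 0 < y i := by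
    intro i
    refine lt_of_le_of_ne (hys i) fun h0 => ?_
    obtain ⟨t, ht0, ht1, ht⟩ := exists_pot_lt (Q.d_pos i) (Q.B.mulVec y i + 1 / 2 * |Q.B i i|)
    have h1 := hge i t (by linarith [hys i])
    rw [hline, ← h0, zero_add] at h1
    have h2 : Q.B i i * t ^ 2 ≤ |Q.B i i| * t := by
      have h3 : t ^ 2 ≤ t := by nlinarith
      calc Q.B i i * t ^ 2 ≤ |Q.B i i| * t ^ 2 :=
            mul_le_mul_of_nonneg_right (le_abs_self _) (sq_nonneg t)
        _ ≤ _ := mul_le_mul_of_nonneg_left h3 (abs_nonneg _)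
    nlinarith
  refine ⟨y, hpos, fun i => ?_⟩
  have hder : HasDerivAt (fun t : ℝ => t * Q.B.mulVec y i + 1 / 2 * Q.B i i * t ^ 2 +
      (pot (Q.d i) (y i + t) - pot (Q.d i) (y i)))
      (Q.B.mulVec y i + log (1 - rexp (-(Q.d i * y i)))) 0 := by
    have h1 : HasDerivAt (fun t : ℝ => t * Q.B.mulVec y i) (Q.B.mulVec y i) 0 := by
      simpa using (hasDerivAt_id (0 : ℝ)).mul_const (Q.B.mulVec y i)
    have h2 : HasDerivAt (fun t : ℝ => 1 / 2 * Q.B i i * t ^ 2) 0 0 := by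
      simpa using (hasDerivAt_pow 2 (0 : ℝ)).const_mul (1 / 2 * Q.B i i)
    have h3 : HasDerivAt (fun t : ℝ => pot (Q.d i) (y i + t))
        (log (1 - rexp (-(Q.d i * y i)))) 0 := by
      refine HasDerivAt.comp_const_add (y i) 0 ?_
      rw [add_zero]; exact hasDerivAt_pot (Q.d_pos i) (hpos i)
    exact ((h1.add h2).add (h3.sub_const (pot (Q.d i) (y i)))).congr_deriv (by ring)
  have hloc : IsLocalMin (fun t : ℝ => t * Q.B.mulVec y i + 1 / 2 * Q.B i i * t ^ 2 +
      (pot (Q.d i) (y i + t) - pot (Q.d i) (y i))) 0 := by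
    filter_upwards [Ioi_mem_nhds (show -y i < 0 by linarith [hpos i])] with t ht
    have := hge i t (by linarith [Set.mem_Ioi.1 ht])
    rw [hline] at this
    simpa using this
  linarith [hloc.hasDerivAt_eq_zero hder]

theorem existsUnique_isNahmSolution : ∃! z : Fin N → ℝ, Q.IsNahmSolution z := by
  obtain ⟨y, hy⟩ := Q.exists_isSaddle
  refine ⟨_, IsSaddle.isNahmSolution Q hy, fun z hz => ?_⟩
  have := IsSaddle.unique Q hy (IsNahmSolution.isSaddle Q hz)
  ext i
  rw [this, mul_div_cancel₀ _ (Q.d_pos' i).ne', neg_neg, exp_log (hz.1 i).1]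

/-- The saddle point `y_i = -log z_i / d_i` of the Nahm sum. -/
noncomputable def saddle (z : Fin N → ℝ) (i : Fin N) : ℝ := -log (z i) / Q.d i

theorem Lam_eq {z : Fin N → ℝ} (hz : Q.IsNahmSolution z) :
    Q.Lam z = 1 / 2 * (Q.saddle z ⬝ᵥ Q.B.mulVec (Q.saddle z)) +
      ∑ i, polylog 2 (1 - z i) / Q.d i := by
  have hs := IsNahmSolution.isSaddle Q hz
  rw [Lam, dotProduct, mul_sum, ← sum_add_distrib, ← sum_neg_distrib]
  refine sum_congr rfl fun i _ => ?_
  have h1 : Q.B.mulVec (Q.saddle z) i = -log (1 - z i) := by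
    have := hs.2 i
    rwa [mul_div_cancel₀ _ (Q.d_pos' i).ne', neg_neg, exp_log (hz.1 i).1] at this
  rw [h1, ← mul_neg, neg_rogersL (hz.1 i), saddle]
  ring

theorem B_mulVec_saddle {z : Fin N → ℝ} (hz : Q.IsNahmSolution z) (i : Fin N) :
    Q.B.mulVec (Q.saddle z) i = -log (1 - z i) := by
  have := (IsNahmSolution.isSaddle Q hz).2 i
  rwa [mul_div_cancel₀ _ (Q.d_pos' i).ne', neg_neg, exp_log (hz.1 i).1] at this

end Datum

/-! ### Sums over lattices -/

theorem summable_norm_prod_and_tsum {ι : Type*} {N : ℕ} (f : Fin N → ι → ℂ)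
    (hf : ∀ i, Summable fun n => ‖f i n‖) :
    (Summable fun n : Fin N → ι => ‖∏ i, f i (n i)‖) ∧
      ∑' n : Fin N → ι, ∏ i, f i (n i) = ∏ i, ∑' n, f i n := by
  induction N with
  | zero => exact ⟨(hasSum_fintype _).summable, by simp⟩
  | succ N ih =>
    obtain ⟨h1, h2⟩ := ih (fun i => f i.succ) fun i => hf i.succ
    have e : ∀ p : ι × (Fin N → ι), ∏ i, f i (Fin.consEquiv (fun _ => ι) p i) =
        f 0 p.1 * ∏ i : Fin N, f i.succ (p.2 i) := fun p => by
      rw [Fin.prod_univ_succ]; simp [Fin.consEquiv]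
    constructor
    · rw [← (Fin.consEquiv fun _ => ι).summable_iff]
      refine ((hf 0).mul_norm h1).congr fun p => ?_
      rw [Function.comp_apply, e p]
    · rw [← (Fin.consEquiv fun _ => ι).tsum_eq, Fin.prod_univ_succ, ← h2]
      rw [tsum_mul_tsum_of_summable_norm (hf 0) h1]
      exact tsum_congr e

theorem summable_norm_prod {ι : Type*} {N : ℕ} (f : Fin N → ι → ℂ)
    (hf : ∀ i, Summable fun n => ‖f i n‖) : Summable fun n : Fin N → ι => ‖∏ i, f i (n i)‖ :=
  (summable_norm_prod_and_tsum f hf).1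

theorem tsum_prod_eq_prod_tsum {ι : Type*} {N : ℕ} (f : Fin N → ι → ℂ)
    (hf : ∀ i, Summable fun n => ‖f i n‖) :
    ∑' n : Fin N → ι, ∏ i, f i (n i) = ∏ i, ∑' n, f i n :=
  (summable_norm_prod_and_tsum f hf).2

theorem summable_exp_neg_abs_and_tsum_le {s : ℝ} (hs : 0 < s) (hs1 : s ≤ 1) (v : ℝ) :
    (Summable fun n : ℤ => rexp (-|s * (n + v)|)) ∧
      ∑' n : ℤ, rexp (-|s * (n + v)|) ≤ 4 / s := by
  have hr1 : rexp (-s) < 1 := Real.exp_lt_one_iff.2 (by linarith)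
  have hgeo : HasSum (fun n : ℕ => rexp (-s) ^ n) (1 - rexp (-s))⁻¹ :=
    hasSum_geometric_of_lt_one (exp_pos _).le hr1
  have hdouble : HasSum (fun n : ℤ => rexp (-s) ^ (if 0 ≤ n then n.toNat else (-n - 1).toNat))
      ((1 - rexp (-s))⁻¹ + (1 - rexp (-s))⁻¹) := by
    refine HasSum.of_nat_of_neg_add_one ?_ ?_
    · convert hgeo using 2 with n
      simp
    · convert hgeo using 2 with n
      rw [if_neg (by omega)]
      congr 1; omega
  set w := Int.fract v
  have hle : ∀ n : ℤ, rexp (-|s * (((n - ⌊v⌋ : ℤ) : ℝ) + v)|) ≤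
      rexp (-s) ^ (if 0 ≤ n then n.toNat else (-n - 1).toNat) := by
    intro n
    rw [← exp_nat_mul, exp_le_exp]
    have hw : ((n - ⌊v⌋ : ℤ) : ℝ) + v = n + w := by
      have : v = ⌊v⌋ + w := (Int.floor_add_fract v).symm
      push_cast; linarith
    have hw0 : 0 ≤ w := Int.fract_nonneg v
    have hw1 : w < 1 := Int.fract_lt_one v
    rw [hw, abs_mul, abs_of_pos hs]
    split_ifs with hn
    · have hn' : ((n.toNat : ℕ) : ℝ) = n := by exact_mod_cast Int.toNat_of_nonneg hn
      have : (0 : ℝ) ≤ n := by exact_mod_cast hn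
      rw [hn', abs_of_nonneg (by linarith)]
      nlinarith
    · have h0 : 0 ≤ -n - 1 := by omega
      have hn' : (((-n - 1).toNat : ℕ) : ℝ) = -n - 1 := by exact_mod_cast Int.toNat_of_nonneg h0
      have : (n : ℝ) ≤ -1 := by exact_mod_cast (by omega : n ≤ -1)
      rw [hn', abs_of_nonpos (by linarith)]
      nlinarith
  have hsum' : Summable fun n : ℤ => rexp (-|s * (((n - ⌊v⌋ : ℤ) : ℝ) + v)|) :=
    Summable.of_nonneg_of_le (fun _ => (exp_pos _).le) hle hdouble.summable
  have hre := (Equiv.subRight ⌊v⌋).summable_iff (f := fun n : ℤ => rexp (-|s * ((n : ℝ) + v)|))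
  refine ⟨hre.1 hsum', ?_⟩
  rw [← (Equiv.subRight ⌊v⌋).tsum_eq]
  refine (hsum'.tsum_le_tsum hle hdouble.summable).trans ?_
  rw [hdouble.tsum_eq]
  have h2 : s / 2 ≤ 1 - rexp (-s) := by
    have h3 : rexp (-s) ≤ (1 + s)⁻¹ := by
      rw [exp_neg]
      exact inv_anti₀ (by linarith) (by linarith [add_one_le_exp s])
    have h4 : (1 + s)⁻¹ ≤ 1 - s / 2 := by
      rw [inv_le_iff_one_le_mul₀ (by linarith)]
      nlinarith
    linarith
  have h5 : (1 - rexp (-s))⁻¹ ≤ 2 / s := by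
    rw [inv_le_comm₀ (by linarith) (by positivity), inv_div]; exact h2
  calc _ ≤ 2 / s + 2 / s := add_le_add h5 h5
    _ = 4 / s := by ring

theorem exists_exp_neg_norm_sq_le {N : ℕ} {c : ℝ} (hc : 0 < c) :
    ∃ K : ℝ, 0 < K ∧ ∀ x : Fin N → ℝ, rexp (-c * ‖x‖ ^ 2) ≤ K * ∏ i, rexp (-|x i|) := by
  refine ⟨rexp (N ^ 2 / (4 * c)), exp_pos _, fun x => ?_⟩
  rw [← exp_sum, ← exp_add, exp_le_exp]
  have h1 : ∑ i, |x i| ≤ N * ‖x‖ := by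
    have : ∑ i, |x i| ≤ ∑ _i : Fin N, ‖x‖ := sum_le_sum fun i _ => norm_le_pi_norm x i
    simpa using this
  rw [sum_neg_distrib]
  have h2 : N * ‖x‖ ≤ N ^ 2 / (4 * c) + c * ‖x‖ ^ 2 := by
    have : 0 ≤ (N - 2 * c * ‖x‖) ^ 2 / (4 * c) := by positivity
    have h3 : (N - 2 * c * ‖x‖) ^ 2 / (4 * c) = N ^ 2 / (4 * c) - N * ‖x‖ + c * ‖x‖ ^ 2 := by
      field_simp; ring
    linarith
  linarith

theorem summable_prod_exp_neg_abs {N : ℕ} {s : ℝ} (hs : 0 < s) (hs1 : s ≤ 1) (v : Fin N → ℝ) :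
    (Summable fun n : Fin N → ℤ => ∏ i, rexp (-|s * (n i + v i)|)) ∧
      ∑' n : Fin N → ℤ, ∏ i, rexp (-|s * (n i + v i)|) ≤ (4 / s) ^ N := by
  have hf : ∀ i, Summable fun n : ℤ => ‖((rexp (-|s * (n + v i)|) : ℝ) : ℂ)‖ := fun i => by
    refine (summable_exp_neg_abs_and_tsum_le hs hs1 (v i)).1.congr fun n => ?_
    rw [norm_real, norm_of_nonneg (exp_pos _).le]
  obtain ⟨h1, h2⟩ := summable_norm_prod_and_tsum
    (fun i (n : ℤ) => ((rexp (-|s * (n + v i)|) : ℝ) : ℂ)) hf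
  constructor
  · refine h1.congr fun n => ?_
    rw [norm_prod]
    exact prod_congr rfl fun i _ => by
      rw [norm_real, norm_of_nonneg (exp_pos _).le]
  · have hT : ∑' n : Fin N → ℤ, ∏ i, rexp (-|s * (n i + v i)|) =
        ∏ i, ∑' n : ℤ, rexp (-|s * (n + v i)|) := by
      apply Complex.ofReal_injective
      rw [ofReal_tsum, ofReal_prod]
      simp_rw [ofReal_prod, ofReal_tsum]
      exact h2
    rw [hT]
    calc ∏ i, ∑' n : ℤ, rexp (-|s * (n + v i)|) ≤ ∏ _i : Fin N, 4 / s :=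
          Finset.prod_le_prod (fun i _ => tsum_nonneg fun n => (exp_pos _).le)
            fun i _ => (summable_exp_neg_abs_and_tsum_le hs hs1 (v i)).2
      _ = _ := by rw [prod_const, card_univ, Fintype.card_fin]

theorem exists_lattice_sum_le {N : ℕ} {c : ℝ} (hc : 0 < c) :
    ∃ K : ℝ, 0 < K ∧ ∀ s : ℝ, 0 < s → s ≤ 1 → ∀ v : Fin N → ℝ,
      (Summable fun n : Fin N → ℤ => rexp (-c * ‖fun i => s * (n i + v i)‖ ^ 2)) ∧
      ∑' n : Fin N → ℤ, rexp (-c * ‖fun i => s * (n i + v i)‖ ^ 2) ≤ K / s ^ N := by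
  obtain ⟨K, hK, hle⟩ := exists_exp_neg_norm_sq_le (N := N) hc
  refine ⟨K * 4 ^ N, by positivity, fun s hs hs1 v => ?_⟩
  obtain ⟨hS, hT⟩ := summable_prod_exp_neg_abs hs hs1 v
  have hle' : ∀ n : Fin N → ℤ, rexp (-c * ‖fun i => s * (n i + v i)‖ ^ 2) ≤
      K * ∏ i, rexp (-|s * (n i + v i)|) := fun n => hle fun i => s * (n i + v i)
  have hsum : Summable fun n : Fin N → ℤ => rexp (-c * ‖fun i => s * (n i + v i)‖ ^ 2) :=
    Summable.of_nonneg_of_le (fun n => (exp_pos _).le) hle' (hS.mul_left K)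
  refine ⟨hsum, (hsum.tsum_le_tsum hle' (hS.mul_left K)).trans ?_⟩
  rw [tsum_mul_left, mul_div_assoc, ← div_pow]
  exact mul_le_mul_of_nonneg_left hT hK.le

theorem summable_exp_neg_norm_sq_nat {N : ℕ} {c : ℝ} (hc : 0 < c) :
    Summable fun n : Fin N → ℕ => rexp (-c * ‖fun i => (n i : ℝ)‖ ^ 2) := by
  obtain ⟨K, -, hK⟩ := exists_lattice_sum_le (N := N) hc
  have h := (hK 1 one_pos le_rfl 0).1
  have hinj : Function.Injective fun (n : Fin N → ℕ) (i : Fin N) => (n i : ℤ) := fun a b hab => by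
    ext i; exact Int.ofNat_injective (congrFun hab i)
  simpa using! h.comp_injective hinj

/-- Gaussians absorb exponentials. -/
theorem exists_exp_linear_le {a b : ℝ} (ha : 0 < a) :
    ∃ K : ℝ, 0 < K ∧ ∀ x : ℝ, rexp (-a * x ^ 2 + b * x) ≤ K * rexp (-(a / 2) * x ^ 2) := by
  refine ⟨rexp (b ^ 2 / (2 * a)), exp_pos _, fun x => ?_⟩
  rw [← exp_add, exp_le_exp]
  have : 0 ≤ (a * x - b) ^ 2 / (2 * a) := by positivity
  have h : (a * x - b) ^ 2 / (2 * a) = a / 2 * x ^ 2 - b * x + b ^ 2 / (2 * a) := by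
    field_simp; ring
  linarith

namespace Datum

variable {N : ℕ} (Q : Datum N)

/-! ### Convergence and holomorphy -/

/-- The quadratic function of the Nahm sum for real arguments. -/
noncomputable def quadR (x : Fin N → ℝ) : ℝ :=
  1 / 2 * (x ⬝ᵥ Q.B.mulVec x) + x ⬝ᵥ (fun i => (Q.b i : ℝ)) + Q.c

theorem quad_cast (n : Fin N → ℤ) : ((Q.quad n : ℚ) : ℝ) = Q.quadR fun i => (n i : ℝ) := by
  simp only [quad, quadR, B, dotProduct, Matrix.mulVec, Matrix.map_apply]
  push_cast
  rfl

theorem exists_le_quadR : ∃ a C : ℝ, 0 < a ∧ 0 < C ∧ ∀ x, a * ‖x‖ ^ 2 - C ≤ Q.quadR x := by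
  obtain ⟨c, hc, hcB⟩ := exists_mul_norm_sq_le_of_posDef Q.B_posDef
  set S := ∑ i, |(Q.b i : ℝ)| with hS
  have hS0 : 0 ≤ S := sum_nonneg fun i _ => abs_nonneg _
  refine ⟨c / 4, S ^ 2 / c + |(Q.c : ℝ)| + 1, by positivity, by positivity, fun x => ?_⟩
  have h1 : -(S * ‖x‖) ≤ x ⬝ᵥ (fun i => (Q.b i : ℝ)) := by
    refine neg_le_of_abs_le ?_
    rw [dotProduct, hS, sum_mul]
    refine (abs_sum_le_sum_abs _ _).trans (sum_le_sum fun i _ => ?_)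
    rw [abs_mul, mul_comm]
    exact mul_le_mul_of_nonneg_left (norm_le_pi_norm x i) (abs_nonneg _)
  have h2 := hcB x
  have h3 := neg_abs_le (Q.c : ℝ)
  have h4 : S * ‖x‖ ≤ S ^ 2 / c + c / 4 * ‖x‖ ^ 2 := by
    have : 0 ≤ (2 * S - c * ‖x‖) ^ 2 / (4 * c) := by positivity
    have h3 : (2 * S - c * ‖x‖) ^ 2 / (4 * c) = S ^ 2 / c - S * ‖x‖ + c / 4 * ‖x‖ ^ 2 := by
      field_simp; ring
    linarith
  rw [quadR]
  linarith

theorem norm_expi (x : ℂ) : ‖expi x‖ = rexp (-(2 * π * x.im)) := by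
  rw [expi, norm_exp]
  congr 1
  simp [mul_assoc]

theorem norm_expi_mul_natCast_lt_one {τ : ℂ} (hτ : 0 < τ.im) (i : Fin N) :
    ‖expi (τ * Q.d i)‖ < 1 := by
  rw [norm_expi, exp_lt_one_iff]
  have := Q.d_pos' i
  simp only [mul_im, natCast_re, natCast_im, mul_zero, zero_add, neg_lt_zero]
  positivity

theorem norm_inv_qPoch_le_pow {q : ℂ} {r : ℝ} (hr : r < 1) (hq : ‖q‖ ≤ r) (n : ℕ) :
    ‖(qPoch q q n)⁻¹‖ ≤ ((1 - r)⁻¹) ^ n := by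
  rw [norm_inv, inv_pow]
  have h0 : 0 < 1 - r := by linarith
  refine inv_anti₀ (pow_pos h0 n) ?_
  rw [qPoch, norm_prod]
  calc (1 - r) ^ n = ∏ _j ∈ range n, (1 - r) := by simp
    _ ≤ _ := Finset.prod_le_prod (fun _ _ => h0.le) fun j _ => by
      have := one_sub_norm_le_norm_one_sub_pow (hq.trans_lt hr) j
      rw [pow_succ] at this; linarith

theorem exists_norm_nahmTerm_le {y₀ y₁ : ℝ} (hy₀ : 0 < y₀) :
    ∃ c K : ℝ, 0 < c ∧ ∀ τ : ℂ, y₀ ≤ τ.im → τ.im ≤ y₁ → ∀ n : Fin N → ℕ,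
      ‖Q.nahmTerm τ n‖ ≤ K * rexp (-c * ‖fun i => (n i : ℝ)‖ ^ 2) := by
  obtain ⟨a, C, ha, hC, hQ⟩ := Q.exists_le_quadR
  set r := rexp (-(2 * π * y₀)) with hr
  have hr1 : r < 1 := Real.exp_lt_one_iff.2 (by have := pi_pos; simp; positivity)
  have h1r : 0 < 1 - r := by linarith
  set κ := log (1 - r)⁻¹ with hκ
  have hκ0 : 0 ≤ κ := Real.log_nonneg (by
    rw [one_le_inv₀ h1r]; linarith [exp_pos (-(2 * π * y₀))])
  obtain ⟨K, hK, hKle⟩ := exists_exp_linear_le (a := 2 * π * y₀ * a) (b := N * κ)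
    (by have := pi_pos; positivity)
  refine ⟨2 * π * y₀ * a / 2, rexp (2 * π * y₁ * C) * K, by have := pi_pos; positivity,
    fun τ hτ₀ hτ₁ n => ?_⟩
  set X := ‖fun i => (n i : ℝ)‖
  rw [nahmTerm, div_eq_mul_inv, norm_mul]
  have h1 : ‖expi (τ * (Q.quad fun i => (n i : ℤ)))‖ ≤
      rexp (2 * π * y₁ * C) * rexp (-(2 * π * y₀ * a) * X ^ 2) := by
    rw [norm_expi, ← exp_add, exp_le_exp]
    have e : (τ * ((Q.quad fun i => (n i : ℤ) : ℚ) : ℂ)).im = τ.im * Q.quadR fun i => (n i : ℝ) := by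
      have := Q.quad_cast fun i => (n i : ℤ)
      simp only [Int.cast_natCast] at this
      rw [← this]
      simp [mul_im]
    rw [e]
    have h2 := hQ fun i => (n i : ℝ)
    have h3 : y₀ * (a * X ^ 2) - y₁ * C ≤ τ.im * Q.quadR fun i => (n i : ℝ) := by
      calc y₀ * (a * X ^ 2) - y₁ * C ≤ τ.im * (a * X ^ 2) - τ.im * C := by gcongr
        _ = τ.im * (a * X ^ 2 - C) := by ring
        _ ≤ _ := mul_le_mul_of_nonneg_left h2 (hy₀.le.trans hτ₀)
    have := pi_pos
    nlinarith
  have h2 : ‖(∏ i, qPoch (expi (τ * Q.d i)) (expi (τ * Q.d i)) (n i))⁻¹‖ ≤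
      rexp (N * κ * X) := by
    rw [← Finset.prod_inv_distrib, norm_prod]
    have h3 : ∀ i ∈ univ, ‖(qPoch (expi (τ * Q.d i)) (expi (τ * Q.d i)) (n i))⁻¹‖ ≤
        rexp (κ * X) := fun i _ => by
      have hqr : ‖expi (τ * Q.d i)‖ ≤ r := by
        rw [norm_expi, hr, exp_le_exp]
        have h1 : (1 : ℝ) ≤ Q.d i := by exact_mod_cast Q.d_pos i
        simp only [mul_im, natCast_re, natCast_im, mul_zero, zero_add]
        have : y₀ ≤ τ.im * Q.d i := by nlinarith
        have := pi_pos
        nlinarith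
      refine (norm_inv_qPoch_le_pow hr1 hqr (n i)).trans ?_
      rw [← exp_log (show 0 < (1 - r)⁻¹ by positivity), ← exp_nat_mul, exp_le_exp,
        mul_comm, ← hκ]
      refine mul_le_mul_of_nonneg_left ?_ hκ0
      have := norm_le_pi_norm (fun i => (n i : ℝ)) i
      simpa using this
    refine (Finset.prod_le_prod (fun _ _ => norm_nonneg _) h3).trans ?_
    rw [prod_const, ← exp_nat_mul]
    simp [mul_assoc]
  calc _ ≤ (rexp (2 * π * y₁ * C) * rexp (-(2 * π * y₀ * a) * X ^ 2)) *
        rexp (N * κ * X) := mul_le_mul h1 h2 (norm_nonneg _) (by positivity)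
    _ = rexp (2 * π * y₁ * C) * rexp (-(2 * π * y₀ * a) * X ^ 2 + N * κ * X) := by
      rw [exp_add]; ring
    _ ≤ rexp (2 * π * y₁ * C) * (K * rexp (-(2 * π * y₀ * a / 2) * X ^ 2)) := by
      gcongr; exact hKle X
    _ = _ := by ring

theorem summable_nahmTerm {τ : ℂ} (hτ : 0 < τ.im) : Summable (Q.nahmTerm τ) := by
  obtain ⟨c, K, hc, h⟩ := Q.exists_norm_nahmTerm_le (y₁ := τ.im) hτ
  exact Summable.of_norm_bounded ((summable_exp_neg_norm_sq_nat hc).mul_left K)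
    fun n => h τ le_rfl le_rfl n

theorem differentiableOn_nahmSum : DifferentiableOn ℂ Q.nahmSum {τ | 0 < τ.im} := by
  intro τ hτ
  have hτ' : 0 < τ.im := hτ
  obtain ⟨c, K, hc, h⟩ := Q.exists_norm_nahmTerm_le (y₀ := τ.im / 2) (y₁ := 2 * τ.im) (by linarith)
  have hU : IsOpen {w : ℂ | τ.im / 2 < w.im ∧ w.im < 2 * τ.im} :=
    (isOpen_lt continuous_const continuous_im).inter
      (isOpen_lt continuous_im continuous_const)
  have hd := Complex.differentiableOn_tsum_of_summable_norm
    (F := fun (n : Fin N → ℕ) w => Q.nahmTerm w n)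
    ((summable_exp_neg_norm_sq_nat hc).mul_left K) (fun n => ?_) hU
    (fun n w hw => h w hw.1.le hw.2.le n)
  · exact (hd.differentiableAt (hU.mem_nhds ⟨by linarith, by linarith⟩)).differentiableWithinAt
  · intro w hw
    have hw0 : 0 < w.im := by linarith [hw.1]
    refine DifferentiableAt.differentiableWithinAt (DifferentiableAt.div ?_ ?_ ?_)
    · unfold expi; fun_prop
    · unfold qPoch expi; fun_prop
    · exact Finset.prod_ne_zero_iff.2 fun i _ =>
        qPoch_ne_zero (Q.norm_expi_mul_natCast_lt_one hw0 i)
          (Q.norm_expi_mul_natCast_lt_one hw0 i) _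

end Datum

/-! ### The infinite Pochhammer symbol near a root of unity -/

theorem one_sub_re_le_norm_one_sub_mul_exp {ω u : ℂ} (hω : ‖ω‖ = 1) :
    1 - rexp (-u.re) ≤ ‖1 - ω * cexp (-u)‖ := by
  have h := norm_sub_norm_le (1 : ℂ) (ω * cexp (-u))
  rwa [norm_one, norm_mul, hω, one_mul, norm_exp, neg_re] at h

theorem one_sub_exp_half_pos : 0 < 1 - rexp (-(1 / 2 : ℝ)) :=
  Datum.one_sub_exp_pos (by norm_num)

theorem exists_norm_inv_one_sub_exp_sub_inv_le :
    ∃ C : ℝ, 0 < C ∧ ∀ u : ℂ, u ≠ 0 → ‖u‖ ≤ 2 * u.re → ‖1 / (1 - cexp (-u)) - 1 / u‖ ≤ C := by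
  have hκ := one_sub_exp_half_pos
  refine ⟨2 * (1 - rexp (-(1 / 2 : ℝ)))⁻¹ + 4, by positivity, fun u hu hre => ?_⟩
  have hu' : 0 < ‖u‖ := norm_pos_iff.2 hu
  rcases le_total ‖u‖ (1 / 2) with hle | hge
  · have h1 : ‖cexp (-u) - 1 - (-u)‖ ≤ ‖u‖ ^ 2 := by
      simpa using Complex.norm_exp_sub_one_sub_id_le (x := -u) (by rw [norm_neg]; linarith)
    have h2 : ‖u‖ / 2 ≤ ‖1 - cexp (-u)‖ := by
      have h3 : u = (1 - cexp (-u)) + (cexp (-u) - 1 - (-u)) := by ring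
      have h4 : ‖u‖ ≤ ‖1 - cexp (-u)‖ + ‖cexp (-u) - 1 - (-u)‖ := by
        conv_lhs => rw [h3]
        exact norm_add_le _ _
      nlinarith
    have h3 : 1 - cexp (-u) ≠ 0 := norm_pos_iff.1 (by linarith)
    have h4 : 1 / (1 - cexp (-u)) - 1 / u =
        (cexp (-u) - 1 - (-u)) / ((1 - cexp (-u)) * u) := by
      field_simp; ring
    rw [h4, norm_div, norm_mul]
    have : ‖cexp (-u) - 1 - (-u)‖ / (‖1 - cexp (-u)‖ * ‖u‖) ≤
        ‖u‖ ^ 2 / (‖u‖ / 2 * ‖u‖) := by gcongr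
    have h5 : ‖u‖ ^ 2 / (‖u‖ / 2 * ‖u‖) = 2 := by field_simp
    have h6 : 0 < (1 - rexp (-(1 / 2 : ℝ)))⁻¹ := by positivity
    linarith
  · have h7 : 1 / 4 ≤ u.re := by linarith
    have h8 : ‖1 / u‖ ≤ 2 := by
      rw [norm_div, norm_one, div_le_iff₀ hu']; linarith
    have h1 := one_sub_re_le_norm_one_sub_mul_exp (ω := 1) (u := u) norm_one
    rw [one_mul] at h1
    have h9 : (1 - rexp (-(1 / 2 : ℝ))) / 2 ≤ 1 - rexp (-u.re) := by
      have e1 : rexp (-u.re) ≤ rexp (-(1 / 4 : ℝ)) := Real.exp_le_exp.2 (by linarith)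
      have e2 : rexp (-(1 / 2 : ℝ)) = rexp (-(1 / 4 : ℝ)) ^ 2 := by
        rw [← exp_nat_mul]; norm_num
      nlinarith [sq_nonneg (rexp (-(1 / 4 : ℝ)) - 1)]
    refine (norm_sub_le _ _).trans ?_
    have h10 : ‖1 / (1 - cexp (-u))‖ ≤ 2 * (1 - rexp (-(1 / 2 : ℝ)))⁻¹ := by
      rw [norm_div, norm_one, one_div,
        show 2 * (1 - rexp (-(1 / 2 : ℝ)))⁻¹ = ((1 - rexp (-(1 / 2 : ℝ))) / 2)⁻¹ by
          rw [inv_div]; rfl]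
      exact inv_anti₀ (by positivity) (h9.trans h1)
    linarith

theorem exists_norm_inv_one_sub_mul_exp_le {ω : ℂ} (hω : ‖ω‖ = 1) (hω1 : ω ≠ 1) :
    ∃ C : ℝ, 0 < C ∧ ∀ u : ℂ, ‖u‖ ≤ 2 * u.re → ‖1 / (1 - ω * cexp (-u))‖ ≤ C := by
  set g := ‖1 - ω‖ with hg
  have hg0 : 0 < g := norm_pos_iff.2 (sub_ne_zero.2 hω1.symm)
  have hg2 : g ≤ 2 := by
    have := norm_sub_le (1 : ℂ) ω
    rw [norm_one, hω] at this; linarith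
  have hκ : 0 < 1 - rexp (-(g / 8)) := Datum.one_sub_exp_pos (by positivity)
  refine ⟨2 / g + (1 - rexp (-(g / 8)))⁻¹, by positivity, fun u hre => ?_⟩
  rw [norm_div, norm_one, one_div]
  rcases le_total ‖u‖ (g / 4) with hle | hge
  · have h1 : ‖cexp (-u) - 1‖ ≤ 2 * ‖u‖ := by
      simpa using norm_exp_sub_one_le (x := -u) (by rw [norm_neg]; linarith)
    have h2 : g / 2 ≤ ‖1 - ω * cexp (-u)‖ := by
      have e : 1 - ω = (1 - ω * cexp (-u)) + ω * (cexp (-u) - 1) := by ring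
      have h3 : g ≤ ‖1 - ω * cexp (-u)‖ + ‖ω * (cexp (-u) - 1)‖ := by
        rw [hg]; conv_lhs => rw [e]
        exact norm_add_le _ _
      rw [norm_mul, hω, one_mul] at h3
      linarith
    have h3 : ‖1 - ω * cexp (-u)‖⁻¹ ≤ 2 / g := by
      rw [← inv_div]; exact inv_anti₀ (by positivity) h2
    have : 0 < (1 - rexp (-(g / 8)))⁻¹ := by positivity
    linarith
  · have h1 := one_sub_re_le_norm_one_sub_mul_exp (u := u) hω
    have h2 : 1 - rexp (-(g / 8)) ≤ 1 - rexp (-u.re) := by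
      have : rexp (-u.re) ≤ rexp (-(g / 8)) := Real.exp_le_exp.2 (by linarith)
      linarith
    have h3 := inv_anti₀ hκ (h2.trans h1)
    have : 0 < 2 / g := by positivity
    linarith

theorem exists_norm_inv_one_sub_rootOfUnity_le {m : ℕ} (hm : 0 < m) {ζ : ℂ}
    (hζ : IsPrimitiveRoot ζ m) :
    ∃ C : ℝ, 0 < C ∧ ∀ (k : ℕ) (u : ℂ), u ≠ 0 → ‖u‖ ≤ 2 * u.re →
      ‖1 / (1 - ζ ^ k * cexp (-u)) - (if m ∣ k then 1 / u else 0)‖ ≤ C := by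
  have hζn : ‖ζ‖ = 1 := hζ.norm'_eq_one hm.ne'
  have key : ∀ j : ℕ, ∃ C : ℝ, 0 < C ∧ ∀ u : ℂ, u ≠ 0 → ‖u‖ ≤ 2 * u.re →
      ‖1 / (1 - ζ ^ j * cexp (-u)) - (if m ∣ j then 1 / u else 0)‖ ≤ C := by
    intro j
    by_cases hj : m ∣ j
    · obtain ⟨C, hC, h⟩ := exists_norm_inv_one_sub_exp_sub_inv_le
      refine ⟨C, hC, fun u hu hre => ?_⟩
      rw [(hζ.pow_eq_one_iff_dvd _).2 hj, one_mul, if_pos hj]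
      exact h u hu hre
    · obtain ⟨C, hC, h⟩ := exists_norm_inv_one_sub_mul_exp_le (ω := ζ ^ j) (by simp [hζn])
        fun h' => hj ((hζ.pow_eq_one_iff_dvd _).1 h')
      refine ⟨C, hC, fun u hu hre => ?_⟩
      rw [if_neg hj, sub_zero]
      exact h u hre
  choose C hC hCle using key
  refine ⟨∑ j ∈ range m, C j, Finset.sum_pos (fun j _ => hC j) ⟨0, by simpa using hm⟩,
    fun k u hu hre => ?_⟩
  have h1 : ζ ^ k = ζ ^ (k % m) := by
    conv_lhs => rw [← Nat.div_add_mod k m, pow_add, pow_mul, hζ.pow_eq_one, one_pow, one_mul]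
  have h2 : (m ∣ k) = (m ∣ k % m) := by rw [Nat.dvd_mod_iff dvd_rfl]
  simp only [h1, h2]
  refine (hCle (k % m) u hu hre).trans ?_
  exact Finset.single_le_sum (f := C) (fun j _ => (hC j).le)
    (Finset.mem_range.2 (Nat.mod_lt _ hm))

theorem norm_mul_exp_neg_lt_one {ζ h : ℂ} (hζ : ‖ζ‖ = 1) (h0 : 0 < h.re) :
    ‖ζ * cexp (-h)‖ < 1 := by
  rw [norm_mul, hζ, one_mul, norm_exp, neg_re]
  exact Real.exp_lt_one_iff.2 (by linarith)

theorem re_pos_of_norm_le {h : ℂ} (h0 : h ≠ 0) (hre : ‖h‖ ≤ 2 * h.re) : 0 < h.re := by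
  have := norm_pos_iff.2 h0
  linarith

/-- Leading behaviour of `log (x; q)_∞` as `q = ζ e^{-h}` tends to `ζ` in a sector. -/
theorem exists_norm_lq_sub_dilog_le {m : ℕ} (hm : 0 < m) {ζ : ℂ} (hζ : IsPrimitiveRoot ζ m)
    {r : ℝ} (hr : r < 1) :
    ∃ C : ℝ, 0 < C ∧ ∀ h : ℂ, h ≠ 0 → ‖h‖ ≤ 2 * h.re → ∀ x : ℂ, ‖x‖ ≤ r →
      ‖lq (ζ * cexp (-h)) x - polylog 2 (x ^ m) / (m ^ 2 * h)‖ ≤ C := by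
  have hζn : ‖ζ‖ = 1 := hζ.norm'_eq_one hm.ne'
  obtain ⟨C, hC, hCle⟩ := exists_norm_inv_one_sub_rootOfUnity_le hm hζ
  have hm' : (m : ℂ) ≠ 0 := by exact_mod_cast hm.ne'
  set r' := max r 0
  have hr0 : 0 ≤ r' := le_max_right _ _
  have hr1 : r' < 1 := max_lt hr one_pos
  have hgeo := (hasSum_geometric_of_lt_one hr0 hr1).mul_left C
  refine ⟨C * (1 - r')⁻¹, mul_pos hC (inv_pos.2 (by linarith)), fun h h0 hre x hx => ?_⟩
  have hx1 : ‖x‖ < 1 := hx.trans_lt hr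
  have hre0 := re_pos_of_norm_le h0 hre
  have hq : ‖ζ * cexp (-h)‖ < 1 := norm_mul_exp_neg_lt_one hζn hre0
  have e1 : polylog 2 (x ^ m) / (m ^ 2 * h) =
      ∑' k : ℕ, (if m ∣ k + 1 then x ^ (k + 1) / (((k + 1 : ℕ) : ℂ) * (((k + 1 : ℕ) : ℂ) * h))
        else 0) := by
    rw [tsum_dvd_succ hm fun k => x ^ k / ((k : ℂ) * ((k : ℂ) * h)), polylog, ← tsum_div_const]
    refine tsum_congr fun j => ?_
    have : ((j + 1 : ℕ) : ℂ) ≠ 0 := Nat.cast_ne_zero.2 (by omega)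
    rw [zpow_ofNat, ← pow_mul, Nat.cast_mul]
    field_simp
  have hs2 : Summable fun k : ℕ => (if m ∣ k + 1 then x ^ (k + 1) /
      (((k + 1 : ℕ) : ℂ) * (((k + 1 : ℕ) : ℂ) * h)) else 0) := by
    refine Summable.of_norm_bounded ((summable_norm_polylog 2 hx1).div_const ‖h‖) fun k => ?_
    split_ifs
    · rw [← norm_div, zpow_ofNat, pow_two, div_div, mul_assoc]
    · rw [norm_zero]; positivity
  rw [e1, lq, ← (summable_lq hq hx1).tsum_sub hs2]
  refine tsum_of_norm_bounded hgeo fun k => ?_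
  have hk : ((k + 1 : ℕ) : ℂ) ≠ 0 := Nat.cast_ne_zero.2 (by omega)
  have hkr : (0 : ℝ) < ((k + 1 : ℕ) : ℝ) := by positivity
  have hu := hCle (k + 1) (((k + 1 : ℕ) : ℂ) * h) (mul_ne_zero hk h0) (by
    rw [norm_mul, Complex.norm_natCast, ← ofReal_natCast, re_ofReal_mul]
    nlinarith)
  have e2 : x ^ (k + 1) / (((k + 1 : ℕ) : ℂ) * (1 - (ζ * cexp (-h)) ^ (k + 1))) -
      (if m ∣ k + 1 then x ^ (k + 1) / (((k + 1 : ℕ) : ℂ) * (((k + 1 : ℕ) : ℂ) * h)) else 0) =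
      x ^ (k + 1) / ((k + 1 : ℕ) : ℂ) * (1 / (1 - ζ ^ (k + 1) * cexp (-(((k + 1 : ℕ) : ℂ) * h)))
        - (if m ∣ k + 1 then 1 / (((k + 1 : ℕ) : ℂ) * h) else 0)) := by
    rw [mul_pow, ← Complex.exp_nat_mul, mul_neg]
    split_ifs
    · rw [mul_sub (x ^ (k + 1) / _), div_mul_div_comm, div_mul_div_comm, mul_one]
    · rw [sub_zero, sub_zero, div_mul_div_comm, mul_one]
  rw [e2, norm_mul, norm_div, norm_pow, Complex.norm_natCast, mul_comm C]
  have hx' : ‖x‖ ≤ r' := hx.trans (le_max_left _ _)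
  have h3 : ‖x‖ ^ (k + 1) / ((k + 1 : ℕ) : ℝ) ≤ r' ^ k := by
    have h1k : (1 : ℝ) ≤ ((k + 1 : ℕ) : ℝ) := by push_cast; linarith [k.cast_nonneg (α := ℝ)]
    refine (div_le_self (by positivity) h1k).trans ?_
    calc ‖x‖ ^ (k + 1) ≤ ‖x‖ ^ k := pow_le_pow_of_le_one (norm_nonneg _) hx1.le (by omega)
      _ ≤ r' ^ k := pow_le_pow_left₀ (norm_nonneg _) hx' _
  exact mul_le_mul h3 hu (norm_nonneg _) (pow_nonneg hr0 _)

/-! ### The dilogarithm on a circle -/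

theorem norm_dilog_sub_le {r : ℝ} (hr : r < 1) {x y : ℂ} (hx : ‖x‖ ≤ r) (hy : ‖y‖ ≤ r) :
    ‖polylog 2 x - polylog 2 y‖ ≤ (1 - r)⁻¹ * ‖x - y‖ := by
  have hr0 : 0 ≤ r := (norm_nonneg x).trans hx
  rw [polylog, polylog, ← (summable_polylog 2 (hx.trans_lt hr)).tsum_sub
    (summable_polylog 2 (hy.trans_lt hr))]
  refine tsum_of_norm_bounded ((hasSum_geometric_of_lt_one hr0 hr).mul_right ‖x - y‖) fun k => ?_
  rw [← sub_div, norm_div, zpow_ofNat, norm_pow, Complex.norm_natCast]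
  have h1 : ‖x ^ (k + 1) - y ^ (k + 1)‖ ≤ (k + 1 : ℕ) * r ^ k * ‖x - y‖ := by
    rw [← (Commute.all x y).geom_sum₂_mul, norm_mul]
    refine mul_le_mul_of_nonneg_right ?_ (norm_nonneg _)
    refine (norm_sum_le_of_le (f := fun i => x ^ i * y ^ (k + 1 - 1 - i)) (n := fun _ => r ^ k) _
      fun i hi => ?_).trans (by simp)
    rw [norm_mul, norm_pow, norm_pow]
    have hi' : i ≤ k := by have := Finset.mem_range.1 hi; omega
    calc ‖x‖ ^ i * ‖y‖ ^ (k + 1 - 1 - i) ≤ r ^ i * r ^ (k + 1 - 1 - i) := by gcongr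
      _ = r ^ k := by rw [← pow_add]; congr 1; omega
  have hk1 : (1 : ℝ) ≤ ((k + 1 : ℕ) : ℝ) := by push_cast; linarith [k.cast_nonneg (α := ℝ)]
  rw [div_le_iff₀ (by positivity)]
  refine h1.trans ?_
  have : 0 ≤ r ^ k * ‖x - y‖ := by positivity
  nlinarith [mul_le_mul_of_nonneg_left hk1 (mul_nonneg this (by positivity : 0 ≤ ((k + 1 : ℕ) : ℝ)))]

theorem norm_exp_mul_I_sub_one_sub_le (φ : ℝ) :
    ‖cexp (φ * Complex.I) - 1 - φ * Complex.I‖ ≤ 2 * φ ^ 2 := by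
  have hn : ‖(φ : ℂ) * Complex.I‖ = |φ| := by simp
  rcases le_total |φ| 1 with h | h
  · have := Complex.norm_exp_sub_one_sub_id_le (x := φ * Complex.I) (by rwa [hn])
    rw [hn, sq_abs] at this
    nlinarith [sq_nonneg φ]
  · refine (norm_sub_le _ _).trans ?_
    have h1 : ‖cexp (φ * Complex.I) - 1‖ ≤ |φ| := by
      rw [mul_comm]; exact Real.norm_exp_I_mul_ofReal_sub_one_le
    rw [hn]
    nlinarith [sq_abs φ, abs_nonneg φ]

/-- Second order expansion of the dilogarithm on a circle around the origin. -/
theorem norm_dilog_circle_le {r : ℝ} (hr0 : 0 ≤ r) (hr : r < 1) (φ : ℝ) :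
    ‖polylog 2 ((r : ℂ) * cexp (φ * Complex.I)) - polylog 2 (r : ℂ) +
      φ * Complex.I * log (1 - r)‖ ≤ (1 - r)⁻¹ * (2 * φ ^ 2) := by
  have hrn : ‖(r : ℂ)‖ < 1 := by rwa [norm_real, norm_of_nonneg hr0]
  have hx : ‖(r : ℂ) * cexp (φ * Complex.I)‖ < 1 := by
    rw [norm_mul, norm_exp_ofReal_mul_I, mul_one]; exact hrn
  have hlog : (log (1 - r) : ℂ) = -polylog 1 (r : ℂ) := by
    rw [polylog_one hrn, neg_neg, ofReal_log (by linarith)]; push_cast; rfl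
  rw [hlog, mul_neg, ← sub_eq_add_neg, polylog, polylog, polylog, ← tsum_mul_left,
    ← (summable_polylog 2 hx).tsum_sub (summable_polylog 2 hrn),
    ← ((summable_polylog 2 hx).sub (summable_polylog 2 hrn)).tsum_sub
      ((summable_polylog 1 hrn).mul_left _)]
  refine tsum_of_norm_bounded ((hasSum_geometric_of_lt_one hr0 hr).mul_right (2 * φ ^ 2)) fun k => ?_
  have hk : ((k + 1 : ℕ) : ℂ) ≠ 0 := Nat.cast_ne_zero.2 (by omega)
  have e : ((r : ℂ) * cexp (φ * Complex.I)) ^ (k + 1) / ((k + 1 : ℕ) : ℂ) ^ (2 : ℤ) -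
      (r : ℂ) ^ (k + 1) / ((k + 1 : ℕ) : ℂ) ^ (2 : ℤ) -
      φ * Complex.I * ((r : ℂ) ^ (k + 1) / ((k + 1 : ℕ) : ℂ) ^ (1 : ℤ)) =
      (r : ℂ) ^ (k + 1) / ((k + 1 : ℕ) : ℂ) ^ 2 * (cexp (((((k + 1 : ℕ) : ℝ) * φ : ℝ) : ℂ) *
        Complex.I) - 1 - ((((k + 1 : ℕ) : ℝ) * φ : ℝ) : ℂ) * Complex.I) := by
    rw [mul_pow, ← Complex.exp_nat_mul, zpow_ofNat, zpow_one]
    push_cast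
    rw [show ((k : ℂ) + 1) * (φ * Complex.I) = ((k : ℂ) + 1) * φ * Complex.I by ring]
    push_cast at hk
    field_simp
  rw [e, norm_mul, norm_div, norm_pow, norm_pow, Complex.norm_natCast, norm_real,
    norm_of_nonneg hr0]
  have h1 := norm_exp_mul_I_sub_one_sub_le (((k + 1 : ℕ) : ℝ) * φ)
  have hkr : (0 : ℝ) < ((k + 1 : ℕ) : ℝ) := by positivity
  calc _ ≤ r ^ (k + 1) / ((k + 1 : ℕ) : ℝ) ^ 2 * (2 * (((k + 1 : ℕ) : ℝ) * φ) ^ 2) := by gcongr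
    _ = r ^ (k + 1) * (2 * φ ^ 2) := by field_simp
    _ ≤ r ^ k * (2 * φ ^ 2) :=
      mul_le_mul_of_nonneg_right (pow_le_pow_of_le_one hr0 hr.le (Nat.le_succ k)) (by positivity)

theorem re_dilog_circle_le {r : ℝ} (hr0 : 0 ≤ r) (hr : r < 1) (φ : ℝ) :
    (polylog 2 ((r : ℂ) * cexp (φ * Complex.I))).re ≤
      polylog 2 r - r * (1 - cos φ) := by
  have hrn : ‖(r : ℂ)‖ < 1 := by rwa [norm_real, norm_of_nonneg hr0]
  have hrn' : ‖r‖ < 1 := by rwa [norm_of_nonneg hr0]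
  have hx : ‖(r : ℂ) * cexp (φ * Complex.I)‖ < 1 := by
    rw [norm_mul, norm_exp_ofReal_mul_I, mul_one]; exact hrn
  have hs := summable_polylog 2 hx
  have hre : ∀ k : ℕ, (((r : ℂ) * cexp (φ * Complex.I)) ^ (k + 1) /
      ((k + 1 : ℕ) : ℂ) ^ (2 : ℤ)).re = r ^ (k + 1) / ((k + 1 : ℕ) : ℝ) ^ (2 : ℤ) *
        cos (((k + 1 : ℕ) : ℝ) * φ) := by
    intro k
    rw [mul_pow, ← Complex.exp_nat_mul, zpow_ofNat, zpow_ofNat,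
      show ((k + 1 : ℕ) : ℂ) * (φ * Complex.I) = ((((k + 1 : ℕ) : ℝ) * φ : ℝ) : ℂ) * Complex.I by
        push_cast; ring,
      show (r : ℂ) ^ (k + 1) * cexp (((((k + 1 : ℕ) : ℝ) * φ : ℝ) : ℂ) * Complex.I) /
        ((k + 1 : ℕ) : ℂ) ^ 2 = ((r ^ (k + 1) / ((k + 1 : ℕ) : ℝ) ^ 2 : ℝ) : ℂ) *
          cexp (((((k + 1 : ℕ) : ℝ) * φ : ℝ) : ℂ) * Complex.I) by push_cast; ring,
      re_ofReal_mul, Complex.exp_ofReal_mul_I_re]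
  have hsr : Summable fun k : ℕ => r ^ (k + 1) / ((k + 1 : ℕ) : ℝ) ^ (2 : ℤ) *
        cos (((k + 1 : ℕ) : ℝ) * φ) := (Complex.reCLM.summable hs).congr fun k => hre k
  have h0 : (polylog 2 ((r : ℂ) * cexp (φ * Complex.I))).re =
      ∑' k : ℕ, r ^ (k + 1) / ((k + 1 : ℕ) : ℝ) ^ (2 : ℤ) * cos (((k + 1 : ℕ) : ℝ) * φ) := by
    rw [polylog, Complex.re_tsum hs]
    exact tsum_congr hre
  rw [h0, polylog]
  have hs' := summable_polylog (𝕜 := ℝ) 2 hrn'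
  rw [hsr.tsum_eq_zero_add, hs'.tsum_eq_zero_add]
  have h1 : ∑' k : ℕ, r ^ (k + 1 + 1) / ((k + 1 + 1 : ℕ) : ℝ) ^ (2 : ℤ) *
      cos (((k + 1 + 1 : ℕ) : ℝ) * φ) ≤
      ∑' k : ℕ, r ^ (k + 1 + 1) / ((k + 1 + 1 : ℕ) : ℝ) ^ (2 : ℤ) := by
    refine Summable.tsum_le_tsum (fun k => ?_) ((summable_nat_add_iff 1).2 hsr)
      ((summable_nat_add_iff 1).2 hs')
    refine mul_le_of_le_one_right ?_ (cos_le_one _)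
    rw [zpow_ofNat]; positivity
  simp only [zero_add, pow_one, Nat.cast_one, one_zpow, div_one, one_mul] at h1 ⊢
  linarith

/-! ### Finite Fourier expansion -/

theorem exists_finite_fourier {N L : ℕ} (hL : 0 < L) (p : (Fin N → ℕ) → ℂ)
    (hp : ∀ n n' : Fin N → ℕ, (∀ i, n i ≡ n' i [MOD L]) → p n = p n') :
    ∃ γ : (Fin N → Fin L) → ℂ, ∀ n : Fin N → ℕ,
      p n = ∑ l : Fin N → Fin L, γ l * ∏ i, expi (((l i : ℕ) / L : ℚ) : ℂ) ^ n i := by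
  have hL' : (L : ℂ) ≠ 0 := by exact_mod_cast hL.ne'
  refine ⟨fun l => ∑ k : Fin N → Fin L, p (fun i => (k i : ℕ)) *
    ∏ i, (L : ℂ)⁻¹ * expi ((-((l i : ℕ) * (k i : ℕ) / L) : ℚ) : ℂ), fun n => ?_⟩
  have h1 : ∀ k : Fin N → Fin L, ∑ l : Fin N → Fin L,
      (∏ i, (L : ℂ)⁻¹ * expi ((-((l i : ℕ) * (k i : ℕ) / L) : ℚ) : ℂ)) *
        ∏ i, expi (((l i : ℕ) / L : ℚ) : ℂ) ^ n i = if (∀ i, n i % L = k i) then 1 else 0 := by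
    intro k
    simp_rw [← prod_mul_distrib]
    have h2 := Finset.prod_univ_sum (R := ℂ) (fun _ : Fin N => (univ : Finset (Fin L)))
      fun i l => (L : ℂ)⁻¹ * expi ((-((l : ℕ) * (k i : ℕ) / L) : ℚ) : ℂ) *
        expi (((l : ℕ) / L : ℚ) : ℂ) ^ n i
    rw [Fintype.piFinset_univ] at h2
    rw [← h2]
    have h3 : ∀ i, ∑ l : Fin L, (L : ℂ)⁻¹ * expi ((-((l : ℕ) * (k i : ℕ) / L) : ℚ) : ℂ) *
        expi (((l : ℕ) / L : ℚ) : ℂ) ^ n i = if n i % L = k i then 1 else 0 := by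
      intro i
      have h4 := sum_expi_div L hL ((n i : ℤ) - (k i : ℕ))
      rw [← Fin.sum_univ_eq_sum_range
        (fun l : ℕ => expi ((l * (((n i : ℤ) - (k i : ℕ) : ℤ) : ℚ) / L : ℚ) : ℂ))] at h4
      have h5 : ∀ l : Fin L, (L : ℂ)⁻¹ * expi ((-((l : ℕ) * (k i : ℕ) / L) : ℚ) : ℂ) *
        expi (((l : ℕ) / L : ℚ) : ℂ) ^ n i = (L : ℂ)⁻¹ *
          expi (((l : ℕ) * (((n i : ℤ) - (k i : ℕ) : ℤ) : ℚ) / L : ℚ) : ℂ) := fun l => by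
        rw [mul_assoc, ← expi_nat_mul, ← expi_add]
        congr 2
        push_cast; ring
      rw [sum_congr rfl fun l _ => h5 l, ← mul_sum, h4]
      have h6 : ((L : ℤ) ∣ (n i : ℤ) - (k i : ℕ)) ↔ n i % L = k i := by
        rw [← Int.modEq_iff_dvd, Int.natCast_modEq_iff, Nat.ModEq, Nat.mod_eq_of_lt (k i).2, eq_comm]
      simp only [h6]
      split_ifs
      · field_simp
      · simp
    rw [prod_congr rfl fun i _ => h3 i]
    split_ifs with h
    · exact Finset.prod_eq_one fun i _ => if_pos (h i)
    · push Not at h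
      obtain ⟨i, hi⟩ := h
      exact Finset.prod_eq_zero (mem_univ i) (if_neg hi)
  simp_rw [sum_mul]
  rw [sum_comm]
  simp_rw [mul_assoc, ← mul_sum, h1]
  rw [Finset.sum_eq_single fun i => (⟨n i % L, Nat.mod_lt _ hL⟩ : Fin L)]
  · rw [if_pos fun i => rfl, mul_one]
    exact hp _ _ fun i => (Nat.mod_modEq _ _).symm
  · intro k _ hk
    rw [if_neg, mul_zero]
    intro h
    exact hk (funext fun i => Fin.ext (h i).symm)
  · simp

/-! ### A Gaussian integral representation -/

theorem dotProduct_gram_mulVec {N : ℕ} (R : Matrix (Fin N) (Fin N) ℝ) (x y : Fin N → ℝ) :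
    x ⬝ᵥ (R.transpose * R).mulVec y = R.mulVec x ⬝ᵥ R.mulVec y := by
  rw [← Matrix.mulVec_mulVec, Matrix.dotProduct_mulVec, Matrix.vecMul_transpose]

theorem integral_gaussian_shift {N : ℕ} (R : Matrix (Fin N) (Fin N) ℝ) (n y : Fin N → ℝ) {h M : ℂ}
    (hh : 0 < h.re) (hM : M ≠ 0) :
    ∫ v : Fin N → ℝ, cexp (-∑ i, (1 / (2 * h)) * (v i : ℂ) ^ 2 +
        ∑ i, (Complex.I * (R.mulVec n i - R.mulVec y i / (M * h))) * v i) =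
      (∏ _i : Fin N, (π / (1 / (2 * h))) ^ (1 / 2 : ℂ)) *
        cexp (-(h / 2) * (n ⬝ᵥ (R.transpose * R).mulVec n : ℝ) +
          1 / M * (n ⬝ᵥ (R.transpose * R).mulVec y : ℝ) -
          1 / (2 * M ^ 2 * h) * (y ⬝ᵥ (R.transpose * R).mulVec y : ℝ)) := by
  have h0 : h ≠ 0 := fun h' => by simp [h'] at hh
  have hb : ∀ _i : Fin N, 0 < (1 / (2 * h)).re := fun _ => by
    rw [one_div, inv_re]
    have : 0 < normSq (2 * h) := Complex.normSq_pos.2 (mul_ne_zero two_ne_zero h0)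
    refine div_pos ?_ this
    simpa using hh
  rw [GaussianFourier.integral_cexp_neg_sum_mul_add hb, prod_mul_distrib, ← Complex.exp_sum]
  congr 2
  simp only [dotProduct_gram_mulVec]
  simp only [dotProduct]
  push_cast
  rw [mul_sum, mul_sum, mul_sum, ← sum_add_distrib,
    ← sum_sub_distrib]
  refine sum_congr rfl fun i _ => ?_
  rw [mul_pow, I_sq]
  field_simp
  ring

open MatrixOrder in
theorem exists_gram {N : ℕ} {M : Matrix (Fin N) (Fin N) ℝ} (hM : M.PosSemidef) :
    ∃ R : Matrix (Fin N) (Fin N) ℝ, M = R.transpose * R := by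
  obtain ⟨R, hR⟩ := CStarAlgebra.nonneg_iff_eq_star_mul_self.1 (Matrix.nonneg_iff_posSemidef.2 hM)
  exact ⟨R, hR⟩

/-- The Gaussian kernel, with a linear phase, of the integral representation. -/
noncomputable def gaussKernel {N : ℕ} (R : Matrix (Fin N) (Fin N) ℝ) (y : Fin N → ℝ) (h M : ℂ)
    (v : Fin N → ℝ) : ℂ :=
  cexp (-∑ i, (1 / (2 * h)) * (v i : ℂ) ^ 2 +
    ∑ i, (-Complex.I * (R.mulVec y i / (M * h))) * v i)

namespace Datum

variable {N : ℕ} (Q : Datum N)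

theorem integrable_gaussKernel (R : Matrix (Fin N) (Fin N) ℝ) (y : Fin N → ℝ) {h : ℂ} (M : ℂ)
    (hh : 0 < h.re) : Integrable (gaussKernel R y h M) := by
  refine GaussianFourier.integrable_cexp_neg_sum_mul_add (fun _ => ?_) _
  have h0 : h ≠ 0 := fun h' => by simp [h'] at hh
  rw [one_div, inv_re]
  have : 0 < normSq (2 * h) := Complex.normSq_pos.2 (mul_ne_zero two_ne_zero h0)
  refine div_pos ?_ this
  simpa using hh

/-- The argument of the Pochhammer symbols in the integral representation. -/
noncomputable def nodeArg (R : Matrix (Fin N) (Fin N) ℝ) (z : Fin N → ℝ) (m : ℕ) (h : ℂ)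
    (ω : Fin N → ℂ) (v : Fin N → ℝ) (i : Fin N) : ℂ :=
  ω i * cexp (log (1 - z i) / m - h * Q.b i + Complex.I * R.transpose.mulVec v i)

theorem norm_nodeArg (R : Matrix (Fin N) (Fin N) ℝ) (z : Fin N → ℝ) (m : ℕ) (h : ℂ)
    {ω : Fin N → ℂ} (hω : ∀ i, ‖ω i‖ = 1) (v : Fin N → ℝ) (i : Fin N) :
    ‖Q.nodeArg R z m h ω v i‖ = rexp (log (1 - z i) / m - h.re * Q.b i) := by
  rw [nodeArg, norm_mul, hω, one_mul, norm_exp]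
  congr 1
  simp [div_natCast_re]

/-- The terms of the Nahm sum with the phase replaced by a character. -/
noncomputable def twistedTerm (h : ℂ) (ω q : Fin N → ℂ) (n : Fin N → ℕ) : ℂ :=
  cexp (-h * Q.quadR fun i => (n i : ℝ)) * ∏ i, ω i ^ n i / qPoch (q i) (q i) (n i)

theorem exp_neg_quadR_eq {z : Fin N → ℝ} (hz : Q.IsNahmSolution z)
    {R : Matrix (Fin N) (Fin N) ℝ} (hR : Q.B = R.transpose * R) {m : ℕ} (hm : 0 < m) {h : ℂ}
    (hh : 0 < h.re) (ω : Fin N → ℂ) (n : Fin N → ℕ) :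
    cexp (-h * Q.quadR fun i => (n i : ℝ)) * ∏ i, ω i ^ n i =
      cexp (-h * Q.c + 1 / (2 * m ^ 2 * h) *
          (Q.saddle z ⬝ᵥ Q.B.mulVec (Q.saddle z) : ℝ)) *
        (∏ _i : Fin N, (π / (1 / (2 * h))) ^ (1 / 2 : ℂ))⁻¹ *
        ∫ v : Fin N → ℝ, gaussKernel R (Q.saddle z) h m v *
          ∏ i, Q.nodeArg R z m h ω v i ^ n i := by
  have h0 : h ≠ 0 := fun h' => by simp [h'] at hh
  have hm' : (m : ℂ) ≠ 0 := by exact_mod_cast hm.ne'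
  have hZ : (∏ _i : Fin N, (π / (1 / (2 * h))) ^ (1 / 2 : ℂ)) ≠ 0 := by
    refine Finset.prod_ne_zero_iff.2 fun i _ => ?_
    rw [Ne, Complex.cpow_eq_zero_iff]
    rintro ⟨h1, -⟩
    refine absurd h1 (div_ne_zero (by exact_mod_cast Real.pi_pos.ne') ?_)
    exact one_div_ne_zero (mul_ne_zero two_ne_zero h0)
  set nr : Fin N → ℝ := fun i => (n i : ℝ) with hnr
  have e1 : ∀ v : Fin N → ℝ, gaussKernel R (Q.saddle z) h m v * ∏ i, Q.nodeArg R z m h ω v i ^ n i =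
      (∏ i, (ω i ^ n i * cexp (n i * (log (1 - z i) / m - h * Q.b i)))) *
      cexp (-∑ i, (1 / (2 * h)) * (v i : ℂ) ^ 2 +
        ∑ i, (Complex.I * (R.mulVec nr i - R.mulVec (Q.saddle z) i / (m * h))) * v i) := by
    intro v
    have e2 : ∑ i, (Complex.I * (R.mulVec nr i : ℝ)) * (v i : ℂ) =
        ∑ i, (n i : ℂ) * (Complex.I * (R.transpose.mulVec v i : ℝ)) := by
      have : R.mulVec nr ⬝ᵥ v = nr ⬝ᵥ R.transpose.mulVec v := by
        rw [Matrix.dotProduct_mulVec, Matrix.vecMul_transpose]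
      simp only [dotProduct, hnr] at this
      have := congrArg (fun x : ℝ => Complex.I * (x : ℂ)) this
      push_cast at this
      rw [mul_sum, mul_sum] at this
      calc _ = ∑ i, Complex.I * ((R.mulVec nr i : ℂ) * (v i : ℂ)) :=
            sum_congr rfl fun i _ => by ring
        _ = _ := this
        _ = _ := sum_congr rfl fun i _ => by ring
    have e3 : ∀ i, Q.nodeArg R z m h ω v i ^ n i =
        (ω i ^ n i * cexp (n i * (log (1 - z i) / m - h * Q.b i))) *
          cexp ((n i : ℂ) * (Complex.I * (R.transpose.mulVec v i : ℝ))) := fun i => by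
      rw [nodeArg, mul_pow, ← Complex.exp_nat_mul, mul_assoc, ← Complex.exp_add]
      congr 2; ring
    rw [prod_congr rfl fun i _ => e3 i, prod_mul_distrib, gaussKernel, mul_left_comm,
      ← Complex.exp_sum, ← Complex.exp_add, ← e2, add_assoc, ← sum_add_distrib]
    congr 3
    congr 1
    ext i
    ring
  simp_rw [e1]
  rw [integral_const_mul, integral_gaussian_shift R nr (Q.saddle z) hh hm', ← hR,
    prod_mul_distrib, ← Complex.exp_sum]
  have e4 : nr ⬝ᵥ Q.B.mulVec (Q.saddle z) = -∑ i, (n i : ℝ) * log (1 - z i) := by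
    rw [dotProduct, ← sum_neg_distrib]
    exact sum_congr rfl fun i _ => by rw [Q.B_mulVec_saddle hz]; simp [hnr]
  have e5 : ∑ i, (n i : ℂ) * (log (1 - z i) / m - h * Q.b i) =
      (∑ i, (n i : ℂ) * log (1 - z i)) / m - h * ∑ i, (n i : ℂ) * Q.b i := by
    rw [sum_div, mul_sum, ← sum_sub_distrib]
    exact sum_congr rfl fun i _ => by ring
  have e6 : (Q.quadR nr : ℂ) = 1 / 2 * (nr ⬝ᵥ Q.B.mulVec nr : ℝ) + ∑ i, (n i : ℂ) * Q.b i + Q.c := by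
    rw [quadR]; push_cast
    congr 2
    simp [dotProduct, hnr]
  rw [e4, e5, e6]
  push_cast
  set Z := (∏ _i : Fin N, (π / (1 / (2 * h))) ^ (1 / 2 : ℂ)) with hZdef
  set W := ∏ i, ω i ^ n i
  have : ∀ a b c d : ℂ, a = b + c + d →
      cexp a * W = cexp b * Z⁻¹ * (W * cexp c * (Z * cexp d)) := by
    intro a b c d habc
    rw [habc, Complex.exp_add, Complex.exp_add]
    field_simp
  apply this
  field_simp
  ring

theorem tsum_twistedTerm {z : Fin N → ℝ} (hz : Q.IsNahmSolution z)
    {R : Matrix (Fin N) (Fin N) ℝ} (hR : Q.B = R.transpose * R) {m : ℕ} (hm : 0 < m) {h : ℂ}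
    (hh : 0 < h.re) {ω q : Fin N → ℂ} (hω : ∀ i, ‖ω i‖ = 1) (hq : ∀ i, ‖q i‖ < 1)
    (hX : ∀ i, rexp (log (1 - z i) / m - h.re * Q.b i) < 1) :
    ∑' n, Q.twistedTerm h ω q n =
      cexp (-h * Q.c + 1 / (2 * m ^ 2 * h) *
          (Q.saddle z ⬝ᵥ Q.B.mulVec (Q.saddle z) : ℝ)) *
        (∏ _i : Fin N, (π / (1 / (2 * h))) ^ (1 / 2 : ℂ))⁻¹ *
        ∫ v : Fin N → ℝ, gaussKernel R (Q.saddle z) h m v *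
          ∏ i, cexp (lq (q i) (Q.nodeArg R z m h ω v i)) := by
  set K := cexp (-h * Q.c + 1 / (2 * m ^ 2 * h) *
          (Q.saddle z ⬝ᵥ Q.B.mulVec (Q.saddle z) : ℝ)) *
        (∏ _i : Fin N, (π / (1 / (2 * h))) ^ (1 / 2 : ℂ))⁻¹ with hK
  set X := Q.nodeArg R z m h ω
  set ρ : Fin N → ℝ := fun i => rexp (log (1 - z i) / m - h.re * Q.b i) with hρ
  have hXn : ∀ v i, ‖X v i‖ = ρ i := fun v i => Q.norm_nodeArg R z m h hω v i
  set F : (Fin N → ℕ) → (Fin N → ℝ) → ℂ := fun n v => gaussKernel R (Q.saddle z) h m v *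
    ∏ i, X v i ^ n i / qPoch (q i) (q i) (n i) with hF
  have hterm : ∀ n, Q.twistedTerm h ω q n = K * ∫ v, F n v := by
    intro n
    have := Q.exp_neg_quadR_eq hz hR hm hh ω n
    rw [twistedTerm, prod_div_distrib, ← mul_div_assoc, this, ← hK, mul_div_assoc,
      ← integral_div]
    congr 2
    ext v
    rw [hF]; simp only
    rw [prod_div_distrib, mul_div_assoc]
  have hG := integrable_gaussKernel R (Q.saddle z) (m : ℂ) hh
  have hFn : ∀ n v, ‖F n v‖ = ‖gaussKernel R (Q.saddle z) h m v‖ *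
      ‖∏ i, (ρ i : ℂ) ^ n i / qPoch (q i) (q i) (n i)‖ := by
    intro n v
    simp only [hF]
    rw [norm_mul, norm_prod, norm_prod]
    congr 1
    refine prod_congr rfl fun i _ => ?_
    rw [norm_div, norm_div, norm_pow, norm_pow, hXn, norm_real,
      norm_of_nonneg (exp_pos _).le]
  have hmeas : ∀ n, AEStronglyMeasurable (F n) volume := fun n => by
    refine Continuous.aestronglyMeasurable ?_
    simp only [hF, X, gaussKernel, nodeArg]
    refine Continuous.mul (by fun_prop) (continuous_finsetProd _ fun i _ => ?_)
    refine Continuous.div_const ?_ _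
    have : Continuous fun v : Fin N → ℝ => R.transpose.mulVec v i := by
      simp only [Matrix.mulVec]; fun_prop
    fun_prop
  have hFi : ∀ n, Integrable (F n) := fun n => by
    refine (hG.mul_const (∏ i, (ρ i : ℂ) ^ n i / qPoch (q i) (q i) (n i))).mono (hmeas n)
      (Eventually.of_forall fun v => ?_)
    rw [hFn, norm_mul]
  have hρs : Summable fun n : Fin N → ℕ => ‖∏ i, (ρ i : ℂ) ^ n i / qPoch (q i) (q i) (n i)‖ := by
    refine summable_norm_prod (fun i n => (ρ i : ℂ) ^ n / qPoch (q i) (q i) n) fun i => ?_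
    refine summable_norm_pow_div_qPoch (hq i) ?_
    rw [norm_real, norm_of_nonneg (exp_pos _).le]
    exact hX i
  have hsum := hasSum_integral_of_summable_integral_norm hFi (by
    simp_rw [hFn, integral_mul_const]
    exact hρs.mul_left _)
  simp_rw [hterm]
  rw [tsum_mul_left, hsum.tsum_eq]
  congr 2
  ext v
  simp only [hF]
  rw [tsum_mul_left]
  congr 1
  have hXv : ∀ i, ‖X v i‖ < 1 := fun i => by rw [hXn]; exact hX i
  rw [tsum_prod_eq_prod_tsum (fun i n => X v i ^ n / qPoch (q i) (q i) n)
    fun i => summable_norm_pow_div_qPoch (hq i) (hXv i)]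
  exact prod_congr rfl fun i _ => tsum_pow_div_qPoch (hq i) (hXv i)

end Datum

/-! ### The phase function -/

theorem abs_mulVec_le {N : ℕ} (M : Matrix (Fin N) (Fin N) ℝ) (i : Fin N) :
    ∃ C : ℝ, 0 < C ∧ ∀ v : Fin N → ℝ, M.mulVec v i ^ 2 ≤ C * ∑ j, v j ^ 2 := by
  refine ⟨∑ j, M i j ^ 2 + 1, by positivity, fun v => ?_⟩
  have := Finset.sum_mul_sq_le_sq_mul_sq univ (fun j => M i j) v
  rw [Matrix.mulVec, dotProduct]
  nlinarith [sum_nonneg fun j (_ : j ∈ univ) => sq_nonneg (v j)]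

/-- The phase function of the integral representation, normalized to vanish at the saddle point. -/
noncomputable def phase {N : ℕ} (R : Matrix (Fin N) (Fin N) ℝ) (y a d μ : Fin N → ℝ) (m : ℕ)
    (v : Fin N → ℝ) : ℂ :=
  -(m ^ 2 / 2) * ((∑ i, v i ^ 2 : ℝ) : ℂ) - Complex.I * m * ((∑ i, R.mulVec y i * v i : ℝ) : ℂ) +
    ∑ i, ((d i)⁻¹ : ℂ) * (polylog 2 ((a i : ℂ) *
      cexp ((m * R.transpose.mulVec v i + μ i : ℝ) * Complex.I)) - polylog 2 (a i : ℂ))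

variable {N : ℕ} {R : Matrix (Fin N) (Fin N) ℝ} {y a d μ : Fin N → ℝ} {m : ℕ}

theorem re_phase_le (ha : ∀ i, 0 < a i ∧ a i < 1) (hd : ∀ i, 0 < d i) (v : Fin N → ℝ) :
    (phase R y a d μ m v).re ≤ -(m ^ 2 / 2) * ∑ i, v i ^ 2 -
      ∑ i, (d i)⁻¹ * (a i * (1 - cos (m * R.transpose.mulVec v i + μ i))) := by
  have e : (phase R y a d μ m v).re = -(m ^ 2 / 2) * ∑ i, v i ^ 2 +
      ∑ i, (d i)⁻¹ * ((polylog 2 ((a i : ℂ) *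
        cexp ((m * R.transpose.mulVec v i + μ i : ℝ) * Complex.I))).re - polylog 2 (a i)) := by
    rw [phase, add_re, sub_re, Complex.re_sum]
    congr 1
    · rw [show -((m : ℂ) ^ 2 / 2) * ((∑ i, v i ^ 2 : ℝ) : ℂ) =
        ((-(m ^ 2 / 2) * ∑ i, v i ^ 2 : ℝ) : ℂ) by push_cast; ring, ofReal_re,
        show Complex.I * (m : ℂ) * ((∑ i, R.mulVec y i * v i : ℝ) : ℂ) =
          ((m * ∑ i, R.mulVec y i * v i : ℝ) : ℂ) * Complex.I by push_cast; ring,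
        re_ofReal_mul, I_re, mul_zero, sub_zero]
    · refine sum_congr rfl fun i _ => ?_
      rw [← ofReal_inv, re_ofReal_mul, sub_re, ← polylog_ofReal,
        ofReal_re]
  rw [e, sub_eq_add_neg, ← sum_neg_distrib]
  gcongr with i
  rw [← mul_neg]
  refine mul_le_mul_of_nonneg_left ?_ (inv_pos.2 (hd i)).le
  linarith [re_dilog_circle_le (ha i).1.le (ha i).2 (m * R.transpose.mulVec v i + μ i)]

theorem phase_im_eq (v : Fin N → ℝ) : (phase R y a d μ m v).im =
    -(m * ∑ i, R.mulVec y i * v i) + ∑ i, (d i)⁻¹ * ((polylog 2 ((a i : ℂ) *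
        cexp ((m * R.transpose.mulVec v i + μ i : ℝ) * Complex.I))) -
          polylog 2 (a i : ℂ)).im := by
  rw [phase, add_im, sub_im, Complex.im_sum]
  congr 1
  · rw [show -((m : ℂ) ^ 2 / 2) * ((∑ i, v i ^ 2 : ℝ) : ℂ) =
      ((-(m ^ 2 / 2) * ∑ i, v i ^ 2 : ℝ) : ℂ) by push_cast; ring, ofReal_im,
      show Complex.I * (m : ℂ) * ((∑ i, R.mulVec y i * v i : ℝ) : ℂ) =
        ((m * ∑ i, R.mulVec y i * v i : ℝ) : ℂ) * Complex.I by push_cast; ring,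
      im_ofReal_mul, I_im, mul_one, zero_sub]
  · refine sum_congr rfl fun i _ => ?_
    rw [← ofReal_inv, im_ofReal_mul]

theorem exists_abs_im_phase_le_of_trivial (ha : ∀ i, 0 < a i ∧ a i < 1) (hd : ∀ i, 0 < d i)
    (hy : ∀ i, d i * y i = -log (1 - a i))
    (hμ : ∀ i, cexp (μ i * Complex.I) = 1) :
    ∃ C : ℝ, 0 < C ∧ ∀ v, |(phase R y a d μ m v).im| ≤ C * ∑ i, v i ^ 2 := by
  choose C hC hCle using fun i => abs_mulVec_le R.transpose i
  have hnn : 0 ≤ ∑ i, (d i)⁻¹ * ((1 - a i)⁻¹ * (2 * (m ^ 2 * C i))) :=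
    sum_nonneg fun i _ => by
      have := hd i; have := hC i; have h1 : 0 < 1 - a i := by linarith [(ha i).2]
      positivity
  refine ⟨∑ i, (d i)⁻¹ * ((1 - a i)⁻¹ * (2 * (m ^ 2 * C i))) + 1, by linarith, fun v => ?_⟩
  have hexp : ∀ i, cexp ((m * R.transpose.mulVec v i + μ i : ℝ) * Complex.I) =
      cexp ((m * R.transpose.mulVec v i : ℝ) * Complex.I) := fun i => by
    rw [ofReal_add, add_mul, Complex.exp_add, hμ, mul_one]
  have hlin : m * ∑ i, R.mulVec y i * v i =
      ∑ i, (d i)⁻¹ * (-((m * R.transpose.mulVec v i) * log (1 - a i))) := by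
    have : R.mulVec y ⬝ᵥ v = y ⬝ᵥ R.transpose.mulVec v := by
      rw [Matrix.dotProduct_mulVec, Matrix.vecMul_transpose]
    rw [dotProduct, dotProduct] at this
    rw [this, mul_sum]
    refine sum_congr rfl fun i _ => ?_
    have h1 := hy i
    have h2 := (hd i).ne'
    rw [← mul_neg, ← h1]
    field_simp
  have hS : 0 ≤ ∑ i, v i ^ 2 := sum_nonneg fun i _ => sq_nonneg _
  rw [phase_im_eq, hlin, ← sum_neg_distrib, ← sum_add_distrib]
  refine (abs_sum_le_sum_abs _ _).trans ?_
  rw [add_mul, sum_mul, one_mul]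
  refine le_add_of_le_of_nonneg (sum_le_sum fun i _ => ?_) hS
  have h1 := norm_dilog_circle_le (ha i).1.le (ha i).2 (m * R.transpose.mulVec v i)
  have h2 := (abs_im_le_norm _).trans h1
  have e : (polylog 2 ((a i : ℂ) * cexp (((m * R.transpose.mulVec v i : ℝ) : ℂ) * Complex.I)) -
      polylog 2 (a i : ℂ) + ((m * R.transpose.mulVec v i : ℝ) : ℂ) * Complex.I *
        log (1 - a i)).im =
      (polylog 2 ((a i : ℂ) * cexp (((m * R.transpose.mulVec v i : ℝ) : ℂ) * Complex.I)) -
      polylog 2 (a i : ℂ)).im + (m * R.transpose.mulVec v i) * log (1 - a i) := by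
    rw [add_im, show ((m * R.transpose.mulVec v i : ℝ) : ℂ) * Complex.I *
      (log (1 - a i) : ℂ) = (((m * R.transpose.mulVec v i) * log (1 - a i) : ℝ) : ℂ) *
        Complex.I by push_cast; ring, im_ofReal_mul, I_im, mul_one]
  rw [e] at h2
  rw [hexp, mul_neg, neg_neg, ← mul_add, abs_mul, abs_of_pos (inv_pos.2 (hd i)),
    mul_assoc (d i)⁻¹ ((1 - a i)⁻¹ * _), add_comm]
  refine mul_le_mul_of_nonneg_left (h2.trans ?_) (inv_pos.2 (hd i)).le
  rw [mul_assoc]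
  refine mul_le_mul_of_nonneg_left ?_ (inv_pos.2 (by linarith [(ha i).2])).le
  have h3 := hCle i v
  rw [mul_pow]
  nlinarith [sq_nonneg (m : ℝ), mul_le_mul_of_nonneg_left h3 (sq_nonneg (m : ℝ))]

theorem norm_dilog_le {r : ℝ} (hr0 : 0 ≤ r) (hr : r < 1) {x : ℂ} (hx : ‖x‖ ≤ r) :
    ‖polylog 2 x‖ ≤ (1 - r)⁻¹ := by
  have h := norm_dilog_sub_le hr hx (y := 0) (by simpa using hr0)
  have h0 : polylog 2 (0 : ℂ) = 0 := by simp [polylog]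
  rw [h0, sub_zero, sub_zero] at h
  have h1 : 0 < (1 - r)⁻¹ := inv_pos.2 (by linarith)
  nlinarith

theorem exists_abs_im_phase_le (ha : ∀ i, 0 < a i ∧ a i < 1) (hd : ∀ i, 0 < d i) :
    ∃ C : ℝ, 0 < C ∧ ∀ v, |(phase R y a d μ m v).im| ≤ C * (∑ i, v i ^ 2 + 1) := by
  set K := ∑ i, (d i)⁻¹ * (2 * (1 - a i)⁻¹) with hK
  have hK0 : 0 ≤ K := sum_nonneg fun i _ => by
    have := hd i; have h1 : 0 < 1 - a i := by linarith [(ha i).2]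
    positivity
  set P := ∑ i, R.mulVec y i ^ 2
  have hP : 0 ≤ P := sum_nonneg fun i _ => sq_nonneg _
  refine ⟨m * (P + 1) + K + 1, by positivity, fun v => ?_⟩
  have hS : 0 ≤ ∑ i, v i ^ 2 := sum_nonneg fun i _ => sq_nonneg _
  rw [phase_im_eq]
  have h1 : |∑ i, R.mulVec y i * v i| ≤ P + ∑ i, v i ^ 2 := by
    refine (abs_sum_le_sum_abs _ _).trans ?_
    rw [← sum_add_distrib]
    refine sum_le_sum fun i _ => ?_
    rw [abs_le]; constructor <;> nlinarith [sq_nonneg (R.mulVec y i + v i),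
      sq_nonneg (R.mulVec y i - v i), sq_nonneg (R.mulVec y i), sq_nonneg (v i)]
  have h2 : |∑ i, (d i)⁻¹ * ((polylog 2 ((a i : ℂ) *
        cexp ((m * R.transpose.mulVec v i + μ i : ℝ) * Complex.I))) -
          polylog 2 (a i : ℂ)).im| ≤ K := by
    refine (abs_sum_le_sum_abs _ _).trans (sum_le_sum fun i _ => ?_)
    rw [abs_mul, abs_of_pos (inv_pos.2 (hd i))]
    refine mul_le_mul_of_nonneg_left ((abs_im_le_norm _).trans
      ((norm_sub_le _ _).trans ?_)) (inv_pos.2 (hd i)).le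
    have hn : ‖(a i : ℂ)‖ = a i := by rw [norm_real, norm_of_nonneg (ha i).1.le]
    have e1 := norm_dilog_le (ha i).1.le (ha i).2 (x := (a i : ℂ)) hn.le
    have e2 := norm_dilog_le (ha i).1.le (ha i).2 (x := (a i : ℂ) *
        cexp ((m * R.transpose.mulVec v i + μ i : ℝ) * Complex.I))
        (by rw [norm_mul, norm_exp_ofReal_mul_I, mul_one, hn])
    linarith
  refine (abs_add_le _ _).trans ?_
  rw [abs_neg, abs_mul, Nat.abs_cast]
  have hm : (0 : ℝ) ≤ m := Nat.cast_nonneg m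
  nlinarith [mul_le_mul_of_nonneg_left h1 hm, mul_nonneg hm hS, mul_nonneg hK0 hS,
    mul_nonneg (mul_nonneg hm hP) hS]

theorem exists_re_phase_le_of_nontrivial (ha : ∀ i, 0 < a i ∧ a i < 1) (hd : ∀ i, 0 < d i)
    (hm : 0 < m) (i₀ : Fin N) (hμ : cos (μ i₀) ≠ 1) :
    ∃ c : ℝ, 0 < c ∧ ∀ v, (phase R y a d μ m v).re ≤ -c * (∑ i, v i ^ 2 + 1) := by
  obtain ⟨C, hC, hCle⟩ := abs_mulVec_le R.transpose i₀
  set g := 1 - cos (μ i₀) with hg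
  have hg0 : 0 < g := sub_pos.2 (lt_of_le_of_ne (cos_le_one _) hμ)
  set κ := (d i₀)⁻¹ * a i₀ with hκ
  have hκ0 : 0 < κ := mul_pos (inv_pos.2 (hd i₀)) (ha i₀).1
  have hm1 : (1 : ℝ) ≤ m := by exact_mod_cast hm
  set c := min (1 / 4) (min (κ * g / 2) (g ^ 2 / (16 * m ^ 2 * C))) with hc
  have hc1 : c ≤ 1 / 4 := min_le_left _ _
  have hc2 : c ≤ κ * g / 2 := (min_le_right _ _).trans (min_le_left _ _)
  have hc3 : c ≤ g ^ 2 / (16 * m ^ 2 * C) := (min_le_right _ _).trans (min_le_right _ _)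
  refine ⟨c, by simp only [hc, lt_min_iff]; refine ⟨by norm_num, by positivity, by positivity⟩,
    fun v => ?_⟩
  have hS : 0 ≤ ∑ i, v i ^ 2 := sum_nonneg fun i _ => sq_nonneg _
  refine (re_phase_le ha hd v).trans ?_
  have hterm : ∀ i, 0 ≤ (d i)⁻¹ * (a i * (1 - cos (m * R.transpose.mulVec v i + μ i))) :=
    fun i => mul_nonneg (inv_pos.2 (hd i)).le (mul_nonneg (ha i).1.le
      (by linarith [cos_le_one (m * R.transpose.mulVec v i + μ i)]))
  have hsingle : (d i₀)⁻¹ * (a i₀ * (1 - cos (m * R.transpose.mulVec v i₀ + μ i₀))) ≤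
      ∑ i, (d i)⁻¹ * (a i * (1 - cos (m * R.transpose.mulVec v i + μ i))) :=
    Finset.single_le_sum (f := fun i => (d i)⁻¹ *
      (a i * (1 - cos (m * R.transpose.mulVec v i + μ i)))) (fun i _ => hterm i)
      (mem_univ i₀)
  set ψ := m * R.transpose.mulVec v i₀ with hψ
  have hψ2 : ψ ^ 2 ≤ m ^ 2 * C * ∑ i, v i ^ 2 := by
    rw [hψ, mul_pow, mul_assoc]
    exact mul_le_mul_of_nonneg_left (hCle v) (sq_nonneg _)
  have hmS : -(m ^ 2 / 2 : ℝ) * ∑ i, v i ^ 2 ≤ -(1 / 2) * ∑ i, v i ^ 2 := by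
    have : (1 : ℝ) ≤ m ^ 2 := one_le_pow₀ hm1
    nlinarith
  have hcos : g - |ψ| ≤ 1 - cos (ψ + μ i₀) := by
    have := Real.abs_cos_sub_cos_le (ψ + μ i₀) (μ i₀)
    rw [add_sub_cancel_right] at this
    linarith [le_abs_self (cos (ψ + μ i₀) - cos (μ i₀))]
  rw [← mul_assoc] at hsingle
  rcases le_total |ψ| (g / 2) with hle | hge
  · have : κ * (g / 2) ≤ κ * (1 - cos (ψ + μ i₀)) :=
      mul_le_mul_of_nonneg_left (by linarith) hκ0.le
    nlinarith
  · have h1 : (g / 2) ^ 2 ≤ ψ ^ 2 := by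
      rw [← sq_abs ψ]; exact pow_le_pow_left₀ (by positivity) hge 2
    have h2 : g ^ 2 / (16 * m ^ 2 * C) ≤ 1 / 4 * ∑ i, v i ^ 2 := by
      rw [div_le_iff₀ (by positivity)]; nlinarith
    have h3 : 0 ≤ ∑ i, (d i)⁻¹ * (a i * (1 - cos (m * R.transpose.mulVec v i + μ i))) :=
      sum_nonneg fun i _ => hterm i
    nlinarith

theorem exists_re_phase_div_le (ha : ∀ i, 0 < a i ∧ a i < 1) (hd : ∀ i, 0 < d i)
    (hy : ∀ i, d i * y i = -log (1 - a i)) (hm : 0 < m) :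
    ∃ κ c : ℝ, 0 < κ ∧ κ ≤ 1 ∧ 0 < c ∧ ∀ (v : Fin N → ℝ) (ε : ℂ), 0 < ε.re → |ε.im| ≤ κ * ε.re →
      (phase R y a d μ m v / ε).re ≤ -c * (∑ i, v i ^ 2) * (ε.re / normSq ε) := by
  have key : ∃ c C e : ℝ, 0 < c ∧ 0 < C ∧ 0 ≤ e ∧ ∀ v : Fin N → ℝ,
      (phase R y a d μ m v).re ≤ -c * (∑ i, v i ^ 2 + e) ∧
      |(phase R y a d μ m v).im| ≤ C * (∑ i, v i ^ 2 + e) := by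
    by_cases h : ∀ i, cos (μ i) = 1
    · have hμ : ∀ i, cexp (μ i * Complex.I) = 1 := fun i => by
        have hs : sin (μ i) = 0 := by
          have := Real.sin_sq_add_cos_sq (μ i)
          rw [h i] at this
          exact pow_eq_zero_iff two_ne_zero |>.1 (by linarith)
        rw [exp_mul_I, ← ofReal_cos, ← ofReal_sin, h i, hs]; simp
      obtain ⟨C, hC, hCle⟩ := exists_abs_im_phase_le_of_trivial (R := R) (m := m) ha hd hy hμ
      refine ⟨1 / 2, C, 0, by norm_num, hC, le_rfl, fun v => ?_⟩
      rw [add_zero]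
      refine ⟨(re_phase_le ha hd v).trans ?_, hCle v⟩
      have h3 : 0 ≤ ∑ i, (d i)⁻¹ * (a i * (1 - cos (m * R.transpose.mulVec v i + μ i))) :=
        sum_nonneg fun i _ => mul_nonneg (inv_pos.2 (hd i)).le (mul_nonneg (ha i).1.le
          (by linarith [cos_le_one (m * R.transpose.mulVec v i + μ i)]))
      have hS : 0 ≤ ∑ i, v i ^ 2 := sum_nonneg fun i _ => sq_nonneg _
      have hm1 : (1 : ℝ) ≤ m ^ 2 := one_le_pow₀ (by exact_mod_cast hm)
      nlinarith
    · push Not at h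
      obtain ⟨i₀, hi₀⟩ := h
      obtain ⟨C, hC, hCle⟩ := exists_abs_im_phase_le (R := R) (y := y) (μ := μ) (m := m) ha hd
      obtain ⟨c, hc, hcle⟩ := exists_re_phase_le_of_nontrivial (R := R) (y := y) ha hd hm i₀ hi₀
      exact ⟨c, C, 1, hc, hC, zero_le_one, fun v => ⟨hcle v, hCle v⟩⟩
  obtain ⟨c, C, e, hc, hC, he, h⟩ := key
  refine ⟨min 1 (c / (2 * C)), c / 2, by positivity, min_le_left _ _, by positivity,
    fun v ε hε him => ?_⟩
  obtain ⟨h1, h2⟩ := h v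
  set S := ∑ i, v i ^ 2
  have hS : 0 ≤ S := sum_nonneg fun i _ => sq_nonneg _
  set V := phase R y a d μ m v
  have hn : 0 < normSq ε := Complex.normSq_pos.2 fun h' => by simp [h'] at hε
  have e1 : (V / ε).re = (V.re * ε.re + V.im * ε.im) / normSq ε := by
    rw [div_re]; ring
  rw [e1, ← mul_div_assoc]
  refine div_le_div_of_nonneg_right ?_ hn.le
  have h3 : V.im * ε.im ≤ C * (S + e) * (c / (2 * C) * ε.re) := by
    calc V.im * ε.im ≤ |V.im| * |ε.im| := by rw [← abs_mul]; exact le_abs_self _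
      _ ≤ C * (S + e) * (c / (2 * C) * ε.re) := by
        refine mul_le_mul h2 (him.trans ?_) (abs_nonneg _) (by positivity)
        exact mul_le_mul_of_nonneg_right (min_le_right _ _) hε.le
  have h4 : C * (S + e) * (c / (2 * C) * ε.re) = c / 2 * (S + e) * ε.re := by field_simp
  have h5 := mul_le_mul_of_nonneg_right h1 hε.le
  have h6 : 0 ≤ c / 2 * e * ε.re := by positivity
  nlinarith

end Nahm

namespace Nahm

theorem norm_le_two_mul_re {ε : ℂ} (h0 : 0 < ε.re) (h : |ε.im| ≤ ε.re) : ‖ε‖ ≤ 2 * ε.re := by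
  have := Complex.norm_le_abs_re_add_abs_im ε
  rw [abs_of_pos h0] at this
  linarith

theorem integrable_exp_neg_mul_sum_sq {N : ℕ} {c : ℝ} (hc : 0 < c) :
    Integrable fun v : Fin N → ℝ => rexp (-c * ∑ i, v i ^ 2) := by
  have h := Integrable.fintype_prod (ι := Fin N) (μ := fun _ => (volume : Measure ℝ))
    (f := fun _ x => rexp (-c * x ^ 2)) fun _ => integrable_exp_neg_mul_sq hc
  refine h.congr (Eventually.of_forall fun v => ?_)
  simp only
  rw [← exp_sum, mul_sum]

theorem exists_norm_inv_sqrt_le {m : ℕ} (hm : 0 < m) :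
    ∃ C : ℝ, 0 < C ∧ ∀ ε : ℂ, ε ≠ 0 → ‖ε‖ ≤ 1 →
      ‖((π / (1 / (2 * (ε / m)))) ^ (1 / 2 : ℂ) : ℂ)⁻¹‖ ≤ C * ‖ε‖⁻¹ := by
  have hm' : (0 : ℝ) < m := by exact_mod_cast hm
  have hπ := pi_pos
  set c₀ : ℝ := 2 * π / m with hc₀
  have hc0 : 0 < c₀ := by positivity
  refine ⟨(1 + c₀) / c₀, by positivity, fun ε hε hε1 => ?_⟩
  have hn : 0 < ‖ε‖ := norm_pos_iff.2 hε
  have e1 : (π / (1 / (2 * (ε / m))) : ℂ) = (c₀ : ℂ) * ε := by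
    rw [hc₀]; push_cast; field_simp
  rw [e1]
  set w := ((c₀ : ℂ) * ε) ^ (1 / 2 : ℂ) with hw
  have hw2 : ‖w‖ ^ 2 = c₀ * ‖ε‖ := by
    rw [← norm_pow, hw, ← Complex.cpow_nat_mul]
    norm_num
    exact Or.inl hc0.le
  have hw0 : 0 < ‖w‖ := by
    rcases (norm_nonneg w).eq_or_lt with h | h
    · rw [← h] at hw2
      have : 0 < c₀ * ‖ε‖ := by positivity
      norm_num at hw2
      rcases hw2 with h | h
      · exact absurd h hc0.ne'
      · exact absurd h hε
    · exact h
  have hw1 : ‖w‖ ≤ 1 + c₀ := by nlinarith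
  rw [norm_inv, inv_le_iff_one_le_mul₀ hw0, div_mul_eq_mul_div, div_mul_eq_mul_div, one_le_div hc0]
  calc c₀ = (c₀ * ‖ε‖) * ‖ε‖⁻¹ := by field_simp
    _ = ‖w‖ * ‖w‖ * ‖ε‖⁻¹ := by rw [← hw2, sq]
    _ ≤ (1 + c₀) * ‖w‖ * ‖ε‖⁻¹ := by gcongr
    _ = _ := by ring

namespace Datum

variable {N : ℕ} (Q : Datum N)

theorem exists_small_radius {z : Fin N → ℝ} (hz : ∀ i, 0 < z i ∧ z i < 1) :
    ∃ r : ℝ, 0 < r ∧ r ≤ 1 ∧ ∀ i, |(Q.b i : ℝ)| * r ≤ 1 ∧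
      |(Q.b i : ℝ)| * r ≤ -log (1 - z i) / 2 := by
  have hev : ∀ᶠ r : ℝ in 𝓝[>] 0, ∀ i, |(Q.b i : ℝ)| * r ≤ 1 ∧
      |(Q.b i : ℝ)| * r ≤ -log (1 - z i) / 2 := by
    rw [eventually_all]
    intro i
    have ht : Tendsto (fun r : ℝ => |(Q.b i : ℝ)| * r) (𝓝[>] 0) (𝓝 0) := by
      have : Tendsto (fun r : ℝ => |(Q.b i : ℝ)| * r) (𝓝 0) (𝓝 (|(Q.b i : ℝ)| * 0)) :=
        tendsto_const_nhds.mul tendsto_id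
      rw [mul_zero] at this
      exact tendsto_nhdsWithin_of_tendsto_nhds this
    have hlog : 0 < -log (1 - z i) / 2 := by
      have := log_neg (show 0 < 1 - z i by linarith [(hz i).2]) (by linarith [(hz i).1])
      linarith
    exact (ht.eventually (eventually_le_nhds one_pos)).and (ht.eventually (eventually_le_nhds hlog))
  obtain ⟨r, h1, h2⟩ := (hev.and (Ioo_mem_nhdsGT one_pos)).exists
  exact ⟨r, h2.1, h2.2.le, h1⟩

/-- Upper bound, in a sector, for the Nahm sum with its phase replaced by a character. -/
theorem exists_norm_tsum_twistedTerm_le {z : Fin N → ℝ} (hz : Q.IsNahmSolution z) {m : ℕ}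
    (hm : 0 < m) {ζ : Fin N → ℂ} (hζ : ∀ i, IsPrimitiveRoot (ζ i) m) (β : Fin N → ℝ) :
    ∃ κ r C : ℝ, 0 < κ ∧ κ ≤ 1 ∧ 0 < r ∧ r ≤ 1 ∧ 0 < C ∧ ∀ ε : ℂ, 0 < ε.re → |ε.im| ≤ κ * ε.re →
      ‖ε‖ ≤ r → ‖cexp (-(Q.Lam z : ℂ) / (m * ε)) *
        ∑' n, Q.twistedTerm (ε / m) (fun i => expi (β i))
          (fun i => ζ i * cexp (-(Q.d i * (ε / m)))) n‖ ≤ C * (‖ε‖ ^ N)⁻¹ := by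
  have hm' : (0 : ℝ) < m := by exact_mod_cast hm
  have hm1 : (1 : ℝ) ≤ m := by exact_mod_cast hm
  have hmc : (m : ℂ) ≠ 0 := by exact_mod_cast hm.ne'
  obtain ⟨R, hR⟩ := exists_gram Q.B_posDef.posSemidef
  set y := Q.saddle z with hy
  set a : Fin N → ℝ := fun i => 1 - z i with ha
  have ha01 : ∀ i, 0 < a i ∧ a i < 1 := fun i =>
    ⟨by simp only [ha]; linarith [(hz.1 i).2], by simp only [ha]; linarith [(hz.1 i).1]⟩
  set dr : Fin N → ℝ := fun i => Q.d i with hdr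
  set μ : Fin N → ℝ := fun i => 2 * π * m * β i with hμ
  have hya : ∀ i, dr i * y i = -log (1 - a i) := fun i => by
    simp only [hdr, hy, saddle, ha, sub_sub_cancel]
    rw [mul_div_cancel₀ _ (Q.d_pos' i).ne']
  obtain ⟨κ, c, hκ, hκ1, hc, hphase⟩ := exists_re_phase_div_le (R := R) (μ := μ) ha01
    (fun i => Q.d_pos' i) hya hm
  set ρ : Fin N → ℝ := fun i => rexp (log (1 - z i) / (2 * m)) with hρ
  have hlog : ∀ i, log (1 - z i) < 0 := fun i => log_neg (ha01 i).1 (ha01 i).2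
  have hρ1 : ∀ i, ρ i < 1 := fun i => Real.exp_lt_one_iff.2
    (div_neg_of_neg_of_pos (hlog i) (by positivity))
  choose C₁ hC₁ hC₁le using fun i => exists_norm_lq_sub_dilog_le hm (hζ i) (hρ1 i)
  obtain ⟨r, hr, hr1, hrb⟩ := Q.exists_small_radius hz.1
  obtain ⟨C₂, hC₂, hC₂le⟩ := exists_norm_inv_sqrt_le hm
  have hρm : ∀ i, ρ i ^ m < 1 := fun i => pow_lt_one₀ (exp_pos _).le (hρ1 i) hm.ne'
  set E : ℝ := ∑ i, (C₁ i + (1 - ρ i ^ m)⁻¹ * (2 * |(Q.b i : ℝ)|)) with hE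
  set J : ℝ := ∫ v : Fin N → ℝ, rexp E * rexp (-(c / (2 * m)) * ∑ i, v i ^ 2) with hJ
  have hJi : Integrable fun v : Fin N → ℝ =>
      rexp E * rexp (-(c / (2 * m)) * ∑ i, v i ^ 2) :=
    (integrable_exp_neg_mul_sum_sq (by positivity)).const_mul _
  have hJ0 : 0 ≤ J := integral_nonneg fun v => by positivity
  refine ⟨κ, r, rexp |(Q.c : ℝ)| * C₂ ^ N * J + 1, hκ, hκ1, hr, hr1, by positivity,
    fun ε hε him hεr => ?_⟩
  have hε0 : ε ≠ 0 := fun h => by simp [h] at hε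
  have hεn : 0 < ‖ε‖ := norm_pos_iff.2 hε0
  have him' : |ε.im| ≤ ε.re := him.trans (by nlinarith)
  have hcone := norm_le_two_mul_re hε him'
  have hh : (ε / m).re = ε.re / m := by rw [div_natCast_re]
  have hhpos : 0 < (ε / m).re := by rw [hh]; positivity
  have hhle : (ε / m).re ≤ r := by
    rw [hh]
    calc ε.re / m ≤ ε.re := div_le_self hε.le hm1
      _ ≤ ‖ε‖ := re_le_norm ε
      _ ≤ r := hεr
  have hω : ∀ i, ‖expi (β i)‖ = 1 := fun i => norm_expi_real _
  have hζn : ∀ i, ‖ζ i‖ = 1 := fun i => (hζ i).norm'_eq_one hm.ne'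
  have hdh : ∀ i, 0 < (Q.d i * (ε / m) : ℂ).re := fun i => by
    rw [← ofReal_natCast, re_ofReal_mul]; exact mul_pos (Q.d_pos' i) hhpos
  have hq : ∀ i, ‖ζ i * cexp (-(Q.d i * (ε / m)))‖ < 1 := fun i =>
    norm_mul_exp_neg_lt_one (hζn i) (hdh i)
  have hXle : ∀ i, rexp (log (1 - z i) / m - (ε / m).re * Q.b i) ≤ ρ i := fun i => by
    rw [hρ, exp_le_exp, hh]
    have h1 := (hrb i).2
    have h2 : -(ε.re * Q.b i) ≤ |(Q.b i : ℝ)| * r := by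
      calc -(ε.re * Q.b i) ≤ |ε.re * Q.b i| := neg_le_abs _
        _ = ε.re * |(Q.b i : ℝ)| := by rw [abs_mul, abs_of_pos hε]
        _ ≤ r * |(Q.b i : ℝ)| := by
          gcongr; exact (re_le_norm ε).trans hεr
        _ = _ := mul_comm _ _
    have h3 : log (1 - z i) / m - ε.re / m * Q.b i =
        (log (1 - z i) - ε.re * Q.b i) / m := by ring
    rw [h3, div_le_div_iff₀ hm' (by positivity)]
    nlinarith
  have hX1 : ∀ i, rexp (log (1 - z i) / m - (ε / m).re * Q.b i) < 1 := fun i =>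
    (hXle i).trans_lt (hρ1 i)
  rw [Q.tsum_twistedTerm hz hR hm hhpos hω hq hX1]
  set X := Q.nodeArg R z m (ε / m) fun i => expi (β i) with hX
  have hXn : ∀ v i, ‖X v i‖ ≤ ρ i := fun v i => by
    rw [hX, Q.norm_nodeArg R z m _ hω]; exact hXle i
  set err : (Fin N → ℝ) → Fin N → ℂ := fun v i =>
    lq (ζ i * cexp (-(Q.d i * (ε / m)))) (X v i) -
      polylog 2 ((a i : ℂ) * cexp ((m * R.transpose.mulVec v i + μ i : ℝ) * Complex.I)) /
        (m * Q.d i * ε) with herr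
  have hdc : ∀ i, (Q.d i : ℂ) ≠ 0 := fun i => by exact_mod_cast (Q.d_pos i).ne'
  have herrle : ∀ v i, ‖err v i‖ ≤ C₁ i + (1 - ρ i ^ m)⁻¹ * (2 * |(Q.b i : ℝ)|) := by
    intro v i
    have h1 := hC₁le i (Q.d i * (ε / m)) (mul_ne_zero (hdc i) (div_ne_zero hε0 hmc)) (by
      rw [norm_mul, norm_div, Complex.norm_natCast, Complex.norm_natCast, ← ofReal_natCast,
        re_ofReal_mul, hh]
      have := Q.d_pos' i
      calc (Q.d i : ℝ) * (‖ε‖ / m) ≤ Q.d i * (2 * ε.re / m) := by gcongr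
        _ = _ := by ring) (X v i) (hXn v i)
    have hxm : X v i ^ m = (a i : ℂ) * cexp ((m * R.transpose.mulVec v i + μ i : ℝ) *
        Complex.I) * cexp (-(ε * Q.b i)) := by
      rw [hX, nodeArg, expi, ← Complex.exp_add, ← Complex.exp_nat_mul]
      have : (a i : ℂ) = cexp (log (1 - z i)) := by
        rw [← ofReal_exp, exp_log (ha01 i).1]
      rw [this, ← Complex.exp_add, ← Complex.exp_add]
      congr 1
      simp only [hμ]
      push_cast
      field_simp
      ring
    have hbn : ‖(ε * Q.b i : ℂ)‖ ≤ 1 := by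
      rw [norm_mul, ← ofReal_ratCast, norm_real, norm_eq_abs]
      calc ‖ε‖ * |(Q.b i : ℝ)| ≤ r * |(Q.b i : ℝ)| := by gcongr
        _ ≤ 1 := by rw [mul_comm]; exact (hrb i).1
    have hcirc : ‖(a i : ℂ) * cexp ((m * R.transpose.mulVec v i + μ i : ℝ) *
        Complex.I)‖ = a i := by
      rw [norm_mul, norm_exp_ofReal_mul_I, mul_one, norm_real,
        norm_of_nonneg (ha01 i).1.le]
    have haρ : a i ≤ ρ i ^ m := by
      rw [hρ, ← exp_nat_mul, show (m : ℝ) * (log (1 - z i) / (2 * m)) =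
        log (1 - z i) / 2 by field_simp, ← exp_log (ha01 i).1, exp_le_exp]
      have := hlog i
      change log (1 - z i) ≤ _
      linarith
    have h2 := norm_dilog_sub_le (hρm i) (x := X v i ^ m) (y := (a i : ℂ) *
      cexp ((m * R.transpose.mulVec v i + μ i : ℝ) * Complex.I))
      (by rw [norm_pow]; exact pow_le_pow_left₀ (norm_nonneg _) (hXn v i) m)
      (by rw [hcirc]; exact haρ)
    have h3 : ‖X v i ^ m - (a i : ℂ) * cexp ((m * R.transpose.mulVec v i + μ i : ℝ) *
        Complex.I)‖ ≤ 2 * (|(Q.b i : ℝ)| * ‖ε‖) := by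
      rw [hxm, ← mul_sub_one, norm_mul, hcirc]
      have h4 := norm_exp_sub_one_le (x := -(ε * Q.b i)) (by rwa [norm_neg])
      rw [norm_neg, norm_mul, ← ofReal_ratCast, norm_real, norm_eq_abs] at h4
      rw [← ofReal_ratCast]
      calc _ ≤ 1 * (2 * (‖ε‖ * |(Q.b i : ℝ)|)) :=
            mul_le_mul (ha01 i).2.le h4 (norm_nonneg _) zero_le_one
        _ = _ := by ring
    have e : err v i = (lq (ζ i * cexp (-(Q.d i * (ε / m)))) (X v i) -
        polylog 2 (X v i ^ m) / (m ^ 2 * (Q.d i * (ε / m)))) +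
        (polylog 2 (X v i ^ m) - polylog 2 ((a i : ℂ) *
          cexp ((m * R.transpose.mulVec v i + μ i : ℝ) * Complex.I))) / (m * Q.d i * ε) := by
      simp only [herr]
      have := hdc i
      field_simp
      ring
    rw [e]
    refine (norm_add_le _ _).trans (add_le_add h1 ?_)
    rw [norm_div, norm_mul, norm_mul, Complex.norm_natCast, Complex.norm_natCast]
    have hd1 : (1 : ℝ) ≤ Q.d i := by exact_mod_cast Q.d_pos i
    have hinv : 0 < (1 - ρ i ^ m)⁻¹ := inv_pos.2 (by linarith [hρm i])
    rw [div_le_iff₀ (by positivity)]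
    calc _ ≤ (1 - ρ i ^ m)⁻¹ * (2 * (|(Q.b i : ℝ)| * ‖ε‖)) :=
          h2.trans (mul_le_mul_of_nonneg_left h3 hinv.le)
      _ = (1 - ρ i ^ m)⁻¹ * (2 * |(Q.b i : ℝ)|) * (1 * 1 * ‖ε‖) := by ring
      _ ≤ _ := by gcongr
  have hexpo : ∀ v : Fin N → ℝ, cexp (-(Q.Lam z : ℂ) / (m * ε)) *
      cexp (1 / (2 * m ^ 2 * (ε / m)) * (y ⬝ᵥ Q.B.mulVec y : ℝ)) *
      (gaussKernel R y (ε / m) m v *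
        ∏ i, cexp (lq (ζ i * cexp (-(Q.d i * (ε / m)))) (X v i))) =
      cexp (phase R y a dr μ m v / ε / m + ∑ i, err v i) := by
    intro v
    rw [gaussKernel, ← Complex.exp_sum, ← Complex.exp_add, ← Complex.exp_add, ← Complex.exp_add]
    congr 1
    have e1 : ∑ i, lq (ζ i * cexp (-(Q.d i * (ε / m)))) (X v i) = ∑ i, err v i +
        ∑ i, polylog 2 ((a i : ℂ) * cexp ((m * R.transpose.mulVec v i + μ i : ℝ) *
          Complex.I)) / (m * Q.d i * ε) := by
      rw [← sum_add_distrib]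
      exact sum_congr rfl fun i _ => by simp only [herr]; ring
    have e2 : (Q.Lam z : ℂ) = 1 / 2 * (y ⬝ᵥ Q.B.mulVec y : ℝ) +
        ∑ i, polylog 2 (a i : ℂ) / Q.d i := by
      rw [Q.Lam_eq hz]
      push_cast
      simp only [polylog_ofReal, ha]
      push_cast; rfl
    rw [e1, e2, phase]
    have e3 : ∑ i, ((dr i)⁻¹ : ℂ) * (polylog 2 ((a i : ℂ) *
        cexp ((m * R.transpose.mulVec v i + μ i : ℝ) * Complex.I)) - polylog 2 (a i : ℂ)) =
        m * ε * (∑ i, polylog 2 ((a i : ℂ) * cexp ((m * R.transpose.mulVec v i + μ i : ℝ) *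
          Complex.I)) / (m * Q.d i * ε)) - ∑ i, polylog 2 (a i : ℂ) / Q.d i := by
      rw [mul_sum, ← sum_sub_distrib]
      refine sum_congr rfl fun i _ => ?_
      have := hdc i
      simp only [hdr]
      push_cast
      field_simp
    rw [e3]
    have e4 : ∑ i, 1 / (2 * (ε / m)) * (v i : ℂ) ^ 2 =
        1 / (2 * (ε / m)) * ((∑ i, v i ^ 2 : ℝ) : ℂ) := by
      push_cast; rw [mul_sum]
    have e5 : ∑ i, -Complex.I * ((R.mulVec y i : ℂ) / (m * (ε / m))) * (v i : ℂ) =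
        -Complex.I / ε * ((∑ i, R.mulVec y i * v i : ℝ) : ℂ) := by
      push_cast; rw [mul_sum]
      refine sum_congr rfl fun i _ => ?_
      field_simp
    rw [e4, e5]
    field_simp
    ring
  have hint : ‖∫ v : Fin N → ℝ, cexp (phase R y a dr μ m v / ε / m + ∑ i, err v i)‖ ≤ J := by
    refine norm_integral_le_of_norm_le hJi (Eventually.of_forall fun v => ?_)
    rw [norm_exp, ← exp_add, exp_le_exp, add_re, add_comm]
    refine add_le_add ?_ ?_
    · refine (re_le_norm _).trans (norm_sum_le_of_le _ fun i _ => herrle v i)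
    · rw [div_natCast_re]
      have h1 := hphase v ε hε him
      have hS : 0 ≤ ∑ i, v i ^ 2 := sum_nonneg fun i _ => sq_nonneg _
      have h2 : 1 / 2 ≤ ε.re / normSq ε := by
        have hn : 0 < normSq ε := Complex.normSq_pos.2 hε0
        have hre1 : ε.re ≤ 1 := (re_le_norm ε).trans (hεr.trans hr1)
        rw [div_le_div_iff₀ two_pos hn, Complex.normSq_apply]
        have h3 : ε.im * ε.im ≤ ε.re * ε.re := by
          rw [← abs_mul_abs_self ε.im]; exact mul_le_mul him' him' (abs_nonneg _) hε.le
        nlinarith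
      rw [div_le_iff₀ hm']
      refine h1.trans ?_
      have : c * (∑ i, v i ^ 2) * (1 / 2) ≤ c * (∑ i, v i ^ 2) * (ε.re / normSq ε) :=
        mul_le_mul_of_nonneg_left h2 (by positivity)
      have e : -(c / (2 * m)) * (∑ i, v i ^ 2) * m = -(c * (∑ i, v i ^ 2) * (1 / 2)) := by
        field_simp
      rw [e]; linarith
  have e7 : cexp (-(Q.Lam z : ℂ) / (m * ε)) *
      (cexp (-(ε / m) * Q.c + 1 / (2 * m ^ 2 * (ε / m)) * (y ⬝ᵥ Q.B.mulVec y : ℝ)) *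
        (∏ _i : Fin N, (π / (1 / (2 * (ε / m)))) ^ (1 / 2 : ℂ))⁻¹ *
        ∫ v : Fin N → ℝ, gaussKernel R y (ε / m) m v *
          ∏ i, cexp (lq (ζ i * cexp (-(Q.d i * (ε / m)))) (X v i))) =
      cexp (-(ε / m) * Q.c) * (∏ _i : Fin N, (π / (1 / (2 * (ε / m)))) ^ (1 / 2 : ℂ))⁻¹ *
        ∫ v : Fin N → ℝ, cexp (phase R y a dr μ m v / ε / m + ∑ i, err v i) := by
    simp_rw [← hexpo]
    rw [integral_const_mul, Complex.exp_add]
    ring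
  rw [e7, norm_mul, norm_mul]
  have h8 : ‖cexp (-(ε / m) * Q.c)‖ ≤ rexp |(Q.c : ℝ)| := by
    rw [norm_exp, exp_le_exp]
    refine (re_le_norm _).trans ?_
    rw [norm_mul, norm_neg, norm_div, Complex.norm_natCast, ← ofReal_ratCast,
      norm_real, norm_eq_abs]
    refine mul_le_of_le_one_left (abs_nonneg _) ?_
    rw [div_le_one hm']; linarith
  have h9 : ‖(∏ _i : Fin N, (π / (1 / (2 * (ε / m)))) ^ (1 / 2 : ℂ))⁻¹‖ ≤ C₂ ^ N * (‖ε‖ ^ N)⁻¹ := by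
    rw [prod_const, card_univ, Fintype.card_fin, ← inv_pow, norm_pow, ← inv_pow,
      ← mul_pow]
    exact pow_le_pow_left₀ (norm_nonneg _) (hC₂le ε hε0 (hεr.trans hr1)) N
  calc _ ≤ rexp |(Q.c : ℝ)| * (C₂ ^ N * (‖ε‖ ^ N)⁻¹) * J := by gcongr
    _ = rexp |(Q.c : ℝ)| * C₂ ^ N * J * (‖ε‖ ^ N)⁻¹ := by ring
    _ ≤ _ := by gcongr; linarith

end Datum

/-! ### Arithmetic of the quadratic function -/

theorem coprime_den_add {m : ℕ} {x y : ℚ} (hx : m.Coprime x.den) (hy : m.Coprime y.den) :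
    m.Coprime (x + y).den :=
  (hx.mul_right hy).coprime_dvd_right (Rat.add_den_dvd x y)

theorem coprime_den_mul {m : ℕ} {x y : ℚ} (hx : m.Coprime x.den) (hy : m.Coprime y.den) :
    m.Coprime (x * y).den :=
  (hx.mul_right hy).coprime_dvd_right (Rat.mul_den_dvd x y)

theorem coprime_den_int (m : ℕ) (n : ℤ) : m.Coprime (n : ℚ).den := by simp

theorem coprime_den_sum {m : ℕ} {ι : Type*} (s : Finset ι) (f : ι → ℚ)
    (h : ∀ i ∈ s, m.Coprime (f i).den) : m.Coprime (∑ i ∈ s, f i).den := by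
  classical
  induction s using induction_on with
  | empty => simp
  | insert a s ha ih =>
    rw [sum_insert ha]
    exact coprime_den_add (h _ (Finset.mem_insert_self _ _))
      (ih fun i hi => h i (Finset.mem_insert_of_mem hi))

theorem coprime_den_of_mul_eq_int {m D : ℕ} (hD : D ≠ 0) (h : m.Coprime D) {x : ℚ} {n : ℤ}
    (hx : D * x = n) : m.Coprime x.den := by
  have hD' : (D : ℚ) ≠ 0 := by exact_mod_cast hD
  have : x = Rat.divInt n D := by
    rw [Rat.divInt_eq_div]; field_simp; push_cast; linarith
  refine h.coprime_dvd_right ?_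
  rw [this]
  exact_mod_cast Rat.den_dvd n D

theorem ratMod_mul_den {m : ℕ} {x : ℚ} (h : m.Coprime x.den) :
    ratMod m x * (x.den : ZMod m) = (x.num : ZMod m) := by
  rw [ratMod, mul_assoc, mul_comm _ (x.den : ZMod m), ZMod.coe_mul_inv_eq_one _ h.symm, mul_one]

/-- `ratMod m` depends only on the class modulo `m` in the localization of `ℤ` at `m`. -/
theorem ratMod_add_mul {m : ℕ} {x y : ℚ} (hx : m.Coprime x.den) (hy : m.Coprime y.den) :
    ratMod m (x + m * y) = ratMod m x := by
  set w := x + m * y with hw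
  have hwd : m.Coprime w.den := coprime_den_add hx (coprime_den_mul (coprime_den_int m m) hy)
  have u1 : IsUnit (w.den : ZMod m) := (ZMod.isUnit_iff_coprime _ _).2 hwd.symm
  have u2 : IsUnit (x.den : ZMod m) := (ZMod.isUnit_iff_coprime _ _).2 hx.symm
  have u3 : IsUnit (y.den : ZMod m) := (ZMod.isUnit_iff_coprime _ _).2 hy.symm
  have e : w.num * x.den * y.den = x.num * w.den * y.den + m * y.num * w.den * x.den := by
    have h1 : (w.num : ℚ) = w * w.den := (Rat.mul_den_eq_num w).symm
    have h2 : (x.num : ℚ) = x * x.den := (Rat.mul_den_eq_num x).symm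
    have h3 : (y.num : ℚ) = y * y.den := (Rat.mul_den_eq_num y).symm
    have : ((w.num * x.den * y.den : ℤ) : ℚ) =
        (x.num * w.den * y.den + m * y.num * w.den * x.den : ℤ) := by
      push_cast
      rw [h1, h2, h3, hw]; ring
    exact_mod_cast this
  have e' : (w.num : ZMod m) * x.den * y.den = x.num * w.den * y.den := by
    have := congrArg (Int.cast : ℤ → ZMod m) e
    push_cast at this
    simpa using this
  rw [← ratMod_mul_den hwd, ← ratMod_mul_den hx] at e'
  have := u3.mul_right_cancel e'
  apply (u1.mul u2).mul_right_cancel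
  linear_combination this

namespace Datum

variable {N : ℕ} (Q : Datum N)

/-- The polar form of the quadratic function on integral vectors. -/
def polar (k l : Fin N → ℤ) : ℚ :=
  (fun i => (k i : ℚ)) ⬝ᵥ (Q.A * Q.D).mulVec fun i => (l i : ℚ)

theorem AD_symm (i j : Fin N) : (Q.A * Q.D) i j = (Q.A * Q.D) j i := by
  have := Q.posDef.1.apply i j
  simp only [Matrix.map_apply, star_trivial] at this
  exact_mod_cast this.symm

theorem quad_add (k l : Fin N → ℤ) :
    Q.quad (k + l) = Q.quad k + (Q.quad l - Q.c) + Q.polar k l := by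
  have hs : (fun i => (l i : ℚ)) ⬝ᵥ (Q.A * Q.D).mulVec (fun i => (k i : ℚ)) =
      (fun i => (k i : ℚ)) ⬝ᵥ (Q.A * Q.D).mulVec fun i => (l i : ℚ) := by
    simp only [dotProduct, Matrix.mulVec, mul_sum]
    rw [sum_comm]
    refine sum_congr rfl fun i _ => sum_congr rfl fun j _ => ?_
    rw [Q.AD_symm]; ring
  have hk : (fun i => (((k + l) i : ℤ) : ℚ)) = (fun i => (k i : ℚ)) + fun i => (l i : ℚ) := by
    ext i; simp
  simp only [quad, polar]
  rw [hk, Matrix.mulVec_add, dotProduct_add, add_dotProduct, add_dotProduct, add_dotProduct, hs]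
  ring

theorem quad_smul_sub (a : ℤ) (v : Fin N → ℤ) :
    Q.quad (a • v) - Q.c = a ^ 2 / 2 * Q.polar v v + a * ((fun i => (v i : ℚ)) ⬝ᵥ Q.b) := by
  have hk : (fun i => (((a • v) i : ℤ) : ℚ)) = (a : ℚ) • fun i => (v i : ℚ) := by
    ext i; simp
  simp only [quad, polar]
  rw [hk, Matrix.mulVec_smul, dotProduct_smul, smul_dotProduct, smul_dotProduct]
  simp only [smul_eq_mul]
  ring

theorem polar_smul (a : ℤ) (k l : Fin N → ℤ) : Q.polar k (a • l) = a * Q.polar k l := by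
  have h : (fun i => (((a • l) i : ℤ) : ℚ)) = (a : ℚ) • fun i => (l i : ℚ) := by
    ext i; simp
  simp only [polar]
  rw [h, Matrix.mulVec_smul, dotProduct_smul, smul_eq_mul]

theorem polar_single (i j : Fin N) :
    Q.polar (Pi.single i 1) (Pi.single j 1) = (Q.A * Q.D) i j := by
  have h : ∀ i : Fin N, (fun r => (((Pi.single i 1 : Fin N → ℤ) r : ℤ) : ℚ)) = Pi.single i 1 := by
    intro i; ext r; by_cases h : r = i <;> simp [h]
  simp [polar, h]

variable {Q}

theorem IsStrongDenominator.exists_mul_AD {δ : ℕ} (hδ : Q.IsStrongDenominator δ) (i j : Fin N) :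
    ∃ n : ℤ, δ * (Q.A * Q.D) i j = n := by
  have h1 : ∀ l : Fin N → ℤ, ∃ n : ℤ, Q.polar l ((δ : ℤ) • Pi.single j 1) +
      (Q.quad ((δ : ℤ) • Pi.single j 1) - Q.c) = n := fun l => by
    obtain ⟨n, hn⟩ := hδ.2 (l + (δ : ℤ) • Pi.single j 1) l fun r => by
      simp [Int.modEq_iff_dvd]
    rw [Q.quad_add] at hn
    exact ⟨n, by linarith⟩
  obtain ⟨n₀, h0⟩ := h1 0
  obtain ⟨n₁, h1⟩ := h1 (Pi.single i 1)
  refine ⟨n₁ - n₀, ?_⟩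
  have e0 : Q.polar 0 ((δ : ℤ) • Pi.single j 1) = 0 := by simp [polar]
  have e1 : Q.polar (Pi.single i 1) ((δ : ℤ) • Pi.single j 1) = δ * (Q.A * Q.D) i j := by
    rw [Q.polar_smul, polar_single]; push_cast; rfl
  rw [e0] at h0
  rw [e1] at h1
  push_cast
  linarith

theorem IsStrongDenominator.exists_mul_polar {δ : ℕ} (hδ : Q.IsStrongDenominator δ)
    (k l : Fin N → ℤ) : ∃ n : ℤ, δ * Q.polar k l = n := by
  choose a ha using fun i j => hδ.exists_mul_AD i j
  refine ⟨∑ i, ∑ j, k i * a i j * l j, ?_⟩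
  simp only [polar, dotProduct, Matrix.mulVec, mul_sum]
  push_cast
  refine sum_congr rfl fun i _ => sum_congr rfl fun j _ => ?_
  rw [← ha]; ring

theorem IsStrongDenominator.exists_sq_mul_single {δ : ℕ} (hδ : Q.IsStrongDenominator δ)
    (i : Fin N) : ∃ n : ℤ, δ ^ 2 * (Q.quad (Pi.single i 1) - Q.c) = n := by
  obtain ⟨a, ha⟩ := hδ.exists_mul_AD i i
  obtain ⟨x, hx⟩ := hδ.2 ((δ : ℤ) • Pi.single i 1) 0 fun r => by simp [Int.modEq_iff_dvd]
  have h0 : Q.quad 0 = Q.c := by simp [quad]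
  have h1 := Q.quad_smul_sub δ (Pi.single i 1)
  have h2 := Q.quad_smul_sub 1 (Pi.single i 1)
  rw [one_smul] at h2
  rw [h0, h1, polar_single] at hx
  rw [h2, polar_single]
  have hpar : ∃ t : ℤ, (δ : ℤ) * (1 - δ) = 2 * t := by
    rcases Int.even_or_odd (δ : ℤ) with h | h
    · obtain ⟨r, hr⟩ := h
      exact ⟨r * (1 - δ), by rw [hr]; ring⟩
    · obtain ⟨r, hr⟩ := h
      exact ⟨-δ * r, by rw [hr]; ring⟩
  obtain ⟨t, ht⟩ := hpar
  refine ⟨δ * x + a * t, ?_⟩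
  have ht' : (δ : ℚ) * (1 - δ) = 2 * t := by exact_mod_cast ht
  push_cast at hx ⊢
  rw [← ha, ← hx]
  linear_combination (1 / 2 * δ * (Q.A * Q.D) i i) * ht'

/-- `δ²` is a common denominator of the values of `Q - Q(0)`. -/
theorem IsStrongDenominator.exists_sq_mul {δ : ℕ} (hδ : Q.IsStrongDenominator δ)
    (k : Fin N → ℤ) : ∃ n : ℤ, δ ^ 2 * (Q.quad k - Q.c) = n := by
  let H : AddSubgroup (Fin N → ℤ) :=
    { carrier := {k | ∃ n : ℤ, (δ : ℚ) ^ 2 * (Q.quad k - Q.c) = n}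
      zero_mem' := ⟨0, by simp [quad]⟩
      add_mem' := by
        rintro k l ⟨a, ha⟩ ⟨b, hb⟩
        obtain ⟨n, hn⟩ := hδ.exists_mul_polar k l
        refine ⟨a + b + δ * n, ?_⟩
        rw [Q.quad_add]
        push_cast
        rw [← ha, ← hb, ← hn]; ring
      neg_mem' := by
        rintro k ⟨a, ha⟩
        obtain ⟨n, hn⟩ := hδ.exists_mul_polar k k
        refine ⟨δ * n - a, ?_⟩
        have h1 := Q.quad_smul_sub (-1) k
        have h2 := Q.quad_smul_sub 1 k
        rw [neg_smul, one_smul] at h1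
        rw [one_smul] at h2
        push_cast at h1 h2 ⊢
        rw [← ha, ← hn, h1, h2]; ring }
  have : k ∈ H := by
    have hk : k = ∑ i, k i • (Pi.single i 1 : Fin N → ℤ) := by
      ext r
      simp [Pi.single_apply]
    rw [hk]
    exact H.sum_mem fun i _ => H.zsmul_mem (hδ.exists_sq_mul_single i) _
  exact this

theorem IsStrongDenominator.coprime_den {δ m : ℕ} (hδ : Q.IsStrongDenominator δ)
    (hmδ : m.Coprime δ) (hmc : m.Coprime Q.c.den) (k : Fin N → ℤ) : m.Coprime (Q.quad k).den := by
  obtain ⟨n, hn⟩ := hδ.exists_sq_mul k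
  rw [show Q.quad k = (Q.quad k - Q.c) + Q.c by ring]
  exact coprime_den_add (coprime_den_of_mul_eq_int (D := δ ^ 2) (pow_ne_zero 2 hδ.1.ne')
    (hmδ.pow_right 2) (by push_cast; exact hn)) hmc

/-- `Q(k)` modulo `m` depends only on `k` modulo `m`. -/
theorem IsStrongDenominator.ratMod_quad {δ m : ℕ} (hδ : Q.IsStrongDenominator δ)
    (hmδ : m.Coprime δ) (hmb : ∀ i, m.Coprime (Q.b i).den) (hmc : m.Coprime Q.c.den)
    {k l : Fin N → ℤ} (h : ∀ i, k i ≡ l i [ZMOD m]) :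
    ratMod m (Q.quad k) = ratMod m (Q.quad l) := by
  choose v hv using fun i => (h i).symm.dvd
  have hk : k = l + (m : ℤ) • v := by
    ext i; simp only [Pi.add_apply, Pi.smul_apply, smul_eq_mul]; linarith [hv i]
  have hp : Q.polar l ((m : ℤ) • v) = m * Q.polar l v := by
    rw [Q.polar_smul]; push_cast; rfl
  have hcop : ∀ k l, m.Coprime (Q.polar k l).den := fun k l => by
    obtain ⟨n, hn⟩ := hδ.exists_mul_polar k l
    exact coprime_den_of_mul_eq_int hδ.1.ne' hmδ hn
  have hhalf : m.Coprime ((m : ℚ) / 2).den := by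
    rcases Nat.even_or_odd m with he | ho
    · obtain ⟨r, hr⟩ := he
      have : (m : ℚ) / 2 = ((r : ℤ) : ℚ) := by rw [hr]; push_cast; ring
      rw [this]; exact coprime_den_int _ _
    · exact coprime_den_of_mul_eq_int two_ne_zero (n := m) (Nat.coprime_two_right.2 ho)
        (by push_cast; ring)
  have hb : m.Coprime ((fun i => (v i : ℚ)) ⬝ᵥ Q.b).den :=
    coprime_den_sum _ _ fun i _ => coprime_den_mul (coprime_den_int m _) (hmb i)
  rw [hk, Q.quad_add, Q.quad_smul_sub, hp]
  rw [← ratMod_add_mul (hδ.coprime_den hmδ hmc l) (coprime_den_add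
    (coprime_den_add (coprime_den_mul hhalf (hcop v v)) hb) (hcop l v))]
  congr 1
  push_cast
  ring

/-- Splitting of `𝐞(α Q(k))` into factors depending on `k` modulo `δ` and modulo `m`. -/
theorem IsStrongDenominator.expi_mul_quad {δ : ℕ} (hδ : Q.IsStrongDenominator δ) {α : ℚ}
    (hmδ : α.den.Coprime δ) (hmc : α.den.Coprime Q.c.den) (k : Fin N → ℤ) :
    expi (α * Q.quad k) = expi (((ratMod (δ ^ 2 * Q.c.den) α).val : ℂ) * Q.quad k) *
      expi α ^ (ratMod α.den (Q.quad k)).val := by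
  set M := δ ^ 2 * Q.c.den with hM
  have hM0 : M ≠ 0 := mul_ne_zero (pow_ne_zero 2 hδ.1.ne') Q.c.den_nz
  have : NeZero M := ⟨hM0⟩
  have : NeZero α.den := ⟨α.den_nz⟩
  have hcop : α.den.Coprime M := (hmδ.pow_right 2).mul_right hmc
  set x := Q.quad k with hx
  have hxd : α.den.Coprime x.den := hδ.coprime_den hmδ hmc k
  have hxM : x.den ∣ M := by
    obtain ⟨n, hn⟩ := hδ.exists_sq_mul k
    have : x = Rat.divInt (n * Q.c.den + δ ^ 2 * Q.c.num) M := by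
      have hcd : (Q.c.den : ℚ) ≠ 0 := by exact_mod_cast Q.c.den_nz
      have hM' : (M : ℚ) ≠ 0 := by exact_mod_cast hM0
      rw [Rat.divInt_eq_div, eq_div_iff (by exact_mod_cast hM'), hM]
      push_cast
      rw [← hn, ← Rat.mul_den_eq_num Q.c]
      ring
    rw [this]
    exact Int.natCast_dvd_natCast.1 (Rat.den_dvd _ _)
  set a := (ratMod M α).val with ha
  set r := (ratMod α.den x).val with hr
  have h1 : ((a * α.den - α.num : ℤ) : ZMod M) = 0 := by
    have := ratMod_mul_den hcop.symm
    push_cast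
    rw [ha, ZMod.natCast_zmod_val, this, sub_self]
  have h2 : ((r * x.den - x.num : ℤ) : ZMod α.den) = 0 := by
    have := ratMod_mul_den hxd
    push_cast
    rw [hr, ZMod.natCast_zmod_val, this, sub_self]
  rw [ZMod.intCast_zmod_eq_zero_iff_dvd] at h1 h2
  have h3 : (x.den : ℤ) ∣ a * α.den - α.num := (Int.natCast_dvd_natCast.2 hxM).trans h1
  have h4 : ((α.den : ℤ) * x.den) ∣
      α.num * x.num - a * x.num * α.den - α.num * r * x.den := by
    refine IsCoprime.mul_dvd (Nat.isCoprime_iff_coprime.2 hxd) ?_ ?_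
    · obtain ⟨t, ht⟩ := h2
      exact ⟨-α.num * t - a * x.num, by linear_combination (-α.num) * ht⟩
    · obtain ⟨t, ht⟩ := h3
      exact ⟨-x.num * t - α.num * r, by linear_combination (-x.num) * ht⟩
  obtain ⟨t, ht⟩ := h4
  rw [← expi_nat_mul, ← expi_add]
  have := expi_eq_of_sub_int (x := α * x) (y := a * x + r * α) ⟨t, by
    have hαd : (α.den : ℚ) ≠ 0 := by exact_mod_cast α.den_nz
    have hxd' : (x.den : ℚ) ≠ 0 := by exact_mod_cast x.den_nz
    have ht' : (α.num : ℚ) * x.num - a * x.num * α.den - α.num * r * x.den =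
      α.den * x.den * t := by exact_mod_cast ht
    rw [← Rat.mul_den_eq_num α, ← Rat.mul_den_eq_num x] at ht'
    have hne := mul_ne_zero hαd hxd'
    apply mul_left_cancel₀ hne
    linear_combination ht'⟩
  push_cast at this
  exact this

/-- The part of `𝐞(α Q(k))` is periodic modulo `m δ`. -/
theorem IsStrongDenominator.expi_mul_quad_congr {δ : ℕ} (hδ : Q.IsStrongDenominator δ) {α : ℚ}
    (hmδ : α.den.Coprime δ) (hmb : ∀ i, α.den.Coprime (Q.b i).den) (hmc : α.den.Coprime Q.c.den)
    {k l : Fin N → ℤ} (h : ∀ i, k i ≡ l i [ZMOD (α.den * δ : ℕ)]) :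
    expi (α * Q.quad k) = expi (α * Q.quad l) := by
  rw [hδ.expi_mul_quad hmδ hmc, hδ.expi_mul_quad hmδ hmc, hδ.ratMod_quad hmδ hmb hmc (l := l)
    fun i => (h i).of_dvd (by push_cast; exact dvd_mul_right _ _)]
  congr 1
  obtain ⟨n, hn⟩ := hδ.2 k l fun i => (h i).of_dvd (by push_cast; exact dvd_mul_left _ _)
  have := expi_eq_of_sub_int (x := (ratMod (δ ^ 2 * Q.c.den) α).val * Q.quad k)
    (y := (ratMod (δ ^ 2 * Q.c.den) α).val * Q.quad l)
    ⟨(ratMod (δ ^ 2 * Q.c.den) α).val * n, by push_cast; rw [← hn]; ring⟩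
  push_cast at this
  exact this

theorem isPrimitiveRoot_expi {α : ℚ} {d : ℕ} (hmd : α.den.Coprime d) :
    IsPrimitiveRoot (expi α ^ d) α.den := by
  refine IsPrimitiveRoot.pow_of_coprime ?_ d hmd.symm
  have hd : (α.den : ℚ) ≠ 0 := by exact_mod_cast α.den_nz
  rw [IsPrimitiveRoot.iff_def]
  constructor
  · rw [← expi_nat_mul]
    have := (expi_eq_one_iff_int (α.den * α)).2 ⟨α.num, Rat.den_mul_eq_num α⟩
    push_cast at this
    exact this
  · intro l hl
    rw [← expi_nat_mul] at hl
    obtain ⟨n, hn⟩ := (expi_eq_one_iff_int (l * α)).1 (by push_cast; exact hl)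
    have h1 : (l : ℤ) * α.num = n * α.den := by
      have : (l : ℚ) * α.num = n * α.den := by
        rw [← hn, ← Rat.den_mul_eq_num α]; ring
      exact_mod_cast this
    have h2 : (α.den : ℤ) ∣ l * α.num := ⟨n, by rw [h1]; ring⟩
    have h3 : IsCoprime (α.den : ℤ) α.num :=
      (Int.isCoprime_iff_gcd_eq_one.2 (by rw [Int.gcd, Int.natAbs_natCast]; exact α.reduced)).symm
    exact_mod_cast h3.dvd_of_dvd_mul_right h2

/-- `τ = α + iε/(2πm)`. -/
noncomputable def tauOf (α : ℚ) (ε : ℂ) : ℂ := α + Complex.I * ε / (2 * π * α.den)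

theorem tauOf_im (α : ℚ) (ε : ℂ) : (tauOf α ε).im = ε.re / (2 * π * α.den) := by
  have : tauOf α ε = (α : ℚ) + ((2 * π * α.den : ℝ) : ℂ)⁻¹ * (Complex.I * ε) := by
    rw [tauOf]; push_cast; ring
  rw [this, add_im, ← ofReal_inv, im_ofReal_mul]
  simp [div_eq_inv_mul]

theorem expi_tauOf_mul (α : ℚ) (ε x : ℂ) :
    expi (tauOf α ε * x) = expi (α * x) * cexp (-(ε / α.den) * x) := by
  have hd : (α.den : ℂ) ≠ 0 := by exact_mod_cast α.den_nz
  have hpi : (π : ℂ) ≠ 0 := by exact_mod_cast Real.pi_ne_zero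
  rw [tauOf, add_mul, expi_add]
  congr 1
  rw [expi]
  congr 1
  field_simp
  linear_combination ε * x * I_sq

variable (Q) in
/-- The Nahm sum on the ray, as a sum over twisted terms. -/
theorem nahmTerm_tauOf (α : ℚ) (ε : ℂ) (n : Fin N → ℕ) :
    Q.nahmTerm (tauOf α ε) n = expi (α * Q.quad fun i => (n i : ℤ)) *
      Q.twistedTerm (ε / α.den) (fun _ => 1)
        (fun i => expi α ^ Q.d i * cexp (-(Q.d i * (ε / α.den)))) n := by
  have h : ∀ i, expi (tauOf α ε * Q.d i) =
      expi α ^ Q.d i * cexp (-(Q.d i * (ε / α.den))) := fun i => by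
    rw [expi_tauOf_mul, mul_comm (α : ℂ), expi_nat_mul]
    congr 2; ring
  have hq : ((Q.quad fun i => (n i : ℤ) : ℚ) : ℂ) = ((Q.quadR fun i => (n i : ℝ) : ℝ) : ℂ) := by
    have := Q.quad_cast fun i => (n i : ℤ)
    rw [← ofReal_ratCast, this]
    simp
  simp only [nahmTerm, twistedTerm, h, expi_tauOf_mul, one_pow, one_div, Finset.prod_inv_distrib]
  rw [hq, div_eq_mul_inv]
  ring

variable (Q) in
theorem summable_twistedTerm (α : ℚ) {ε : ℂ} (hε : 0 < ε.re) {ω : Fin N → ℂ}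
    (hω : ∀ i, ‖ω i‖ = 1) : Summable (Q.twistedTerm (ε / α.den) ω
        (fun i => expi α ^ Q.d i * cexp (-(Q.d i * (ε / α.den))))) := by
  have hτ : 0 < (tauOf α ε).im := by
    rw [tauOf_im]
    have := pi_pos
    have : (0 : ℝ) < α.den := by exact_mod_cast α.den_pos
    positivity
  refine Summable.of_norm_bounded (Q.summable_nahmTerm hτ).norm fun n => le_of_eq ?_
  have h1 : expi (α * Q.quad fun i => (n i : ℤ)) =
    expi ((α * Q.quad fun i => (n i : ℤ) : ℚ) : ℂ) := by push_cast; rfl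
  rw [nahmTerm_tauOf, norm_mul, h1, norm_expi_rat, one_mul]
  simp [twistedTerm, hω]

/-- The bound for the Nahm sum in a cone around the positive axis. -/
theorem IsStrongDenominator.exists_norm_nahmSum_le {δ : ℕ} (hδ : Q.IsStrongDenominator δ) {α : ℚ}
    (hmδ : α.den.Coprime δ) (hmd : ∀ i, α.den.Coprime (Q.d i))
    (hmb : ∀ i, α.den.Coprime (Q.b i).den) (hmc : α.den.Coprime Q.c.den)
    {z : Fin N → ℝ} (hz : Q.IsNahmSolution z) :
    ∃ κ r C : ℝ, 0 < κ ∧ κ ≤ 1 ∧ 0 < r ∧ 0 < C ∧ ∀ ε : ℂ, 0 < ε.re → |ε.im| ≤ κ * ε.re →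
      ‖ε‖ ≤ r → ‖cexp (-(Q.Lam z : ℂ) / (α.den * ε)) * Q.nahmSum (tauOf α ε)‖ ≤
        C * (‖ε‖ ^ N)⁻¹ := by
  have hL : 0 < α.den * δ := Nat.mul_pos α.den_pos hδ.1
  obtain ⟨γ, hγ⟩ := exists_finite_fourier hL (fun n : Fin N → ℕ =>
    expi (α * Q.quad fun i => (n i : ℤ))) fun n n' h =>
      hδ.expi_mul_quad_congr hmδ hmb hmc fun i => Int.natCast_modEq_iff.2 (h i)
  have hmain := fun l : Fin N → Fin (α.den * δ) => Q.exists_norm_tsum_twistedTerm_le hz α.den_pos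
    (fun i => isPrimitiveRoot_expi (hmd i)) fun i => (((l i : ℕ) / (α.den * δ : ℕ) : ℚ) : ℝ)
  choose κ r C hκ hκ1 hr hr1 hC hb using hmain
  have : Nonempty (Fin (α.den * δ)) := ⟨⟨0, hL⟩⟩
  refine ⟨Finset.univ.inf' Finset.univ_nonempty κ, Finset.univ.inf' Finset.univ_nonempty r,
    1 + ∑ l, ‖γ l‖ * C l, ?_, ?_, ?_, ?_, fun ε hε hcone hεr => ?_⟩
  · simpa using hκ
  · exact (inf'_le _ (mem_univ (Classical.arbitrary _))).trans (hκ1 _)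
  · simpa using hr
  · have : 0 ≤ ∑ l, ‖γ l‖ * C l := sum_nonneg fun l _ =>
      mul_nonneg (norm_nonneg _) (hC l).le
    linarith
  · have hterm : ∀ n, Q.nahmTerm (tauOf α ε) n = ∑ l : Fin N → Fin (α.den * δ), γ l *
        Q.twistedTerm (ε / α.den)
          (fun i => expi ((((l i : ℕ) / (α.den * δ : ℕ) : ℚ) : ℝ) : ℂ))
          (fun i => expi α ^ Q.d i * cexp (-(Q.d i * (ε / α.den)))) n := fun n => by
      rw [nahmTerm_tauOf, hγ n, sum_mul]
      refine sum_congr rfl fun l _ => ?_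
      simp only [twistedTerm, one_pow, prod_div_distrib, Finset.prod_const_one,
        ofReal_ratCast]
      ring
    have hsum : Q.nahmSum (tauOf α ε) = ∑ l : Fin N → Fin (α.den * δ), γ l *
        ∑' n, Q.twistedTerm (ε / α.den)
          (fun i => expi ((((l i : ℕ) / (α.den * δ : ℕ) : ℚ) : ℝ) : ℂ))
          (fun i => expi α ^ Q.d i * cexp (-(Q.d i * (ε / α.den)))) n := by
      rw [nahmSum]
      simp_rw [hterm]
      rw [Summable.tsum_finsetSum fun l _ => ?_]
      · simp_rw [tsum_mul_left]
      · exact (Q.summable_twistedTerm α hε fun i => norm_expi_real _).mul_left _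
    rw [hsum, mul_sum]
    refine (norm_sum_le _ _).trans ?_
    have hN : 0 ≤ (‖ε‖ ^ N)⁻¹ := by positivity
    rw [add_mul, sum_mul]
    refine le_add_of_nonneg_of_le (by positivity) (sum_le_sum fun l _ => ?_)
    rw [mul_left_comm, norm_mul, mul_assoc]
    refine mul_le_mul_of_nonneg_left (hb l ε hε (hcone.trans ?_) (hεr.trans ?_)) (norm_nonneg _)
    · exact mul_le_mul_of_nonneg_right (inf'_le _ (mem_univ l)) hε.le
    · exact inf'_le _ (mem_univ l)

end Datum

/-! ### From a ray to a sector -/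

/-- The estimate on the upper half of a sector for a bounded holomorphic function that is small on
the positive axis. -/
theorem norm_le_of_small_on_ray_upper {H : ℂ → ℂ} (hH : DifferentiableOn ℂ H {ε | 0 < ε.re})
    {κ r C : ℝ} (hκ : 0 < κ) (hκ1 : κ ≤ 1) (hr : 0 < r) (hC : 0 < C) {K : ℕ}
    (hbd : ∀ ε : ℂ, 0 < ε.re → |ε.im| ≤ κ * ε.re → ‖ε‖ ≤ r → ‖H ε‖ ≤ C)
    (hray : ∀ s : ℝ, 0 < s → s ≤ r → ‖H s‖ ≤ C * (s / r) ^ (2 * K)) {ε : ℂ} (h0 : 0 < ε.re)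
    (him : 0 ≤ ε.im) (hcone : ε.im ≤ κ / 8 * ε.re) (hεr : ‖ε‖ ≤ r / 4) :
    ‖H ε‖ ≤ C * (2 * ‖ε‖ / r) ^ K := by
  set η := κ / 2 with hη
  have hη0 : 0 < η := by positivity
  have hη1 : η ≤ 1 / 2 := by linarith
  have hpi := Real.pi_gt_three
  set E : ℂ → ℂ := fun w => r / (1 + cexp (-w)) with hE
  have hexp : ∀ w : ℂ, cexp (-w) = ⟨rexp (-w.re) * cos w.im,
      -(rexp (-w.re) * sin w.im)⟩ := fun w => by
    apply Complex.ext
    · simp [Complex.exp_re]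
    · simp [Complex.exp_im]
  have hcos : ∀ w : ℂ, w.im ∈ Set.Icc 0 η → 7 / 8 ≤ cos w.im := fun w hw => by
    have := Real.one_sub_sq_div_two_le_cos (x := w.im)
    nlinarith [hw.1, hw.2]
  have hden : ∀ w : ℂ, w.im ∈ Set.Icc 0 η → 1 ≤ (1 + cexp (-w)).re := fun w hw => by
    rw [add_re, hexp]
    have := hcos w hw
    have := exp_pos (-w.re)
    simp only [one_re]
    nlinarith
  have hEre : ∀ w : ℂ, w.im ∈ Set.Icc 0 η → 0 < (E w).re ∧ |(E w).im| ≤ κ * (E w).re ∧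
      ‖E w‖ ≤ r := fun w hw => by
    have h1 := hden w hw
    set D := 1 + cexp (-w) with hD
    have hD0 : 0 < normSq D := Complex.normSq_pos.2 fun h => by
      rw [h] at h1; norm_num at h1
    have hE' : E w = (r / normSq D : ℝ) * (starRingEnd ℂ) D := by
      simp only [hE, ← hD]
      rw [div_eq_mul_inv, Complex.inv_def]; push_cast; ring
    have hq : 0 < r / normSq D := by positivity
    have hDim : D.im = -(rexp (-w.re) * sin w.im) := by
      rw [hD, add_im, hexp]; simp
    have hDre : D.re = 1 + rexp (-w.re) * cos w.im := by
      rw [hD, add_re, hexp]; simp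
    refine ⟨?_, ?_, ?_⟩
    · rw [hE', re_ofReal_mul, conj_re]; positivity
    · rw [hE', re_ofReal_mul, im_ofReal_mul, conj_re, conj_im,
        hDim, neg_neg, abs_mul, abs_of_pos hq, mul_left_comm]
      refine mul_le_mul_of_nonneg_left ?_ hq.le
      have hs0 : 0 ≤ sin w.im :=
        Real.sin_nonneg_of_nonneg_of_le_pi hw.1 (by linarith [hw.2])
      have hs1 : sin w.im ≤ w.im := Real.sin_le hw.1
      rw [abs_of_nonneg (mul_nonneg (exp_pos _).le hs0), hDre]
      have h2 : sin w.im ≤ κ * cos w.im := by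
        have := hcos w hw
        nlinarith [hw.2]
      nlinarith [exp_pos (-w.re)]
    · simp only [hE, ← hD, norm_div, norm_real, norm_of_nonneg hr.le]
      exact div_le_self hr.le (h1.trans (re_le_norm D))
  set mult : ℂ → ℂ := fun w => cexp (-(2 * K) * (w + Complex.I * w ^ 2 / (2 * η))) with hmult
  have hmn : ∀ w : ℂ, ‖mult w‖ = rexp (-(2 * K) * (w.re * (1 - w.im / η))) := fun w => by
    rw [hmult]
    simp only
    rw [norm_exp]
    congr 1
    have : (-(2 * K) * (w + Complex.I * w ^ 2 / (2 * η)) : ℂ) =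
      ((-(2 * K) : ℝ) : ℂ) * (w + ((1 / (2 * η) : ℝ) : ℂ) * (Complex.I * w ^ 2)) := by
      push_cast; ring
    rw [this, re_ofReal_mul, add_re, re_ofReal_mul]
    simp only [Complex.mul_re, I_re, I_im, pow_two, mul_im]
    field_simp
    ring
  have hdiff : DifferentiableOn ℂ (fun w => mult w * H (E w)) (Complex.im ⁻¹' Set.Icc 0 η) := by
    intro w hw
    have h1 : DifferentiableAt ℂ H (E w) :=
      (hH (E w) (hEre w hw).1).differentiableAt
        ((isOpen_lt continuous_const Complex.continuous_re).mem_nhds (hEre w hw).1)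
    have h2 : DifferentiableAt ℂ E w := by
      refine (differentiableAt_const _).div (by fun_prop) fun h => ?_
      have := hden w hw
      rw [h] at this; norm_num at this
    have h3 : DifferentiableAt ℂ mult w := by simp only [hmult]; fun_prop
    exact (h3.mul (h1.comp w h2)).differentiableWithinAt
  have hcl : closure (Complex.im ⁻¹' Set.Ioo 0 η) ⊆ Complex.im ⁻¹' Set.Icc 0 η :=
    closure_minimal (Set.preimage_mono Set.Ioo_subset_Icc_self)
      (isClosed_Icc.preimage continuous_im)
  have hstrip : ∀ w : ℂ, 0 ≤ w.im → w.im ≤ η → ‖mult w * H (E w)‖ ≤ C := by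
    intro w hw0 hw1
    refine PhragmenLindelof.horizontal_strip (a := 0) (b := η) (C := C)
      (f := fun w => mult w * H (E w)) (hdiff.mono hcl).diffContOnCl ?_ ?_ ?_ hw0 hw1
    · refine ⟨1, by rw [sub_zero, lt_div_iff₀ hη0]; linarith, 2 * K, ?_⟩
      refine IsBigO.of_bound C ?_
      filter_upwards [mem_inf_of_right (mem_principal_self _)] with w hw
      have hw' : w.im ∈ Set.Icc 0 η := ⟨hw.1.le, hw.2.le⟩
      have h1 := hEre w hw'
      rw [norm_mul, mul_comm, norm_of_nonneg (exp_pos _).le]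
      refine mul_le_mul (hbd _ h1.1 h1.2.1 h1.2.2) ?_ (norm_nonneg _) hC.le
      rw [hmn]
      refine Real.exp_le_exp.2 ?_
      have h2 : |w.re * (1 - w.im / η)| ≤ |w.re| := by
        rw [abs_mul]
        refine mul_le_of_le_one_right (abs_nonneg _) ?_
        have : w.im / η ≤ 1 := (div_le_one hη0).2 hw'.2
        have : 0 ≤ w.im / η := div_nonneg hw'.1 hη0.le
        rw [abs_le]; constructor <;> linarith
      have h3 : |w.re| ≤ rexp |w.re| := by linarith [add_one_le_exp |w.re|]
      have h4 := neg_abs_le (w.re * (1 - w.im / η))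
      have hK : (0 : ℝ) ≤ 2 * K := by positivity
      rw [one_mul]
      nlinarith
    · intro w hw
      have hw' : w.im ∈ Set.Icc 0 η := ⟨hw.ge, by rw [hw]; exact hη0.le⟩
      have hEw : E w = ((r / (1 + rexp (-w.re)) : ℝ) : ℂ) := by
        have : w = (w.re : ℂ) := Complex.ext rfl (by simp [hw])
        simp only [hE]
        rw [this]; push_cast; simp
      have hpos := exp_pos (-w.re)
      have h1 := hray (r / (1 + rexp (-w.re))) (by positivity)
        (div_le_self hr.le (by linarith))
      rw [norm_mul, hmn, hEw, hw, zero_div, sub_zero, mul_one]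
      have h2 : r / (1 + rexp (-w.re)) / r ≤ rexp w.re := by
        rw [div_div, mul_comm, ← div_div, div_self hr.ne', div_le_iff₀ (by positivity), mul_add,
          ← exp_add]
        simp [(exp_pos w.re).le]
      calc _ ≤ rexp (-(2 * K) * w.re) * (C * rexp w.re ^ (2 * K)) := by
            refine mul_le_mul_of_nonneg_left (h1.trans ?_) (exp_pos _).le
            gcongr
        _ = C := by
            rw [← exp_nat_mul, mul_left_comm, ← exp_add]
            push_cast
            rw [show -(2 * (K : ℝ)) * w.re + 2 * K * w.re = 0 by ring, exp_zero, mul_one]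
    · intro w hw
      have hw' : w.im ∈ Set.Icc 0 η := ⟨by rw [hw]; exact hη0.le, hw.le⟩
      have h1 := hEre w hw'
      rw [norm_mul, hmn, hw, div_self hη0.ne', sub_self, mul_zero, mul_zero, exp_zero, one_mul]
      exact hbd _ h1.1 h1.2.1 h1.2.2
  -- the point of the strip over `ε`
  have hε0 : ε ≠ 0 := fun h => by rw [h] at h0; simp at h0
  have hεn : 0 < ‖ε‖ := norm_pos_iff.2 hε0
  have hns : normSq ε = ‖ε‖ ^ 2 := Complex.normSq_eq_norm_sq ε
  set u : ℂ := r / ε - 1 with hu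
  have hure : u.re = r * ε.re / ‖ε‖ ^ 2 - 1 := by
    rw [hu, sub_re, div_re, hns]; simp
  have huim : u.im = -(r * ε.im / ‖ε‖ ^ 2) := by
    rw [hu, sub_im, Complex.div_im, hns]; simp
  have h2re : ‖ε‖ ≤ 2 * ε.re := norm_le_two_mul_re h0 (by
    rw [abs_of_nonneg him]; nlinarith)
  have hu1 : 1 ≤ u.re := by
    rw [hure, le_sub_iff_add_le, le_div_iff₀ (by positivity)]
    nlinarith
  have hu0 : u ≠ 0 := fun h => by rw [h] at hu1; norm_num at hu1
  set w := -Complex.log u with hw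
  have hew : cexp (-w) = u := by rw [hw, neg_neg, Complex.exp_log hu0]
  have hEw : E w = ε := by
    simp only [hE, hew, hu]
    have : (r : ℂ) ≠ 0 := by exact_mod_cast hr.ne'
    rw [add_sub_cancel, div_div_cancel₀ this]
  have hwim : w.im = -u.arg := by simp [hw, log_im]
  have hargn : u.arg ≤ 0 := by
    rcases lt_or_eq_of_le him with h | h
    · refine (Complex.arg_neg_iff.2 ?_).le
      rw [huim]
      have : 0 < r * ε.im / ‖ε‖ ^ 2 := by positivity
      linarith
    · refine (Complex.arg_eq_zero_iff.2 ⟨by linarith, ?_⟩).le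
      rw [huim, ← h]; simp
  have harg2 : |u.arg| < π / 2 := (Complex.abs_arg_lt_pi_div_two_iff).2 (Or.inl (by linarith))
  have htan : -u.arg ≤ η / 2 := by
    have h1 := Real.le_tan (x := -u.arg) (by linarith) (by rw [abs_of_nonpos hargn] at harg2; exact harg2)
    rw [Real.tan_neg, Complex.tan_arg] at h1
    refine h1.trans ?_
    rw [← neg_div, div_le_iff₀ (by linarith), huim, neg_neg]
    have h2 : r * ε.im / ‖ε‖ ^ 2 ≤ κ / 8 * (u.re + 1) := by
      rw [hure, sub_add_cancel, ← mul_div_assoc]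
      refine div_le_div_of_nonneg_right ?_ (by positivity)
      nlinarith [mul_le_mul_of_nonneg_left hcone hr.le]
    have : u.re + 1 ≤ 2 * u.re := by linarith
    rw [hη]
    nlinarith
  have hfin := hstrip w (by rw [hwim]; linarith) (by rw [hwim]; linarith)
  rw [norm_mul, hEw, hmn] at hfin
  have hxe : rexp w.re = ‖ε‖ / ‖(r : ℂ) - ε‖ := by
    have h1 : ‖cexp (-w)‖ = ‖(r : ℂ) - ε‖ / ‖ε‖ := by
      rw [hew, hu, div_sub_one hε0, norm_div]
    rw [norm_exp, neg_re, exp_neg] at h1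
    rw [← inv_inv (rexp w.re), h1, inv_div]
  have hrε : r / 2 ≤ ‖(r : ℂ) - ε‖ := by
    have := norm_sub_norm_le (r : ℂ) ε
    rw [norm_real, norm_of_nonneg hr.le] at this
    linarith
  have hx2 : rexp w.re ≤ 2 * ‖ε‖ / r := by
    rw [hxe, div_le_div_iff₀ (by linarith) hr]
    nlinarith
  have hx0 : w.re ≤ 0 := by
    rw [← Real.exp_le_one_iff]
    refine hx2.trans ((div_le_one hr).2 ?_)
    linarith
  have hm1 : rexp w.re ^ K * rexp (-(2 * K) * (w.re * (1 - w.im / η))) ≥ 1 := by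
    rw [← exp_nat_mul, ← exp_add]
    refine Real.one_le_exp ?_
    have h1 : w.im / η ≤ 1 / 2 := by
      rw [div_le_iff₀ hη0, hwim]; linarith
    have hK : (0 : ℝ) ≤ K := by positivity
    have h2 : 0 ≤ -w.re * (1 - 2 * (w.im / η)) := mul_nonneg (by linarith) (by linarith)
    nlinarith [mul_nonneg hK h2]
  have hpK : 0 < rexp w.re ^ K := by positivity
  calc ‖H ε‖ ≤ rexp w.re ^ K * rexp (-(2 * K) * (w.re * (1 - w.im / η))) * ‖H ε‖ :=
        le_mul_of_one_le_left (norm_nonneg _) hm1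
    _ ≤ rexp w.re ^ K * C := by rw [mul_assoc]; exact mul_le_mul_of_nonneg_left hfin hpK.le
    _ ≤ C * (2 * ‖ε‖ / r) ^ K := by rw [mul_comm]; gcongr

theorem norm_le_of_small_on_ray {H : ℂ → ℂ} (hH : DifferentiableOn ℂ H {ε | 0 < ε.re})
    {κ r C : ℝ} (hκ : 0 < κ) (hκ1 : κ ≤ 1) (hr : 0 < r) (hC : 0 < C) {K : ℕ}
    (hbd : ∀ ε : ℂ, 0 < ε.re → |ε.im| ≤ κ * ε.re → ‖ε‖ ≤ r → ‖H ε‖ ≤ C)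
    (hray : ∀ s : ℝ, 0 < s → s ≤ r → ‖H s‖ ≤ C * (s / r) ^ (2 * K)) {ε : ℂ} (h0 : 0 < ε.re)
    (hcone : |ε.im| ≤ κ / 8 * ε.re) (hεr : ‖ε‖ ≤ r / 4) :
    ‖H ε‖ ≤ C * (2 * ‖ε‖ / r) ^ K := by
  rcases le_total 0 ε.im with him | him
  · exact norm_le_of_small_on_ray_upper hH hκ hκ1 hr hC hbd hray h0 him
      (by rwa [abs_of_nonneg him] at hcone) hεr
  · have hH' : DifferentiableOn ℂ (fun w => (starRingEnd ℂ) (H ((starRingEnd ℂ) w)))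
        {ε | 0 < ε.re} := by
      intro w hw
      have hw' : 0 < ((starRingEnd ℂ) w).re := by rw [conj_re]; exact hw
      have h1 : DifferentiableAt ℂ H ((starRingEnd ℂ) w) := (hH _ hw').differentiableAt
        ((isOpen_lt continuous_const Complex.continuous_re).mem_nhds hw')
      have := h1.conj_conj
      simp only [Complex.conj_conj] at this
      exact this.differentiableWithinAt
    have := norm_le_of_small_on_ray_upper hH' hκ hκ1 hr hC (K := K) (ε := (starRingEnd ℂ) ε)
      (fun w h1 h2 h3 => by
        rw [norm_conj]
        refine hbd _ (by simpa using h1) (by simpa using h2) (by simpa using h3))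
      (fun s h1 h2 => by
        rw [norm_conj, Complex.conj_ofReal]; exact hray s h1 h2)
      (by simpa using h0) (by simpa using him)
      (by rw [abs_of_nonpos him] at hcone; simpa using hcone) (by simpa using hεr)
    simpa using this

theorem sector_subset_cone {κ : ℝ} (hκ : 0 < κ) (hκ1 : κ ≤ 1) {ε : ℂ} (h : ε ∈ sector (κ / 16)) :
    0 < ε.re ∧ |ε.im| ≤ κ / 8 * ε.re := by
  have hn : 0 < ‖ε‖ := norm_pos_iff.2 h.1
  have h2 : |ε.arg| ≤ κ / 16 := h.2
  have hre : ε.re = ‖ε‖ * cos ε.arg := (Complex.norm_mul_cos_arg ε).symm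
  have him : ε.im = ‖ε‖ * sin ε.arg := (Complex.norm_mul_sin_arg ε).symm
  have hs : |sin ε.arg| ≤ κ / 16 := Real.abs_sin_le_abs.trans h2
  have hc : 1 / 2 ≤ cos ε.arg := by
    have h3 := Real.one_sub_sq_div_two_le_cos (x := ε.arg)
    have h4 : ε.arg ^ 2 ≤ 1 := by
      rw [← sq_abs]; nlinarith [abs_nonneg ε.arg]
    linarith
  constructor
  · rw [hre]; positivity
  · rw [him, abs_mul, abs_of_pos hn, hre, mul_left_comm]
    refine mul_le_mul_of_nonneg_left (hs.trans ?_) hn.le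
    nlinarith

/-- An asymptotic expansion along the positive axis of a function of moderate growth in a cone
persists in a smaller sector. -/
theorem hasAsymptoticExpansion_of_ray {G : ℂ → ℂ} (hG : DifferentiableOn ℂ G {ε | 0 < ε.re})
    {κ r C : ℝ} (hκ : 0 < κ) (hκ1 : κ ≤ 1) (hr : 0 < r) (hC : 0 < C) {M : ℕ}
    (hbd : ∀ ε : ℂ, 0 < ε.re → |ε.im| ≤ κ * ε.re → ‖ε‖ ≤ r → ‖G ε‖ ≤ C * (‖ε‖ ^ M)⁻¹)
    (a : PowerSeries ℂ)
    (hray : ∀ K : ℕ, (fun s : ℝ => G s - ∑ j ∈ range K, coeff j a * (s : ℂ) ^ j)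
      =O[𝓝[>] 0] fun s : ℝ => s ^ K) :
    HasAsymptoticExpansion G (nhdsWithin 0 (sector (κ / 16))) a := by
  intro K
  set K' := 2 * (K + M) with hK'
  set P : ℂ → ℂ := fun ε => ∑ j ∈ range K', coeff j a * ε ^ j with hP
  obtain ⟨C₁, hC₁, h1⟩ := (hray K').exists_pos
  rw [isBigOWith_iff] at h1
  obtain ⟨s₀, hs₀, h1⟩ := mem_nhdsGT_iff_exists_Ioc_subset.1 h1
  have hs₀' : 0 < s₀ := hs₀
  set S := ∑ j ∈ range K', ‖coeff j a‖ with hS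
  have hS0 : 0 ≤ S := sum_nonneg fun j _ => norm_nonneg _
  set ρ := min (min r 1) s₀ with hρ
  have hρ0 : 0 < ρ := lt_min (lt_min hr one_pos) hs₀'
  have hρr : ρ ≤ r := (min_le_left _ _).trans (min_le_left _ _)
  have hρ1 : ρ ≤ 1 := (min_le_left _ _).trans (min_le_right _ _)
  have hρs : ρ ≤ s₀ := min_le_right _ _
  have hPbd : ∀ ε : ℂ, ‖ε‖ ≤ 1 → ‖P ε‖ ≤ S := fun ε hε => by
    refine (norm_sum_le _ _).trans (sum_le_sum fun j _ => ?_)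
    rw [norm_mul, norm_pow]
    exact mul_le_of_le_one_right (norm_nonneg _) (pow_le_one₀ (norm_nonneg _) hε)
  have hHd : DifferentiableOn ℂ (fun ε => ε ^ M * (G ε - P ε)) {ε | 0 < ε.re} := by
    refine DifferentiableOn.mul (by fun_prop) (hG.sub ?_)
    simp only [hP]; fun_prop
  have key := fun {ε : ℂ} => norm_le_of_small_on_ray hHd hκ hκ1 hρ0
    (C := C + S + C₁) (by positivity) (K := K + M)
    (fun ε h0 hc hε => by
      have hε0 : 0 < ‖ε‖ := norm_pos_iff.2 fun h => by rw [h] at h0; simp at h0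
      rw [mul_sub]
      refine (norm_sub_le _ _).trans ?_
      rw [norm_mul, norm_mul, norm_pow]
      have h2 := hbd ε h0 hc (hε.trans hρr)
      have h3 : ‖ε‖ ^ M * ‖G ε‖ ≤ C := by
        calc _ ≤ ‖ε‖ ^ M * (C * (‖ε‖ ^ M)⁻¹) := by gcongr
          _ = C := by field_simp
      have h4 : ‖ε‖ ^ M * ‖P ε‖ ≤ S := by
        calc _ ≤ 1 * S := by
              gcongr
              · exact pow_le_one₀ (norm_nonneg _) (hε.trans hρ1)
              · exact hPbd ε (hε.trans hρ1)
          _ = S := one_mul S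
      linarith)
    (fun s hs0 hsρ => by
      have h2 := h1 ⟨hs0, hsρ.trans hρs⟩
      simp only [Set.mem_ofPred_eq] at h2
      rw [norm_mul, norm_pow, norm_real, norm_of_nonneg hs0.le]
      rw [norm_of_nonneg (by positivity)] at h2
      calc s ^ M * ‖G s - P s‖ ≤ 1 * (C₁ * s ^ K') := by
            gcongr
            exact pow_le_one₀ hs0.le (hsρ.trans hρ1)
        _ ≤ (C + S + C₁) * (s / ρ) ^ K' := by
            rw [one_mul]
            gcongr
            · linarith
            · rw [le_div_iff₀ hρ0]; nlinarith) (ε := ε)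
  have hmain : (fun ε => G ε - P ε) =O[nhdsWithin 0 (sector (κ / 16))] fun ε => ε ^ K := by
    refine IsBigO.of_bound ((C + S + C₁) * (2 / ρ) ^ (K + M)) ?_
    have hball : ∀ᶠ ε : ℂ in nhdsWithin 0 (sector (κ / 16)), ‖ε‖ ≤ ρ / 4 := by
      refine mem_nhdsWithin_of_mem_nhds ?_
      filter_upwards [Metric.closedBall_mem_nhds (0 : ℂ) (by positivity : 0 < ρ / 4)] with ε hε
      simpa using hε
    filter_upwards [hball, self_mem_nhdsWithin] with ε hε hsec
    have hc := sector_subset_cone hκ hκ1 hsec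
    have hε0 : 0 < ‖ε‖ := norm_pos_iff.2 hsec.1
    have h2 := key hc.1 hc.2 hε
    rw [norm_mul, norm_pow] at h2
    rw [norm_pow]
    have h3 : (0 : ℝ) < ‖ε‖ ^ M := by positivity
    refine le_of_mul_le_mul_left (h2.trans (le_of_eq ?_)) h3
    rw [pow_add, pow_add, div_pow, div_pow, div_pow, div_pow, mul_pow, mul_pow]
    ring
  have hdiff : (fun ε : ℂ => P ε - ∑ j ∈ range K, coeff j a * ε ^ j)
      =O[nhdsWithin 0 (sector (κ / 16))] fun ε => ε ^ K := by
    have : ∀ ε : ℂ, P ε - ∑ j ∈ range K, coeff j a * ε ^ j =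
        ε ^ K * ∑ j ∈ range (K' - K), coeff (K + j) a * ε ^ j := fun ε => by
      have h2 : K' = K + (K' - K) := by omega
      simp only [hP]
      rw [h2, Finset.sum_range_add, add_sub_cancel_left, mul_sum, ← h2]
      exact sum_congr rfl fun j _ => by rw [pow_add]; ring
    simp_rw [this]
    have h3 : (fun ε : ℂ => ∑ j ∈ range (K' - K), coeff (K + j) a * ε ^ j)
        =O[nhdsWithin 0 (sector (κ / 16))] fun _ => (1 : ℂ) := by
      have : Continuous fun ε : ℂ => ∑ j ∈ range (K' - K),
        coeff (K + j) a * ε ^ j := by fun_prop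
      exact ((this.tendsto 0).mono_left nhdsWithin_le_nhds).isBigO_one ℂ
    simpa using (isBigO_refl (fun ε : ℂ => ε ^ K) _).mul h3
  have := hmain.add hdiff
  refine this.congr (fun ε => ?_) fun _ => rfl
  ring

/-! ### The Euler product at a root of unity -/

theorem lq_pow_mul {q x : ℂ} (hq : ‖q‖ < 1) (hx : ‖x‖ < 1) (n : ℕ) :
    lq q (q ^ n * x) = lq q x + ∑ j ∈ range n, Complex.log (1 - q ^ j * x) := by
  induction n with
  | zero => simp
  | succ n ih =>
    have := lq_sub_lq_mul hq (norm_pow_mul_lt_one hq hx n)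
    rw [sum_range_succ, pow_succ', mul_assoc]
    linear_combination ih - this

theorem summable_log_one_sub_pow {q : ℂ} (hq : ‖q‖ < 1) :
    Summable fun n : ℕ => Complex.log (1 - q ^ (n + 1)) := by
  have h : Summable fun n : ℕ => -q ^ (n + 1) :=
    (((summable_geometric_of_norm_lt_one hq).mul_left q).congr fun n => (pow_succ' q n).symm).neg
  refine (Complex.summable_log_one_add_of_summable h).congr fun n => ?_
  rw [sub_eq_add_neg]

theorem tsum_log_one_sub_pow {q : ℂ} (hq : ‖q‖ < 1) :
    ∑' n : ℕ, Complex.log (1 - q ^ (n + 1)) = -lq q q := by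
  refine HasSum.tsum_eq (((summable_log_one_sub_pow hq).hasSum_iff_tendsto_nat).2 ?_)
  have h1 : ∀ n : ℕ, ∑ j ∈ range n, Complex.log (1 - q ^ (j + 1)) =
      lq q (q ^ n * q) - lq q q := fun n => by
    rw [lq_pow_mul hq hq, add_sub_cancel_left]
    simp [pow_succ]
  simp_rw [h1]
  have h2 : Tendsto (fun n : ℕ => lq q (q ^ n * q)) atTop (𝓝 0) := by
    have h3 : Tendsto (fun n : ℕ => ‖q ^ n * q‖) atTop (𝓝 0) := by
      have := (tendsto_pow_atTop_nhds_zero_of_norm_lt_one hq).mul_const q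
      simpa using this.norm
    have h4 : Tendsto (fun n : ℕ => ‖q ^ n * q‖ / (1 - ‖q ^ n * q‖) / (1 - ‖q‖)) atTop
        (𝓝 (0 / (1 - 0) / (1 - ‖q‖))) :=
      (h3.div (tendsto_const_nhds.sub h3) (by norm_num)).div_const _
    rw [zero_div, zero_div] at h4
    exact squeeze_zero_norm (fun n => norm_lq_le hq (norm_pow_mul_lt_one hq hq n)) h4
  simpa using h2.sub_const (lq q q)

theorem exp_neg_lq_self {q : ℂ} (hq : ‖q‖ < 1) :
    cexp (-lq q q) = ∏' n : ℕ, (1 - q ^ (n + 1)) := by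
  rw [← tsum_log_one_sub_pow hq, Complex.cexp_tsum_eq_tprod _ (summable_log_one_sub_pow hq)]
  exact fun n => one_sub_pow_ne_zero hq n

theorem discriminant_eq (τ : UpperHalfPlane) : ModularForm.discriminant τ =
    expi τ * cexp (-lq (expi τ) (expi τ)) ^ 24 := by
  have hq : ‖expi τ‖ < 1 := by
    rw [Datum.norm_expi]
    have := mul_pos pi_pos τ.im_pos
    exact Real.exp_lt_one_iff.2 (by simp only [UpperHalfPlane.coe_im]; nlinarith)
  rw [exp_neg_lq_self hq, ModularForm.discriminant, ModularForm.eta, mul_pow]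
  congr 2
  · rw [Function.Periodic.qParam, ← Complex.exp_nat_mul, expi]
    congr 1
    push_cast; ring
  · refine tprod_congr fun n => ?_
    rw [ModularForm.eta_q_eq_pow, expi]

/-- The transformation of the Euler product under the element of the modular group that sends
`p / m` to the cusp at infinity. -/
theorem eulerProduct_transform {m : ℕ} (hm : 0 < m) {p a b : ℤ} (hab : -(a * p) - b * m = 1) {ε : ℝ}
    (hε : 0 < ε) {q q₁ : ℂ} (hq : q = expi (p / m) * cexp (-(ε / m)))
    (hq₁ : q₁ = expi (a / m) * cexp (-(4 * π ^ 2 / (m * ε)))) :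
    q₁ * cexp (-lq q₁ q₁) ^ 24 =
      (ε / (2 * π)) ^ 12 * (q * cexp (-lq q q) ^ 24) := by
  have hmR : (0 : ℝ) < m := by exact_mod_cast hm
  have hmC : (m : ℂ) ≠ 0 := by exact_mod_cast hm.ne'
  have hεC : (ε : ℂ) ≠ 0 := by exact_mod_cast hε.ne'
  have hpC : (π : ℂ) ≠ 0 := by exact_mod_cast Real.pi_ne_zero
  have hpi := pi_pos
  let γ : Matrix.SpecialLinearGroup (Fin 2) ℤ := ⟨!![a, b; m, -p], by
    rw [Matrix.det_fin_two_of]; linarith⟩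
  let τ : UpperHalfPlane := ⟨p / m + ((ε / (2 * π * m) : ℝ) : ℂ) * Complex.I, by
    have : ((p : ℂ) / m).im = 0 := by
      have : (p / m : ℂ) = ((p / m : ℝ) : ℂ) := by push_cast; rfl
      rw [this, ofReal_im]
    rw [add_im, this, im_ofReal_mul]
    simp only [I_im, mul_one, zero_add]
    positivity⟩
  have hτ : (τ : ℂ) = p / m + ((ε / (2 * π * m) : ℝ) : ℂ) * Complex.I := rfl
  have hden : (m : ℂ) * τ + -p = Complex.I * ε / (2 * π) := by
    rw [hτ]; push_cast; field_simp; ring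
  have hinv : SlashAction.map (12 : ℤ) γ ModularForm.discriminant = ModularForm.discriminant :=
    SlashInvariantForm.slash_action_generators_SL2Z
    ModularForm.discriminant_S_invariant ModularForm.discriminant_T_invariant γ
  have h1 := congrFun hinv τ
  rw [ModularForm.SL_slash_apply, zpow_neg, mul_inv_eq_iff_eq_mul₀
    (zpow_ne_zero _ (UpperHalfPlane.denom_ne_zero _ _))] at h1
  have hd : UpperHalfPlane.denom γ τ = Complex.I * ε / (2 * π) := by
    rw [← hden]
    change (((γ.1 1 0 : ℤ) : ℝ) : ℂ) * (τ : ℂ) + (((γ.1 1 1 : ℤ) : ℝ) : ℂ) = _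
    simp [γ]
  have hγτ : ((γ • τ : UpperHalfPlane) : ℂ) =
      a / m + ((2 * π / (m * ε) : ℝ) : ℂ) * Complex.I := by
    rw [UpperHalfPlane.coe_specialLinearGroup_apply]
    simp only [γ, Matrix.of_apply, Matrix.cons_val', Matrix.cons_val_zero,
      Matrix.cons_val_one, Matrix.cons_val_fin_one]
    simp only [eq_intCast, Int.cast_neg, Int.cast_natCast, ofReal_neg,
      ofReal_natCast, Complex.ofReal_intCast]
    rw [hden, hτ]
    have hab' : (b : ℂ) = (-(a * p) - 1) / m := by
      rw [eq_div_iff hmC]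
      have : (-(a * p) - b * m : ℂ) = 1 := by exact_mod_cast hab
      linear_combination -this
    rw [hab']
    push_cast
    field_simp
    linear_combination (-2 * π : ℂ) * I_sq
  have e1 : expi τ = q := by
    rw [hτ, expi_add, hq]
    congr 1
    rw [expi]
    congr 1
    push_cast
    field_simp
    linear_combination I_sq
  have e2 : expi ((γ • τ : UpperHalfPlane) : ℂ) = q₁ := by
    rw [hγτ, expi_add, hq₁]
    congr 1
    rw [expi]
    congr 1
    push_cast
    field_simp
    linear_combination (4 : ℂ) * I_sq
  rw [discriminant_eq, discriminant_eq, hd, e1, e2] at h1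
  rw [h1, mul_comm]
  congr 1
  have hI : Complex.I ^ 12 = 1 := by
    rw [show 12 = 4 * 3 by norm_num, pow_mul, Complex.I_pow_four, one_pow]
  norm_cast
  rw [mul_div_assoc, mul_pow, hI, one_mul]
  push_cast; rfl

/-! ### The phase of the Euler product -/

theorem one_sub_mem_slitPlane {w : ℂ} (hw : ‖w‖ ≤ 1) (h1 : w ≠ 1) : 1 - w ∈ slitPlane := by
  rw [Complex.mem_slitPlane_iff]
  by_contra! h
  simp only [sub_re, one_re, sub_im, Complex.one_im, zero_sub,
    neg_eq_zero] at h
  have h2 := re_le_norm w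
  exact h1 (Complex.ext (by simp; linarith [h.1]) (by simp [h.2]))

theorem im_log_one_sub_expi {y : ℝ} (h0 : 0 < y) (h1 : y < 1) :
    (Complex.log (1 - expi y)).im = π * (y - 1 / 2) := by
  have hpi := pi_pos
  have hs : 0 < 2 * sin (π * y) :=
    mul_pos two_pos (Real.sin_pos_of_pos_of_lt_pi (by positivity) (by nlinarith))
  have : 1 - expi y = ((2 * sin (π * y) : ℝ) : ℂ) *
      (Complex.cos ((π * (y - 1 / 2) : ℝ) : ℂ) + Complex.sin ((π * (y - 1 / 2) : ℝ) : ℂ) *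
        Complex.I) := by
    have e1 : cos (π * (y - 1 / 2)) = sin (π * y) := by
      rw [show π * (y - 1 / 2) = π * y - π / 2 by ring, Real.cos_sub_pi_div_two]
    have e2 : sin (π * (y - 1 / 2)) = -cos (π * y) := by
      rw [show π * (y - 1 / 2) = π * y - π / 2 by ring, Real.sin_sub_pi_div_two]
    rw [← ofReal_cos, ← ofReal_sin, e1, e2, expi,
      show 2 * π * Complex.I * y = ((2 * (π * y) : ℝ) : ℂ) * Complex.I by push_cast; ring,
      exp_mul_I, ← ofReal_cos, ← ofReal_sin, Real.cos_two_mul,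
      Real.sin_two_mul]
    have := Real.sin_sq_add_cos_sq (π * y)
    have h3 : ((sin (π * y) : ℂ)) ^ 2 + (cos (π * y) : ℂ) ^ 2 = 1 := by
      exact_mod_cast this
    push_cast at h3 ⊢
    linear_combination (-2) * h3
  rw [log_im, this, Complex.arg_mul_cos_add_sin_mul_I hs]
  constructor <;> nlinarith

theorem im_log_one_sub_conj {m : ℕ} (hm : 0 < m) {ζ : ℂ} (hζ : IsPrimitiveRoot ζ m) {t : ℕ}
    (ht : t ∈ Ico 1 m) {x : ℝ} (hx0 : 0 ≤ x) (hx1 : x ≤ 1) :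
    (Complex.log (1 - ζ ^ (m - t) * x)).im = -(Complex.log (1 - ζ ^ t * x)).im := by
  rw [mem_Ico] at ht
  have hζn : ‖ζ‖ = 1 := hζ.norm'_eq_one hm.ne'
  have h1 : ζ ^ (m - t) = (starRingEnd ℂ) (ζ ^ t) := by
    have hn : ‖ζ ^ t‖ = 1 := by rw [norm_pow, hζn, one_pow]
    rw [← Complex.inv_eq_conj hn]
    refine eq_inv_of_mul_eq_one_left ?_
    rw [← pow_add, Nat.sub_add_cancel ht.2.le, hζ.pow_eq_one]
  have h2 : 1 - ζ ^ (m - t) * x = (starRingEnd ℂ) (1 - ζ ^ t * x) := by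
    rw [h1]; simp
  have hn : ‖ζ ^ t * x‖ = x := by
    rw [norm_mul, norm_pow, hζn, one_pow, one_mul, norm_real, norm_of_nonneg hx0]
  have hne : ζ ^ t * x ≠ 1 := fun h => by
    rw [h, norm_one] at hn
    rw [← hn, ofReal_one, mul_one] at h
    exact hζ.pow_ne_one_of_pos_of_lt (by omega) ht.2 h
  have h3 : (1 - ζ ^ t * x).arg ≠ π :=
    Complex.mem_slitPlane_iff_arg.1 (one_sub_mem_slitPlane (by rw [hn]; exact hx1) hne) |>.1
  rw [h2, Complex.log_conj _ h3, conj_im]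

theorem sum_im_log_one_sub {m : ℕ} (hm : 0 < m) {ζ : ℂ} (hζ : IsPrimitiveRoot ζ m) {x : ℝ}
    (hx0 : 0 ≤ x) (hx1 : x ≤ 1) :
    ∑ t ∈ Ico 1 m, (Complex.log (1 - ζ ^ t * x)).im = 0 := by
  have h := Finset.sum_Ico_reflect (fun t => (Complex.log (1 - ζ ^ t * x)).im) 1
    (show m ≤ m + 1 by omega)
  rw [Nat.add_sub_cancel_left, Nat.add_sub_cancel] at h
  rw [sum_congr rfl fun t ht => im_log_one_sub_conj hm hζ ht hx0 hx1,
    sum_neg_distrib] at h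
  linarith

/-- The Dedekind sum as a sum of arguments. -/
theorem pi_mul_dedekindSum {m : ℕ} (hm : 0 < m) {p : ℤ} (hp : IsCoprime p m)
    (hζ : IsPrimitiveRoot (expi (p / m)) m) :
    π * (dedekindSum p m : ℝ) =
      ∑ t ∈ Ico 1 m, (t / m : ℝ) * (Complex.log (1 - expi (p / m) ^ t)).im := by
  have hmQ : (m : ℚ) ≠ 0 := by exact_mod_cast hm.ne'
  have hmC : (m : ℂ) ≠ 0 := by exact_mod_cast hm.ne'
  have key : ∀ t ∈ Ico 1 m, (Complex.log (1 - expi (p / m) ^ t)).im =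
      π * (saw ((p : ℚ) * t / m) : ℝ) ∧ saw ((t : ℚ) / m) = t / m - 1 / 2 := by
    intro t ht
    rw [mem_Ico] at ht
    have hnint : ∀ a : ℤ, ¬ (m : ℤ) ∣ a → ((a : ℚ) / m).den ≠ 1 := fun a ha h => by
      apply ha
      have := Rat.coe_int_num_of_den_eq_one h
      rw [eq_div_iff hmQ] at this
      exact ⟨((a : ℚ) / m).num, by rw [mul_comm]; exact_mod_cast this.symm⟩
    have hnt : ¬ (m : ℤ) ∣ t := fun h => by
      have := Nat.le_of_dvd (by omega) (Int.natCast_dvd_natCast.1 h); omega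
    have hnpt : ¬ (m : ℤ) ∣ p * t := fun h => hnt (hp.symm.dvd_of_dvd_mul_left h)
    have h1 := hnint t hnt
    have h2 := hnint (p * t) hnpt
    push_cast at h1 h2
    refine ⟨?_, ?_⟩
    · set y := (p : ℚ) * t / m with hy
      have hf0 : 0 < Int.fract y := by
        refine (Int.fract_nonneg y).lt_of_ne fun h => ?_
        obtain ⟨n, hn⟩ := Int.fract_eq_zero_iff.1 h.symm
        exact h2 (by rw [← hn]; simp)
      have hf1 := Int.fract_lt_one y
      have e1 : expi (p / m) ^ t = expi (((Int.fract y : ℚ) : ℝ) : ℂ) := by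
        rw [← expi_nat_mul, ofReal_ratCast]
        have := expi_eq_of_sub_int (x := y) (y := Int.fract y) ⟨⌊y⌋, by
          rw [Int.self_sub_fract]⟩
        rw [← this, hy]
        congr 1; push_cast; ring
      rw [e1, im_log_one_sub_expi (by exact_mod_cast hf0) (by exact_mod_cast hf1), saw, if_neg h2]
      congr 1
      rw [Int.fract]; push_cast; ring
    · rw [saw, if_neg h1]
      have : ⌊(t : ℚ) / m⌋ = 0 := by
        rw [Int.floor_eq_zero_iff]
        refine ⟨by positivity, (div_lt_one (by positivity)).2 (by exact_mod_cast ht.2)⟩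
      rw [this]; simp
  have h0 : ∑ t ∈ Ico 1 m, (Complex.log (1 - expi (p / m) ^ t)).im = 0 := by
    simpa using sum_im_log_one_sub hm hζ (x := 1) zero_le_one le_rfl
  rw [dedekindSum, Finset.range_eq_Ico, Finset.sum_eq_sum_Ico_succ_bot hm]
  have hs0 : saw ((0 : ℕ) / m : ℚ) = 0 := by simp [saw]
  rw [hs0, zero_mul, zero_add]
  push_cast
  rw [mul_sum]
  have e2 : ∀ t ∈ Ico 1 m, π * ((saw ((t : ℚ) / m) : ℝ) * (saw ((p : ℚ) * t / m) : ℝ)) =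
      (t / m : ℝ) * (Complex.log (1 - expi (p / m) ^ t)).im -
        1 / 2 * (Complex.log (1 - expi (p / m) ^ t)).im := fun t ht => by
    rw [(key t ht).1, (key t ht).2]; push_cast; ring
  rw [sum_congr rfl e2, sum_sub_distrib, ← mul_sum, h0]
  ring

theorem exists_norm_inv_one_sub_le {ω : ℂ} (hω : ‖ω‖ = 1) (h1 : ω ≠ 1) :
    ∃ C : ℝ, 0 ≤ C ∧ ∀ x : ℝ, 0 ≤ x → x ≤ 1 → ‖(1 - ω * x)⁻¹‖ ≤ C := by
  have hc : ContinuousOn (fun x : ℝ => (1 - ω * x : ℂ)⁻¹) (Set.Icc 0 1) := by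
    refine ContinuousOn.inv₀ (by fun_prop) fun x hx h => h1 ?_
    have h2 : ω * x = 1 := (sub_eq_zero.1 h).symm
    have h3 : ‖ω * x‖ = x := by
      rw [norm_mul, hω, one_mul, norm_real, norm_of_nonneg hx.1]
    rw [h2, norm_one] at h3
    rw [← h3] at h2
    simpa using h2
  obtain ⟨C, hC⟩ := isCompact_Icc.exists_bound_of_continuousOn hc
  exact ⟨C, (norm_nonneg _).trans (hC 0 (by simp)), fun x h0 h1 => hC x ⟨h0, h1⟩⟩

/-- First order Taylor expansion of `log (1 - ω e^{-v})`, uniformly for `v ≥ 0`. -/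
theorem exists_norm_log_one_sub_taylor_le {ω : ℂ} (hω : ‖ω‖ = 1) (h1 : ω ≠ 1) :
    ∃ C : ℝ, 0 ≤ C ∧ ∀ v a : ℝ, 0 ≤ v → 0 ≤ a →
      ‖Complex.log (1 - ω * rexp (-(v + a))) - Complex.log (1 - ω * rexp (-v)) -
        a * (ω * rexp (-v) / (1 - ω * rexp (-v)))‖ ≤ C * a ^ 2 * rexp (-v) := by
  obtain ⟨C, hC0, hC⟩ := exists_norm_inv_one_sub_le hω h1
  refine ⟨C ^ 2, by positivity, fun v a hv ha => ?_⟩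
  have hexp : ∀ x : ℝ, 0 ≤ x → rexp (-(v + x)) ≤ 1 := fun x hx =>
    Real.exp_le_one_iff.2 (by linarith)
  have hslit : ∀ x : ℝ, 0 ≤ x → 1 - ω * rexp (-(v + x)) ∈ slitPlane := fun x hx => by
    have hn : ‖ω * rexp (-(v + x))‖ = rexp (-(v + x)) := by
      rw [norm_mul, hω, one_mul, norm_real, norm_of_nonneg (exp_pos _).le]
    refine one_sub_mem_slitPlane (by rw [hn]; exact hexp x hx) fun h => h1 ?_
    rw [h, norm_one] at hn
    rw [← hn, ofReal_one, mul_one] at h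
    exact h
  set g' : ℝ → ℂ := fun x => ω * rexp (-(v + x)) / (1 - ω * rexp (-(v + x))) with hg'
  have hd : ∀ x : ℝ, 0 ≤ x → HasDerivAt (fun x : ℝ => Complex.log (1 - ω * rexp (-(v + x))) -
      x * (ω * rexp (-v) / (1 - ω * rexp (-v)))) (g' x - g' 0) x := fun x hx => by
    have e1 : HasDerivAt (fun x : ℝ => rexp (-(v + x))) (-rexp (-(v + x))) x := by
      have := ((hasDerivAt_id x).const_add v).neg.exp
      simpa using this
    have e2 : HasDerivAt (fun x : ℝ => 1 - ω * (rexp (-(v + x)) : ℂ))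
        (ω * rexp (-(v + x))) x := by
      have := (e1.ofReal_comp.const_mul ω).const_sub 1
      simpa using this
    have e3 := e2.clog_real (hslit x hx)
    have e4 := ((hasDerivAt_id x).ofReal_comp).mul_const
      (ω * rexp (-v) / (1 - ω * rexp (-v)))
    exact (e3.sub e4).congr_deriv (by simp [hg'])
  have hb : ∀ x ∈ Set.Icc 0 a, ‖g' x - g' 0‖ ≤ C ^ 2 * a * rexp (-v) := fun x hx => by
    have hx0 := Complex.slitPlane_ne_zero (hslit x hx.1)
    have h00 := Complex.slitPlane_ne_zero (hslit 0 le_rfl)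
    have e1 : g' x - g' 0 = -(ω * rexp (-v) * (1 - rexp (-x) : ℝ)) *
        (1 - ω * rexp (-(v + x)))⁻¹ * (1 - ω * rexp (-(v + 0)))⁻¹ := by
      simp only [hg']
      rw [div_sub_div _ _ hx0 h00, div_eq_mul_inv, mul_inv, ← mul_assoc]
      congr 2
      have : rexp (-(v + x)) = rexp (-v) * rexp (-x) := by
        rw [← exp_add]; ring_nf
      rw [this, add_zero]
      push_cast; ring
    rw [e1, norm_mul, norm_mul, norm_neg, norm_mul, norm_mul, hω, one_mul, norm_real,
      norm_real, norm_of_nonneg (exp_pos _).le]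
    have e2 : ‖1 - rexp (-x)‖ ≤ a := by
      have := add_one_le_exp (-x)
      have := Real.exp_le_one_iff.2 (by linarith [hx.1] : -x ≤ 0)
      rw [norm_of_nonneg (by linarith)]
      linarith [hx.2]
    calc _ ≤ rexp (-v) * a * C * C := by
          gcongr
          · exact hC _ (exp_pos _).le (hexp x hx.1)
          · exact hC _ (exp_pos _).le (hexp 0 le_rfl)
      _ = _ := by ring
  have := (convex_Icc (0 : ℝ) a).norm_image_sub_le_of_norm_hasDerivWithin_le
    (fun x hx => (hd x hx.1).hasDerivWithinAt) hb ⟨le_rfl, ha⟩ ⟨ha, le_rfl⟩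
  simp only [add_zero, Complex.ofReal_zero, zero_mul, sub_zero] at this
  rw [norm_of_nonneg ha] at this
  refine (le_of_eq ?_).trans (this.trans (le_of_eq (by ring)))
  congr 1; ring

theorem sum_range_mul_eq (f : ℕ → ℝ) (m J : ℕ) : ∑ n ∈ range (m * J), f n =
    ∑ j ∈ range J, ∑ t ∈ range m, f (m * j + t) := by
  induction J with
  | zero => simp
  | succ J ih => rw [Nat.mul_succ, Finset.sum_range_add, ih, sum_range_succ]

theorem exists_abs_im_lq_sub_le {m : ℕ} (hm : 0 < m) {ζ : ℂ} (hζ : IsPrimitiveRoot ζ m) :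
    ∃ C : ℝ, ∀ u : ℝ, 0 < u → u ≤ 1 →
      |(lq (ζ * rexp (-u)) (ζ * rexp (-u))).im -
        ∑ t ∈ Ico 1 m, (t / m : ℝ) * (Complex.log (1 - ζ ^ t)).im| ≤ C * u := by
  have hζn : ‖ζ‖ = 1 := hζ.norm'_eq_one hm.ne'
  have hmR : (1 : ℝ) ≤ m := by exact_mod_cast hm
  have hT : ∀ t : ℕ, ∃ C : ℝ, 0 ≤ C ∧ (t ∈ Ico 1 m → ∀ v a : ℝ, 0 ≤ v → 0 ≤ a →
      ‖Complex.log (1 - ζ ^ t * rexp (-(v + a))) - Complex.log (1 - ζ ^ t * rexp (-v)) -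
        a * (ζ ^ t * rexp (-v) / (1 - ζ ^ t * rexp (-v)))‖ ≤
          C * a ^ 2 * rexp (-v)) := fun t => by
    by_cases ht : t ∈ Ico 1 m
    · rw [mem_Ico] at ht
      obtain ⟨C, hC, h⟩ := exists_norm_log_one_sub_taylor_le (ω := ζ ^ t)
        (by rw [norm_pow, hζn, one_pow]) (hζ.pow_ne_one_of_pos_of_lt (by omega) ht.2)
      exact ⟨C, hC, fun _ => h⟩
    · exact ⟨0, le_rfl, fun h => absurd h ht⟩
  choose C hC0 hC using hT
  set φ : ℕ → ℝ → ℝ := fun t v => (Complex.log (1 - ζ ^ t * rexp (-v))).im with hφ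
  have hphi : ∀ t ∈ Ico 1 m, ∀ v u : ℝ, 0 ≤ v → 0 ≤ u →
      |φ t (v + t * u) - φ t v - t / m * (φ t (v + m * u) - φ t v)| ≤
        2 * C t * m ^ 2 * u ^ 2 * rexp (-v) := fun t ht v u hv hu => by
    have ht' := Finset.mem_Ico.1 ht
    have htm : (t : ℝ) ≤ m := by exact_mod_cast ht'.2.le
    have ht0 : (0 : ℝ) ≤ t := by positivity
    set D : ℂ := ζ ^ t * rexp (-v) / (1 - ζ ^ t * rexp (-v)) with hD
    have him : ∀ a : ℝ, 0 ≤ a → |φ t (v + a) - φ t v - a * D.im| ≤ C t * a ^ 2 * rexp (-v) :=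
      fun a ha => by
        have h1 := hC t ht v a hv ha
        have h2 := (abs_im_le_norm _).trans h1
        rw [sub_im, sub_im, im_ofReal_mul] at h2
        exact h2
    have h1 := him (t * u) (by positivity)
    have h2 := him (m * u) (by positivity)
    have e : φ t (v + t * u) - φ t v - t / m * (φ t (v + m * u) - φ t v) =
        (φ t (v + t * u) - φ t v - t * u * D.im) -
          t / m * (φ t (v + m * u) - φ t v - m * u * D.im) := by
      field_simp; ring
    rw [e]
    refine (abs_sub _ _).trans ?_
    rw [abs_mul, abs_of_nonneg (by positivity : (0 : ℝ) ≤ t / m)]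
    have h3 : (t / m : ℝ) ≤ 1 := (div_le_one (by linarith)).2 htm
    have h4 : C t * (t * u) ^ 2 * rexp (-v) ≤ C t * (m * u) ^ 2 * rexp (-v) := by
      have := hC0 t
      gcongr
    have h5 : (t / m : ℝ) * |φ t (v + m * u) - φ t v - m * u * D.im| ≤
        1 * (C t * (m * u) ^ 2 * rexp (-v)) := by
      gcongr
    nlinarith
  refine ⟨4 * m ^ 2 * ∑ t ∈ Ico 1 m, C t, fun u hu hu1 => ?_⟩
  set S := ∑ t ∈ Ico 1 m, C t with hS
  have hS0 : 0 ≤ S := sum_nonneg fun t _ => hC0 t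
  set q : ℂ := ζ * rexp (-u) with hq
  have hqn : ‖q‖ < 1 := by
    rw [hq, norm_mul, hζn, one_mul, norm_real, norm_of_nonneg (exp_pos _).le]
    exact Real.exp_lt_one_iff.2 (by linarith)
  have hqpow : ∀ n : ℕ, q ^ n = ζ ^ n * (rexp (-(n * u)) : ℂ) := fun n => by
    rw [hq, mul_pow, ← ofReal_pow, ← exp_nat_mul]
    congr 3; ring
  have hblock : ∀ j : ℕ, |∑ t ∈ range m, (Complex.log (1 - q ^ (m * j + t + 1))).im -
      ∑ t ∈ Ico 1 m, t / m * (φ t (m * u * (j + 1 : ℕ)) - φ t (m * u * j))| ≤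
        2 * m ^ 2 * S * u ^ 2 * rexp (-(m * u)) ^ j := fun j => by
    have e1 : ∑ t ∈ range m, (Complex.log (1 - q ^ (m * j + t + 1))).im =
        ∑ t ∈ Ico 1 m, φ t (m * u * j + t * u) := by
      have h1 : ∀ t : ℕ, (Complex.log (1 - q ^ (m * j + t))).im = φ t (m * u * j + t * u) :=
        fun t => by
          simp only [hφ]
          rw [hqpow, pow_add, pow_mul, hζ.pow_eq_one, one_pow, one_mul]
          push_cast
          congr 5; ring
      obtain ⟨k, rfl⟩ : ∃ k, m = k + 1 := ⟨m - 1, by omega⟩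
      rw [sum_range_succ, sum_Ico_eq_sum_range, Nat.add_sub_cancel]
      have h2 : (Complex.log (1 - q ^ ((k + 1) * j + k + 1))).im = 0 := by
        rw [add_assoc, h1]
        simp only [hφ, hζ.pow_eq_one, one_mul]
        rw [← ofReal_one, ← ofReal_sub, log_im, Complex.arg_ofReal_of_nonneg]
        rw [sub_nonneg]
        refine Real.exp_le_one_iff.2 ?_
        rw [neg_nonpos]; positivity
      rw [h2, add_zero]
      refine sum_congr rfl fun t _ => ?_
      rw [add_assoc, h1, add_comm 1 t]
    have e2 : ∑ t ∈ Ico 1 m, φ t (m * u * j) = 0 :=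
      sum_im_log_one_sub hm hζ (exp_pos _).le
        (Real.exp_le_one_iff.2 (by rw [neg_nonpos]; positivity))
    have e3 : rexp (-(m * u)) ^ j = rexp (-(m * u * j)) := by
      rw [← exp_nat_mul]; congr 1; ring
    rw [e1, e3, ← sub_zero (∑ t ∈ Ico 1 m, φ t (m * u * j + t * u)), ← e2,
      ← sum_sub_distrib, ← sum_sub_distrib]
    refine (abs_sum_le_sum_abs _ _).trans ?_
    rw [hS, mul_sum, sum_mul, sum_mul]
    refine sum_le_sum fun t ht => ?_
    have h3 := hphi t ht (m * u * j) u (by positivity) hu.le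
    rw [show (m : ℝ) * u * (j + 1 : ℕ) = m * u * j + m * u by push_cast; ring]
    refine h3.trans (le_of_eq ?_)
    ring
  have hpart : ∀ J : ℕ, |∑ n ∈ range (m * J), (Complex.log (1 - q ^ (n + 1))).im -
      ∑ t ∈ Ico 1 m, t / m * (φ t (m * u * J) - φ t 0)| ≤ 4 * m ^ 2 * S * u := fun J => by
    have e1 : ∑ t ∈ Ico 1 m, t / m * (φ t (m * u * J) - φ t 0) =
        ∑ j ∈ range J, ∑ t ∈ Ico 1 m,
          t / m * (φ t (m * u * (j + 1 : ℕ)) - φ t (m * u * j)) := by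
      rw [sum_comm]
      refine sum_congr rfl fun t _ => ?_
      rw [← mul_sum, Finset.sum_range_sub fun j : ℕ => φ t (m * u * j)]
      simp
    rw [sum_range_mul_eq (fun n => (Complex.log (1 - q ^ (n + 1))).im), e1,
      ← sum_sub_distrib]
    refine (abs_sum_le_sum_abs _ _).trans
      ((sum_le_sum fun j _ => hblock j).trans ?_)
    rw [← mul_sum]
    set x := (m : ℝ) * u with hx
    have hx0 : u ≤ x := by rw [hx]; nlinarith
    have hxp : 0 < x := by linarith
    have hgeo : ∑ j ∈ range J, rexp (-x) ^ j ≤ 1 + 1 / x := by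
      have h1 : rexp (-x) < 1 := Real.exp_lt_one_iff.2 (by linarith)
      refine ((summable_geometric_of_lt_one (exp_pos _).le h1).sum_le_tsum _
        fun _ _ => by positivity).trans ?_
      rw [tsum_geometric_of_lt_one (exp_pos _).le h1]
      have h2 : rexp (-x) ≤ (1 + x)⁻¹ := by
        rw [exp_neg]
        exact inv_anti₀ (by linarith) (by linarith [add_one_le_exp x])
      rw [inv_le_iff_one_le_mul₀ (by linarith)]
      have h3 : 1 - (1 + x)⁻¹ ≤ 1 - rexp (-x) := by linarith
      calc (1 : ℝ) = (1 + 1 / x) * (1 - (1 + x)⁻¹) := by field_simp; ring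
        _ ≤ _ := by gcongr
    have h6 : u ^ 2 * (1 + 1 / x) ≤ 2 * u := by
      have : 1 / x ≤ 1 / u := one_div_le_one_div_of_le hu hx0
      calc u ^ 2 * (1 + 1 / x) ≤ u ^ 2 * (1 + 1 / u) := by gcongr
        _ = u ^ 2 + u := by field_simp
        _ ≤ 2 * u := by nlinarith
    calc 2 * m ^ 2 * S * u ^ 2 * ∑ j ∈ range J, rexp (-x) ^ j
        ≤ 2 * m ^ 2 * S * u ^ 2 * (1 + 1 / x) := by gcongr
      _ = 2 * m ^ 2 * S * (u ^ 2 * (1 + 1 / x)) := by ring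
      _ ≤ 2 * m ^ 2 * S * (2 * u) := by gcongr
      _ = _ := by ring
  have hl1 : Tendsto (fun J : ℕ => ∑ n ∈ range (m * J), (Complex.log (1 - q ^ (n + 1))).im)
      atTop (𝓝 (-lq q q).im) := by
    have h1 := (summable_log_one_sub_pow hqn).hasSum
    rw [tsum_log_one_sub_pow hqn] at h1
    have h2 := (Complex.hasSum_im h1).tendsto_sum_nat
    exact h2.comp (tendsto_id.const_mul_atTop' hm)
  have hl2 : Tendsto (fun J : ℕ => ∑ t ∈ Ico 1 m, (t / m : ℝ) * (φ t (m * u * J) - φ t 0))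
      atTop (𝓝 (∑ t ∈ Ico 1 m, (t / m : ℝ) * (0 - φ t 0))) := by
    refine tendsto_finsetSum _ fun t _ => ((Tendsto.sub_const ?_ _).const_mul _)
    have h1 : Tendsto (fun J : ℕ => (m : ℝ) * u * J) atTop atTop :=
      tendsto_natCast_atTop_atTop.const_mul_atTop (by positivity)
    have h2 : Tendsto (fun J : ℕ => (1 - ζ ^ t * (rexp (-(m * u * J)) : ℂ))) atTop (𝓝 1) := by
      have h3 := (Real.tendsto_exp_atBot.comp (tendsto_neg_atTop_atBot.comp h1))
      have h4 := ((Complex.continuous_ofReal.tendsto 0).comp h3).const_mul (ζ ^ t)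
      simpa using h4.const_sub 1
    have h5 := (Complex.continuous_im.tendsto _).comp
      (h2.clog (by simp [slitPlane]))
    rw [Complex.log_one, Complex.zero_im] at h5
    exact h5
  have := le_of_tendsto ((hl1.sub hl2).abs) (Eventually.of_forall hpart)
  refine (le_of_eq ?_).trans this
  rw [← abs_neg]
  congr 1
  simp only [zero_sub, mul_neg, sum_neg_distrib, hφ, neg_zero, exp_zero,
    ofReal_one, mul_one, Complex.neg_im]
  ring

theorem exp_neg_div_isBigO {a : ℝ} (ha : 0 < a) (K : ℕ) :
    (fun ε : ℝ => rexp (-(a / ε))) =O[𝓝[>] 0] fun ε => ε ^ K := by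
  have h1 := (isLittleO_exp_neg_mul_rpow_atTop ha (-K)).isBigO.comp_tendsto
    tendsto_inv_nhdsGT_zero
  refine (h1.congr' ?_ ?_)
  · filter_upwards with ε
    simp [div_eq_mul_inv]
  · filter_upwards [self_mem_nhdsWithin] with ε (hε : 0 < ε)
    simp only [Function.comp]
    rw [rpow_neg (by positivity), Real.rpow_natCast, inv_pow, inv_inv]

theorem isBigO_sub_one_of_pow {f g : ℝ → ℂ} {h : ℝ → ℝ} {l : Filter ℝ} (hf : Tendsto f l (𝓝 1))
    (hfg : ∀ᶠ x in l, f x ^ 24 = g x) (hg : (fun x => g x - 1) =O[l] h) :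
    (fun x => f x - 1) =O[l] h := by
  have h1 : Tendsto (fun x => ∑ i ∈ range 24, f x ^ i) l (𝓝 24) := by
    have := tendsto_finsetSum (range 24) fun i _ => hf.pow i
    simpa using this
  have h2 := (h1.inv₀ (by norm_num)).isBigO_one ℝ
  have h3 := hg.mul h2
  simp only [mul_one] at h3
  refine h3.congr' ?_ EventuallyEq.rfl
  filter_upwards [hfg, h1.eventually_ne (by norm_num : (24 : ℂ) ≠ 0)] with x hx hx0
  rw [← hx, ← mul_geom_sum, mul_assoc, mul_inv_cancel₀ hx0, mul_one]

/-- The 24th power of the normalized Euler product. -/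
theorem eulerProduct_normalized_pow {m : ℕ} (hm : 0 < m) {p a b : ℤ} (hab : -(a * p) - b * m = 1)
    {ε : ℝ} (hε : 0 < ε) (x : ℂ) {q q₁ : ℂ} (hq : q = expi (p / m) * rexp (-(ε / m)))
    (hq₁ : q₁ = expi (a / m) * rexp (-(4 * π ^ 2 / (m * ε)))) :
    (cexp (-lq q q) * (x * (sqrt (ε / (2 * π)) *
      rexp (π ^ 2 / (6 * m * ε) - ε / (24 * m)) : ℝ))) ^ 24 =
      x ^ 24 * (expi (a / m) / expi (p / m)) * cexp (-lq q₁ q₁) ^ 24 := by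
  have hmR : (0 : ℝ) < m := by exact_mod_cast hm
  have hpi := pi_pos
  have htr := eulerProduct_transform hm hab hε (q := q) (q₁ := q₁)
    (by rw [hq]; push_cast; rfl) (by rw [hq₁]; push_cast; rfl)
  generalize cexp (-lq q q) = E at htr ⊢
  generalize cexp (-lq q₁ q₁) = E₁ at htr ⊢
  have e1 : sqrt (ε / (2 * π)) ^ 24 = (ε / (2 * π)) ^ 12 := by
    rw [show 24 = 2 * 12 by norm_num, pow_mul, sq_sqrt (by positivity)]
  have e2 : rexp (π ^ 2 / (6 * m * ε) - ε / (24 * m)) ^ 24 =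
      rexp (4 * π ^ 2 / (m * ε)) * rexp (-(ε / m)) := by
    rw [← exp_nat_mul, ← exp_add]
    congr 1
    push_cast
    field_simp
    ring
  have e3 : rexp (4 * π ^ 2 / (m * ε)) * rexp (-(4 * π ^ 2 / (m * ε))) = 1 := by
    rw [← exp_add, add_neg_cancel, exp_zero]
  have e3' : (rexp (4 * π ^ 2 / (m * ε)) : ℂ) * rexp (-(4 * π ^ 2 / (m * ε))) = 1 := by
    rw [← ofReal_mul, e3, ofReal_one]
  have h0 := expi_ne_zero (p / m : ℂ)
  generalize expi (p / m : ℂ) = y at hq h0 ⊢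
  generalize expi (a / m : ℂ) = y₁ at hq₁ ⊢
  rw [mul_pow, mul_pow, ← ofReal_pow, mul_pow, e1, e2]
  generalize rexp (4 * π ^ 2 / (m * ε)) = X at e3' ⊢
  generalize rexp (-(4 * π ^ 2 / (m * ε))) = X' at e3' hq₁
  generalize rexp (-(ε / m)) = Z at hq ⊢
  have hr : (ε / (2 * π) : ℂ) = ((ε / (2 * π) : ℝ) : ℂ) := by push_cast; rfl
  rw [hr] at htr
  generalize ε / (2 * π) = r at htr ⊢
  subst hq hq₁
  rw [ofReal_mul, ofReal_mul, ofReal_pow]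
  field_simp
  linear_combination (-x ^ 24 * X) * htr + (x ^ 24 * y₁ * E₁ ^ 24) * e3'

/-- The Euler product near a root of unity, up to a factor `1 + O(ε^∞)`. -/
theorem eulerProduct_asymptotic {m : ℕ} (hm : 0 < m) {p : ℤ} (hp : IsCoprime p m)
    (hζ : IsPrimitiveRoot (expi (p / m)) m) (K : ℕ) :
    (fun ε : ℝ => cexp (lq (expi (p / m) * rexp (-(ε / m)))
        (expi (p / m) * rexp (-(ε / m)))) * (expi ((-dedekindSum p m / 2 : ℚ) : ℂ) *
        (sqrt (2 * π / ε) * rexp (-(π ^ 2 / (6 * m * ε)) + ε / (24 * m)) : ℝ)) - 1)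
      =O[𝓝[>] 0] fun ε => ε ^ K := by
  have hmR : (0 : ℝ) < m := by exact_mod_cast hm
  have hpi := pi_pos
  obtain ⟨a, b, hab⟩ : ∃ a b : ℤ, -(a * p) - b * m = 1 := by
    obtain ⟨u, v, huv⟩ := hp
    exact ⟨-u, -v, by linarith⟩
  set q : ℝ → ℂ := fun ε => expi (p / m) * rexp (-(ε / m)) with hq
  set q₁ : ℝ → ℂ := fun ε => expi (a / m) * rexp (-(4 * π ^ 2 / (m * ε))) with hq₁
  set Y : ℝ → ℂ := fun ε => cexp (-lq (q ε) (q ε)) * (expi ((dedekindSum p m / 2 : ℚ) : ℂ) *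
    (sqrt (ε / (2 * π)) * rexp (π ^ 2 / (6 * m * ε) - ε / (24 * m)) : ℝ)) with hY
  have hnint : ∀ k : ℤ, ‖expi (k / m)‖ = 1 := fun k => by
    have : (k / m : ℂ) = ((k / m : ℝ) : ℂ) := by push_cast; rfl
    rw [this, norm_expi_real]
  have hqn : ∀ ε : ℝ, 0 < ε → ‖q ε‖ < 1 := fun ε hε => by
    simp only [hq]
    rw [norm_mul, hnint, one_mul, norm_real, norm_of_nonneg (exp_pos _).le]
    exact Real.exp_lt_one_iff.2 (by rw [neg_lt_zero]; positivity)
  have hq₁n : ∀ ε : ℝ, ‖q₁ ε‖ = rexp (-(4 * π ^ 2 / m / ε)) := fun ε => by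
    simp only [hq₁]
    rw [norm_mul, hnint, one_mul, norm_real, norm_of_nonneg (exp_pos _).le,
      div_div]
  set G : ℝ → ℂ := fun ε => cexp (-lq (q₁ ε) (q₁ ε)) ^ 24 with hG
  have hKz : Tendsto (fun ε : ℝ => ε ^ 1) (𝓝[>] 0) (𝓝 0) := by
    have : Continuous fun ε : ℝ => ε ^ 1 := by fun_prop
    simpa using (this.tendsto 0).mono_left nhdsWithin_le_nhds
  have hlq₁ : ∀ K : ℕ, (fun ε => lq (q₁ ε) (q₁ ε)) =O[𝓝[>] 0] fun ε : ℝ => ε ^ K := fun K => by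
    have h0 : ∀ K : ℕ, (fun ε => ‖q₁ ε‖) =O[𝓝[>] 0] fun ε : ℝ => ε ^ K := fun K => by
      simp_rw [hq₁n]; exact exp_neg_div_isBigO (by positivity) K
    have h2 : Tendsto (fun ε => ‖q₁ ε‖) (𝓝[>] 0) (𝓝 0) := (h0 1).trans_tendsto hKz
    refine IsBigO.trans (IsBigO.of_bound 4 ?_) (h0 K)
    filter_upwards [h2.eventually (eventually_le_nhds (by norm_num : (0 : ℝ) < 1 / 2))] with ε hε
    have hlt : ‖q₁ ε‖ < 1 := by linarith
    refine (norm_lq_le hlt hlt).trans ?_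
    rw [div_div, div_le_iff₀ (by nlinarith), norm_of_nonneg (norm_nonneg _)]
    have : 1 / 4 ≤ (1 - ‖q₁ ε‖) * (1 - ‖q₁ ε‖) := by nlinarith
    nlinarith [norm_nonneg (q₁ ε)]
  have hG1 : ∀ K : ℕ, (fun ε => G ε - 1) =O[𝓝[>] 0] fun ε : ℝ => ε ^ K := fun K => by
    have h0 : Tendsto (fun ε => ((24 : ℕ) : ℂ) * -lq (q₁ ε) (q₁ ε)) (𝓝[>] 0) (𝓝 0) := by
      simpa using (((hlq₁ 1).trans_tendsto hKz).neg.const_mul ((24 : ℕ) : ℂ))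
    have h1 : (fun ε => ((24 : ℕ) : ℂ) * -lq (q₁ ε) (q₁ ε)) =O[𝓝[>] 0] fun ε : ℝ => ε ^ K :=
      (hlq₁ K).neg_left.const_mul_left _
    refine IsBigO.trans (IsBigO.of_bound 2 ?_) h1
    have h2 : ∀ᶠ ε in 𝓝[>] (0 : ℝ), ‖((24 : ℕ) : ℂ) * -lq (q₁ ε) (q₁ ε)‖ ≤ 1 := by
      have := h0.norm
      rw [norm_zero] at this
      exact this.eventually (eventually_le_nhds one_pos)
    filter_upwards [h2] with ε hε
    simp only [hG]
    rw [← Complex.exp_nat_mul]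
    exact norm_exp_sub_one_le hε
  have hGlim : Tendsto G (𝓝[>] 0) (𝓝 1) := by
    simpa using ((hG1 1).trans_tendsto hKz).add_const 1
  set U : ℂ := expi ((dedekindSum p m / 2 : ℚ) : ℂ) ^ 24 * (expi (a / m) / expi (p / m)) with hU
  have hY24 : ∀ ε : ℝ, 0 < ε → Y ε ^ 24 = U * G ε := fun ε hε =>
    eulerProduct_normalized_pow hm hab hε _ rfl rfl
  have hUn : ‖U‖ = 1 := by
    rw [hU, norm_mul, norm_pow, norm_div, hnint, hnint, norm_expi_rat]; norm_num
  have hYnorm : Tendsto (fun ε => ‖Y ε‖) (𝓝[>] 0) (𝓝 1) := by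
    have h1 : Tendsto (fun ε => ‖G ε‖ ^ ((24 : ℕ) : ℝ)⁻¹) (𝓝[>] 0) (𝓝 1) := by
      have := (hGlim.norm).rpow_const (p := ((24 : ℕ) : ℝ)⁻¹) (Or.inl (by simp))
      simpa using this
    refine h1.congr' ?_
    filter_upwards [self_mem_nhdsWithin] with ε hε
    have h2 := congrArg norm (hY24 ε hε)
    rw [norm_pow, norm_mul U, hUn, one_mul] at h2
    rw [← h2, Real.pow_rpow_inv_natCast (norm_nonneg _) (by norm_num)]
  set φ : ℝ → ℝ := fun ε => -(lq (q ε) (q ε)).im + π * (dedekindSum p m : ℝ) with hφ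
  have hφlim : Tendsto φ (𝓝[>] 0) (𝓝 0) := by
    obtain ⟨C, hC⟩ := exists_abs_im_lq_sub_le hm hζ
    rw [← pi_mul_dedekindSum hm hp hζ] at hC
    have h1 : Tendsto (fun ε : ℝ => C * (ε / m)) (𝓝[>] 0) (𝓝 0) := by
      have : Continuous fun ε : ℝ => C * (ε / m) := by fun_prop
      simpa using (this.tendsto 0).mono_left nhdsWithin_le_nhds
    refine squeeze_zero_norm' ?_ h1
    filter_upwards [Ioc_mem_nhdsGT hmR] with ε hε
    have := hC (ε / m) (div_pos hε.1 hmR) ((div_le_one hmR).2 hε.2)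
    rw [norm_eq_abs, ← abs_neg]
    refine (le_of_eq ?_).trans this
    congr 1
    simp only [hφ, hq]; ring
  have hYpolar : ∀ ε : ℝ, 0 < ε → Y ε = ‖Y ε‖ * cexp (φ ε * Complex.I) := fun ε hε => by
    have hpos : 0 < sqrt (ε / (2 * π)) *
        rexp (π ^ 2 / (6 * m * ε) - ε / (24 * m)) := by positivity
    have hn : ‖Y ε‖ = rexp (-(lq (q ε) (q ε)).re) * (sqrt (ε / (2 * π)) *
        rexp (π ^ 2 / (6 * m * ε) - ε / (24 * m))) := by
      simp only [hY]
      rw [norm_mul, norm_mul, norm_expi_rat, one_mul, norm_exp, neg_re,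
        norm_real, norm_of_nonneg hpos.le]
    have e : cexp (-lq (q ε) (q ε)) * expi ((dedekindSum p m / 2 : ℚ) : ℂ) =
        (rexp (-(lq (q ε) (q ε)).re) : ℂ) * cexp (φ ε * Complex.I) := by
      rw [expi, ofReal_exp, ← Complex.exp_add, ← Complex.exp_add]
      congr 1
      simp only [hφ]
      conv_lhs => rw [← Complex.re_add_im (lq (q ε) (q ε))]
      push_cast
      ring
    rw [hn]
    simp only [hY]
    rw [ofReal_mul (rexp _), ← mul_assoc, e]
    ring
  have hYlim : Tendsto Y (𝓝[>] 0) (𝓝 1) := by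
    have h1 : Tendsto (fun ε => (‖Y ε‖ : ℂ) * cexp (φ ε * Complex.I)) (𝓝[>] 0) (𝓝 1) := by
      have h2 := (Complex.continuous_ofReal.tendsto _).comp hYnorm
      have h3 := (Complex.continuous_exp.tendsto _).comp
        (((Complex.continuous_ofReal.tendsto _).comp hφlim).mul_const Complex.I)
      simpa using h2.mul h3
    refine h1.congr' ?_
    filter_upwards [self_mem_nhdsWithin] with ε hε using (hYpolar ε hε).symm
  have hU1 : U = 1 := by
    have h1 : Tendsto (fun ε => Y ε ^ 24) (𝓝[>] 0) (𝓝 1) := by simpa using hYlim.pow 24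
    have h2 : Tendsto (fun ε => U * G ε) (𝓝[>] 0) (𝓝 U) := by simpa using hGlim.const_mul U
    refine tendsto_nhds_unique (h2.congr' ?_) h1
    filter_upwards [self_mem_nhdsWithin] with ε hε using (hY24 ε hε).symm
  have hYK : (fun ε => Y ε - 1) =O[𝓝[>] 0] fun ε : ℝ => ε ^ K :=
    isBigO_sub_one_of_pow hYlim (by
      filter_upwards [self_mem_nhdsWithin] with ε hε
      rw [hY24 ε hε, hU1, one_mul]) (hG1 K)
  have hYinv := hYK.neg_left.mul ((hYlim.inv₀ one_ne_zero).isBigO_one ℝ)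
  simp only [mul_one] at hYinv
  refine hYinv.congr' ?_ EventuallyEq.rfl
  filter_upwards [self_mem_nhdsWithin, hYlim.eventually_ne one_ne_zero] with ε hε hne
  have hε' : 0 < ε := hε
  rw [neg_mul, sub_mul, mul_inv_cancel₀ hne, one_mul, neg_sub, sub_left_inj]
  simp only [hY]
  rw [mul_inv, mul_inv, ← Complex.exp_neg, neg_neg, ← expi_neg, ← ofReal_inv, mul_inv,
    ← Real.sqrt_inv, inv_div, ← exp_neg]
  have : (-(dedekindSum p m / 2) : ℚ) = (-dedekindSum p m / 2 : ℚ) := by ring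
  rw [← this]
  congr 4
  · push_cast; ring
  · ring_nf

/-! ### Expansions with respect to a scale -/

/-- `g ~ ∑ₑ aₑ` along `l`, where the error after the terms `e < K` is `O(ρ ^ K)`. -/
def HasExp {α : Type*} (l : Filter α) (ρ : α → ℝ) (g : α → ℂ) (a : α → PowerSeries ℂ) : Prop :=
  ∀ K : ℕ, (fun p => g p - ∑ e ∈ range K, coeff e (a p)) =O[l] fun p => ρ p ^ K

theorem isBigO_pow_of_le {α : Type*} {l : Filter α} {ρ : α → ℝ}
    (hρ : ∀ᶠ p in l, 0 ≤ ρ p ∧ ρ p ≤ 1) {a b : ℕ} (h : a ≤ b) :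
    (fun p => ρ p ^ b) =O[l] fun p => ρ p ^ a := by
  refine IsBigO.of_bound 1 ?_
  filter_upwards [hρ] with p hp
  rw [one_mul, norm_of_nonneg (pow_nonneg hp.1 _), norm_of_nonneg (pow_nonneg hp.1 _)]
  exact pow_le_pow_of_le_one hp.1 hp.2 h

namespace HasExp

variable {α : Type*} {l : Filter α} {ρ : α → ℝ} {g g₁ g₂ : α → ℂ} {a a₁ a₂ : α → PowerSeries ℂ}

theorem coeff_isBigO (hρ : ∀ᶠ p in l, 0 ≤ ρ p ∧ ρ p ≤ 1) (h : HasExp l ρ g a) (e : ℕ) :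
    (fun p => coeff e (a p)) =O[l] fun p => ρ p ^ e := by
  have := (h e).sub ((h (e + 1)).trans (isBigO_pow_of_le hρ (Nat.le_succ e)))
  refine this.congr_left fun p => ?_
  rw [sum_range_succ]; ring

/-- An exact finite expansion. -/
theorem of_eq_sum (hρ : ∀ᶠ p in l, 0 ≤ ρ p ∧ ρ p ≤ 1)
    (hc : ∀ e, (fun p => coeff e (a p)) =O[l] fun p => ρ p ^ e) (E : ℕ)
    (h0 : ∀ p, ∀ e ≥ E, coeff e (a p) = 0)
    (hg : ∀ᶠ p in l, g p = ∑ e ∈ range E, coeff e (a p)) : HasExp l ρ g a := by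
  intro K
  rcases le_total E K with h | h
  · refine (isBigO_zero _ l).congr' ?_ EventuallyEq.rfl
    filter_upwards [hg] with p hp
    rw [hp, ← sum_range_add_sum_Ico _ h,
      sum_eq_zero (s := Ico E K) fun e he => h0 p e (Finset.mem_Ico.1 he).1]
    simp
  · have : (fun p => ∑ e ∈ Ico K E, coeff e (a p)) =O[l] fun p => ρ p ^ K :=
      IsBigO.fun_sum fun e he => (hc e).trans (isBigO_pow_of_le hρ (Finset.mem_Ico.1 he).1)
    refine this.congr' ?_ EventuallyEq.rfl
    filter_upwards [hg] with p hp
    rw [hp, ← sum_range_add_sum_Ico _ h]; ring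

theorem congr_left (h : HasExp l ρ g₁ a) (hg : ∀ᶠ p in l, g₁ p = g₂ p) : HasExp l ρ g₂ a := by
  intro K
  refine (h K).congr' ?_ EventuallyEq.rfl
  filter_upwards [hg] with p hp
  rw [hp]

protected theorem add (h₁ : HasExp l ρ g₁ a₁) (h₂ : HasExp l ρ g₂ a₂) :
    HasExp l ρ (fun p => g₁ p + g₂ p) fun p => a₁ p + a₂ p := by
  intro K
  refine ((h₁ K).add (h₂ K)).congr_left fun p => ?_
  simp only [map_add, sum_add_distrib]; ring

theorem const_mul (c : ℂ) (h : HasExp l ρ g a) :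
    HasExp l ρ (fun p => c * g p) fun p => PowerSeries.C c * a p := by
  intro K
  refine ((h K).const_mul_left c).congr_left fun p => ?_
  simp only [coeff_C_mul, ← mul_sum]; ring

theorem one : HasExp l ρ (fun _ => 1) fun _ => 1 := by
  intro K
  rcases K with _ | K
  · exact IsBigO.of_bound 1 (Eventually.of_forall fun p => by simp)
  · refine (isBigO_zero _ l).congr_left fun p => ?_
    simp [coeff_one]

theorem zero : HasExp l ρ (fun _ => 0) fun _ => 0 := by
  intro K
  refine (isBigO_zero _ l).congr_left fun p => ?_
  simp

theorem sum {ι : Type*} (s : Finset ι) {g : ι → α → ℂ} {a : ι → α → PowerSeries ℂ}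
    (h : ∀ i ∈ s, HasExp l ρ (g i) (a i)) :
    HasExp l ρ (fun p => ∑ i ∈ s, g i p) fun p => ∑ i ∈ s, a i p := by
  intro K
  have := IsBigO.fun_sum fun i hi => h i hi K
  refine this.congr_left fun p => ?_
  rw [sum_sub_distrib, sum_comm]
  simp only [map_sum]

protected theorem mul (hρ : ∀ᶠ p in l, 0 ≤ ρ p ∧ ρ p ≤ 1) (h₁ : HasExp l ρ g₁ a₁)
    (h₂ : HasExp l ρ g₂ a₂) : HasExp l ρ (fun p => g₁ p * g₂ p) fun p => a₁ p * a₂ p := by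
  intro K
  have hb1 : (fun p => ∑ e ∈ range K, coeff e (a₁ p)) =O[l] fun p => ρ p ^ 0 :=
    IsBigO.fun_sum fun e _ => (h₁.coeff_isBigO hρ e).trans (isBigO_pow_of_le hρ (Nat.zero_le e))
  have hg2 : g₂ =O[l] fun p => ρ p ^ 0 := by simpa using h₂ 0
  have hA := hb1.mul (h₂ K)
  have hB := (h₁ K).mul hg2
  have hC : (fun p => ∑ x ∈ (range K ×ˢ range K).filter (fun x => K ≤ x.1 + x.2),
      coeff x.1 (a₁ p) * coeff x.2 (a₂ p)) =O[l] fun p => ρ p ^ K := by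
    refine IsBigO.fun_sum fun x hx => ?_
    have := (h₁.coeff_isBigO hρ x.1).mul (h₂.coeff_isBigO hρ x.2)
    refine (this.congr_right fun p => (pow_add _ _ _).symm).trans (isBigO_pow_of_le hρ ?_)
    exact (Finset.mem_filter.1 hx).2
  simp only [pow_zero, one_mul, mul_one] at hA hB
  refine ((hA.add hB).add hC).congr_left fun p => ?_
  have hprod : (∑ e ∈ range K, coeff e (a₁ p)) *
      (∑ e ∈ range K, coeff e (a₂ p)) =
      ∑ e ∈ range K, coeff e (a₁ p * a₂ p) +
      ∑ x ∈ (range K ×ˢ range K).filter (fun x => K ≤ x.1 + x.2),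
        coeff x.1 (a₁ p) * coeff x.2 (a₂ p) := by
    rw [Finset.sum_mul_sum, ← Finset.sum_product',
      ← Finset.sum_filter_add_sum_filter_not _ (fun x => K ≤ x.1 + x.2), add_comm]
    congr 1
    simp only [PowerSeries.coeff_mul]
    rw [sum_sigma']
    refine sum_bij' (fun x _ => ⟨x.1 + x.2, x⟩) (fun y _ => y.2) ?_ ?_ ?_ ?_ ?_
    · intro x hx
      simp only [Finset.mem_filter, Finset.mem_product, mem_range, not_le] at hx
      simp [hx.2]
    · intro y hy
      have h2 := Finset.HasAntidiagonal.mem_antidiagonal.1 (Finset.mem_sigma.1 hy).2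
      have h1 := Finset.mem_range.1 (Finset.mem_sigma.1 hy).1
      simp only [Finset.mem_filter, Finset.mem_product, mem_range, not_le]
      omega
    · intro x _; rfl
    · rintro ⟨e, x⟩ hy
      have h2 := Finset.HasAntidiagonal.mem_antidiagonal.1 (Finset.mem_sigma.1 hy).2
      obtain rfl : x.1 + x.2 = e := h2
      rfl
    · intro x _; rfl
  linear_combination -hprod

theorem pow (hρ : ∀ᶠ p in l, 0 ≤ ρ p ∧ ρ p ≤ 1) (h : HasExp l ρ g a) (n : ℕ) :
    HasExp l ρ (fun p => g p ^ n) fun p => a p ^ n := by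
  induction n with
  | zero => simpa using one
  | succ n ih => simpa only [pow_succ] using ih.mul hρ h

theorem prod (hρ : ∀ᶠ p in l, 0 ≤ ρ p ∧ ρ p ≤ 1) {ι : Type*} (s : Finset ι) {g : ι → α → ℂ}
    {a : ι → α → PowerSeries ℂ} (h : ∀ i ∈ s, HasExp l ρ (g i) (a i)) :
    HasExp l ρ (fun p => ∏ i ∈ s, g i p) fun p => ∏ i ∈ s, a i p := by
  classical
  induction s using induction_on with
  | empty => simpa using one
  | insert i s hi ih =>
    simp only [Finset.prod_insert hi]
    exact (h i (Finset.mem_insert_self _ _)).mul hρ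
      (ih fun j hj => h j (Finset.mem_insert_of_mem hj))

theorem exp (hρ : ∀ᶠ p in l, 0 ≤ ρ p ∧ ρ p ≤ 1) (h : HasExp l ρ g a)
    (h0 : ∀ p, coeff 0 (a p) = 0) :
    HasExp l ρ (fun p => cexp (g p)) fun p => formalExp (a p) := by
  intro K
  have hg1 : g =O[l] ρ := by
    have := h 1
    simpa [h0] using this
  have hS : HasExp l ρ (fun p => ∑ j ∈ range K, (1 / (j.factorial : ℂ)) * g p ^ j)
      (fun p => ∑ j ∈ range K, PowerSeries.C (1 / (j.factorial : ℂ)) * a p ^ j) :=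
    HasExp.sum _ fun j _ => (h.pow hρ j).const_mul _
  have hR : (fun p => cexp (g p) - ∑ j ∈ range K, (1 / (j.factorial : ℂ)) * g p ^ j)
      =O[l] fun p => ρ p ^ K := by
    obtain ⟨C, hC0, hC⟩ := hg1.exists_nonneg
    refine IsBigO.of_bound (C ^ K * rexp C) ?_
    filter_upwards [hρ, hC.bound] with p hp hCp
    rw [norm_of_nonneg hp.1] at hCp
    have hgC : ‖g p‖ ≤ C := hCp.trans (mul_le_of_le_one_right hC0 hp.2)
    have h1 := Complex.norm_exp_sub_sum_le_norm_mul_exp (g p) K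
    have e1 : ∑ j ∈ range K, (1 / (j.factorial : ℂ)) * g p ^ j =
        ∑ j ∈ range K, g p ^ j / (j.factorial : ℂ) :=
      sum_congr rfl fun j _ => by ring
    rw [e1, norm_of_nonneg (pow_nonneg hp.1 _)]
    calc _ ≤ ‖g p‖ ^ K * rexp ‖g p‖ := h1
      _ ≤ (C * ρ p) ^ K * rexp C := by
          have := mul_nonneg hC0 hp.1
          gcongr
      _ = _ := by rw [mul_pow]; ring
  refine (hR.add (hS K)).congr_left fun p => ?_
  have e2 : ∑ e ∈ range K, coeff e (∑ j ∈ range K,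
      PowerSeries.C (1 / (j.factorial : ℂ)) * a p ^ j) =
      ∑ e ∈ range K, coeff e (formalExp (a p)) := by
    refine sum_congr rfl fun e he => ?_
    rw [mem_range] at he
    simp only [map_sum, coeff_C_mul, formalExp, coeff_mk]
    rw [← sum_range_add_sum_Ico _ (show e + 1 ≤ K by omega),
      sum_eq_zero (s := Ico (e + 1) K), add_zero]
    · refine sum_congr rfl fun j _ => ?_
      simp
    · intro j hj
      rw [mem_Ico] at hj
      have hX : PowerSeries.X ∣ a p := PowerSeries.X_dvd_iff.2 (by
        rw [← PowerSeries.coeff_zero_eq_constantCoeff_apply]; exact h0 p)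
      rw [PowerSeries.X_pow_dvd_iff.1 (pow_dvd_pow_of_dvd hX j) e (by omega), mul_zero]
  rw [e2]; ring

end HasExp

/-! ### Bernoulli expansion of the logarithm of the `q`-Pochhammer symbol -/

/-- The Bernoulli polynomials with complex coefficients. -/
noncomputable def bernC (r : ℕ) : Polynomial ℂ := (Polynomial.bernoulli r).map (algebraMap ℚ ℂ)

theorem natDegree_bernC_le (r : ℕ) : (bernC r).natDegree ≤ r := by
  refine Polynomial.natDegree_map_le.trans (Polynomial.natDegree_le_iff_coeff_eq_zero.2 ?_)
  intro i hi
  rw [Polynomial.coeff_bernoulli, if_neg (by omega)]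

theorem norm_eval_le {p : Polynomial ℂ} {D : ℕ} (hp : p.natDegree ≤ D) {c : ℂ} {X : ℝ}
    (hX : 1 ≤ X) (hc : ‖c‖ ≤ X) :
    ‖p.eval c‖ ≤ (∑ i ∈ range (D + 1), ‖p.coeff i‖) * X ^ D := by
  rw [Polynomial.eval_eq_sum_range' (Nat.lt_succ_of_le hp), sum_mul]
  refine (norm_sum_le _ _).trans (sum_le_sum fun i hi => ?_)
  rw [norm_mul, norm_pow]
  refine mul_le_mul_of_nonneg_left ?_ (norm_nonneg _)
  calc ‖c‖ ^ i ≤ X ^ i := by gcongr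
    _ ≤ X ^ D := pow_le_pow_right₀ hX (by have := Finset.mem_range.1 hi; omega)

theorem sum_bernC_eval (n : ℕ) (c : ℂ) :
    ∑ r ∈ range (n + 1), (bernC r).eval c / (r.factorial * (n + 1 - r).factorial : ℂ) =
      c ^ n / n.factorial := by
  have h := congrArg (fun p : Polynomial ℚ => (p.map (algebraMap ℚ ℂ)).eval c)
    (Polynomial.sum_bernoulli n)
  simp only [Polynomial.map_sum, Polynomial.eval_finsetSum, Polynomial.map_smul,
    Polynomial.eval_smul, Polynomial.map_monomial, Polynomial.eval_monomial, smul_eq_mul] at h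
  have hf : ((n + 1).factorial : ℂ) ≠ 0 := by exact_mod_cast (n + 1).factorial_ne_zero
  have hf' : (n.factorial : ℂ) ≠ 0 := by exact_mod_cast n.factorial_ne_zero
  have hn : (n + 1 : ℂ) ≠ 0 := by exact_mod_cast n.succ_ne_zero
  have e1 : ∀ r ∈ range (n + 1),
      (bernC r).eval c / (r.factorial * (n + 1 - r).factorial : ℂ) =
      ((n + 1).factorial : ℂ)⁻¹ * (algebraMap ℚ ℂ ((n + 1).choose r : ℚ) * (bernC r).eval c) :=
    fun r hr => by
      have hr' : r ≤ n + 1 := by have := Finset.mem_range.1 hr; omega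
      have hch : ((n + 1).choose r : ℂ) * (r.factorial * (n + 1 - r).factorial) =
          (n + 1).factorial := by
        have := Nat.choose_mul_factorial_mul_factorial hr'
        rw [← mul_assoc]; exact_mod_cast this
      have h1 : (r.factorial * (n + 1 - r).factorial : ℂ) ≠ 0 := by
        exact_mod_cast mul_ne_zero r.factorial_ne_zero (n + 1 - r).factorial_ne_zero
      rw [div_eq_iff h1, ← hch]
      have h2 : ((n + 1).choose r : ℂ) ≠ 0 := by exact_mod_cast (Nat.choose_pos hr').ne'
      have h3 : (r.factorial : ℂ) ≠ 0 := by exact_mod_cast r.factorial_ne_zero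
      have h4 : ((n + 1 - r).factorial : ℂ) ≠ 0 := by exact_mod_cast (n + 1 - r).factorial_ne_zero
      simp only [map_natCast]
      field_simp
  rw [sum_congr rfl e1, ← mul_sum]
  have h' : ∑ r ∈ range (n + 1), algebraMap ℚ ℂ ((n + 1).choose r : ℚ) * (bernC r).eval c =
      (n + 1) * c ^ n := by
    have h2 : algebraMap ℚ ℂ (n + 1 : ℚ) = n + 1 := by simp
    rw [h2] at h
    exact h
  rw [h', Nat.factorial_succ]
  push_cast
  field_simp

/-- Remainder of the expansion of `e^{cu} / (e^u - 1)` in Bernoulli polynomials. -/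
theorem exists_norm_bernoulli_remainder_le (R : ℕ) : ∃ C : ℝ, 0 < C ∧ ∀ (c : ℂ) (β u : ℝ), 0 ≤ β →
    ‖c‖ ≤ 1 + β → 0 < u →
    ‖cexp (c * u) / (cexp u - 1) -
      ∑ r ∈ range (R + 1), (bernC r).eval c * (u : ℂ) ^ r / (u * r.factorial)‖ ≤
        C * (1 + β) ^ (R + 1) * u ^ R * (1 + u) * rexp (β * u) := by
  set b : ℕ → ℝ := fun r => ∑ i ∈ range (r + 1), ‖(bernC r).coeff i‖ with hb
  have hb0 : ∀ r, 0 ≤ b r := fun r => sum_nonneg fun _ _ => norm_nonneg _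
  refine ⟨1 + ∑ r ∈ range (R + 1), b r / r.factorial, by
    have : 0 ≤ ∑ r ∈ range (R + 1), b r / r.factorial :=
      sum_nonneg fun r _ => div_nonneg (hb0 r) (by positivity)
    linarith, fun c β u hβ hc hu => ?_⟩
  have huC : (u : ℂ) ≠ 0 := by exact_mod_cast hu.ne'
  set X := 1 + β with hX
  have hX1 : 1 ≤ X := by linarith
  have hexp1 : 1 < rexp u := Real.one_lt_exp_iff.2 hu
  have hexpC : cexp u - 1 ≠ 0 := by
    rw [← ofReal_exp, sub_ne_zero]
    exact_mod_cast hexp1.ne'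
  set E₁ : ℂ := cexp (c * u) - ∑ j ∈ range (R + 1), (c * u) ^ j / j.factorial with hE₁
  set E : ℕ → ℂ := fun r => cexp u - ∑ j ∈ range (R + 2 - r), (u : ℂ) ^ j / j.factorial
    with hE
  have hpoly : ∑ r ∈ range (R + 1), (bernC r).eval c / r.factorial * (u : ℂ) ^ r *
      ∑ j ∈ range (R + 1 - r), (u : ℂ) ^ (j + 1) / (j + 1).factorial =
      u * ∑ j ∈ range (R + 1), (c * u) ^ j / j.factorial := by
    simp_rw [mul_sum]
    rw [sum_sigma']
    have e1 : ∀ n ∈ range (R + 1), (u : ℂ) * ((c * u) ^ n / n.factorial) =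
        ∑ r ∈ range (n + 1), u ^ (n + 1) *
          ((bernC r).eval c / (r.factorial * (n + 1 - r).factorial)) := fun n _ => by
      rw [← mul_sum, sum_bernC_eval, mul_pow]; ring
    rw [sum_congr rfl e1, sum_sigma']
    refine sum_bij' (fun x _ => ⟨x.1 + x.2, x.1⟩) (fun y _ => ⟨y.2, y.1 - y.2⟩) ?_ ?_ ?_ ?_ ?_
    · rintro ⟨r, j⟩ h
      simp only [mem_sigma, mem_range] at h ⊢
      omega
    · rintro ⟨n, r⟩ h
      simp only [mem_sigma, mem_range] at h ⊢
      omega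
    · rintro ⟨r, j⟩ h
      simp
    · rintro ⟨n, r⟩ h
      simp only [mem_sigma, mem_range] at h
      simp only [Sigma.mk.injEq, heq_eq_eq, and_true]
      omega
    · rintro ⟨r, j⟩ h
      simp only
      rw [show r + j + 1 - r = j + 1 by omega, show r + j + 1 = r + (j + 1) by ring, pow_add]
      ring
  have hE' : ∀ r ∈ range (R + 1), cexp u - 1 =
      ∑ j ∈ range (R + 1 - r), (u : ℂ) ^ (j + 1) / (j + 1).factorial + E r := fun r hr => by
    have hr' := Finset.mem_range.1 hr
    simp only [hE]
    rw [show R + 2 - r = (R + 1 - r) + 1 by omega, sum_range_succ']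
    simp only [pow_zero, Nat.factorial_zero, Nat.cast_one, div_one]
    ring
  have hf : u * cexp (c * u) - (cexp u - 1) *
      ∑ r ∈ range (R + 1), (bernC r).eval c / r.factorial * (u : ℂ) ^ r =
      u * E₁ - ∑ r ∈ range (R + 1), (bernC r).eval c / r.factorial * (u : ℂ) ^ r * E r := by
    rw [mul_sum]
    have e2 : ∀ r ∈ range (R + 1), (cexp u - 1) *
        ((bernC r).eval c / r.factorial * (u : ℂ) ^ r) =
        (bernC r).eval c / r.factorial * (u : ℂ) ^ r *
      ∑ j ∈ range (R + 1 - r), (u : ℂ) ^ (j + 1) / (j + 1).factorial +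
        (bernC r).eval c / r.factorial * (u : ℂ) ^ r * E r := fun r hr => by
      rw [hE' r hr]; ring
    rw [sum_congr rfl e2, sum_add_distrib, hpoly, hE₁]
    ring
  have hE₁n : ‖E₁‖ ≤ (X * u) ^ (R + 1) * rexp (X * u) := by
    have h1 := Complex.norm_exp_sub_sum_le_norm_mul_exp (c * u) (R + 1)
    have h2 : ‖c * u‖ ≤ X * u := by
      rw [norm_mul, norm_real, norm_of_nonneg hu.le]; gcongr
    exact h1.trans (by gcongr)
  have hEn : ∀ r ∈ range (R + 1), ‖(u : ℂ) ^ r * E r‖ ≤ u ^ (R + 2) * rexp (X * u) :=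
    fun r hr => by
      have hr' := Finset.mem_range.1 hr
      have h1 := Complex.norm_exp_sub_sum_le_norm_mul_exp (u : ℂ) (R + 2 - r)
      rw [norm_real, norm_of_nonneg hu.le] at h1
      rw [norm_mul, norm_pow, norm_real, norm_of_nonneg hu.le]
      calc u ^ r * ‖E r‖ ≤ u ^ r * (u ^ (R + 2 - r) * rexp u) := by gcongr
        _ = u ^ (R + 2) * rexp u := by
          rw [← mul_assoc, ← pow_add]; congr 2; omega
        _ ≤ _ := by gcongr; nlinarith
  have hnf : ‖u * E₁ - ∑ r ∈ range (R + 1),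
      (bernC r).eval c / r.factorial * (u : ℂ) ^ r * E r‖ ≤
      (1 + ∑ r ∈ range (R + 1), b r / r.factorial) * X ^ (R + 1) * u ^ (R + 2) *
        rexp (X * u) := by
    refine (norm_sub_le _ _).trans ?_
    have h1 : ‖u * E₁‖ ≤ X ^ (R + 1) * u ^ (R + 2) * rexp (X * u) := by
      rw [norm_mul, norm_real, norm_of_nonneg hu.le]
      calc u * ‖E₁‖ ≤ u * ((X * u) ^ (R + 1) * rexp (X * u)) := by gcongr
        _ = _ := by rw [mul_pow]; ring
    have h2 : ‖∑ r ∈ range (R + 1), (bernC r).eval c / r.factorial * (u : ℂ) ^ r * E r‖ ≤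
        (∑ r ∈ range (R + 1), b r / r.factorial) * X ^ (R + 1) * u ^ (R + 2) *
          rexp (X * u) := by
      rw [sum_mul, sum_mul, sum_mul]
      refine (norm_sum_le _ _).trans (sum_le_sum fun r hr => ?_)
      rw [mul_assoc, norm_mul, norm_div, Complex.norm_natCast, mul_assoc (b r / _ * _)]
      have h3 := norm_eval_le (natDegree_bernC_le r) hX1 hc
      have h4 : X ^ r ≤ X ^ (R + 1) :=
        pow_le_pow_right₀ hX1 (by have := Finset.mem_range.1 hr; omega)
      refine mul_le_mul ?_ (hEn r hr) (norm_nonneg _) (mul_nonneg (div_nonneg (hb0 r)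
        (by positivity)) (by positivity))
      rw [div_mul_eq_mul_div]
      refine div_le_div_of_nonneg_right (h3.trans ?_) (by positivity)
      exact mul_le_mul_of_nonneg_left h4 (hb0 r)
    linarith
  have hgoal : cexp (c * u) / (cexp u - 1) -
      ∑ r ∈ range (R + 1), (bernC r).eval c * (u : ℂ) ^ r / (u * r.factorial) =
      (u * E₁ - ∑ r ∈ range (R + 1), (bernC r).eval c / r.factorial * (u : ℂ) ^ r * E r) /
        (u * (cexp u - 1)) := by
    rw [← hf, eq_div_iff (mul_ne_zero huC hexpC), sub_mul, mul_sum, sum_mul]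
    congr 1
    · field_simp
    · refine sum_congr rfl fun r _ => ?_
      have : (r.factorial : ℂ) ≠ 0 := by exact_mod_cast r.factorial_ne_zero
      field_simp
  rw [hgoal, norm_div]
  have hden : ‖(u : ℂ) * (cexp u - 1)‖ = u * (rexp u - 1) := by
    rw [← ofReal_exp, ← ofReal_one, ← ofReal_sub, ← ofReal_mul,
      norm_real, norm_of_nonneg (mul_nonneg hu.le (by linarith))]
  rw [hden, div_le_iff₀ (mul_pos hu (by linarith))]
  refine hnf.trans ?_
  have hkey : u * rexp u ≤ (1 + u) * (rexp u - 1) := by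
    have := add_one_le_exp u
    nlinarith
  have hXe : rexp (X * u) = rexp (β * u) * rexp u := by
    rw [← exp_add]; congr 1; rw [hX]; ring
  rw [hXe]
  set A := (1 + ∑ r ∈ range (R + 1), b r / r.factorial) * X ^ (R + 1) with hA
  have hA0 : 0 ≤ A := by
    have : 0 ≤ ∑ r ∈ range (R + 1), b r / r.factorial :=
      sum_nonneg fun r _ => div_nonneg (hb0 r) (by positivity)
    positivity
  calc A * u ^ (R + 2) * (rexp (β * u) * rexp u)
      = A * u ^ (R + 1) * rexp (β * u) * (u * rexp u) := by ring
    _ ≤ A * u ^ (R + 1) * rexp (β * u) * ((1 + u) * (rexp u - 1)) := by gcongr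
    _ = _ := by ring

/-- The logarithm of `(q ^ (n + 1); q)_∞` for `q = ζ e^{-u/m}`, split over the residues mod `m`. -/
theorem lq_pow_mul_eq_sum {m : ℕ} (hm : 0 < m) {ζ : ℂ} (hζ : IsPrimitiveRoot ζ m) {u : ℝ}
    (hu : 0 < u) {n : ℕ} {ν θ : ℝ} (hθ : rexp (-(n * u / m)) = θ * rexp (-(ν * u / m)))
    {q : ℂ} (hq : q = ζ * rexp (-(u / m))) :
    lq q (q ^ n * q) = ∑' k : ℕ, ∑ t ∈ Icc 1 m,
      (ζ ^ t * (ζ ^ n * θ)) ^ (k + 1) / ((k + 1 : ℕ) : ℂ) *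
        (cexp ((1 - (t + ν) / m) * (u * (k + 1 : ℕ) : ℝ)) /
          (cexp (u * (k + 1 : ℕ) : ℝ) - 1)) := by
  have hmR : (0 : ℝ) < m := by exact_mod_cast hm
  have hmC : (m : ℂ) ≠ 0 := by exact_mod_cast hm.ne'
  have hζn : ‖ζ‖ = 1 := hζ.norm'_eq_one hm.ne'
  have hqn : ‖q‖ < 1 := by
    rw [hq, norm_mul, hζn, one_mul, norm_real, norm_of_nonneg (exp_pos _).le]
    exact Real.exp_lt_one_iff.2 (by rw [neg_lt_zero]; positivity)
  rw [lq]
  refine tsum_congr fun k => ?_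
  set U : ℝ := u * (k + 1 : ℕ) with hU
  have hU0 : 0 < U := by rw [hU]; positivity
  have hk : ((k + 1 : ℕ) : ℂ) ≠ 0 := by exact_mod_cast k.succ_ne_zero
  have hQ : ∀ j : ℕ, (q ^ j) ^ (k + 1) = (ζ ^ j) ^ (k + 1) * cexp (-(j * U / m)) := fun j => by
    rw [hq, mul_pow, mul_pow, ← ofReal_pow, ← ofReal_pow, ← exp_nat_mul,
      ← exp_nat_mul, ofReal_exp]
    congr 2
    rw [hU]; push_cast; ring
  have hQm : (q ^ (k + 1)) ^ m = cexp (-U) := by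
    have := hQ m
    rw [hζ.pow_eq_one, one_pow, one_mul] at this
    rw [pow_right_comm, this]
    congr 1
    field_simp
  have hQ1 : q ^ (k + 1) ≠ 1 := fun h => one_sub_pow_ne_zero hqn k (by rw [h, sub_self])
  have hgeom : (1 - q ^ (k + 1))⁻¹ = (∑ t ∈ range m, (q ^ (k + 1)) ^ t) *
      (1 - cexp (-U))⁻¹ := by
    have h1 := mul_neg_geom_sum (q ^ (k + 1)) m
    rw [hQm] at h1
    have h2 : 1 - q ^ (k + 1) ≠ 0 := sub_ne_zero.2 (Ne.symm hQ1)
    have h3 : 1 - cexp (-U) ≠ 0 := by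
      rw [← ofReal_neg, ← ofReal_exp, sub_ne_zero]
      exact_mod_cast (Real.exp_lt_one_iff.2 (by linarith : -U < 0)).ne'
    rw [← h1] at h3 ⊢
    rw [mul_inv, mul_left_comm, mul_inv_cancel₀ (right_ne_zero_of_mul h3), mul_one]
  have hshift : ∑ t ∈ range m, (q ^ (k + 1)) ^ t * q ^ (k + 1) =
      ∑ t ∈ Icc 1 m, (q ^ t) ^ (k + 1) := by
    rw [← Finset.Ico_succ_right_eq_Icc, sum_Ico_eq_sum_range]
    simp only [Nat.succ_eq_succ, Nat.succ_sub_one]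
    refine sum_congr rfl fun t _ => ?_
    rw [← pow_succ, pow_right_comm, add_comm]
  have hθU : cexp (-(n * U / m)) = (θ : ℂ) ^ (k + 1) * cexp (-(ν * U / m)) := by
    have h1 := congrArg (fun y : ℝ => ((y ^ (k + 1) : ℝ) : ℂ)) hθ
    simp only [mul_pow, ← exp_nat_mul] at h1
    push_cast at h1
    rw [hU]
    refine Eq.trans ?_ (h1.trans ?_)
    · congr 1; push_cast; ring
    · congr 2; push_cast; ring
  have hratio : ∀ t : ℕ, cexp ((1 - (t + ν) / m) * U) / (cexp U - 1) =
      cexp (-(t * U / m)) * cexp (-(ν * U / m)) * (1 - cexp (-U))⁻¹ := fun t => by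
    have h1 : cexp U - 1 = cexp U * (1 - cexp (-U)) := by
      rw [mul_sub, mul_one, ← Complex.exp_add, add_neg_cancel, Complex.exp_zero]
    rw [h1, div_eq_mul_inv, mul_inv, ← mul_assoc, ← Complex.exp_neg, ← Complex.exp_add,
      ← Complex.exp_add]
    congr 2
    ring
  calc (q ^ n * q) ^ (k + 1) / (((k + 1 : ℕ) : ℂ) * (1 - q ^ (k + 1)))
      = (q ^ n) ^ (k + 1) / ((k + 1 : ℕ) : ℂ) *
        (∑ t ∈ range m, (q ^ (k + 1)) ^ t * q ^ (k + 1)) * (1 - cexp (-U))⁻¹ := by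
        rw [mul_pow, div_eq_mul_inv, mul_inv, hgeom, ← sum_mul]; ring
    _ = _ := by
        rw [hshift, mul_sum, sum_mul]
        refine sum_congr rfl fun t _ => ?_
        rw [hratio, hQ n, hQ t, hθU]
        rw [mul_pow, mul_pow]
        ring

set_option maxHeartbeats 400000 in
/-- The Bernoulli expansion of `log (q ^ (n + 1); q)_∞` with remainder. -/
theorem exists_norm_lq_sub_bernoulli_le {m : ℕ} (hm : 0 < m) {ζ : ℂ} (hζ : IsPrimitiveRoot ζ m)
    {θ β : ℝ} (hθ0 : 0 < θ) (hβ : 0 ≤ β) (hθβ : θ * rexp β < 1) (R : ℕ) :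
    ∃ C : ℝ, 0 < C ∧ ∀ (u ν : ℝ) (n : ℕ), 0 < u → u ≤ 1 → |ν| * u ≤ β →
      rexp (-(n * u / m)) = θ * rexp (-(ν * u / m)) → ∀ q : ℂ,
      q = ζ * rexp (-(u / m)) →
      ‖lq q (q ^ n * q) - ∑ r ∈ range (R + 1), ∑ t ∈ Icc 1 m,
        (bernC r).eval (1 - (t + ν) / m : ℂ) * polylog (2 - r : ℤ) (ζ ^ t * (ζ ^ n * θ)) *
          ((u : ℂ) ^ r / (u * r.factorial))‖ ≤ C * (1 + |ν|) ^ (R + 1) * u ^ R := by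
  obtain ⟨C, hC, hrem⟩ := exists_norm_bernoulli_remainder_le R
  have hmR : (1 : ℝ) ≤ m := by exact_mod_cast hm
  have hmC : (m : ℂ) ≠ 0 := by exact_mod_cast hm.ne'
  have hζn : ‖ζ‖ = 1 := hζ.norm'_eq_one hm.ne'
  set x := θ * rexp β with hx
  have hx0 : 0 < x := by positivity
  have hsum : Summable fun k : ℕ => ((k + 1 : ℕ) : ℝ) ^ R * x ^ (k + 1) :=
    (summable_nat_add_iff (f := fun n : ℕ => (n : ℝ) ^ R * x ^ n) 1).2
      (summable_pow_mul_geometric_of_norm_lt_one R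
        (by rw [norm_of_nonneg hx0.le]; exact hθβ))
  set T := ∑' k : ℕ, ((k + 1 : ℕ) : ℝ) ^ R * x ^ (k + 1) with hT
  have hT0 : 0 ≤ T := tsum_nonneg fun k => by positivity
  refine ⟨2 * m * C * (T + 1), by positivity, fun u ν n hu hu1 hνu hθ q hq => ?_⟩
  have huC : (u : ℂ) ≠ 0 := by exact_mod_cast hu.ne'
  have hθ1 : θ < 1 := lt_of_le_of_lt (le_mul_of_one_le_right hθ0.le (Real.one_le_exp hβ)) hθβ
  have hwn : ∀ t : ℕ, ‖ζ ^ t * (ζ ^ n * θ)‖ = θ := fun t => by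
    rw [norm_mul, norm_mul, norm_pow, norm_pow, hζn, one_pow, one_pow, one_mul, one_mul,
      norm_real, norm_of_nonneg hθ0.le]
  have hpl : HasSum (fun k : ℕ => ∑ r ∈ range (R + 1), ∑ t ∈ Icc 1 m,
      (bernC r).eval (1 - (t + ν) / m : ℂ) * ((ζ ^ t * (ζ ^ n * θ)) ^ (k + 1) /
        ((k + 1 : ℕ) : ℂ) ^ (2 - r : ℤ)) * ((u : ℂ) ^ r / (u * r.factorial)))
      (∑ r ∈ range (R + 1), ∑ t ∈ Icc 1 m,
        (bernC r).eval (1 - (t + ν) / m : ℂ) * polylog (2 - r : ℤ) (ζ ^ t * (ζ ^ n * θ)) *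
          ((u : ℂ) ^ r / (u * r.factorial))) := by
    refine hasSum_sum fun r _ => hasSum_sum fun t _ => ?_
    refine (HasSum.mul_left _ ?_).mul_right _
    exact (summable_polylog _ (by rw [hwn]; exact hθ1)).hasSum
  have hqn : ‖q‖ < 1 := by
    rw [hq, norm_mul, hζn, one_mul, norm_real, norm_of_nonneg (exp_pos _).le]
    exact Real.exp_lt_one_iff.2 (by rw [neg_lt_zero]; positivity)
  set f : ℕ → ℂ := fun k => ∑ t ∈ Icc 1 m,
      (ζ ^ t * (ζ ^ n * θ)) ^ (k + 1) / ((k + 1 : ℕ) : ℂ) *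
        (cexp ((1 - (t + ν) / m) * (u * (k + 1 : ℕ) : ℝ)) /
          (cexp (u * (k + 1 : ℕ) : ℝ) - 1)) with hf
  set g : ℕ → ℂ := fun k => ∑ r ∈ range (R + 1), ∑ t ∈ Icc 1 m,
      (bernC r).eval (1 - (t + ν) / m : ℂ) * ((ζ ^ t * (ζ ^ n * θ)) ^ (k + 1) /
        ((k + 1 : ℕ) : ℂ) ^ (2 - r : ℤ)) * ((u : ℂ) ^ r / (u * r.factorial)) with hg
  have hterm : ∀ k : ℕ, ‖f k - g k‖ ≤
      2 * m * C * (1 + |ν|) ^ (R + 1) * u ^ R * (((k + 1 : ℕ) : ℝ) ^ R * x ^ (k + 1)) := fun k => by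
    set U : ℝ := u * (k + 1 : ℕ) with hU
    have hkR : (1 : ℝ) ≤ ((k + 1 : ℕ) : ℝ) := by push_cast; linarith [k.cast_nonneg (α := ℝ)]
    have hkC : ((k + 1 : ℕ) : ℂ) ≠ 0 := by exact_mod_cast k.succ_ne_zero
    have hU0 : 0 < U := by rw [hU]; positivity
    have e1 : f k - g k = ∑ t ∈ Icc 1 m, (ζ ^ t * (ζ ^ n * θ)) ^ (k + 1) /
        ((k + 1 : ℕ) : ℂ) * (cexp ((1 - (t + ν) / m) * U) / (cexp U - 1) -
          ∑ r ∈ range (R + 1), (bernC r).eval (1 - (t + ν) / m : ℂ) * (U : ℂ) ^ r /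
            (U * r.factorial)) := by
      simp only [hf, hg]
      rw [sum_comm, ← sum_sub_distrib]
      refine sum_congr rfl fun t _ => ?_
      rw [mul_sub]
      congr 1
      rw [mul_sum]
      refine sum_congr rfl fun r _ => ?_
      have hr' : (r.factorial : ℂ) ≠ 0 := by exact_mod_cast r.factorial_ne_zero
      rw [hU, zpow_sub₀ hkC, zpow_natCast, zpow_ofNat, ofReal_mul, ofReal_natCast]
      generalize (bernC r).eval _ = b
      generalize (ζ ^ t * (ζ ^ n * θ)) ^ (k + 1) = y
      generalize ((k + 1 : ℕ) : ℂ) = κ at hkC ⊢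
      rw [mul_pow]
      field_simp
    rw [e1]
    refine (norm_sum_le _ _).trans ?_
    have hone : ∀ t ∈ Icc 1 m, ‖(ζ ^ t * (ζ ^ n * θ)) ^ (k + 1) /
        ((k + 1 : ℕ) : ℂ) * (cexp ((1 - (t + ν) / m) * U) / (cexp U - 1) -
          ∑ r ∈ range (R + 1), (bernC r).eval (1 - (t + ν) / m : ℂ) * (U : ℂ) ^ r /
            (U * r.factorial))‖ ≤
        2 * C * (1 + |ν|) ^ (R + 1) * u ^ R * (((k + 1 : ℕ) : ℝ) ^ R * x ^ (k + 1)) :=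
      fun t ht => by
        rw [Finset.mem_Icc] at ht
        have htm : (t : ℝ) ≤ m := by exact_mod_cast ht.2
        have hc : ‖(1 - (t + ν) / m : ℂ)‖ ≤ 1 + |ν| := by
          have : (1 - (t + ν) / m : ℂ) = ((1 - t / m - ν / m : ℝ) : ℂ) := by push_cast; ring
          rw [this, norm_real, norm_eq_abs]
          refine (abs_sub _ _).trans (add_le_add ?_ ?_)
          · have h1 : (t / m : ℝ) ≤ 1 := (div_le_one (by linarith)).2 htm
            have h2 : (0 : ℝ) ≤ t / m := by positivity
            rw [abs_le]; constructor <;> linarith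
          · rw [abs_div, abs_of_pos (by linarith : (0 : ℝ) < m)]
            exact div_le_self (abs_nonneg _) hmR
        have h1 := hrem _ |ν| U (abs_nonneg _) hc hU0
        rw [norm_mul, norm_div, norm_pow, hwn, Complex.norm_natCast]
        have h2 : rexp (|ν| * U) ≤ rexp β ^ (k + 1) := by
          rw [← exp_nat_mul]
          refine Real.exp_le_exp.2 ?_
          rw [hU, ← mul_assoc, mul_comm]
          gcongr
        have h3 : (1 + U) / ((k + 1 : ℕ) : ℝ) ≤ 2 := by
          rw [div_le_iff₀ (by linarith), hU]
          nlinarith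
        calc θ ^ (k + 1) / ((k + 1 : ℕ) : ℝ) * _
            ≤ θ ^ (k + 1) / ((k + 1 : ℕ) : ℝ) *
              (C * (1 + |ν|) ^ (R + 1) * U ^ R * (1 + U) * rexp (|ν| * U)) := by gcongr
          _ ≤ θ ^ (k + 1) / ((k + 1 : ℕ) : ℝ) *
              (C * (1 + |ν|) ^ (R + 1) * U ^ R * (1 + U) * rexp β ^ (k + 1)) := by gcongr
          _ = C * (1 + |ν|) ^ (R + 1) * U ^ R * x ^ (k + 1) * ((1 + U) / ((k + 1 : ℕ) : ℝ)) := by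
              rw [hx, mul_pow]; ring
          _ ≤ C * (1 + |ν|) ^ (R + 1) * U ^ R * x ^ (k + 1) * 2 := by gcongr
          _ = _ := by rw [hU, mul_pow]; ring
    refine (sum_le_sum hone).trans (le_of_eq ?_)
    rw [sum_const, Nat.card_Icc, Nat.add_sub_cancel, nsmul_eq_mul]
    ring
  have hdsum : Summable fun k => f k - g k :=
    Summable.of_norm_bounded (hsum.mul_left _) hterm
  have hfsum : HasSum f (∑' k, f k) := by
    have : Summable f := (hdsum.add hpl.summable).congr fun k => by simp [hg]
    exact this.hasSum
  rw [lq_pow_mul_eq_sum hm hζ hu hθ hq]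
  have hd := hfsum.sub hpl
  rw [← hd.tsum_eq]
  refine (tsum_of_norm_bounded (hsum.hasSum.mul_left _) hterm).trans ?_
  rw [← hT]
  calc 2 * m * C * (1 + |ν|) ^ (R + 1) * u ^ R * T
      ≤ 2 * m * C * (1 + |ν|) ^ (R + 1) * u ^ R * (T + 1) := by gcongr; linarith
    _ = _ := by ring

/-! ### Specialization of the formal integrand -/

/-- Specialization of a power series in `s` over `ℂ[x₁, …, x_N]` at real numbers. The variable of
the resulting power series only records the degree. -/
noncomputable def spec {N : ℕ} (s : ℝ) (x : Fin N → ℝ) :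
    PowerSeries (MvPolynomial (Fin N) ℂ) →+* PowerSeries ℂ :=
  (PowerSeries.rescale (s : ℂ)).comp (PowerSeries.map (MvPolynomial.eval fun i => (x i : ℂ)))

theorem coeff_spec {N : ℕ} (s : ℝ) (x : Fin N → ℝ) (F : PowerSeries (MvPolynomial (Fin N) ℂ))
    (e : ℕ) : coeff e (spec s x F) =
      (s : ℂ) ^ e * MvPolynomial.eval (fun i => (x i : ℂ)) (coeff e F) := by
  simp [spec, PowerSeries.coeff_rescale]

theorem spec_formalExp {N : ℕ} (s : ℝ) (x : Fin N → ℝ)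
    (F : PowerSeries (MvPolynomial (Fin N) ℂ)) : spec s x (formalExp F) = formalExp (spec s x F) := by
  ext e
  rw [coeff_spec]
  simp only [formalExp, coeff_mk, map_sum, map_mul, mul_sum]
  refine sum_congr rfl fun j _ => ?_
  rw [← map_pow, coeff_spec]
  have : (MvPolynomial.eval fun i => (x i : ℂ))
      (algebraMap ℚ (MvPolynomial (Fin N) ℂ) (1 / j.factorial)) =
      algebraMap ℚ ℂ (1 / j.factorial) := by
    rw [IsScalarTower.algebraMap_apply ℚ ℂ (MvPolynomial (Fin N) ℂ), MvPolynomial.algebraMap_eq,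
      MvPolynomial.eval_C]
  rw [this]; ring

theorem coeff_zero_formalExp_arg_of_rescale {N : ℕ} {F : PowerSeries (Polynomial ℂ)}
    (h0 : coeff 0 F = 0) (h1 : (coeff 1 F).natDegree ≤ 1) (d : ℕ)
    (i : Fin N) : coeff 0 (rescale F d i) = 0 := by
  simp only [rescale, coeff_mk, zero_add, sum_range_succ, sum_range_zero]
  rw [h0, Polynomial.coeff_eq_zero_of_natDegree_lt (p := coeff 1 F) (by omega)]
  simp

/-- The part of `rescale F d i` that comes from the term of degree `n` of `F`. -/
noncomputable def monoPart (F : PowerSeries (Polynomial ℂ)) (d n : ℕ) (s X : ℝ) : PowerSeries ℂ :=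
  PowerSeries.mk fun e => if e ≤ 2 * n then
    (coeff n F).coeff (2 * n - e) * (d : ℂ) ^ n * (X : ℂ) ^ (2 * n - e) * (s : ℂ) ^ e
  else 0

theorem hasExp_monoPart {α : Type*} {l : Filter α} {ρ s X : α → ℝ}
    (hρ : ∀ᶠ p in l, 0 ≤ ρ p ∧ ρ p ≤ 1)
    (hs : ∀ᶠ p in l, 0 < s p ∧ s p * (1 + |X p|) ^ 3 ≤ ρ p) {F : PowerSeries (Polynomial ℂ)}
    (hdeg : ∀ n, (coeff n F).natDegree ≤ n + 1)
    (h1 : (coeff 1 F).natDegree ≤ 1) (d : ℕ) {n : ℕ} (hn : 1 ≤ n) :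
    HasExp l ρ (fun p => (coeff n F).eval (X p / s p : ℂ) * (d * s p ^ 2 : ℂ) ^ n)
      fun p => monoPart F d n (s p) (X p) := by
  refine HasExp.of_eq_sum hρ (fun e => ?_) (2 * n + 1) (fun p e he => ?_) ?_
  · simp only [monoPart, coeff_mk]
    by_cases he : e ≤ 2 * n
    · simp only [if_pos he]
      by_cases hc : (coeff n F).coeff (2 * n - e) = 0
      · simp only [hc, zero_mul]; exact isBigO_zero _ _
      have hj : 2 * n - e ≤ 3 * e := by
        have h2 := (Polynomial.le_natDegree_of_ne_zero hc).trans (hdeg n)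
        rcases Nat.eq_or_lt_of_le hn with h | h
        · subst h
          have h3 := (Polynomial.le_natDegree_of_ne_zero hc).trans h1
          omega
        · omega
      refine IsBigO.of_bound (‖(coeff n F).coeff (2 * n - e) * (d : ℂ) ^ n‖) ?_
      filter_upwards [hs, hρ] with p hp hp'
      rw [mul_assoc, norm_mul]
      refine mul_le_mul_of_nonneg_left ?_ (norm_nonneg _)
      rw [norm_mul, norm_pow, norm_pow, norm_real, norm_real,
        norm_of_nonneg hp.1.le, norm_of_nonneg (pow_nonneg hp'.1 _), norm_eq_abs]
      calc |X p| ^ (2 * n - e) * s p ^ e ≤ (1 + |X p|) ^ (2 * n - e) * s p ^ e := by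
            have := hp.1.le
            gcongr
            linarith
        _ ≤ (1 + |X p|) ^ (3 * e) * s p ^ e := by
            have := hp.1.le
            gcongr
            linarith [abs_nonneg (X p)]
        _ = (s p * (1 + |X p|) ^ 3) ^ e := by rw [mul_pow, pow_mul]; ring
        _ ≤ ρ p ^ e := by
            have := hp.1.le
            gcongr
            exact hp.2
    · simp only [if_neg he]; exact isBigO_zero _ _
  · simp only [monoPart, coeff_mk]
    rw [if_neg (by omega)]
  · filter_upwards [hs] with p hp
    have hs0 : (s p : ℂ) ≠ 0 := by exact_mod_cast hp.1.ne'
    rw [Polynomial.eval_eq_sum_range' (n := 2 * n + 1) (by have := hdeg n; omega), sum_mul,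
      ← Finset.sum_range_reflect]
    refine sum_congr rfl fun e he => ?_
    have he' := Finset.mem_range.1 he
    simp only [monoPart, coeff_mk]
    rw [if_pos (by omega), show 2 * n + 1 - 1 - e = 2 * n - e by omega, div_pow, mul_pow, ← pow_mul]
    have : (s p : ℂ) ^ (2 * n) = (s p : ℂ) ^ (2 * n - e) * (s p : ℂ) ^ e := by
      rw [← pow_add]; congr 1; omega
    rw [this]
    field_simp

theorem hasExp_rescale {N : ℕ} {α : Type*} {l : Filter α} {ρ s : α → ℝ} {x : α → Fin N → ℝ}
    (i : Fin N) (hρ : ∀ᶠ p in l, 0 ≤ ρ p ∧ ρ p ≤ 1)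
    (hs : ∀ᶠ p in l, 0 < s p ∧ s p * (1 + |x p i|) ^ 3 ≤ ρ p) {F : PowerSeries (Polynomial ℂ)}
    (h0 : coeff 0 F = 0) (hdeg : ∀ n, (coeff n F).natDegree ≤ n + 1)
    (h1 : (coeff 1 F).natDegree ≤ 1) (d : ℕ) {g : α → ℂ}
    (hg : ∀ K : ℕ, (fun p => g p - ∑ n ∈ range (K + 2),
      (coeff n F).eval (x p i / s p : ℂ) * (d * s p ^ 2 : ℂ) ^ n) =O[l]
        fun p => ρ p ^ K) :
    HasExp l ρ g fun p => spec (s p) (x p) (rescale F d i) := by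
  intro K
  have hsum : HasExp l ρ (fun p => ∑ n ∈ range (K + 2),
      (coeff n F).eval (x p i / s p : ℂ) * (d * s p ^ 2 : ℂ) ^ n)
      fun p => ∑ n ∈ range (K + 2), monoPart F d n (s p) (x p i) := by
    refine HasExp.sum _ fun n _ => ?_
    rcases Nat.eq_zero_or_pos n with hn | hn
    · subst hn
      simp only [h0, Polynomial.eval_zero, zero_mul]
      have : ∀ p, monoPart F d 0 (s p) (x p i) = 0 := fun p => by
        ext e
        simp [monoPart, h0]
      simp only [this]
      exact HasExp.zero
    · exact hasExp_monoPart hρ hs hdeg h1 d hn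
  refine ((hg K).add (hsum K)).congr_left fun p => ?_
  have : ∀ e ∈ range K, coeff e (∑ n ∈ range (K + 2),
      monoPart F d n (s p) (x p i)) = coeff e (spec (s p) (x p) (rescale F d i)) := by
    intro e he
    have he' := Finset.mem_range.1 he
    rw [coeff_spec]
    simp only [map_sum, monoPart, coeff_mk, rescale]
    rw [mul_sum, ← sum_range_add_sum_Ico _ (show e + 2 ≤ K + 2 by omega),
      sum_eq_zero (s := Ico (e + 2) (K + 2)), add_zero]
    · refine sum_congr rfl fun n _ => ?_
      split_ifs with h
      · simp; ring
      · simp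
    · intro n hn
      rw [mem_Ico] at hn
      rw [if_pos (by omega), Polynomial.coeff_eq_zero_of_natDegree_lt
        (lt_of_le_of_lt (hdeg n) (by omega))]
      simp
  rw [sum_congr rfl this]; ring

/-! ### The series `ψ` -/

theorem natDegree_linear_le (m t : ℕ) :
    (1 - Polynomial.C (1 / m : ℂ) * (Polynomial.C (t : ℂ) + Polynomial.X)).natDegree ≤ 1 := by
  have : (1 - Polynomial.C (1 / m : ℂ) * (Polynomial.C (t : ℂ) + Polynomial.X) : Polynomial ℂ) =
      Polynomial.C (-(1 / m : ℂ)) * Polynomial.X + Polynomial.C (1 - 1 / m * t : ℂ) := by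
    simp only [map_sub, map_neg, map_mul, Polynomial.C_1]; ring
  rw [this]
  exact Polynomial.natDegree_linear_le

theorem bernC_two : bernC 2 = Polynomial.X ^ 2 - Polynomial.X + Polynomial.C (1 / 6) := by
  have : Polynomial.bernoulli 2 =
      Polynomial.X ^ 2 - Polynomial.X + Polynomial.C (1 / 6 : ℚ) := by
    simp only [Polynomial.bernoulli, sum_range_succ, sum_range_zero]
    simp only [bernoulli_zero, bernoulli_one, bernoulli_two, Nat.choose, ← Polynomial.C_mul_X_pow_eq_monomial]
    norm_num
    ring
  rw [bernC, this]
  simp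

theorem natDegree_psiCoeff_le (m : ℕ) (w ζ : ℂ) (r : ℕ) : (psiCoeff m w ζ r).natDegree ≤ r := by
  rw [psiCoeff, Polynomial.natDegree_neg]
  refine Polynomial.natDegree_sum_le_of_forall_le _ _ fun t _ => ?_
  refine (Polynomial.natDegree_mul_C_le _ _).trans ?_
  refine (Polynomial.natDegree_sub_le _ _).trans (max_le ?_ ?_)
  · refine Polynomial.natDegree_comp_le.trans ?_
    calc _ ≤ r * 1 := Nat.mul_le_mul (natDegree_bernC_le r) (natDegree_linear_le m t)
      _ = r := mul_one r
  · split_ifs with h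
    · subst h
      exact (Polynomial.natDegree_C_mul_le _ _).trans (Polynomial.natDegree_X_pow_le 2)
    · simp

theorem natDegree_psiCoeff_two_le (m : ℕ) (w ζ : ℂ) : (psiCoeff m w ζ 2).natDegree ≤ 1 := by
  rw [psiCoeff, Polynomial.natDegree_neg]
  refine Polynomial.natDegree_sum_le_of_forall_le _ _ fun t _ => ?_
  refine (Polynomial.natDegree_mul_C_le _ _).trans ?_
  have : ((Polynomial.bernoulli 2).map (algebraMap ℚ ℂ)).comp
      (1 - Polynomial.C (1 / m : ℂ) * (Polynomial.C (t : ℂ) + Polynomial.X)) -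
      (if (2 : ℕ) = 2 then Polynomial.C (1 / m ^ 2 : ℂ) * Polynomial.X ^ 2 else 0) =
      Polynomial.C (2 * t / m ^ 2 - 1 / m : ℂ) * Polynomial.X +
        Polynomial.C ((1 - t / m) ^ 2 - (1 - t / m) + 1 / 6 : ℂ) := by
    have h := bernC_two
    rw [bernC] at h
    rw [h, if_pos rfl]
    refine Polynomial.funext fun x => ?_
    simp only [Polynomial.eval_sub, Polynomial.eval_add, Polynomial.eval_comp, Polynomial.eval_pow,
      Polynomial.eval_X, Polynomial.eval_mul, Polynomial.eval_C, Polynomial.eval_one]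
    ring
  rw [this]
  exact Polynomial.natDegree_linear_le

theorem eval_psiCoeff (m : ℕ) (w ζ ν : ℂ) (r : ℕ) : (psiCoeff m w ζ r).eval ν =
    -∑ t ∈ Icc 1 m, ((bernC r).eval (1 - (t + ν) / m) -
      if r = 2 then ν ^ 2 / m ^ 2 else 0) * (polylog (2 - r : ℤ) (ζ ^ t * w) / r.factorial) := by
  simp only [psiCoeff, Polynomial.eval_neg, Polynomial.eval_finsetSum, Polynomial.eval_mul,
    Polynomial.eval_sub, Polynomial.eval_comp, Polynomial.eval_C, bernC]
  congr 1
  refine sum_congr rfl fun t _ => ?_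
  congr 2
  · congr 1
    simp; ring
  · split_ifs
    · simp; ring
    · simp

/-! ### Expansion of the logarithm of a Pochhammer symbol near the saddle point -/

theorem coeff_psi (m : ℕ) (w ζ : ℂ) (n : ℕ) : coeff n (psi m w ζ) =
    if n = 0 then 0 else psiCoeff m w ζ (n + 1) := by
  simp [psi]

theorem bernC_zero : bernC 0 = 1 := by simp [bernC]

theorem bernC_one : bernC 1 = Polynomial.X - Polynomial.C (1 / 2) := by
  simp [bernC, Polynomial.bernoulli_one]

/-- The terms of degree `-1`, `0` and the quadratic part of the term of degree `1`, in closed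
form. -/
theorem sum_bernoulli_eq {m : ℕ} (hm : 0 < m) {ζ : ℂ} (hζ : IsPrimitiveRoot ζ m) {z : ℝ}
    (hz0 : 0 < z) (hz1 : z < 1) {w : ℂ} (hw : w ^ m = z) (hw1 : ‖w‖ < 1) (ν u : ℂ) (hu : u ≠ 0)
    (K : ℕ) :
    ∑ r ∈ range (K + 3), ∑ t ∈ Icc 1 m,
        (bernC r).eval (1 - (t + ν) / m : ℂ) * polylog (2 - r : ℤ) (ζ ^ t * w) *
          (u ^ r / (u * r.factorial)) =
      polylog 2 (z : ℂ) / (m * u) - (1 / 2 - ν / m) * log (1 - z) +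
        (∑ t ∈ Icc 1 m, (t : ℂ) * Complex.log (1 - ζ ^ t * w)) / m +
        ν ^ 2 * u * z / (2 * m * (1 - z)) -
        ∑ n ∈ range (K + 2), (coeff n (psi m w ζ)).eval ν * u ^ n := by
  have hmC : (m : ℂ) ≠ 0 := by exact_mod_cast hm.ne'
  have hζ1 : ‖ζ‖ = 1 := hζ.norm'_eq_one hm.ne'
  have hz1' : ‖(z : ℂ)‖ < 1 := by rwa [norm_real, norm_of_nonneg hz0.le]
  have hzC : (1 - z : ℂ) ≠ 0 := by
    rw [← ofReal_one, ← ofReal_sub]; exact_mod_cast (sub_pos.2 hz1).ne'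
  have hlt : ∀ t : ℕ, ‖ζ ^ t * w‖ < 1 := fun t => by
    rw [norm_mul, norm_pow, hζ1, one_pow, one_mul]; exact hw1
  have hL2 := sum_polylog_rootsOfUnity hm hζ 2 hw1
  have hL1 := sum_polylog_rootsOfUnity hm hζ 1 hw1
  have hL0 := sum_polylog_rootsOfUnity hm hζ 0 hw1
  rw [hw] at hL2 hL1 hL0
  rw [polylog_one hz1'] at hL1
  rw [polylog_zero hz1'] at hL0
  have hlog : Complex.log (1 - z) = (log (1 - z) : ℝ) := by
    rw [ofReal_log (sub_pos.2 hz1).le]; push_cast; rfl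
  rw [hlog] at hL1
  rw [sum_range_succ' _ (K + 2), sum_range_succ' _ (K + 1),
    sum_range_succ' _ K, sum_range_succ' _ (K + 1), sum_range_succ' _ K]
  have h0 : ∑ t ∈ Icc 1 m, (bernC 0).eval (1 - (t + ν) / m : ℂ) *
      polylog (2 - (0 : ℕ) : ℤ) (ζ ^ t * w) * (u ^ 0 / (u * (Nat.factorial 0 : ℕ))) =
      polylog 2 (z : ℂ) / (m * u) := by
    simp only [bernC_zero, Polynomial.eval_one, one_mul, Nat.cast_zero, sub_zero, pow_zero,
      Nat.factorial_zero, Nat.cast_one, mul_one]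
    rw [← sum_mul, hL2]
    norm_num
    field_simp
  have h1 : ∑ t ∈ Icc 1 m, (bernC (0 + 1)).eval (1 - (t + ν) / m : ℂ) *
      polylog (2 - ((0 + 1 : ℕ) : ℕ) : ℤ) (ζ ^ t * w) *
        (u ^ (0 + 1) / (u * (Nat.factorial (0 + 1) : ℕ))) =
      - (1 / 2 - ν / m) * log (1 - z) +
        (∑ t ∈ Icc 1 m, (t : ℂ) * Complex.log (1 - ζ ^ t * w)) / m := by
    have e : ∀ t ∈ Icc 1 m, (bernC (0 + 1)).eval (1 - (t + ν) / m : ℂ) *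
        polylog (2 - ((0 + 1 : ℕ) : ℕ) : ℤ) (ζ ^ t * w) *
        (u ^ (0 + 1) / (u * (Nat.factorial (0 + 1) : ℕ))) =
        (1 / 2 - ν / m) * polylog 1 (ζ ^ t * w) + t * Complex.log (1 - ζ ^ t * w) / m := by
      intro t _
      have : (2 - ((0 + 1 : ℕ) : ℤ)) = 1 := by norm_num
      rw [this, zero_add, bernC_one, polylog_one (hlt t)]
      simp
      field_simp
      ring
    rw [sum_congr rfl e, sum_add_distrib, ← mul_sum, ← sum_div, hL1]
    norm_num
    ring
  have h2 : ∑ t ∈ Icc 1 m, (bernC (0 + 1 + 1)).eval (1 - (t + ν) / m : ℂ) *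
      polylog (2 - ((0 + 1 + 1 : ℕ) : ℕ) : ℤ) (ζ ^ t * w) *
        (u ^ (0 + 1 + 1) / (u * (Nat.factorial (0 + 1 + 1) : ℕ))) =
      ν ^ 2 * u * z / (2 * m * (1 - z)) -
        (coeff (0 + 1) (psi m w ζ)).eval ν * u ^ (0 + 1) := by
    have e : (2 - ((0 + 1 + 1 : ℕ) : ℤ)) = 0 := by norm_num
    have e' : (2 - ((1 + 1 : ℕ) : ℤ)) = 0 := by norm_num
    rw [coeff_psi, zero_add, if_neg one_ne_zero, eval_psiCoeff]
    simp only [e']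
    have : ν ^ 2 * u * z / (2 * m * (1 - z)) = ∑ t ∈ Icc 1 m,
        ν ^ 2 / m ^ 2 * polylog 0 (ζ ^ t * w) * (u / 2) := by
      rw [← sum_mul, ← mul_sum, hL0]
      norm_num
      field_simp
    rw [this, neg_mul, sub_neg_eq_add, sum_mul, ← sum_add_distrib]
    refine sum_congr rfl fun t _ => ?_
    simp only [Nat.factorial]
    push_cast
    field_simp
    ring
  have h3 : ∀ r ∈ range K, ∑ t ∈ Icc 1 m,
      (bernC (r + 1 + 1 + 1)).eval (1 - (t + ν) / m : ℂ) *
      polylog (2 - ((r + 1 + 1 + 1 : ℕ) : ℕ) : ℤ) (ζ ^ t * w) *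
        (u ^ (r + 1 + 1 + 1) / (u * (Nat.factorial (r + 1 + 1 + 1) : ℕ))) =
      -((coeff (r + 1 + 1) (psi m w ζ)).eval ν * u ^ (r + 1 + 1)) := by
    intro r _
    rw [coeff_psi, if_neg (by omega), eval_psiCoeff, neg_mul, neg_neg, sum_mul]
    refine sum_congr rfl fun t _ => ?_
    rw [if_neg (by omega), sub_zero, pow_succ u (r + 1 + 1)]
    have : ((r + 1 + 1 + 1).factorial : ℂ) ≠ 0 := by exact_mod_cast Nat.factorial_ne_zero _
    field_simp
  rw [sum_congr rfl h3, h2, h1, h0, sum_neg_distrib]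
  simp only [coeff_psi  m w ζ 0, if_true, Polynomial.eval_zero, zero_mul]
  ring

/-- The error in the approximation of `-lq q (q ^ (n + 1))` at `q = ζ exp(-d s² / m)` by its Taylor
polynomial of degree two about the saddle point, where `n = k` modulo `m`. -/
noncomputable def psiRem (m d k : ℕ) (ζ : ℂ) (z s x : ℝ) (n : ℕ) : ℂ :=
  -lq (ζ * rexp (-(d * s ^ 2 / m)))
      ((ζ * rexp (-(d * s ^ 2 / m))) ^ n * (ζ * rexp (-(d * s ^ 2 / m)))) +
    (polylog 2 (z : ℂ) / (m * (d * s ^ 2)) - (1 / 2 - x / s / m) * log (1 - z) +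
      (∑ t ∈ Icc 1 m, (t : ℂ) *
        Complex.log (1 - ζ ^ t * (ζ ^ k * ((z ^ (1 / m : ℝ) : ℝ) : ℂ)))) / m +
      x ^ 2 * (d * z) / (2 * m * (1 - z)))

theorem hasExp_psi {N : ℕ} {α : Type*} {l : Filter α} {ρ s : α → ℝ} {x : α → Fin N → ℝ}
    {n : α → ℕ} (i : Fin N) {m : ℕ} (hm : 0 < m) {ζ : ℂ} (hζ : IsPrimitiveRoot ζ m) {d k : ℕ}
    (hd : 0 < d) {z y : ℝ} (hy : 0 < y) (hz : z = rexp (-(d * y)))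
    (hρ : ∀ᶠ p in l, 0 ≤ ρ p ∧ ρ p ≤ 1 ∧ d * ρ p ≤ 1 ∧ ρ p ≤ y / (2 * m))
    (hs : ∀ᶠ p in l, 0 < s p ∧ s p * (1 + |x p i|) ^ 3 ≤ ρ p)
    (hn : ∀ᶠ p in l, n p % m = k % m ∧ s p * n p = x p i + y / s p) :
    HasExp l ρ (fun p => psiRem m d k ζ z (s p) (x p i) (n p))
      fun p => spec (s p) (x p) (rescale (psi m (ζ ^ k * ((z ^ (1 / m : ℝ) : ℝ) : ℂ)) ζ) d i) := by
  have hmR : (0 : ℝ) < m := by exact_mod_cast hm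
  have hdR : (1 : ℝ) ≤ d := by exact_mod_cast hd
  have hz0 : 0 < z := hz ▸ exp_pos _
  have hz1 : z < 1 := by
    rw [hz, exp_lt_one_iff]
    have : 0 < d * y := by positivity
    linarith
  set θ : ℝ := z ^ (1 / m : ℝ) with hθ
  have hθe : θ = rexp (-(d * y / m)) := by
    rw [hθ, hz, ← Real.exp_mul]; congr 1; ring
  have hθ0 : 0 < θ := hθe ▸ exp_pos _
  have hθ1 : θ < 1 := Real.rpow_lt_one hz0.le hz1 (by positivity)
  have hθm : θ ^ m = z := by
    rw [hθ, one_div, Real.rpow_inv_natCast_pow hz0.le hm.ne']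
  have hζ1 : ‖ζ‖ = 1 := hζ.norm'_eq_one hm.ne'
  have hw1 : ‖ζ ^ k * (θ : ℂ)‖ < 1 := by
    rw [norm_mul, norm_pow, hζ1, one_pow, one_mul, norm_real, norm_of_nonneg hθ0.le]
    exact hθ1
  have hw : (ζ ^ k * (θ : ℂ)) ^ m = z := by
    rw [mul_pow, ← pow_mul, mul_comm k, pow_mul, hζ.pow_eq_one, one_pow, one_mul,
      ← ofReal_pow, hθm]
  set β : ℝ := d * y / (2 * m) with hβ
  have hθβ : θ * rexp β < 1 := by
    rw [hθe, ← exp_add, exp_lt_one_iff, hβ]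
    have : 0 < d * y / (2 * m) := by positivity
    have e : d * y / m = 2 * (d * y / (2 * m)) := by field_simp
    linarith
  refine hasExp_rescale i (hρ.mono fun p hp => ⟨hp.1, hp.2.1⟩) hs (by simp [coeff_psi])
    (fun n => ?_) ?_ d fun K => ?_
  · rw [coeff_psi]
    split_ifs
    · simp
    · exact natDegree_psiCoeff_le _ _ _ _
  · rw [coeff_psi, if_neg one_ne_zero]
    exact natDegree_psiCoeff_two_le _ _ _
  · obtain ⟨C, hC, hrem⟩ := exists_norm_lq_sub_bernoulli_le hm hζ hθ0
      (show 0 ≤ β by positivity) hθβ (K + 2)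
    refine IsBigO.of_bound (C * d ^ (K + 2)) ?_
    filter_upwards [hρ, hs, hn] with p ⟨hp0, hp1, hp2, hp3⟩ ⟨hs0, hsx⟩ ⟨hnk, hnx⟩
    have hx1 : 1 ≤ 1 + |x p i| := by linarith [abs_nonneg (x p i)]
    have hsx' : s p * (1 + |x p i|) ≤ ρ p := by
      refine le_trans ?_ hsx
      exact mul_le_mul_of_nonneg_left (le_self_pow₀ hx1 (by norm_num)) hs0.le
    have hsρ : s p ≤ ρ p := (le_mul_of_one_le_right hs0.le hx1).trans hsx'
    have hs1 : s p ≤ 1 := hsρ.trans hp1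
    have hu0 : 0 < d * s p ^ 2 := by positivity
    have hu1 : d * s p ^ 2 ≤ 1 := by
      calc d * s p ^ 2 ≤ d * s p := by
            refine mul_le_mul_of_nonneg_left ?_ (by positivity)
            nlinarith
        _ ≤ d * ρ p := by gcongr
        _ ≤ 1 := hp2
    have hνu : |x p i / s p| * (d * s p ^ 2) ≤ β := by
      rw [abs_div, abs_of_pos hs0, hβ]
      calc |x p i| / s p * (d * s p ^ 2) = d * (s p * |x p i|) := by field_simp
        _ ≤ d * (y / (2 * m)) := by
            have : s p * |x p i| ≤ s p * (1 + |x p i|) := by nlinarith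
            have := this.trans (hsx'.trans hp3)
            gcongr
        _ = _ := by ring
    have hexp : rexp (-(n p * (d * s p ^ 2) / m)) =
        θ * rexp (-(x p i / s p * (d * s p ^ 2) / m)) := by
      rw [hθe, ← exp_add]
      congr 1
      have : (n p : ℝ) * (d * s p ^ 2) = d * s p * (s p * n p) := by ring
      rw [this, hnx]
      field_simp
      ring
    have h := hrem (d * s p ^ 2) (x p i / s p) (n p) hu0 hu1 hνu hexp _ rfl
    have hζn : ζ ^ n p = ζ ^ k := by
      rw [← pow_mod_orderOf ζ (n p), ← pow_mod_orderOf ζ k, ← hζ.eq_orderOf, hnk]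
    rw [hζn] at h
    have hu0' : ((d * s p ^ 2 : ℝ) : ℂ) ≠ 0 := by exact_mod_cast hu0.ne'
    rw [sum_bernoulli_eq hm hζ hz0 hz1 hw hw1 _ _ hu0' K] at h
    have hsC : (s p : ℂ) ≠ 0 := by exact_mod_cast hs0.ne'
    rw [← norm_neg] at h
    calc _ ≤ C * (1 + |x p i / s p|) ^ (K + 2 + 1) * (d * s p ^ 2) ^ (K + 2) := by
          refine le_trans (le_of_eq ?_) h
          congr 1
          rw [psiRem]
          push_cast
          have : (x p i / s p : ℂ) ^ 2 * (d * s p ^ 2) * z / (2 * m * (1 - z)) =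
            x p i ^ 2 * (d * z) / (2 * m * (1 - z)) := by
            field_simp
          rw [this]
          ring
      _ ≤ C * ((1 + |x p i|) / s p) ^ (K + 2 + 1) * (d * s p ^ 2) ^ (K + 2) := by
          gcongr
          rw [abs_div, abs_of_pos hs0, add_div]
          gcongr
          exact (one_le_div hs0).2 hs1
      _ = C * d ^ (K + 2) * (s p ^ (K + 1) * (1 + |x p i|) ^ (K + 3)) := by
          rw [div_pow, mul_pow, ← pow_mul, show 2 * (K + 2) = (K + 2 + 1) + (K + 1) by ring,
            pow_add (s p)]
          field_simp
          ring
      _ ≤ C * d ^ (K + 2) * ‖ρ p ^ K‖ := by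
          rw [norm_of_nonneg (pow_nonneg hp0 _)]
          gcongr
          calc s p ^ (K + 1) * (1 + |x p i|) ^ (K + 3)
              ≤ s p ^ (K + 1) * (1 + |x p i|) ^ (3 * (K + 1)) := by
                gcongr
                omega
            _ = (s p * (1 + |x p i|) ^ 3) ^ (K + 1) := by rw [mul_pow, ← pow_mul]
            _ ≤ ρ p ^ (K + 1) := by gcongr
            _ ≤ ρ p ^ K := pow_le_pow_of_le_one hp0 hp1 (Nat.le_succ K)

/-! ### Expansion of the integrand -/

theorem hasExp_linear {N : ℕ} {α : Type*} {l : Filter α} {ρ s : α → ℝ} {x : α → Fin N → ℝ}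
    (hρ : ∀ᶠ p in l, 0 ≤ ρ p ∧ ρ p ≤ 1) (hs : ∀ᶠ p in l, 0 < s p ∧ s p * (1 + ‖x p‖) ^ 3 ≤ ρ p)
    (b : Fin N → ℂ) (c : ℂ) :
    HasExp l ρ (fun p => -(s p * ∑ i, b i * x p i) - s p ^ 2 * c) fun p => spec (s p) (x p)
      (-monomial 1 (∑ i, MvPolynomial.C (b i) * MvPolynomial.X i) -
        monomial 2 (MvPolynomial.C c)) := by
  have hsle : ∀ᶠ p in l, 0 < s p ∧ s p ≤ ρ p ∧ s p * (1 + ‖x p‖) ≤ ρ p := by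
    filter_upwards [hs] with p ⟨h0, h⟩
    have h1 : 1 ≤ 1 + ‖x p‖ := by linarith [norm_nonneg (x p)]
    have h2 : s p * (1 + ‖x p‖) ≤ ρ p :=
      (mul_le_mul_of_nonneg_left (le_self_pow₀ h1 (by norm_num)) h0.le).trans h
    exact ⟨h0, (le_mul_of_one_le_right h0.le h1).trans h2, h2⟩
  refine HasExp.of_eq_sum hρ (fun e => ?_) 3 (fun p e he => ?_) (Eventually.of_forall fun p => ?_)
  · rcases eq_or_ne e 1 with rfl | h1
    · refine IsBigO.of_bound (∑ i, ‖b i‖) ?_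
      filter_upwards [hsle] with p ⟨h0, _, h⟩
      rw [coeff_spec]
      simp only [map_sub, map_neg, coeff_monomial, if_true, OfNat.one_ne_ofNat, if_false,
        map_sum, map_mul, MvPolynomial.eval_C, MvPolynomial.eval_X, sub_zero, pow_one]
      rw [norm_mul, norm_neg, norm_real, norm_of_nonneg h0.le]
      have : ‖∑ i, b i * (x p i : ℂ)‖ ≤ (∑ i, ‖b i‖) * ‖x p‖ := by
        rw [sum_mul]
        refine (norm_sum_le _ _).trans (sum_le_sum fun i _ => ?_)
        rw [norm_mul, norm_real]
        exact mul_le_mul_of_nonneg_left (norm_le_pi_norm _ i) (norm_nonneg _)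
      have hb : 0 ≤ ∑ i, ‖b i‖ := sum_nonneg fun _ _ => norm_nonneg _
      calc _ ≤ s p * ((∑ i, ‖b i‖) * ‖x p‖) := by gcongr
        _ = (∑ i, ‖b i‖) * (s p * ‖x p‖) := by ring
        _ ≤ (∑ i, ‖b i‖) * ‖ρ p‖ := by
            refine mul_le_mul_of_nonneg_left ?_ hb
            have : s p * ‖x p‖ ≤ s p * (1 + ‖x p‖) := by nlinarith
            exact (this.trans h).trans (le_abs_self _)
    rcases eq_or_ne e 2 with rfl | h2
    · refine IsBigO.of_bound ‖c‖ ?_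
      filter_upwards [hsle] with p ⟨h0, h, _⟩
      rw [coeff_spec]
      simp only [map_sub, map_neg, coeff_monomial, if_true, if_false,
        OfNat.ofNat_ne_one, MvPolynomial.eval_C, zero_sub, neg_zero]
      rw [norm_mul, norm_neg, norm_pow, norm_pow, norm_real, mul_comm,
        norm_of_nonneg h0.le, norm_of_nonneg (h0.le.trans h)]
      have := h0.le
      gcongr
    · have : ∀ p, coeff e (spec (s p) (x p)
          (-monomial 1 (∑ i, MvPolynomial.C (b i) * MvPolynomial.X i) -
        monomial 2 (MvPolynomial.C c))) = 0 := fun p => by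
        rw [coeff_spec]
        simp [coeff_monomial, h1, h2]
      simp only [this]
      exact isBigO_zero _ _
  · rw [coeff_spec]
    simp [coeff_monomial, show e ≠ 1 by omega, show e ≠ 2 by omega]
  · simp only [sum_range_succ, sum_range_zero, coeff_spec, map_sub, map_neg,
      coeff_monomial]
    simp
    ring

/-- The exact value of which the formal integrand is the asymptotic expansion. -/
noncomputable def Datum.integrandVal {N : ℕ} (Q : Datum N) (m : ℕ) (ζ : ℂ) (z : Fin N → ℝ)
    (k : Fin N → ℕ) (s : ℝ) (x : Fin N → ℝ) (n : Fin N → ℕ) : ℂ :=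
  cexp (-(s * ∑ i, (1 / m * Q.b i : ℂ) * x i) -
      s ^ 2 * (1 / m * (Q.c + (∑ i, (Q.d i : ℂ)) / 24))) *
    ∏ i, cexp (psiRem m (Q.d i) (k i) (ζ ^ Q.d i) (z i) s (x i) (n i))

theorem Datum.hasExp_integrand {N : ℕ} (Q : Datum N) {α : Type*} {l : Filter α} {ρ s : α → ℝ}
    {x : α → Fin N → ℝ} {n : α → Fin N → ℕ} {m : ℕ} (hm : 0 < m) {ζ : ℂ}
    (hζ : ∀ i, IsPrimitiveRoot (ζ ^ Q.d i) m) {z y : Fin N → ℝ} (k : Fin N → ℕ)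
    (hy : ∀ i, 0 < y i) (hz : ∀ i, z i = rexp (-(Q.d i * y i)))
    (hρ : ∀ᶠ p in l, 0 ≤ ρ p ∧ ρ p ≤ 1 ∧ ∀ i, Q.d i * ρ p ≤ 1 ∧ ρ p ≤ y i / (2 * m))
    (hs : ∀ᶠ p in l, 0 < s p ∧ s p * (1 + ‖x p‖) ^ 3 ≤ ρ p)
    (hn : ∀ᶠ p in l, ∀ i, n p i % m = k i % m ∧ s p * n p i = x p i + y i / s p) :
    HasExp l ρ (fun p => Q.integrandVal m ζ z k (s p) (x p) (n p))
      fun p => spec (s p) (x p) (Q.integrand m ζ z k) := by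
  have hρ' : ∀ᶠ p in l, 0 ≤ ρ p ∧ ρ p ≤ 1 := hρ.mono fun p hp => ⟨hp.1, hp.2.1⟩
  have hlin := HasExp.exp hρ' (hasExp_linear hρ' hs (fun i => (1 / m * Q.b i : ℂ))
    (1 / m * (Q.c + (∑ i, (Q.d i : ℂ)) / 24))) fun p => by
      rw [coeff_spec, map_sub, map_neg, coeff_monomial, coeff_monomial,
        if_neg (by norm_num), if_neg (by norm_num)]
      simp
  have hpsi : ∀ i ∈ univ, HasExp l ρ
      (fun p => cexp (psiRem m (Q.d i) (k i) (ζ ^ Q.d i) (z i) (s p) (x p i) (n p i)))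
      fun p => formalExp (spec (s p) (x p) (rescale (psi m ((ζ ^ Q.d i) ^ k i *
        ((z i ^ (1 / m : ℝ) : ℝ) : ℂ)) (ζ ^ Q.d i)) (Q.d i) i)) := by
    intro i _
    refine HasExp.exp hρ' (hasExp_psi (n := fun p => n p i) i hm (hζ i) (Q.d_pos i) (hy i) (hz i)
      (hρ.mono fun p hp => ⟨hp.1, hp.2.1, hp.2.2 i⟩) (hs.mono fun p hp => ⟨hp.1, ?_⟩)
      (hn.mono fun p hp => hp i)) fun p => ?_
    · refine le_trans ?_ hp.2
      have := hp.1.le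
      gcongr
      exact norm_le_pi_norm (x p) i
    · rw [coeff_spec, coeff_zero_formalExp_arg_of_rescale (by simp [coeff_psi])
        (by rw [coeff_psi, if_neg one_ne_zero]; exact natDegree_psiCoeff_two_le _ _ _), map_zero,
        mul_zero]
  have h := hlin.mul hρ' (HasExp.prod hρ' univ hpsi)
  simp only [← spec_formalExp, ← map_prod, ← map_mul] at h
  exact h

/-! ### Parity -/

theorem spec_neg_rescale {N : ℕ} (F : PowerSeries (Polynomial ℂ)) (d : ℕ) (i : Fin N)
    (x : Fin N → ℝ) : spec 1 (-x) (rescale F d i) = spec (-1) x (rescale F d i) := by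
  ext e
  rw [coeff_spec, coeff_spec]
  simp only [rescale, coeff_mk, map_sum, mul_sum]
  refine sum_congr rfl fun n _ => ?_
  split_ifs with h
  · simp only [map_mul, map_pow, MvPolynomial.eval_C, MvPolynomial.eval_X, Pi.neg_apply,
      ofReal_neg, ofReal_one, one_pow, one_mul]
    rw [neg_pow (x i : ℂ)]
    have : (-1 : ℂ) ^ (2 * n - e) = (-1) ^ e := by
      refine mul_right_cancel₀ (b := (-1 : ℂ) ^ e) (pow_ne_zero _ (by norm_num)) ?_
      rw [← pow_add, ← pow_add, Nat.sub_add_cancel h, pow_mul, ← two_mul, pow_mul]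
      norm_num
    rw [this]; ring
  · simp

theorem Datum.spec_neg_integrand {N : ℕ} (Q : Datum N) (m : ℕ) (ζ : ℂ) (z : Fin N → ℝ)
    (k : Fin N → ℕ) (x : Fin N → ℝ) :
    spec 1 (-x) (Q.integrand m ζ z k) = spec (-1) x (Q.integrand m ζ z k) := by
  simp only [Datum.integrand, map_mul, map_prod, spec_formalExp, spec_neg_rescale]
  congr 2
  ext e
  rw [coeff_spec, coeff_spec]
  simp only [map_sub, map_neg, coeff_monomial]
  split_ifs with h1 h2 h3
  · omega
  · subst h1; simp
  · subst h3; simp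
  · simp

theorem Datum.eval_neg_coeff_integrand {N : ℕ} (Q : Datum N) (m : ℕ) (ζ : ℂ) (z : Fin N → ℝ)
    (k : Fin N → ℕ) (e : ℕ) (x : Fin N → ℝ) :
    MvPolynomial.eval (fun i => ((-x) i : ℂ)) (coeff e (Q.integrand m ζ z k)) =
      (-1) ^ e * MvPolynomial.eval (fun i => (x i : ℂ))
        (coeff e (Q.integrand m ζ z k)) := by
  have := congrArg (coeff e) (Q.spec_neg_integrand m ζ z k x)
  simpa [coeff_spec] using this

/-! ### Lattice sums of Gaussian functions -/

theorem exists_one_add_pow_le {c : ℝ} (hc : 0 < c) (J : ℕ) :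
    ∃ C : ℝ, 0 < C ∧ ∀ t : ℝ, 0 ≤ t → (1 + t) ^ J ≤ C * rexp (c * t ^ 2) := by
  refine ⟨J.factorial * rexp (1 + 1 / (4 * c)), by positivity, fun t ht => ?_⟩
  have h := Real.pow_div_factorial_le_exp (1 + t) (by linarith) J
  rw [div_le_iff₀ (by positivity), mul_comm] at h
  refine h.trans ?_
  rw [mul_assoc, ← exp_add]
  refine mul_le_mul_of_nonneg_left (Real.exp_le_exp.2 ?_) (by positivity)
  have : 0 ≤ (2 * c * t - 1) ^ 2 / (4 * c) := by positivity
  have e : (2 * c * t - 1) ^ 2 / (4 * c) = c * t ^ 2 - t + 1 / (4 * c) := by field_simp; ring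
  linarith

theorem exp_neg_norm_add_sq_le {N : ℕ} {c : ℝ} (hc : 0 < c) (a b : Fin N → ℝ) :
    rexp (-c * ‖a + b‖ ^ 2) ≤ rexp (c * ‖b‖ ^ 2) * rexp (-(c / 2) * ‖a‖ ^ 2) := by
  rw [← exp_add, exp_le_exp]
  have h : ‖a‖ ≤ ‖a + b‖ + ‖b‖ := by simpa using norm_sub_le (a + b) b
  nlinarith [sq_nonneg (‖a + b‖ - ‖b‖), norm_nonneg a, norm_nonneg b, norm_nonneg (a + b),
    mul_self_le_mul_self (norm_nonneg a) h]

/-- The product of the Gaussian of `M` and a polynomial. -/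
noncomputable def gaussPoly {N : ℕ} (M : Matrix (Fin N) (Fin N) ℝ) (P : MvPolynomial (Fin N) ℂ)
    (x : Fin N → ℝ) : ℂ :=
  (rexp (-(1 / 2) * (x ⬝ᵥ M.mulVec x)) : ℂ) * MvPolynomial.eval (fun i => (x i : ℂ)) P

theorem exists_norm_mvPolynomial_eval_le {N : ℕ} (P : MvPolynomial (Fin N) ℂ) :
    ∃ (C : ℝ) (J : ℕ), 0 < C ∧ ∀ x : Fin N → ℝ,
      ‖MvPolynomial.eval (fun i => (x i : ℂ)) P‖ ≤ C * (1 + ‖x‖) ^ J := by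
  induction P using MvPolynomial.induction_on with
  | C a => exact ⟨‖a‖ + 1, 0, by positivity, fun x => by simp⟩
  | add p q hp hq =>
    obtain ⟨C, J, hC, h⟩ := hp
    obtain ⟨C', J', hC', h'⟩ := hq
    refine ⟨C + C', J + J', by positivity, fun x => ?_⟩
    have h1 : 1 ≤ 1 + ‖x‖ := by linarith [norm_nonneg x]
    rw [map_add]
    refine (norm_add_le _ _).trans (le_trans (add_le_add (h x) (h' x)) ?_)
    rw [add_mul]
    gcongr <;> first | exact h1 | omega
  | mul_X p i hp =>
    obtain ⟨C, J, hC, h⟩ := hp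
    refine ⟨C, J + 1, hC, fun x => ?_⟩
    rw [map_mul, norm_mul, MvPolynomial.eval_X, norm_real, pow_succ, ← mul_assoc]
    gcongr
    · exact h x
    · have := norm_le_pi_norm x i
      linarith

theorem exists_norm_gaussPoly_le {N : ℕ} {M : Matrix (Fin N) (Fin N) ℝ} (hM : M.PosDef) :
    ∃ c : ℝ, 0 < c ∧ ∀ P : MvPolynomial (Fin N) ℂ, ∃ C : ℝ, 0 < C ∧ ∀ x : Fin N → ℝ,
      ‖gaussPoly M P x‖ ≤ C * rexp (-c * ‖x‖ ^ 2) := by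
  obtain ⟨c, hc, h⟩ := exists_mul_norm_sq_le_of_posDef hM
  refine ⟨c / 4, by positivity, fun P => ?_⟩
  obtain ⟨C, J, hC, hP⟩ := exists_norm_mvPolynomial_eval_le P
  obtain ⟨C', hC', hJ⟩ := exists_one_add_pow_le (show 0 < c / 4 by positivity) J
  refine ⟨C * C', by positivity, fun x => ?_⟩
  rw [gaussPoly, norm_mul, norm_real, norm_of_nonneg (exp_pos _).le]
  calc _ ≤ rexp (-(c / 2) * ‖x‖ ^ 2) * (C * (C' * rexp (c / 4 * ‖x‖ ^ 2))) := by
        refine mul_le_mul (Real.exp_le_exp.2 (by linarith [h x])) ((hP x).trans ?_)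
          (norm_nonneg _) (exp_pos _).le
        exact mul_le_mul_of_nonneg_left (hJ _ (norm_nonneg x)) hC.le
    _ = C * C' * (rexp (-(c / 2) * ‖x‖ ^ 2) * rexp (c / 4 * ‖x‖ ^ 2)) := by ring
    _ = _ := by rw [← exp_add]; congr 2; ring

theorem exists_hasDerivAt_eval {N : ℕ} (i : Fin N) (P : MvPolynomial (Fin N) ℂ) :
    ∃ P' : MvPolynomial (Fin N) ℂ, ∀ (x : Fin N → ℝ) (t : ℝ),
      HasDerivAt (fun t : ℝ => MvPolynomial.eval (fun j => ((x + (Pi.single i t : Fin N → ℝ)) j : ℂ)) P)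
        (MvPolynomial.eval (fun j => ((x + (Pi.single i t : Fin N → ℝ)) j : ℂ)) P') t := by
  induction P using MvPolynomial.induction_on with
  | C a => exact ⟨0, fun x t => by simpa using hasDerivAt_const t a⟩
  | add p q hp hq =>
    obtain ⟨p', hp'⟩ := hp
    obtain ⟨q', hq'⟩ := hq
    exact ⟨p' + q', fun x t => by simpa only [map_add] using (hp' x t).fun_add (hq' x t)⟩
  | mul_X p j hp =>
    obtain ⟨p', hp'⟩ := hp
    refine ⟨p' * MvPolynomial.X j + p * MvPolynomial.C (if j = i then 1 else 0), fun x t => ?_⟩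
    have hX : HasDerivAt (fun t : ℝ => ((x + (Pi.single i t : Fin N → ℝ)) j : ℂ)) (if j = i then 1 else 0) t := by
      rcases eq_or_ne j i with rfl | h
      · simpa using (hasDerivAt_id t).ofReal_comp.const_add (x j : ℂ)
      · simpa [h] using hasDerivAt_const t (x j : ℂ)
    simpa only [map_add, map_mul, MvPolynomial.eval_X, MvPolynomial.eval_C] using (hp' x t).fun_mul hX

theorem gaussPoly_eq {N : ℕ} (M : Matrix (Fin N) (Fin N) ℝ) (P : MvPolynomial (Fin N) ℂ)
    (x : Fin N → ℝ) : gaussPoly M P x = cexp (MvPolynomial.eval (fun i => (x i : ℂ))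
      (∑ i, ∑ j, MvPolynomial.C (-(1 / 2) * M i j : ℂ) * MvPolynomial.X i * MvPolynomial.X j)) *
      MvPolynomial.eval (fun i => (x i : ℂ)) P := by
  rw [gaussPoly, ofReal_exp]
  congr 2
  simp only [dotProduct, Matrix.mulVec, mul_sum, map_sum, map_mul, MvPolynomial.eval_C,
    MvPolynomial.eval_X, ofReal_sum]
  refine sum_congr rfl fun i _ => sum_congr rfl fun j _ => ?_
  push_cast; ring

theorem continuous_gaussPoly {N : ℕ} (M : Matrix (Fin N) (Fin N) ℝ)
    (P : MvPolynomial (Fin N) ℂ) : Continuous (gaussPoly M P) := by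
  have h : Continuous fun x : Fin N → ℝ => fun i => (x i : ℂ) := by fun_prop
  have hP := (MvPolynomial.continuous_eval P).comp h
  unfold gaussPoly
  refine Continuous.mul ?_ hP
  fun_prop

theorem exists_hasDerivAt_gaussPoly {N : ℕ} (M : Matrix (Fin N) (Fin N) ℝ) (i : Fin N)
    (P : MvPolynomial (Fin N) ℂ) : ∃ P' : MvPolynomial (Fin N) ℂ, ∀ (x : Fin N → ℝ) (t : ℝ),
      HasDerivAt (fun t : ℝ => gaussPoly M P (x + (Pi.single i t : Fin N → ℝ)))
        (gaussPoly M P' (x + (Pi.single i t : Fin N → ℝ))) t := by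
  obtain ⟨P', hP⟩ := exists_hasDerivAt_eval i P
  obtain ⟨q', hq⟩ := exists_hasDerivAt_eval i
    (∑ i, ∑ j, MvPolynomial.C (-(1 / 2) * M i j : ℂ) * MvPolynomial.X i * MvPolynomial.X j)
  refine ⟨q' * P + P', fun x t => ?_⟩
  simp only [gaussPoly_eq]
  exact ((hq x t).cexp.fun_mul (hP x t)).congr_deriv (by rw [map_add, map_mul]; ring)

theorem norm_le_of_norm_deriv_le {Φ φ φ' : ℝ → ℂ} (h : ∀ t, HasDerivAt Φ (φ t) t)
    (h' : ∀ t, HasDerivAt φ (φ' t) t) (hper : ∀ t, Φ (t + 1) = Φ t) {B : ℝ}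
    (hB : ∀ t, ‖φ' t‖ ≤ B) (t : ℝ) : ‖φ t‖ ≤ B := by
  have hc : Continuous φ := continuous_iff_continuousAt.2 fun t => (h' t).continuousAt
  have h0 : ∫ u in t..(t + 1), φ u = 0 := by
    rw [intervalIntegral.integral_eq_sub_of_hasDerivAt (fun u _ => h u)
      (hc.intervalIntegrable _ _), hper, sub_self]
  have h1 : φ t = ∫ u in t..(t + 1), (φ t - φ u) := by
    rw [intervalIntegral.integral_sub (by simp) (hc.intervalIntegrable _ _), h0]
    simp
  have hB0 : 0 ≤ B := (norm_nonneg _).trans (hB t)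
  have h2 : ‖∫ u in t..(t + 1), (φ t - φ u)‖ ≤ B * |t + 1 - t| := by
    refine intervalIntegral.norm_integral_le_of_norm_le_const fun u hu => ?_
    rw [Set.uIoc_of_le (by linarith), Set.mem_Ioc] at hu
    rw [norm_sub_rev]
    refine (Convex.norm_image_sub_le_of_norm_hasDerivWithin_le
      (fun v _ => (h' v).hasDerivWithinAt) (fun v _ => hB v) convex_univ (Set.mem_univ t)
      (Set.mem_univ u)).trans ?_
    rw [norm_of_nonneg (by linarith)]
    exact mul_le_of_le_one_right hB0 (by linarith)
  rw [h1]
  simpa using h2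

theorem norm_sub_le_of_periodic {φ : ℕ → ℝ → ℂ} (h : ∀ j t, HasDerivAt (φ j) (φ (j + 1) t) t)
    (hper : ∀ j t, φ j (t + 1) = φ j t) {B : ℝ} (K : ℕ) (hB : ∀ t, ‖φ (K + 1) t‖ ≤ B) {t : ℝ}
    (ht0 : 0 ≤ t) (ht1 : t ≤ 1) : ‖φ 0 t - φ 0 0‖ ≤ B := by
  have h1 : ∀ t, ‖φ 1 t‖ ≤ B := by
    induction K with
    | zero => simpa using hB
    | succ K ih => exact ih fun t => norm_le_of_norm_deriv_le (h K) (h (K + 1)) (hper K) hB t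
  refine (Convex.norm_image_sub_le_of_norm_hasDerivWithin_le
      (fun v _ => (h 0 v).hasDerivWithinAt) (fun v _ => h1 v) convex_univ (Set.mem_univ 0)
      (Set.mem_univ t)).trans ?_
  rw [norm_of_nonneg (by linarith)]
  exact mul_le_of_le_one_right ((norm_nonneg _).trans (h1 0)) (by linarith)

/-- The lattice sum `∑_{n ∈ ℤ^N} f(s (n + v))`. -/
noncomputable def latticeSum {N : ℕ} (f : (Fin N → ℝ) → ℂ) (s : ℝ) (v : Fin N → ℝ) : ℂ :=
  ∑' n : Fin N → ℤ, f fun i => s * (n i + v i)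

theorem latticeSum_add_single {N : ℕ} (f : (Fin N → ℝ) → ℂ) (s : ℝ) (v : Fin N → ℝ) (i : Fin N) :
    latticeSum f s (v + (Pi.single i 1 : Fin N → ℝ)) = latticeSum f s v := by
  rw [latticeSum, latticeSum, ← (Equiv.addRight (Pi.single i (1 : ℤ))).tsum_eq
    fun n : Fin N → ℤ => f fun i => s * (n i + v i)]
  refine tsum_congr fun n => congrArg f (funext fun j => ?_)
  rcases eq_or_ne j i with rfl | h
  · simp; left; ring
  · simp [h]

section

variable {N : ℕ} {f : (Fin N → ℝ) → ℂ} {C c : ℝ}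

theorem norm_shift_le (hc : 0 < c) (hf : ∀ x, ‖f x‖ ≤ C * rexp (-c * ‖x‖ ^ 2)) {s : ℝ}
    (hs : 0 < s) (hs1 : s ≤ 1) (v w : Fin N → ℝ) (hw : ‖w‖ ≤ 1) (n : Fin N → ℤ) :
    ‖f fun i => s * (n i + (v + w) i)‖ ≤
      C * rexp c * rexp (-(c / 2) * ‖fun i => s * (n i + v i)‖ ^ 2) := by
  have hC : 0 ≤ C := by
    have := (norm_nonneg _).trans (hf 0)
    simpa using this
  have e : (fun i => s * (n i + (v + w) i)) = (fun i => s * (n i + v i)) + s • w := by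
    funext i; simp; ring
  rw [e]
  refine (hf _).trans ?_
  rw [mul_assoc]
  refine mul_le_mul_of_nonneg_left ((exp_neg_norm_add_sq_le hc _ _).trans ?_) hC
  refine mul_le_mul_of_nonneg_right (Real.exp_le_exp.2 ?_) (exp_pos _).le
  rw [norm_smul, norm_of_nonneg hs.le]
  exact mul_le_of_le_one_right hc.le
    (pow_le_one₀ (by positivity) (mul_le_one₀ hs1 (norm_nonneg w) hw))

theorem summable_lattice (hc : 0 < c) (hf : ∀ x, ‖f x‖ ≤ C * rexp (-c * ‖x‖ ^ 2)) {s : ℝ}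
    (hs : 0 < s) (hs1 : s ≤ 1) (v : Fin N → ℝ) :
    Summable fun n : Fin N → ℤ => f fun i => s * (n i + v i) := by
  obtain ⟨K, -, hK⟩ := exists_lattice_sum_le (N := N) hc
  exact Summable.of_norm_bounded ((hK s hs hs1 v).1.mul_left C) fun n => hf _

theorem exists_norm_latticeSum_le (hc : 0 < c) (hf : ∀ x, ‖f x‖ ≤ C * rexp (-c * ‖x‖ ^ 2)) :
    ∃ K : ℝ, 0 < K ∧ ∀ s : ℝ, 0 < s → s ≤ 1 → ∀ v, s ^ N * ‖latticeSum f s v‖ ≤ K := by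
  obtain ⟨K, hK, hle⟩ := exists_lattice_sum_le (N := N) hc
  have hC : 0 ≤ C := by
    have := (norm_nonneg _).trans (hf 0)
    simpa using this
  refine ⟨(C + 1) * K, by positivity, fun s hs hs1 v => ?_⟩
  have h := tsum_of_norm_bounded ((hle s hs hs1 v).1.mul_left C).hasSum fun n => hf _
  rw [tsum_mul_left] at h
  calc s ^ N * ‖latticeSum f s v‖ ≤ s ^ N * (C * (K / s ^ N)) := by
        gcongr
        exact h.trans (by gcongr; exact (hle s hs hs1 v).2)
    _ = C * K := by field_simp
    _ ≤ _ := by nlinarith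

theorem hasDerivAt_latticeSum {f' : (Fin N → ℝ) → ℂ} {C' : ℝ} (hc : 0 < c)
    (hf : ∀ x, ‖f x‖ ≤ C * rexp (-c * ‖x‖ ^ 2))
    (hf' : ∀ x, ‖f' x‖ ≤ C' * rexp (-c * ‖x‖ ^ 2)) {i : Fin N}
    (h : ∀ (x : Fin N → ℝ) (t : ℝ), HasDerivAt (fun t : ℝ => f (x + (Pi.single i t : Fin N → ℝ))) (f' (x + (Pi.single i t : Fin N → ℝ))) t) {s : ℝ}
    (hs : 0 < s) (hs1 : s ≤ 1) (v : Fin N → ℝ) (t : ℝ) :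
    HasDerivAt (fun t => latticeSum f s (v + (Pi.single i t : Fin N → ℝ)))
      (s * latticeSum f' s (v + (Pi.single i t : Fin N → ℝ))) t := by
  obtain ⟨K, -, hK⟩ := exists_lattice_sum_le (N := N) (show 0 < c / 2 by positivity)
  have hsum := ((hK s hs hs1 (v + (Pi.single i t : Fin N → ℝ))).1.mul_left (C' * rexp c)).mul_left s
  have e : ∀ (n : Fin N → ℤ) (u : ℝ), (fun j => s * (n j + (v + (Pi.single i u : Fin N → ℝ)) j)) =
      (fun j => s * (n j + v j)) + (Pi.single i (s * u) : Fin N → ℝ) := fun n u => by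
    funext j
    rcases eq_or_ne j i with rfl | hj
    · simp; ring
    · simp [hj]
  have hd : ∀ (n : Fin N → ℤ) (u : ℝ), u ∈ Metric.ball t 1 →
      HasDerivAt (fun u : ℝ => f fun j => s * (n j + (v + (Pi.single i u : Fin N → ℝ)) j))
        (s * f' fun j => s * (n j + (v + (Pi.single i u : Fin N → ℝ)) j)) u := by
    intro n u _
    simp only [e]
    have h1 : HasDerivAt (fun u : ℝ => s * u) s u := by simpa using (hasDerivAt_id u).const_mul s
    have h2 := (h (fun j => s * (n j + v j)) (s * u)).scomp u h1
    exact h2.congr_deriv (real_smul)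
  have hb : ∀ (n : Fin N → ℤ) (u : ℝ), u ∈ Metric.ball t 1 →
      ‖s * f' fun j => s * (n j + (v + (Pi.single i u : Fin N → ℝ)) j)‖ ≤
      s * (C' * rexp c * rexp (-(c / 2) *
        ‖fun j => s * (n j + (v + (Pi.single i t : Fin N → ℝ)) j)‖ ^ 2)) := by
    intro n u hu
    rw [norm_mul, norm_real, norm_of_nonneg hs.le]
    refine mul_le_mul_of_nonneg_left ?_ hs.le
    have e2 : v + (Pi.single i u : Fin N → ℝ) =
        (v + (Pi.single i t : Fin N → ℝ)) + (Pi.single i (u - t) : Fin N → ℝ) := by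
      rw [add_assoc, ← Pi.single_add]; simp
    rw [e2]
    refine norm_shift_le hc hf' hs hs1 _ _ ?_ n
    rw [Pi.norm_single]
    exact (mem_ball_iff_norm.1 hu).le
  have key := hasDerivAt_tsum_of_isPreconnected hsum Metric.isOpen_ball
    (convex_ball t 1).isPreconnected hd hb (Metric.mem_ball_self one_pos)
    (summable_lattice hc hf hs hs1 _) (Metric.mem_ball_self one_pos)
  rw [tsum_mul_left] at key
  exact key

end

theorem exists_norm_latticeSum_sub_single_le {N : ℕ} {M : Matrix (Fin N) (Fin N) ℝ} (hM : M.PosDef)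
    (P : MvPolynomial (Fin N) ℂ) (K : ℕ) (i : Fin N) : ∃ C : ℝ, 0 < C ∧ ∀ s : ℝ, 0 < s → s ≤ 1 →
      ∀ (v : Fin N → ℝ) (t : ℝ), 0 ≤ t → t ≤ 1 →
      s ^ N * ‖latticeSum (gaussPoly M P) s (v + (Pi.single i t : Fin N → ℝ)) -
        latticeSum (gaussPoly M P) s v‖ ≤ C * s ^ K := by
  obtain ⟨c, hc, hle⟩ := exists_norm_gaussPoly_le hM
  choose C hC hCle using hle
  choose D hD using exists_hasDerivAt_gaussPoly M i
  obtain ⟨B, hB, hBle⟩ := exists_norm_latticeSum_le hc (hCle (D^[K + 1] P))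
  refine ⟨B, hB, fun s hs hs1 v t ht0 ht1 => ?_⟩
  have h := norm_sub_le_of_periodic
    (φ := fun j t => (s : ℂ) ^ j * latticeSum (gaussPoly M (D^[j] P)) s (v + (Pi.single i t : Fin N → ℝ)))
    (fun j t => ?_) (fun j t => ?_) (B := s ^ (K + 1) * (B / s ^ N)) K (fun t => ?_) ht0 ht1
  · simp only [pow_zero, one_mul, Function.iterate_zero, id, Pi.single_zero, add_zero] at h
    calc _ ≤ s ^ N * (s ^ (K + 1) * (B / s ^ N)) := by gcongr
      _ = B * s ^ (K + 1) := by field_simp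
      _ ≤ B * s ^ K := by
          exact mul_le_mul_of_nonneg_left (pow_le_pow_of_le_one hs.le hs1 (Nat.le_succ K)) hB.le
  · have := (hasDerivAt_latticeSum hc (hCle (D^[j] P)) (hCle (D^[j + 1] P)) (fun x t => by
      rw [Function.iterate_succ_apply']; exact hD _ x t) hs hs1 v t).const_mul ((s : ℂ) ^ j)
    simpa only [pow_succ, mul_assoc] using this
  · simp only [Pi.single_add, ← add_assoc, latticeSum_add_single]
  · rw [norm_mul, norm_pow, norm_real, norm_of_nonneg hs.le]
    gcongr
    rw [le_div_iff₀ (by positivity), mul_comm]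
    exact hBle s hs hs1 _

theorem exists_norm_latticeSum_sub_le {N : ℕ} {M : Matrix (Fin N) (Fin N) ℝ} (hM : M.PosDef)
    (P : MvPolynomial (Fin N) ℂ) (K : ℕ) : ∃ C : ℝ, 0 < C ∧ ∀ s : ℝ, 0 < s → s ≤ 1 →
      ∀ v t : Fin N → ℝ, (∀ i, 0 ≤ t i ∧ t i ≤ 1) →
      s ^ N * ‖latticeSum (gaussPoly M P) s (v + t) - latticeSum (gaussPoly M P) s v‖ ≤
        C * s ^ K := by
  classical
  choose C hC h using exists_norm_latticeSum_sub_single_le hM P K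
  have hC0 : 0 ≤ ∑ i, C i := sum_nonneg fun i _ => (hC i).le
  refine ⟨∑ i, C i + 1, by positivity, fun s hs hs1 v t ht => ?_⟩
  have key : ∀ T : Finset (Fin N), s ^ N * ‖latticeSum (gaussPoly M P) s
      (v + ∑ i ∈ T, (Pi.single i (t i) : Fin N → ℝ)) - latticeSum (gaussPoly M P) s v‖ ≤
      (∑ i ∈ T, C i) * s ^ K := by
    intro T
    induction T using induction_on with
    | empty => simp
    | insert i T hi ih =>
      rw [sum_insert hi, sum_insert hi, add_mul, add_comm (Pi.single i (t i) : Fin N → ℝ),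
        ← add_assoc]
      refine le_trans ?_ (add_le_add (h i s hs hs1 (v + ∑ i ∈ T, (Pi.single i (t i) : Fin N → ℝ)) (t i)
        (ht i).1 (ht i).2) ih)
      rw [← mul_add]
      gcongr
      exact norm_sub_le_norm_sub_add_norm_sub _ _ _
  have := key univ
  rw [Finset.univ_sum_single] at this
  refine this.trans ?_
  gcongr
  linarith

theorem integrable_of_norm_le_gaussian {N : ℕ} {f : (Fin N → ℝ) → ℂ} (hcont : Continuous f)
    {C c : ℝ} (hc : 0 < c) (hf : ∀ x, ‖f x‖ ≤ C * rexp (-c * ‖x‖ ^ 2)) : Integrable f := by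
  have h := (GaussianFourier.integrable_cexp_neg_sum_mul_add
    (b := fun _ : Fin N => ((c / (N + 1) : ℝ) : ℂ))
    (fun i => by rw [ofReal_re]; positivity) 0).norm.const_mul C
  have hC : 0 ≤ C := by
    have := (norm_nonneg _).trans (hf 0)
    simpa using this
  refine Integrable.mono' h hcont.aestronglyMeasurable (Eventually.of_forall fun x => ?_)
  refine (hf x).trans (mul_le_mul_of_nonneg_left ?_ hC)
  rw [norm_exp, exp_le_exp]
  have e : (-∑ i, ((c / (N + 1) : ℝ) : ℂ) * (x i : ℂ) ^ 2 +
      ∑ i, (0 : Fin N → ℂ) i * (x i : ℂ)).re = -(c / (N + 1) * ∑ i, x i ^ 2) := by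
    simp only [Pi.zero_apply, zero_mul, Finset.sum_const_zero, add_zero, ← ofReal_pow,
      ← ofReal_mul, ← ofReal_sum, ← ofReal_neg, ofReal_re,
      mul_sum]
  rw [e, neg_mul, neg_le_neg_iff]
  have h1 : ∑ i, x i ^ 2 ≤ (N + 1) * ‖x‖ ^ 2 := by
    calc ∑ i, x i ^ 2 ≤ ∑ _i : Fin N, ‖x‖ ^ 2 := by
          refine sum_le_sum fun i _ => ?_
          rw [← sq_abs]
          exact pow_le_pow_left₀ (abs_nonneg _) (norm_le_pi_norm x i) 2
      _ = N * ‖x‖ ^ 2 := by simp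
      _ ≤ _ := by nlinarith [sq_nonneg ‖x‖]
  calc c / (N + 1) * ∑ i, x i ^ 2 ≤ c / (N + 1) * ((N + 1) * ‖x‖ ^ 2) := by gcongr
    _ = _ := by field_simp

/-- The half-open unit cube. -/
def unitCube (N : ℕ) : Set (Fin N → ℝ) := Set.univ.pi fun _ => Set.Ico 0 1

theorem measurableSet_unitCube (N : ℕ) : MeasurableSet (unitCube N) :=
  MeasurableSet.univ_pi fun _ => measurableSet_Ico

theorem volume_unitCube (N : ℕ) : volume (unitCube N) = 1 := by
  rw [unitCube, Real.volume_pi_Ico]; simp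

theorem integral_eq_tsum_unitCube {N : ℕ} {g : (Fin N → ℝ) → ℂ} (hg : Integrable g) :
    ∫ x, g x = ∑' n : Fin N → ℤ, ∫ t in unitCube N, g (t + fun i => (n i : ℝ)) := by
  set U : (Fin N → ℤ) → Set (Fin N → ℝ) := fun n =>
    Set.univ.pi fun i => Set.Ico (n i : ℝ) (n i + 1) with hU
  have hmem : ∀ n x, x ∈ U n ↔ ∀ i, ⌊x i⌋ = n i := fun n x => by
    simp [hU, Set.mem_pi, Int.floor_eq_iff]
  have hunion : ⋃ n, U n = Set.univ := by
    refine Set.eq_univ_of_forall fun x => Set.mem_iUnion.2 ⟨fun i => ⌊x i⌋, ?_⟩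
    rw [hmem]; exact fun i => rfl
  have hdisj : Pairwise (Function.onFun Disjoint U) := by
    intro n n' hne
    refine Set.disjoint_left.2 fun x hx hx' => hne (funext fun i => ?_)
    rw [hmem] at hx hx'
    rw [← hx i, hx' i]
  rw [← setIntegral_univ, ← hunion, integral_iUnion
    (fun n => MeasurableSet.univ_pi fun _ => measurableSet_Ico) hdisj hg.integrableOn]
  refine tsum_congr fun n => ?_
  rw [← (measurePreserving_add_right volume fun i => (n i : ℝ)).setIntegral_preimage_emb
    (measurableEmbedding_addRight _)]
  congr 2
  ext x
  simp only [Set.mem_preimage, Set.mem_pi, Set.mem_univ, true_implies, Pi.add_apply, Set.mem_Ico,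
    unitCube]
  refine forall_congr' fun i => ⟨fun h => ⟨by linarith [h.1], by linarith [h.2]⟩,
    fun h => ⟨by linarith [h.1], by linarith [h.2]⟩⟩

theorem integral_eq_integral_latticeSum {N : ℕ} {f : (Fin N → ℝ) → ℂ} (hcont : Continuous f)
    {C c : ℝ} (hc : 0 < c) (hf : ∀ x, ‖f x‖ ≤ C * rexp (-c * ‖x‖ ^ 2)) {s : ℝ} (hs : 0 < s)
    (hs1 : s ≤ 1) (v : Fin N → ℝ) :
    Integrable (fun t => latticeSum f s (v + t)) (volume.restrict (unitCube N)) ∧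
    ∫ x, f x = (s : ℂ) ^ N * ∫ t in unitCube N, latticeSum f s (v + t) := by
  have hint := integrable_of_norm_le_gaussian hcont hc hf
  have h1 : ∫ x, f x = (s : ℂ) ^ N * ∫ x : Fin N → ℝ, f (s • (x + v)) := by
    rw [integral_add_right_eq_self (fun x => f (s • x)) v, Measure.integral_comp_smul]
    have hsC : (s : ℂ) ^ N ≠ 0 := pow_ne_zero _ (by exact_mod_cast hs.ne')
    simp only [Module.finrank_fintype_fun_eq_card, Fintype.card_fin,
      abs_of_pos (inv_pos.2 (pow_pos hs N)), real_smul, ofReal_inv,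
      ofReal_pow]
    rw [mul_inv_cancel_left₀ hsC]
  have hint' : Integrable fun x : Fin N → ℝ => f (s • (x + v)) :=
    (hint.comp_smul hs.ne').comp_add_right v
  rw [h1, integral_eq_tsum_unitCube hint']
  have e : ∀ (n : Fin N → ℤ) (t : Fin N → ℝ), s • (t + (fun i => (n i : ℝ)) + v) =
      fun i => s * (n i + (v + t) i) := fun n t => by
    funext i; simp; left; ring
  simp only [e]
  obtain ⟨K, -, hK⟩ := exists_lattice_sum_le (N := N) (show 0 < c / 2 by positivity)
  have hsum := (hK s hs hs1 v).1.mul_left (C * rexp c)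
  have hbd : ∀ (n : Fin N → ℤ), ∀ t ∈ unitCube N, ‖f fun i => s * (n i + (v + t) i)‖ ≤
      C * rexp c * rexp (-(c / 2) * ‖fun i => s * (n i + v i)‖ ^ 2) := by
    intro n t ht
    refine norm_shift_le hc hf hs hs1 v t ((pi_norm_le_iff_of_nonneg zero_le_one).2 fun i => ?_) n
    have := ht i (Set.mem_univ i)
    rw [norm_of_nonneg this.1]
    exact this.2.le
  have : IsFiniteMeasure (volume.restrict (unitCube N)) :=
    ⟨by rw [Measure.restrict_apply_univ, volume_unitCube]; exact ENNReal.one_lt_top⟩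
  have hcontn : ∀ n : Fin N → ℤ, Continuous fun t : Fin N → ℝ =>
      f fun i => s * (n i + (v + t) i) := fun n => hcont.comp (by fun_prop)
  have hintn : ∀ n : Fin N → ℤ, Integrable (fun t => f fun i => s * (n i + (v + t) i))
      (volume.restrict (unitCube N)) := fun n => by
    refine Integrable.mono' (integrable_const (C * rexp c *
      rexp (-(c / 2) * ‖fun i => s * (n i + v i)‖ ^ 2))) (hcontn n).aestronglyMeasurable ?_
    exact (ae_restrict_iff' (measurableSet_unitCube N)).2 (Eventually.of_forall (hbd n))
  have hsn : Summable fun n : Fin N → ℤ =>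
      ∫ t in unitCube N, ‖f fun i => s * (n i + (v + t) i)‖ := by
    refine Summable.of_nonneg_of_le (fun n => integral_nonneg fun t => norm_nonneg _) (fun n => ?_)
      hsum
    refine (setIntegral_mono_on (hintn n).norm (integrable_const _) (measurableSet_unitCube N)
      (hbd n)).trans (le_of_eq ?_)
    simp [Measure.real, volume_unitCube]
  refine ⟨?_, ?_⟩
  · have hco : ContinuousOn (fun t => latticeSum f s (v + t)) (unitCube N) :=
      continuousOn_tsum (fun n => (hcontn n).continuousOn) hsum hbd
    refine Integrable.mono' (integrable_const (∑' n : Fin N → ℤ, C * rexp c *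
      rexp (-(c / 2) * ‖fun i => s * (n i + v i)‖ ^ 2)))
      (hco.aestronglyMeasurable (measurableSet_unitCube N)) ?_
    exact (ae_restrict_iff' (measurableSet_unitCube N)).2 (Eventually.of_forall fun t ht =>
      tsum_of_norm_bounded hsum.hasSum fun n => hbd n t ht)
  · rw [integral_tsum_of_summable_integral_norm hintn hsn]
    rfl

theorem exists_norm_latticeSum_sub_integral_le {N : ℕ} {M : Matrix (Fin N) (Fin N) ℝ}
    (hM : M.PosDef) (P : MvPolynomial (Fin N) ℂ) (K : ℕ) : ∃ C : ℝ, 0 < C ∧ ∀ s : ℝ, 0 < s → s ≤ 1 →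
      ∀ v : Fin N → ℝ, ‖(s : ℂ) ^ N * latticeSum (gaussPoly M P) s v - ∫ x, gaussPoly M P x‖ ≤
        C * s ^ K := by
  obtain ⟨c, hc, hle⟩ := exists_norm_gaussPoly_le hM
  obtain ⟨C', hC', hf⟩ := hle P
  obtain ⟨C, hC, h⟩ := exists_norm_latticeSum_sub_le hM P K
  refine ⟨C, hC, fun s hs hs1 v => ?_⟩
  obtain ⟨hint, heq⟩ := integral_eq_integral_latticeSum (continuous_gaussPoly M P) hc hf hs hs1 v
  have : IsFiniteMeasure (volume.restrict (unitCube N)) :=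
    ⟨by rw [Measure.restrict_apply_univ, volume_unitCube]; exact ENNReal.one_lt_top⟩
  have e1 : latticeSum (gaussPoly M P) s v = ∫ _t in unitCube N, latticeSum (gaussPoly M P) s v := by
    simp [Measure.real, volume_unitCube]
  rw [heq, e1, ← mul_sub, ← integral_sub (integrable_const _) hint, norm_mul, norm_pow,
    norm_real, norm_of_nonneg hs.le]
  have hb : ‖∫ t in unitCube N, (latticeSum (gaussPoly M P) s v -
      latticeSum (gaussPoly M P) s (v + t))‖ ≤ C * s ^ K / s ^ N * (volume (unitCube N)).toReal := by
    refine norm_setIntegral_le_of_norm_le_const (by rw [volume_unitCube]; exact ENNReal.one_lt_top)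
      fun t ht => ?_
    rw [norm_sub_rev, le_div_iff₀ (by positivity), mul_comm]
    refine h s hs hs1 v t fun i => ?_
    have := ht i (Set.mem_univ i)
    exact ⟨this.1, this.2.le⟩
  rw [volume_unitCube, ENNReal.toReal_one, mul_one, le_div_iff₀ (by positivity), mul_comm] at hb
  exact hb

theorem integral_gaussPoly_one {N : ℕ} {M : Matrix (Fin N) (Fin N) ℝ} (hM : M.PosDef) :
    ∫ x, gaussPoly M 1 x = ((√(2 * π) ^ N / √M.det : ℝ) : ℂ) := by
  obtain ⟨R, hR⟩ := exists_gram hM.posSemidef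
  have hdet : M.det = R.det ^ 2 := by rw [hR, Matrix.det_mul, Matrix.det_transpose]; ring
  have hR0 : R.det ≠ 0 := fun h => by
    have := hM.det_pos
    rw [hdet, h] at this
    simp at this
  set g : (Fin N → ℝ) → ℂ := fun x =>
    cexp (-∑ i, ((1 / 2 : ℝ) : ℂ) * (x i : ℂ) ^ 2 + ∑ i, (0 : Fin N → ℂ) i * x i) with hg
  have e : ∀ x, gaussPoly M 1 x = g (Matrix.toLin' R x) := fun x => by
    have : x ⬝ᵥ M.mulVec x = ∑ i, R.mulVec x i ^ 2 := by
      rw [hR, ← Matrix.mulVec_mulVec, Matrix.dotProduct_mulVec, Matrix.vecMul_transpose]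
      simp [dotProduct, sq]
    simp only [hg, gaussPoly, map_one, mul_one, this, Matrix.toLin'_apply]
    rw [ofReal_exp]
    congr 1
    simp [mul_sum]
  simp only [e]
  have hmap := Real.map_matrix_volume_pi_eq_smul_volume_pi hR0
  have hemb : MeasurableEmbedding (Matrix.toLin' R) :=
    ((LinearEquiv.ofIsUnitDet (f := Matrix.toLin' R) (v := Pi.basisFun ℝ (Fin N))
      (v' := Pi.basisFun ℝ (Fin N)) (by
        rw [LinearMap.toMatrix_eq_toMatrix', LinearMap.toMatrix'_toLin']
        exact hR0.isUnit)).toContinuousLinearEquiv.toHomeomorph).measurableEmbedding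
  rw [← hemb.integral_map, hmap, integral_smul_measure, hg,
    GaussianFourier.integral_cexp_neg_sum_mul_add (fun i => by norm_num)]
  simp only [Pi.zero_apply]
  have e3 : ((π : ℂ) / ((1 / 2 : ℝ) : ℂ)) ^ (1 / 2 : ℂ) = ((√(2 * π) : ℝ) : ℂ) := by
    rw [sqrt_eq_rpow, Complex.ofReal_cpow (by positivity)]
    push_cast
    congr 1
    ring
  rw [hdet, Real.sqrt_sq_eq_abs, ENNReal.toReal_ofReal (abs_nonneg _), abs_inv]
  simp only [e3]
  simp [div_eq_inv_mul]

theorem integral_gaussPoly_of_odd {N : ℕ} (M : Matrix (Fin N) (Fin N) ℝ)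
    {P : MvPolynomial (Fin N) ℂ} (hP : ∀ x : Fin N → ℝ, MvPolynomial.eval (fun i => ((-x) i : ℂ)) P =
      -MvPolynomial.eval (fun i => (x i : ℂ)) P) : ∫ x, gaussPoly M P x = 0 := by
  have h : ∀ x, gaussPoly M P (-x) = -gaussPoly M P x := fun x => by
    rw [gaussPoly, gaussPoly, hP, Matrix.mulVec_neg, neg_dotProduct_neg, mul_neg]
  have h1 := integral_neg_eq_self (gaussPoly M P) volume
  simp only [h, integral_neg] at h1
  exact self_eq_neg.1 h1.symm

/-! ### The terms of the Nahm sum along a ray -/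

namespace Datum

variable {N : ℕ} (Q : Datum N)

theorem sq_mul_quadR {s : ℝ} (hs : s ≠ 0) {n x y : Fin N → ℝ}
    (hn : ∀ i, s * n i = x i + y i / s) : s ^ 2 * Q.quadR n =
      1 / 2 * (x ⬝ᵥ Q.B.mulVec x) + (x ⬝ᵥ Q.B.mulVec y) / s +
        1 / 2 * (y ⬝ᵥ Q.B.mulVec y) / s ^ 2 + s * (x ⬝ᵥ fun i => (Q.b i : ℝ)) +
        (y ⬝ᵥ fun i => (Q.b i : ℝ)) + s ^ 2 * Q.c := by
  obtain rfl : n = s⁻¹ • (x + s⁻¹ • y) := by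
    funext i
    simp only [Pi.smul_apply, Pi.add_apply, smul_eq_mul]
    have := hn i
    field_simp at this ⊢
    linarith
  rw [quadR, Matrix.mulVec_smul, dotProduct_smul, smul_dotProduct, Q.quadForm_add,
    Matrix.mulVec_smul, dotProduct_smul, smul_dotProduct, smul_dotProduct, smul_dotProduct,
    add_dotProduct, smul_dotProduct, Q.B_mulVec_dotProduct_comm x y]
  simp only [smul_eq_mul]
  field_simp
  ring

theorem dotProduct_B_mulVec_saddle {z : Fin N → ℝ} (hz : Q.IsNahmSolution z) (x : Fin N → ℝ) :
    x ⬝ᵥ Q.B.mulVec (Q.saddle z) = -∑ i, x i * log (1 - z i) := by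
  rw [dotProduct, ← sum_neg_distrib]
  exact sum_congr rfl fun i _ => by rw [Q.B_mulVec_saddle hz]; ring

theorem saddle_pos {z : Fin N → ℝ} (hz : Q.IsNahmSolution z) (i : Fin N) : 0 < Q.saddle z i :=
  div_pos (neg_pos.2 (log_neg (hz.1 i).1 (hz.1 i).2)) (Q.d_pos' i)

theorem exp_neg_saddle {z : Fin N → ℝ} (hz : Q.IsNahmSolution z) (i : Fin N) :
    z i = rexp (-(Q.d i * Q.saddle z i)) := by
  rw [saddle, mul_div_cancel₀ _ (Q.d_pos' i).ne', neg_neg, exp_log (hz.1 i).1]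

/-- The value of `q ^ dᵢ` at `q = ζ exp(-s² / m)`. -/
noncomputable def rayBase (m : ℕ) (ζ : ℂ) (s : ℝ) (i : Fin N) : ℂ :=
  ζ ^ Q.d i * rexp (-(Q.d i * s ^ 2 / m))

/-- The term of the Nahm sum at `ε = s²`, without its phase and normalized by the exponential
growth. -/
noncomputable def rayTerm (m : ℕ) (ζ : ℂ) (z : Fin N → ℝ) (s : ℝ) (n : Fin N → ℕ) : ℂ :=
  (rexp (-(Q.Lam z / (m * s ^ 2)) - s ^ 2 * Q.quadR (fun i => (n i : ℝ)) / m) : ℝ) *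
    ∏ i, (qPoch (Q.rayBase m ζ s i) (Q.rayBase m ζ s i) (n i))⁻¹

theorem norm_rayBase_lt_one {m : ℕ} (hm : 0 < m) {ζ : ℂ} (hζ : ‖ζ‖ = 1) {s : ℝ} (hs : 0 < s)
    (i : Fin N) : ‖Q.rayBase m ζ s i‖ < 1 := by
  have hmR : (0 : ℝ) < m := by exact_mod_cast hm
  have := Q.d_pos' i
  rw [rayBase, norm_mul, norm_pow, hζ, one_pow, one_mul, norm_real,
    norm_of_nonneg (exp_pos _).le, exp_lt_one_iff, neg_lt_zero]
  positivity

theorem norm_dilog_le_dilog {r : ℝ} (hr : r < 1) {x : ℂ} (hx : ‖x‖ = r) :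
    ‖polylog 2 x‖ ≤ polylog 2 r := by
  have hr0 : 0 ≤ r := hx ▸ norm_nonneg x
  rw [polylog, polylog]
  refine tsum_of_norm_bounded (summable_polylog (𝕜 := ℝ) 2
    (by rwa [norm_of_nonneg hr0])).hasSum fun k => le_of_eq ?_
  rw [norm_div, norm_pow, hx, norm_zpow, Complex.norm_natCast]

theorem exists_norm_inv_qPoch_le {m : ℕ} (hm : 0 < m) {ζ : ℂ} (hζ : IsPrimitiveRoot ζ m) {d : ℕ}
    (hd : 0 < d) {z : ℝ} (hz : z ∈ Set.Ioo (0 : ℝ) 1) : ∃ C : ℝ, ∀ s : ℝ, 0 < s → ∀ n : ℕ,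
      ‖(qPoch (ζ * rexp (-(d * s ^ 2 / m))) (ζ * rexp (-(d * s ^ 2 / m))) n)⁻¹‖ ≤
        rexp (C + polylog 2 (1 - z) / d / (m * s ^ 2) - n * log (1 - z) / m) := by
  have hmR : (0 : ℝ) < m := by exact_mod_cast hm
  have hdR : (0 : ℝ) < d := by exact_mod_cast hd
  have h1z : 0 < 1 - z := by linarith [hz.2]
  set r : ℝ := rexp (log (1 - z) / m) with hr
  have hlog : log (1 - z) < 0 := log_neg h1z (by linarith [hz.1])
  have hr1 : r < 1 := Real.exp_lt_one_iff.2 (div_neg_of_neg_of_pos hlog hmR)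
  have hrm : r ^ m = 1 - z := by
    rw [hr, ← exp_nat_mul, mul_div_cancel₀ _ hmR.ne', exp_log h1z]
  obtain ⟨C, hC, hle⟩ := exists_norm_lq_sub_dilog_le hm hζ hr1
  refine ⟨C, fun s hs n => ?_⟩
  have hq : ‖ζ * (rexp (-(d * s ^ 2 / m)) : ℝ)‖ < 1 := by
    rw [norm_mul, hζ.norm'_eq_one hm.ne', one_mul, norm_real,
      norm_of_nonneg (exp_pos _).le, exp_lt_one_iff, neg_lt_zero]
    positivity
  refine (norm_inv_qPoch_le hq (exp_pos _) hr1
    (C := rexp (C + polylog 2 (1 - z) / d / (m * s ^ 2))) (fun x hx => ?_) n).trans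
      (le_of_eq ?_)
  · rw [norm_exp, exp_le_exp]
    have hh : ((d * s ^ 2 / m : ℝ) : ℂ) ≠ 0 := by
      have : 0 < d * s ^ 2 / m := by positivity
      exact_mod_cast this.ne'
    have h := hle ((d * s ^ 2 / m : ℝ) : ℂ) hh (by
      rw [norm_real, ofReal_re, norm_of_nonneg (by positivity)]
      have : 0 < d * s ^ 2 / m := by positivity
      linarith) x (le_of_eq hx)
    rw [← ofReal_neg, ← ofReal_exp] at h
    have h2 : ‖polylog 2 (x ^ m) / (m ^ 2 * ((d * s ^ 2 / m : ℝ) : ℂ))‖ ≤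
        polylog 2 (1 - z) / d / (m * s ^ 2) := by
      have e : ((m : ℂ) ^ 2 * ((d * s ^ 2 / m : ℝ) : ℂ)) = ((d * (m * s ^ 2) : ℝ) : ℂ) := by
        push_cast
        have : (m : ℂ) ≠ 0 := by exact_mod_cast hm.ne'
        field_simp
      rw [e, norm_div, norm_real, norm_of_nonneg (by positivity), div_div]
      gcongr
      exact norm_dilog_le_dilog (by linarith [hz.1]) (by rw [norm_pow, hx, ← hr, hrm])
    have h3 := re_le_norm (lq (ζ * (rexp (-(d * s ^ 2 / m)) : ℝ)) x)
    have h4 := norm_le_norm_add_norm_sub' (lq (ζ * (rexp (-(d * s ^ 2 / m)) : ℝ)) x)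
      (polylog 2 (x ^ m) / (m ^ 2 * ((d * s ^ 2 / m : ℝ) : ℂ)))
    linarith
  · rw [← exp_nat_mul, ← exp_neg, ← exp_add]
    congr 1; ring

/-- The Gaussian bound for the normalized terms. -/
theorem exists_norm_rayTerm_le {m : ℕ} (hm : 0 < m) {ζ : ℂ}
    (hζ : ∀ i, IsPrimitiveRoot (ζ ^ Q.d i) m) {z : Fin N → ℝ} (hz : Q.IsNahmSolution z) :
    ∃ c C : ℝ, 0 < c ∧ 0 < C ∧ ∀ s : ℝ, 0 < s → s ≤ 1 → ∀ (n : Fin N → ℕ) (x : Fin N → ℝ),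
      (∀ i, s * n i = x i + Q.saddle z i / s) →
      ‖Q.rayTerm m ζ z s n‖ ≤ C * rexp (-c * ‖x‖ ^ 2) := by
  have hmR : (0 : ℝ) < m := by exact_mod_cast hm
  obtain ⟨κ, hκ, hB⟩ := exists_mul_norm_sq_le_of_posDef Q.B_posDef
  choose E hE using fun i => exists_norm_inv_qPoch_le hm (hζ i) (Q.d_pos i) (hz.1 i)
  set S : ℝ := ∑ i, |(Q.b i : ℝ)| with hS
  set y := Q.saddle z with hy
  set C₀ : ℝ := S ^ 2 / κ + |y ⬝ᵥ fun i => (Q.b i : ℝ)| + |(Q.c : ℝ)| with hC₀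
  refine ⟨κ / (4 * m), rexp (C₀ / m + ∑ i, E i), by positivity, exp_pos _,
    fun s hs hs1 n x hn => ?_⟩
  have h1 : ‖Q.rayTerm m ζ z s n‖ ≤
      rexp (-(Q.Lam z / (m * s ^ 2)) - s ^ 2 * Q.quadR (fun i => (n i : ℝ)) / m) *
      rexp (∑ i, (E i + polylog 2 (1 - z i) / Q.d i / (m * s ^ 2) -
        n i * log (1 - z i) / m)) := by
    rw [rayTerm, norm_mul, norm_real, norm_of_nonneg (exp_pos _).le, norm_prod,
      exp_sum]
    gcongr with i
    exact hE i s hs (n i)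
  refine h1.trans ?_
  rw [← exp_add, ← exp_add, exp_le_exp]
  have hq := Q.sq_mul_quadR hs.ne' (n := fun i => (n i : ℝ)) hn
  have hsum : ∑ i, (E i + polylog 2 (1 - z i) / Q.d i / (m * s ^ 2) -
      n i * log (1 - z i) / m) = ∑ i, E i +
      (∑ i, polylog 2 (1 - z i) / Q.d i) / (m * s ^ 2) +
      ((x ⬝ᵥ Q.B.mulVec y) / s + (y ⬝ᵥ Q.B.mulVec y) / s ^ 2) / m := by
    rw [hy, Q.dotProduct_B_mulVec_saddle hz, Q.dotProduct_B_mulVec_saddle hz, sum_div,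
      ← sum_neg_distrib, ← sum_neg_distrib, sum_div, sum_div,
      ← sum_add_distrib, ← sum_add_distrib, sum_div,
      ← sum_add_distrib]
    refine sum_congr rfl fun i _ => ?_
    have : (n i : ℝ) = (x i + Q.saddle z i / s) / s := by
      rw [eq_div_iff hs.ne', mul_comm]; exact hn i
    rw [this]
    field_simp
    ring
  rw [hsum, hq, Q.Lam_eq hz, ← hy]
  have hb : ∀ w : Fin N → ℝ, |w ⬝ᵥ fun i => (Q.b i : ℝ)| ≤ S * ‖w‖ := fun w => by
    rw [dotProduct, hS, sum_mul]
    refine (abs_sum_le_sum_abs _ _).trans (sum_le_sum fun i _ => ?_)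
    rw [abs_mul, mul_comm]
    exact mul_le_mul_of_nonneg_left (norm_le_pi_norm w i) (abs_nonneg _)
  have hS0 : 0 ≤ S := sum_nonneg fun i _ => abs_nonneg _
  have h2 : -(s * (x ⬝ᵥ fun i => (Q.b i : ℝ))) ≤ κ / 4 * ‖x‖ ^ 2 + S ^ 2 / κ := by
    have ha : |s * (x ⬝ᵥ fun i => (Q.b i : ℝ))| ≤ S * ‖x‖ := by
      rw [abs_mul, abs_of_pos hs]
      have := hb x
      have h0 := abs_nonneg (x ⬝ᵥ fun i => (Q.b i : ℝ))
      nlinarith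
    have hsq : 0 ≤ (κ * ‖x‖ - 2 * S) ^ 2 / (4 * κ) := by positivity
    have e : (κ * ‖x‖ - 2 * S) ^ 2 / (4 * κ) = κ / 4 * ‖x‖ ^ 2 - S * ‖x‖ + S ^ 2 / κ := by
      field_simp; ring
    linarith [neg_abs_le (s * (x ⬝ᵥ fun i => (Q.b i : ℝ)))]
  have h3 : -(s ^ 2 * Q.c) ≤ |(Q.c : ℝ)| := by
    have : |s ^ 2 * (Q.c : ℝ)| ≤ |(Q.c : ℝ)| := by
      rw [abs_mul, abs_of_pos (by positivity)]
      exact mul_le_of_le_one_left (abs_nonneg _) (pow_le_one₀ hs.le hs1)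
    linarith [neg_abs_le (s ^ 2 * (Q.c : ℝ))]
  have h4 : -(1 / 2 * (x ⬝ᵥ Q.B.mulVec x)) - s * (x ⬝ᵥ fun i => (Q.b i : ℝ)) -
      (y ⬝ᵥ fun i => (Q.b i : ℝ)) - s ^ 2 * Q.c ≤ C₀ - κ / 4 * ‖x‖ ^ 2 := by
    have := hB x
    have h5 := neg_abs_le (y ⬝ᵥ fun i => (Q.b i : ℝ))
    rw [hC₀]
    linarith
  have h5 := div_le_div_of_nonneg_right h4 hmR.le
  have e1 : -((1 / 2 * (y ⬝ᵥ Q.B.mulVec y) + ∑ i, polylog 2 (1 - z i) / Q.d i) / (m * s ^ 2)) -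
      (1 / 2 * (x ⬝ᵥ Q.B.mulVec x) + (x ⬝ᵥ Q.B.mulVec y) / s +
        1 / 2 * (y ⬝ᵥ Q.B.mulVec y) / s ^ 2 + s * (x ⬝ᵥ fun i => (Q.b i : ℝ)) +
        (y ⬝ᵥ fun i => (Q.b i : ℝ)) + s ^ 2 * Q.c) / m +
      (∑ i, E i + (∑ i, polylog 2 (1 - z i) / Q.d i) / (m * s ^ 2) +
      ((x ⬝ᵥ Q.B.mulVec y) / s + (y ⬝ᵥ Q.B.mulVec y) / s ^ 2) / m) =
      (-(1 / 2 * (x ⬝ᵥ Q.B.mulVec x)) - s * (x ⬝ᵥ fun i => (Q.b i : ℝ)) -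
      (y ⬝ᵥ fun i => (Q.b i : ℝ)) - s ^ 2 * Q.c) / m + ∑ i, E i := by
    field_simp
    ring
  rw [e1]
  have e2 : C₀ / m + ∑ i, E i + -(κ / (4 * m)) * ‖x‖ ^ 2 =
      (C₀ - κ / 4 * ‖x‖ ^ 2) / m + ∑ i, E i := by
    field_simp
    ring
  rw [e2]
  linarith

end Datum

/-- The ratio of `1 / (q; q)_∞` at `q = 𝐞(p/m) exp(-ε/m)` and its asymptotic main term. -/
noncomputable def etaFactor (m : ℕ) (p : ℤ) (ε : ℝ) : ℂ :=
  cexp (lq (expi (p / m) * rexp (-(ε / m))) (expi (p / m) * rexp (-(ε / m)))) *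
    (expi ((-dedekindSum p m / 2 : ℚ) : ℂ) *
      (sqrt (2 * π / ε) * rexp (-(π ^ 2 / (6 * m * ε)) + ε / (24 * m)) : ℝ))

theorem etaFactor_mul (m : ℕ) (p : ℤ) {d : ℕ} (hd : 0 < d) {s : ℝ} (hs : 0 < s) :
    etaFactor m p (d * s ^ 2) *
      (expi ((dedekindSum p m / 2 : ℚ) : ℂ) * (√(d / (2 * π)) : ℝ) * s) =
      cexp (lq (expi (p / m) * rexp (-(d * s ^ 2 / m)))
        (expi (p / m) * rexp (-(d * s ^ 2 / m)))) *
        (rexp (-(π ^ 2 / (6 * m * (d * s ^ 2))) + d * s ^ 2 / (24 * m)) : ℝ) := by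
  have hdR : (0 : ℝ) < d := by exact_mod_cast hd
  have h1 : expi ((-dedekindSum p m / 2 : ℚ) : ℂ) * expi ((dedekindSum p m / 2 : ℚ) : ℂ) = 1 := by
    rw [← expi_add, ← Rat.cast_add, neg_div, neg_add_cancel, Rat.cast_zero, expi_zero]
  have h2 : √(2 * π / (d * s ^ 2)) * √(d / (2 * π)) * s = 1 := by
    have hpi := pi_pos
    rw [← sqrt_mul (by positivity)]
    have e : 2 * π / (d * s ^ 2) * (d / (2 * π)) = s⁻¹ ^ 2 := by field_simp
    rw [e, Real.sqrt_sq (by positivity), inv_mul_cancel₀ hs.ne']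
  have h3 : ((√(2 * π / (d * s ^ 2)) : ℝ) : ℂ) * (√(d / (2 * π)) : ℝ) * s = 1 := by
    exact_mod_cast h2
  rw [etaFactor, ofReal_mul]
  linear_combination (cexp (lq (expi (p / m) * rexp (-(d * s ^ 2 / m)))
        (expi (p / m) * rexp (-(d * s ^ 2 / m)))) *
        (rexp (-(π ^ 2 / (6 * m * (d * s ^ 2))) + d * s ^ 2 / (24 * m)) : ℝ)) *
      (((√(2 * π / (d * s ^ 2)) : ℝ) : ℂ) * (√(d / (2 * π)) : ℝ) * s * h1 + h3)

/-- `∑_{t=1}^m t log(1 - ζ^t w)`. -/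
noncomputable def weightedLog (m : ℕ) (ζ w : ℂ) : ℂ :=
  ∑ t ∈ Icc 1 m, (t : ℂ) * Complex.log (1 - ζ ^ t * w)

namespace Datum

variable {N : ℕ} (Q : Datum N)

/-- The matrix of the formal Gaussian integral. -/
noncomputable def gaussMat (m : ℕ) (z : Fin N → ℝ) : Matrix (Fin N) (Fin N) ℝ :=
  (1 / m : ℝ) • (Q.Atilde z * Q.D.map fun a => (a : ℝ))

theorem gaussMat_eq (m : ℕ) (z : Fin N → ℝ) : Q.gaussMat m z =
    (1 / m : ℝ) • (Q.B + Matrix.diagonal fun i => Q.d i * z i / (1 - z i)) := by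
  have hD : (Q.D.map fun a => (a : ℝ)) = Matrix.diagonal fun i => (Q.d i : ℝ) := by
    ext i j
    rcases eq_or_ne i j with rfl | h
    · simp [D]
    · simp [D, h]
  rw [gaussMat, hD]
  congr 1
  ext i j
  rw [Matrix.mul_diagonal, Matrix.add_apply, B_apply, Atilde, Matrix.add_apply, Matrix.map_apply]
  rcases eq_or_ne i j with rfl | h
  · rw [Matrix.diagonal_apply_eq, Matrix.diagonal_apply_eq]; ring
  · rw [Matrix.diagonal_apply_ne _ h, Matrix.diagonal_apply_ne _ h]; ring

theorem gaussMat_posDef {m : ℕ} (hm : 0 < m) {z : Fin N → ℝ} (hz : Q.IsNahmSolution z) :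
    (Q.gaussMat m z).PosDef := by
  have hmR : (0 : ℝ) < m := by exact_mod_cast hm
  rw [gaussMat_eq]
  refine Matrix.PosDef.smul (Q.B_posDef.add (Matrix.PosDef.diagonal fun i => ?_)) (by positivity)
  have := hz.1 i
  exact div_pos (mul_pos (Q.d_pos' i) this.1) (by linarith)

theorem dotProduct_gaussMat (m : ℕ) (z x : Fin N → ℝ) : x ⬝ᵥ (Q.gaussMat m z).mulVec x =
    (x ⬝ᵥ Q.B.mulVec x + ∑ i, x i ^ 2 * (Q.d i * z i) / (1 - z i)) / m := by
  rw [gaussMat_eq, Matrix.smul_mulVec, dotProduct_smul, Matrix.add_mulVec, dotProduct_add,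
    smul_eq_mul]
  have : x ⬝ᵥ (Matrix.diagonal fun i => Q.d i * z i / (1 - z i)).mulVec x =
      ∑ i, x i ^ 2 * (Q.d i * z i) / (1 - z i) := by
    rw [dotProduct]
    refine sum_congr rfl fun i _ => ?_
    rw [Matrix.mulVec_diagonal]; ring
  rw [this]; ring

/-- The constant factor of the terms along a ray. -/
noncomputable def rayConst (m : ℕ) (z : Fin N → ℝ) (p : Fin N → ℤ) : ℂ :=
  (∏ i, expi ((dedekindSum (p i) m / 2 : ℚ) : ℂ) * (√(Q.d i / (2 * π)) : ℝ)) *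
    ((rexp (-(Q.saddle z ⬝ᵥ fun i => (Q.b i : ℝ)) / m) : ℝ) * ∏ i, (√(1 - z i) : ℝ))

/-- The factor of the terms along a ray that depends on the residue class. -/
noncomputable def classFactor (m : ℕ) (ζ : ℂ) (z : Fin N → ℝ) (k : Fin N → ℕ) : ℂ :=
  ∏ i, cexp (-weightedLog m (ζ ^ Q.d i)
    ((ζ ^ Q.d i) ^ k i * ((z i ^ (1 / m : ℝ) : ℝ) : ℂ)) / m)

theorem sum_dilog {z : Fin N → ℝ} (hz : Q.IsNahmSolution z) :
    ∑ i, polylog 2 (z i) / Q.d i + ∑ i, polylog 2 (1 - z i) / Q.d i =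
      ∑ i, π ^ 2 / 6 / Q.d i - Q.saddle z ⬝ᵥ Q.B.mulVec (Q.saddle z) := by
  rw [Q.dotProduct_B_mulVec_saddle hz, ← sum_add_distrib, sub_neg_eq_add,
    ← sum_add_distrib]
  refine sum_congr rfl fun i _ => ?_
  rw [← add_div, dilog_add_dilog_one_sub (hz.1 i), saddle]
  ring

theorem ray_exponent_eq {m : ℕ} (hm : 0 < m) {z : Fin N → ℝ} (hz : Q.IsNahmSolution z) {s : ℝ}
    (hs : 0 < s) {n x : Fin N → ℝ} (hn : ∀ i, s * n i = x i + Q.saddle z i / s) :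
    -(Q.Lam z / (m * s ^ 2)) - s ^ 2 * Q.quadR n / m -
      ∑ i, (polylog 2 (z i) / (m * (Q.d i * s ^ 2)) - (1 / 2 - x i / s / m) * log (1 - z i) +
        x i ^ 2 * (Q.d i * z i) / (2 * m * (1 - z i))) =
    ∑ i, (-(π ^ 2 / (6 * m * (Q.d i * s ^ 2))) + Q.d i * s ^ 2 / (24 * m)) +
      -(Q.saddle z ⬝ᵥ fun i => (Q.b i : ℝ)) / m + ∑ i, 1 / 2 * log (1 - z i) +
      (-(1 / 2) * (x ⬝ᵥ (Q.gaussMat m z).mulVec x)) +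
      (-(s * ∑ i, (1 / m * Q.b i) * x i) - s ^ 2 * (1 / m * (Q.c + (∑ i, (Q.d i : ℝ)) / 24))) := by
  have hmR : (0 : ℝ) < m := by exact_mod_cast hm
  have hq := Q.sq_mul_quadR hs.ne' hn
  have hΛ := Q.Lam_eq hz
  have hd := Q.sum_dilog hz
  have hx := Q.dotProduct_B_mulVec_saddle hz x
  have e1 : ∑ i, (polylog 2 (z i) / (m * (Q.d i * s ^ 2)) -
      (1 / 2 - x i / s / m) * log (1 - z i) + x i ^ 2 * (Q.d i * z i) / (2 * m * (1 - z i))) =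
      (∑ i, polylog 2 (z i) / Q.d i) / (m * s ^ 2) - ∑ i, 1 / 2 * log (1 - z i) +
      (∑ i, x i * log (1 - z i)) / (s * m) +
      (∑ i, x i ^ 2 * (Q.d i * z i) / (1 - z i)) / (2 * m) := by
    simp only [sum_div]
    rw [← sum_sub_distrib, ← sum_add_distrib, ← sum_add_distrib]
    refine sum_congr rfl fun i _ => ?_
    have h1 : 1 - z i ≠ 0 := by linarith [(hz.1 i).2]
    have h2 := (Q.d_pos' i).ne'
    field_simp
    ring
  have e2 : ∑ i, (-(π ^ 2 / (6 * m * (Q.d i * s ^ 2))) + Q.d i * s ^ 2 / (24 * m)) =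
      -(∑ i, π ^ 2 / 6 / Q.d i) / (m * s ^ 2) + (∑ i, (Q.d i : ℝ)) * s ^ 2 / (24 * m) := by
    rw [sum_mul, sum_div, ← sum_neg_distrib, sum_div,
      ← sum_add_distrib]
    refine sum_congr rfl fun i _ => ?_
    have h2 := (Q.d_pos' i).ne'
    field_simp
  have e3 : ∑ i, (1 / m * Q.b i : ℝ) * x i = (x ⬝ᵥ fun i => (Q.b i : ℝ)) / m := by
    rw [dotProduct, sum_div]
    exact sum_congr rfl fun i _ => by ring
  rw [e1, e2, e3, hq, hΛ, dotProduct_gaussMat, hx]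
  rw [eq_sub_iff_add_eq] at hd
  rw [← hd]
  field_simp
  ring

/-- The exact form of the terms along a ray. -/
theorem rayTerm_eq {m : ℕ} (hm : 0 < m) {ζ : ℂ} (hζ : ‖ζ‖ = 1) {z : Fin N → ℝ}
    (hz : Q.IsNahmSolution z) {p : Fin N → ℤ} (hp : ∀ i, ζ ^ Q.d i = expi (p i / m))
    (k n : Fin N → ℕ) {s : ℝ} (hs : 0 < s) {x : Fin N → ℝ}
    (hn : ∀ i, s * n i = x i + Q.saddle z i / s) : Q.rayTerm m ζ z s n =
      (∏ i, etaFactor m (p i) (Q.d i * s ^ 2)) *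
        (Q.rayConst m z p * s ^ N * Q.classFactor m ζ z k) *
        ((rexp (-(1 / 2) * (x ⬝ᵥ (Q.gaussMat m z).mulVec x)) : ℝ) *
          Q.integrandVal m ζ z k s x n) := by
  have hmC : (m : ℂ) ≠ 0 := by exact_mod_cast hm.ne'
  set L : Fin N → ℂ := fun i => lq (Q.rayBase m ζ s i) (Q.rayBase m ζ s i) with hL
  set Ψ : Fin N → ℂ := fun i => psiRem m (Q.d i) (k i) (ζ ^ Q.d i) (z i) s (x i) (n i) with hΨ
  set E : Fin N → ℂ := fun i => weightedLog m (ζ ^ Q.d i)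
    ((ζ ^ Q.d i) ^ k i * ((z i ^ (1 / m : ℝ) : ℝ) : ℂ)) with hE
  set t : Fin N → ℝ := fun i => polylog 2 (z i) / (m * (Q.d i * s ^ 2)) -
    (1 / 2 - x i / s / m) * log (1 - z i) + x i ^ 2 * (Q.d i * z i) / (2 * m * (1 - z i))
    with ht
  have hpoch : ∀ i, (qPoch (Q.rayBase m ζ s i) (Q.rayBase m ζ s i) (n i))⁻¹ =
      cexp (L i) * cexp (Ψ i - E i / m - t i) := fun i => by
    rw [inv_qPoch_self (Q.norm_rayBase_lt_one hm hζ hs i)]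
    congr 2
    simp only [hΨ, psiRem, hE, weightedLog, ht, rayBase]
    push_cast
    rw [polylog_ofReal]
    ring
  have heta : (∏ i, etaFactor m (p i) (Q.d i * s ^ 2)) * ((∏ i, expi ((dedekindSum (p i) m / 2 : ℚ) : ℂ) *
      (√(Q.d i / (2 * π)) : ℝ)) * s ^ N) = cexp (∑ i, L i) *
      cexp ((∑ i, (-(π ^ 2 / (6 * m * (Q.d i * s ^ 2))) + Q.d i * s ^ 2 / (24 * m)) : ℝ) : ℂ) := by
    have : (s : ℂ) ^ N = ∏ _i : Fin N, (s : ℂ) := by simp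
    rw [this, ← prod_mul_distrib, ← prod_mul_distrib, Complex.exp_sum,
      ofReal_sum, Complex.exp_sum, ← prod_mul_distrib]
    refine prod_congr rfl fun i _ => ?_
    rw [etaFactor_mul m (p i) (Q.d_pos i) hs, ← hp i, ← ofReal_exp]
    rfl
  have hsqrt : ∏ i, ((√(1 - z i) : ℝ) : ℂ) =
      cexp ((∑ i, 1 / 2 * log (1 - z i) : ℝ) : ℂ) := by
    rw [ofReal_sum, Complex.exp_sum]
    refine prod_congr rfl fun i _ => ?_
    have h1 : 0 < 1 - z i := by linarith [(hz.1 i).2]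
    rw [← ofReal_exp, sqrt_eq_rpow, rpow_def_of_pos h1, mul_comm]
  have hcl : Q.classFactor m ζ z k = cexp (∑ i, -E i / m) := by
    rw [classFactor, Complex.exp_sum]
  have hlin : cexp (-(s * ∑ i, (1 / m * Q.b i : ℂ) * x i) -
      s ^ 2 * (1 / m * (Q.c + (∑ i, (Q.d i : ℂ)) / 24))) =
      cexp ((-(s * ∑ i, (1 / m * Q.b i) * x i) -
        s ^ 2 * (1 / m * (Q.c + (∑ i, (Q.d i : ℝ)) / 24)) : ℝ) : ℂ) := by
    push_cast; rfl
  have hexp := congrArg (fun r : ℝ => cexp (r : ℂ))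
    (Q.ray_exponent_eq hm hz hs (n := fun i => (n i : ℝ)) hn)
  simp only [ofReal_add, Complex.exp_add] at hexp
  have hint : Q.integrandVal m ζ z k s x n = cexp ((-(s * ∑ i, (1 / m * Q.b i) * x i) -
        s ^ 2 * (1 / m * (Q.c + (∑ i, (Q.d i : ℝ)) / 24)) : ℝ) : ℂ) * cexp (∑ i, Ψ i) := by
    rw [integrandVal, hlin, Complex.exp_sum]
  have hprod : ∏ i, (qPoch (Q.rayBase m ζ s i) (Q.rayBase m ζ s i) (n i))⁻¹ =
      cexp (∑ i, L i) * (cexp (∑ i, Ψ i) * cexp (∑ i, -E i / m) *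
        cexp ((-∑ i, t i : ℝ) : ℂ)) := by
    rw [prod_congr rfl fun i _ => hpoch i, prod_mul_distrib, ← Complex.exp_sum,
      ← Complex.exp_sum]
    congr 1
    rw [← Complex.exp_add, ← Complex.exp_add]
    congr 1
    rw [ofReal_neg, ofReal_sum, ← sum_neg_distrib, ← sum_add_distrib,
      ← sum_add_distrib]
    exact sum_congr rfl fun i _ => by ring
  have hsplit : cexp ((-(Q.Lam z / (m * s ^ 2)) - s ^ 2 * Q.quadR (fun i => (n i : ℝ)) / m -
      ∑ i, t i : ℝ) : ℂ) = cexp ((-(Q.Lam z / (m * s ^ 2)) -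
        s ^ 2 * Q.quadR (fun i => (n i : ℝ)) / m : ℝ) : ℂ) *
      cexp ((-∑ i, t i : ℝ) : ℂ) := by
    rw [← Complex.exp_add, ← ofReal_add, sub_eq_add_neg _ (∑ i, t i)]
  rw [hsplit] at hexp
  rw [rayTerm, hprod, rayConst, ofReal_prod, hsqrt, hcl, hint]
  simp only [ofReal_exp]
  linear_combination (cexp (∑ i, L i) * cexp (∑ i, Ψ i) *
    cexp (∑ i, -E i / m)) * hexp -
    (cexp ((-(Q.saddle z ⬝ᵥ fun i => (Q.b i : ℝ)) / m : ℝ) : ℂ) *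
      cexp ((∑ i, 1 / 2 * log (1 - z i) : ℝ) : ℂ) *
      cexp (∑ i, -E i / m) *
      (cexp ((-(1 / 2) * (x ⬝ᵥ (Q.gaussMat m z).mulVec x) : ℝ) : ℂ) *
      (cexp ((-(s * ∑ i, (1 / m * Q.b i) * x i) -
        s ^ 2 * (1 / m * (Q.c + (∑ i, (Q.d i : ℝ)) / 24)) : ℝ) : ℂ) *
        cexp (∑ i, Ψ i)))) * heta

end Datum

/-! ### Comparison of the terms with their expansion -/

theorem exists_exp_neg_le_pow {c ρ : ℝ} (hc : 0 < c) (hρ : 0 < ρ) (J : ℕ) : ∃ C : ℝ, 0 < C ∧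
    ∀ s t : ℝ, 0 < s → 0 ≤ t → ρ ≤ s * (1 + t) ^ 3 →
      rexp (-c * t ^ 2) ≤ C * s ^ J * rexp (-(c / 2) * t ^ 2) := by
  obtain ⟨C, hC, h⟩ := exists_one_add_pow_le (show 0 < c / 2 by positivity) (3 * J)
  refine ⟨C / ρ ^ J, by positivity, fun s t hs ht hst => ?_⟩
  have h1 : ρ ^ J ≤ s ^ J * (C * rexp (c / 2 * t ^ 2)) := by
    calc ρ ^ J ≤ (s * (1 + t) ^ 3) ^ J := by gcongr
      _ = s ^ J * (1 + t) ^ (3 * J) := by rw [mul_pow, ← pow_mul]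
      _ ≤ _ := by gcongr; exact h t ht
  have h2 : rexp (-c * t ^ 2) = rexp (-(c / 2) * t ^ 2) * (rexp (c / 2 * t ^ 2))⁻¹ := by
    rw [← exp_neg, ← exp_add]; congr 1; ring
  rw [h2, mul_comm (C / ρ ^ J * s ^ J)]
  refine mul_le_mul_of_nonneg_left ?_ (exp_pos _).le
  rw [inv_le_iff_one_le_mul₀ (exp_pos _), div_mul_eq_mul_div, div_mul_eq_mul_div,
    one_le_div (by positivity)]
  linarith

theorem exists_norm_sum_gaussPoly_le {N : ℕ} {M : Matrix (Fin N) (Fin N) ℝ} (hM : M.PosDef)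
    (P : ℕ → MvPolynomial (Fin N) ℂ) (K : ℕ) : ∃ c C : ℝ, 0 < c ∧ 0 < C ∧ ∀ s : ℝ, 0 < s → s ≤ 1 →
      ∀ x : Fin N → ℝ, ‖∑ e ∈ range K, (s : ℂ) ^ e * gaussPoly M (P e) x‖ ≤
        C * rexp (-c * ‖x‖ ^ 2) := by
  obtain ⟨c, hc, hle⟩ := exists_norm_gaussPoly_le hM
  choose C hC hCle using hle
  have h0 : 0 ≤ ∑ e ∈ range K, C (P e) := sum_nonneg fun e _ => (hC _).le
  refine ⟨c, ∑ e ∈ range K, C (P e) + 1, hc, by positivity, fun s hs hs1 x => ?_⟩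
  refine (norm_sum_le _ _).trans ((sum_le_sum fun e _ => ?_).trans
    (b := ∑ e ∈ range K, C (P e) * rexp (-c * ‖x‖ ^ 2)) ?_)
  · rw [norm_mul, norm_pow, norm_real, norm_of_nonneg hs.le]
    refine (mul_le_of_le_one_left (norm_nonneg _) (pow_le_one₀ hs.le hs1)).trans (hCle _ _)
  · rw [← sum_mul]
    exact mul_le_mul_of_nonneg_right (by linarith) (exp_pos _).le

theorem prod_etaFactor_isBigO {N m : ℕ} (hm : 0 < m) {p : Fin N → ℤ}
    (hp : ∀ i, IsCoprime (p i) m) (hζ : ∀ i, IsPrimitiveRoot (expi (p i / m)) m) {d : Fin N → ℕ}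
    (hd : ∀ i, 0 < d i) (K : ℕ) :
    (fun s : ℝ => ∏ i, etaFactor m (p i) (d i * s ^ 2) - 1) =O[𝓝[>] 0] fun s => s ^ K := by
  have hρ : ∀ᶠ s : ℝ in 𝓝[>] 0, 0 ≤ s ∧ s ≤ 1 := by
    filter_upwards [Ioo_mem_nhdsGT (zero_lt_one (α := ℝ))] with s hs
    exact ⟨hs.1.le, hs.2.le⟩
  have h1 : ∀ i (K : ℕ), (fun s : ℝ => etaFactor m (p i) (d i * s ^ 2) - 1) =O[𝓝[>] 0]
      fun s => s ^ K := by
    intro i K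
    have hdR : (0 : ℝ) < d i := by exact_mod_cast hd i
    have ht : Tendsto (fun s : ℝ => d i * s ^ 2) (𝓝[>] 0) (𝓝[>] 0) := by
      refine tendsto_nhdsWithin_iff.2 ⟨?_, ?_⟩
      · have : Tendsto (fun s : ℝ => d i * s ^ 2) (𝓝 0) (𝓝 (d i * 0 ^ 2)) :=
          (continuous_const.mul (continuous_pow 2)).tendsto 0
        simp only [ne_eq, OfNat.ofNat_ne_zero, not_false_eq_true, zero_pow, mul_zero] at this
        exact this.mono_left nhdsWithin_le_nhds
      · filter_upwards [self_mem_nhdsWithin] with s hs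
        have : 0 < s := hs
        exact mul_pos hdR (by positivity)
    refine ((eulerProduct_asymptotic hm (hp i) (hζ i) K).comp_tendsto ht).trans ?_
    refine IsBigO.of_bound ((d i : ℝ) ^ K) ?_
    filter_upwards [hρ] with s hs
    have := hs.1
    simp only [Function.comp_apply]
    rw [norm_of_nonneg (by positivity), norm_of_nonneg (by positivity), mul_pow]
    refine mul_le_mul_of_nonneg_left ?_ (by positivity)
    calc (s ^ 2) ^ K = s ^ K * s ^ K := by rw [← pow_mul, ← pow_add]; congr 1; ring
      _ ≤ s ^ K := mul_le_of_le_one_left (by positivity) (pow_le_one₀ hs.1 hs.2)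
  have h2 : ∀ i ∈ univ, HasExp (𝓝[>] (0 : ℝ)) (fun s => s)
      (fun s => etaFactor m (p i) (d i * s ^ 2)) fun _ => 1 := by
    intro i _ K
    have h := (h1 i K).add (HasExp.one (l := 𝓝[>] (0 : ℝ)) (ρ := fun s => s) K)
    exact h.congr_left fun s => by ring
  have h3 := HasExp.prod hρ univ h2 (K + 1)
  simp only [Finset.prod_const_one, sum_range_succ', coeff_one, Nat.add_eq_zero_iff,
    one_ne_zero, and_false, if_false, Finset.sum_const_zero, if_true, zero_add] at h3
  exact h3.trans (isBigO_pow_of_le hρ (Nat.le_succ K))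

namespace Datum

variable {N : ℕ} (Q : Datum N)

/-- The truncation of the expansion of the Gaussian times the integrand. -/
noncomputable def rayApprox (m : ℕ) (ζ : ℂ) (z : Fin N → ℝ) (k : Fin N → ℕ) (K : ℕ) (s : ℝ)
    (x : Fin N → ℝ) : ℂ :=
  ∑ e ∈ range K, (s : ℂ) ^ e *
    gaussPoly (Q.gaussMat m z) (coeff e (Q.integrand m ζ z k)) x

/-- The comparison of the integrand with its expansion near the saddle point. -/
theorem exists_norm_integrandVal_sub_le {m : ℕ} (hm : 0 < m) {ζ : ℂ}
    (hζ : ∀ i, IsPrimitiveRoot (ζ ^ Q.d i) m) {z : Fin N → ℝ} (hz : Q.IsNahmSolution z)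
    (k : Fin N → ℕ) (K : ℕ) : ∃ c C ρ : ℝ, 0 < c ∧ 0 < C ∧ 0 < ρ ∧ (∀ i, ρ ≤ Q.saddle z i) ∧
      ∀ s : ℝ, 0 < s → ∀ (n : Fin N → ℕ) (x : Fin N → ℝ), (∀ i, n i % m = k i % m) →
      (∀ i, s * n i = x i + Q.saddle z i / s) → s * (1 + ‖x‖) ^ 3 ≤ ρ →
      ‖(rexp (-(1 / 2) * (x ⬝ᵥ (Q.gaussMat m z).mulVec x)) : ℝ) *
        Q.integrandVal m ζ z k s x n - Q.rayApprox m ζ z k K s x‖ ≤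
        C * s ^ K * rexp (-c * ‖x‖ ^ 2) := by
  have hmR : (1 : ℝ) ≤ m := by exact_mod_cast hm
  obtain ⟨ρ, hρ0, hρ1, hρ⟩ : ∃ ρ : ℝ, 0 < ρ ∧ ρ ≤ 1 ∧
      ∀ i, Q.d i * ρ ≤ 1 ∧ ρ ≤ Q.saddle z i / (2 * m) := by
    have : ∀ᶠ ρ : ℝ in 𝓝[>] 0, ρ ≤ 1 ∧ ∀ i, Q.d i * ρ ≤ 1 ∧ ρ ≤ Q.saddle z i / (2 * m) := by
      refine (eventually_nhdsWithin_of_eventually_nhds (eventually_le_nhds one_pos)).and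
        (eventually_all.2 fun i => ?_)
      have hd := Q.d_pos' i
      have hy := Q.saddle_pos hz i
      filter_upwards [eventually_nhdsWithin_of_eventually_nhds
          (eventually_le_nhds (show (0 : ℝ) < 1 / Q.d i by positivity)),
        eventually_nhdsWithin_of_eventually_nhds
          (eventually_le_nhds (show (0 : ℝ) < Q.saddle z i / (2 * m) by positivity))] with ρ h1 h2
      rw [le_div_iff₀ hd, mul_comm] at h1
      exact ⟨h1, h2⟩
    obtain ⟨ρ, h, h0⟩ := (this.and self_mem_nhdsWithin).exists
    exact ⟨ρ, h0, h⟩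
  set X : ℝ × (Fin N → ℕ) → Fin N → ℝ := fun p i => p.1 * p.2 i - Q.saddle z i / p.1 with hX
  set Ω : Set (ℝ × (Fin N → ℕ)) := {p | 0 < p.1 ∧ p.1 * (1 + ‖X p‖) ^ 3 ≤ ρ ∧
    ∀ i, p.2 i % m = k i % m} with hΩ
  have hexp := Q.hasExp_integrand (l := 𝓟 Ω) (ρ := fun p => p.1 * (1 + ‖X p‖) ^ 3)
    (s := fun p => p.1) (x := X) (n := fun p => p.2) hm hζ (y := Q.saddle z) k (Q.saddle_pos hz)
    (Q.exp_neg_saddle hz)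
    (eventually_principal.2 fun p hp => by
      have h0 := hp.1
      refine ⟨by positivity, hp.2.1.trans hρ1, fun i => ⟨?_, hp.2.1.trans (hρ i).2⟩⟩
      exact (mul_le_mul_of_nonneg_left hp.2.1 (Nat.cast_nonneg _)).trans (hρ i).1)
    (eventually_principal.2 fun p hp => ⟨hp.1, le_rfl⟩)
    (eventually_principal.2 fun p hp i => ⟨hp.2.2 i, by simp only [hX]; ring⟩) K
  obtain ⟨C, hC⟩ := isBigO_principal.1 hexp
  obtain ⟨c, hc, hM⟩ := exists_mul_norm_sq_le_of_posDef (Q.gaussMat_posDef hm hz)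
  obtain ⟨C', hC', hJ⟩ := exists_one_add_pow_le (show 0 < c / 4 by positivity) (3 * K)
  refine ⟨c / 4, (|C| + 1) * C', ρ, by positivity, by positivity, hρ0, fun i => ?_,
    fun s hs n x hnk hn hsx => ?_⟩
  · refine (hρ i).2.trans (div_le_self (Q.saddle_pos hz i).le (by linarith))
  obtain rfl : x = X (s, n) := by
    funext i
    simp only [hX]
    linarith [hn i]
  have h := hC (s, n) ⟨hs, hsx, hnk⟩
  simp only [coeff_spec] at h
  set x := X (s, n)
  have hx0 := norm_nonneg x
  rw [norm_of_nonneg (by positivity)] at h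
  have e : (rexp (-(1 / 2) * (x ⬝ᵥ (Q.gaussMat m z).mulVec x)) : ℝ) *
      Q.integrandVal m ζ z k s x n - Q.rayApprox m ζ z k K s x =
      (rexp (-(1 / 2) * (x ⬝ᵥ (Q.gaussMat m z).mulVec x)) : ℝ) *
      (Q.integrandVal m ζ z k s x n - ∑ e ∈ range K, (s : ℂ) ^ e *
        MvPolynomial.eval (fun i => (x i : ℂ)) (coeff e (Q.integrand m ζ z k))) := by
    rw [mul_sub, rayApprox, mul_sum]
    congr 1
    refine sum_congr rfl fun e _ => ?_
    rw [gaussPoly]; ring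
  rw [e, norm_mul, norm_real, norm_of_nonneg (exp_pos _).le]
  calc _ ≤ rexp (-(c / 2) * ‖x‖ ^ 2) * ((|C| + 1) * (s * (1 + ‖x‖) ^ 3) ^ K) := by
        refine mul_le_mul (Real.exp_le_exp.2 (by linarith [hM x])) (h.trans ?_) (norm_nonneg _)
          (exp_pos _).le
        gcongr
        linarith [le_abs_self C]
    _ = (|C| + 1) * s ^ K * (rexp (-(c / 2) * ‖x‖ ^ 2) * (1 + ‖x‖) ^ (3 * K)) := by
        rw [mul_pow, ← pow_mul]; ring
    _ ≤ (|C| + 1) * s ^ K * (rexp (-(c / 2) * ‖x‖ ^ 2) *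
          (C' * rexp (c / 4 * ‖x‖ ^ 2))) := by
        gcongr
        exact hJ _ hx0
    _ = (|C| + 1) * C' * s ^ K * (rexp (-(c / 2) * ‖x‖ ^ 2) * rexp (c / 4 * ‖x‖ ^ 2)) := by
        ring
    _ = _ := by rw [← exp_add]; congr 2; ring

/-- The comparison of the normalized terms with their expansion. The terms with a negative index
are zero. -/
theorem exists_norm_rayTerm_sub_le {m : ℕ} (hm : 0 < m) {ζ : ℂ} (hζ1 : ‖ζ‖ = 1)
    (hζ : ∀ i, IsPrimitiveRoot (ζ ^ Q.d i) m) {z : Fin N → ℝ} (hz : Q.IsNahmSolution z)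
    {p : Fin N → ℤ} (hp : ∀ i, ζ ^ Q.d i = expi (p i / m)) (hpm : ∀ i, IsCoprime (p i) m)
    (k : Fin N → ℕ) (K : ℕ) : ∃ c C s₀ : ℝ, 0 < c ∧ 0 < C ∧ 0 < s₀ ∧ s₀ ≤ 1 ∧
      ∀ s : ℝ, 0 < s → s ≤ s₀ → ∀ x : Fin N → ℝ,
      (∀ n : Fin N → ℕ, (∀ i, n i % m = k i % m) → (∀ i, s * n i = x i + Q.saddle z i / s) →
        ‖Q.rayTerm m ζ z s n - Q.rayConst m z p * s ^ N * Q.classFactor m ζ z k *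
          Q.rayApprox m ζ z k K s x‖ ≤ C * s ^ (N + K) * rexp (-c * ‖x‖ ^ 2)) ∧
      ((∃ i, x i + Q.saddle z i / s < 0) →
        ‖Q.rayConst m z p * s ^ N * Q.classFactor m ζ z k * Q.rayApprox m ζ z k K s x‖ ≤
          C * s ^ (N + K) * rexp (-c * ‖x‖ ^ 2)) := by
  obtain ⟨c₁, C₁, ρ, hc₁, hC₁, hρ, hρy, h₁⟩ := Q.exists_norm_integrandVal_sub_le hm hζ hz k K
  obtain ⟨c₂, C₂, hc₂, hC₂, h₂⟩ := exists_norm_sum_gaussPoly_le (Q.gaussMat_posDef hm hz)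
    (fun e => coeff e (Q.integrand m ζ z k)) K
  obtain ⟨c₃, C₃, hc₃, hC₃, h₃⟩ := Q.exists_norm_rayTerm_le hm hζ hz
  obtain ⟨C₄, h₄⟩ := (prod_etaFactor_isBigO hm hpm (fun i => hp i ▸ hζ i) Q.d_pos K).bound
  obtain ⟨s₀, hs₀, h₄⟩ := mem_nhdsGT_iff_exists_Ioc_subset.1 h₄
  obtain ⟨C₅, hC₅, h₅⟩ := exists_exp_neg_le_pow hc₂ hρ (N + K)
  obtain ⟨C₆, hC₆, h₆⟩ := exists_exp_neg_le_pow hc₃ hρ (N + K)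
  set A : ℝ := ‖Q.rayConst m z p * Q.classFactor m ζ z k‖ with hA
  set c : ℝ := min (min c₁ (c₂ / 2)) (c₃ / 2) with hcdef
  have hc : 0 < c := by positivity
  have hexp : ∀ c' t : ℝ, c ≤ c' → rexp (-c' * t ^ 2) ≤ rexp (-c * t ^ 2) := by
    intro c' t h
    rw [exp_le_exp]
    nlinarith [sq_nonneg t]
  have hcc₁ : c ≤ c₁ := (min_le_left _ _).trans (min_le_left _ _)
  have hcc₂ : c ≤ c₂ / 2 := (min_le_left _ _).trans (min_le_right _ _)
  have hcc₃ : c ≤ c₃ / 2 := min_le_right _ _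
  have hA0 : 0 ≤ A := norm_nonneg _
  have hAs : ∀ s : ℝ, 0 < s → ∀ w : ℂ, ‖Q.rayConst m z p * s ^ N * Q.classFactor m ζ z k * w‖ =
      A * s ^ N * ‖w‖ := by
    intro s hs w
    rw [hA, norm_mul, norm_mul, norm_mul, norm_mul, norm_pow, norm_real,
      norm_of_nonneg hs.le]
    ring
  have hfar : ∀ s : ℝ, 0 < s → s ≤ 1 → ∀ x : Fin N → ℝ, ρ ≤ s * (1 + ‖x‖) ^ 3 →
      ‖Q.rayConst m z p * s ^ N * Q.classFactor m ζ z k * Q.rayApprox m ζ z k K s x‖ ≤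
        A * C₂ * C₅ * s ^ (N + K) * rexp (-c * ‖x‖ ^ 2) := by
    intro s hs hs1 x hx
    rw [hAs s hs]
    calc A * s ^ N * ‖Q.rayApprox m ζ z k K s x‖
        ≤ A * 1 * (C₂ * (C₅ * s ^ (N + K) * rexp (-c * ‖x‖ ^ 2))) := by
          gcongr
          · exact pow_le_one₀ hs.le hs1
          · refine (h₂ s hs hs1 x).trans ?_
            gcongr
            refine (h₅ s ‖x‖ hs (norm_nonneg x) hx).trans ?_
            gcongr
      _ = _ := by ring
  refine ⟨c, A * C₂ * C₅ + C₃ * C₆ + (|C₄| * A * (C₂ + C₁) + A * C₁) + 1, min s₀ 1, hc,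
    by positivity, lt_min hs₀ one_pos, min_le_right _ _, fun s hs hss x => ⟨fun n hnk hn => ?_,
      fun hneg => ?_⟩⟩
  · have hs1 : s ≤ 1 := hss.trans (min_le_right _ _)
    by_cases hx : s * (1 + ‖x‖) ^ 3 ≤ ρ
    · have hη := h₄ ⟨hs, hss.trans (min_le_left _ _)⟩
      simp only [Set.mem_ofPred_eq] at hη
      rw [norm_of_nonneg (pow_nonneg hs.le K)] at hη
      rw [Q.rayTerm_eq hm hζ1 hz hp k n hs hn]
      set H := ∏ i, etaFactor m (p i) (Q.d i * s ^ 2)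
      set V : ℂ := (rexp (-(1 / 2) * (x ⬝ᵥ (Q.gaussMat m z).mulVec x)) : ℝ) *
        Q.integrandVal m ζ z k s x n with hV
      have hd := h₁ s hs n x hnk hn hx
      rw [← hV] at hd
      have hd' : ‖V - Q.rayApprox m ζ z k K s x‖ ≤ C₁ * s ^ K * rexp (-c * ‖x‖ ^ 2) :=
        hd.trans (mul_le_mul_of_nonneg_left (hexp _ _ hcc₁) (by positivity))
      have hVn : ‖V‖ ≤ (C₂ + C₁) * rexp (-c * ‖x‖ ^ 2) := by
        have h7 : ‖Q.rayApprox m ζ z k K s x‖ ≤ C₂ * rexp (-c * ‖x‖ ^ 2) :=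
          (h₂ s hs hs1 x).trans (mul_le_mul_of_nonneg_left
            (hexp _ _ (hcc₂.trans (by linarith))) hC₂.le)
        have h8 := norm_le_norm_add_norm_sub' V (Q.rayApprox m ζ z k K s x)
        have h9 : C₁ * s ^ K * rexp (-c * ‖x‖ ^ 2) ≤ C₁ * rexp (-c * ‖x‖ ^ 2) := by
          gcongr
          exact mul_le_of_le_one_right hC₁.le (pow_le_one₀ hs.le hs1)
        rw [add_mul]
        linarith
      have e : H * (Q.rayConst m z p * s ^ N * Q.classFactor m ζ z k) * V -
          Q.rayConst m z p * s ^ N * Q.classFactor m ζ z k * Q.rayApprox m ζ z k K s x =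
          Q.rayConst m z p * s ^ N * Q.classFactor m ζ z k *
            ((H - 1) * V + (V - Q.rayApprox m ζ z k K s x)) := by ring
      rw [e, hAs s hs]
      calc A * s ^ N * ‖(H - 1) * V + (V - Q.rayApprox m ζ z k K s x)‖
          ≤ A * s ^ N * (|C₄| * s ^ K * ((C₂ + C₁) * rexp (-c * ‖x‖ ^ 2)) +
            C₁ * s ^ K * rexp (-c * ‖x‖ ^ 2)) := by
            gcongr
            refine (norm_add_le _ _).trans (add_le_add ?_ hd')
            rw [norm_mul]
            gcongr
            exact hη.trans (mul_le_mul_of_nonneg_right (le_abs_self _) (by positivity))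
        _ = (|C₄| * A * (C₂ + C₁) + A * C₁) * s ^ (N + K) * rexp (-c * ‖x‖ ^ 2) := by
            rw [pow_add]; ring
        _ ≤ _ := by
            have : 0 ≤ A * C₂ * C₅ + C₃ * C₆ := by positivity
            rw [mul_assoc, mul_assoc _ (s ^ (N + K))]
            exact mul_le_mul_of_nonneg_right (by linarith) (by positivity)
    · push Not at hx
      have h7 : ‖Q.rayTerm m ζ z s n‖ ≤ C₃ * C₆ * s ^ (N + K) * rexp (-c * ‖x‖ ^ 2) := by
        refine (h₃ s hs hs1 n x hn).trans ?_
        rw [mul_assoc, mul_assoc]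
        gcongr
        rw [← mul_assoc]
        refine (h₆ s ‖x‖ hs (norm_nonneg x) hx.le).trans ?_
        gcongr
      refine (norm_sub_le _ _).trans ((add_le_add h7 (hfar s hs hs1 x hx.le)).trans ?_)
      rw [← add_mul, ← add_mul]
      have : 0 ≤ |C₄| * A * (C₂ + C₁) + A * C₁ := by positivity
      rw [mul_assoc, mul_assoc _ (s ^ (N + K))]
      exact mul_le_mul_of_nonneg_right (by linarith) (by positivity)
  · obtain ⟨i, hi⟩ := hneg
    have hs1 : s ≤ 1 := hss.trans (min_le_right _ _)
    have h1 : Q.saddle z i ≤ s * ‖x‖ := by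
      have h2 := (neg_abs_le (x i)).trans' (neg_le_neg (norm_le_pi_norm x i))
      have h3 : Q.saddle z i / s ≤ ‖x‖ := by linarith
      rw [div_le_iff₀ hs] at h3
      linarith
    have h2 : ‖x‖ ≤ (1 + ‖x‖) ^ 3 := by
      have := norm_nonneg x
      have h3 : 1 + ‖x‖ ≤ (1 + ‖x‖) ^ 3 := le_self_pow₀ (by linarith) (by norm_num)
      linarith
    refine (hfar s hs hs1 x ((hρy i).trans (h1.trans (by gcongr)))).trans ?_
    have : 0 ≤ C₃ * C₆ + (|C₄| * A * (C₂ + C₁) + A * C₁) := by positivity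
    rw [mul_assoc, mul_assoc _ (s ^ (N + K))]
    exact mul_le_mul_of_nonneg_right (by linarith) (by positivity)

end Datum
namespace Datum

variable {N : ℕ} (Q : Datum N)

/-! ### Sums over residue classes -/

open Classical in
/-- The normalized terms, extended by zero to all integer vectors. -/
noncomputable def rayTermInt (m : ℕ) (ζ : ℂ) (z : Fin N → ℝ) (s : ℝ) (n : Fin N → ℤ) : ℂ :=
  if ∀ i, 0 ≤ n i then Q.rayTerm m ζ z s fun i => (n i).toNat else 0

theorem exists_norm_tsum_rayApprox_sub_le {m : ℕ} (hm : 0 < m) (ζ : ℂ) {z : Fin N → ℝ}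
    (hz : Q.IsNahmSolution z) (k : Fin N → ℕ) (K : ℕ) {L : ℕ} (hL : 0 < L) :
    ∃ C : ℝ, ∀ s : ℝ, 0 < s → s * L ≤ 1 → ∀ v : Fin N → ℝ,
      Summable (fun n : Fin N → ℤ => Q.rayApprox m ζ z k K s fun i => s * L * (n i + v i)) ∧
      ‖(s : ℂ) ^ N * ∑' n : Fin N → ℤ, Q.rayApprox m ζ z k K s (fun i => s * L * (n i + v i)) -
        ((L : ℂ) ^ N)⁻¹ * ∑ e ∈ range K, (s : ℂ) ^ e * ∫ x, gaussPoly (Q.gaussMat m z)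
          (coeff e (Q.integrand m ζ z k)) x‖ ≤ C * s ^ K := by
  have hM := Q.gaussMat_posDef hm hz
  have hLR : (1 : ℝ) ≤ L := by exact_mod_cast hL
  have hLC : (L : ℂ) ≠ 0 := by exact_mod_cast hL.ne'
  obtain ⟨c, hc, hle⟩ := exists_norm_gaussPoly_le hM
  choose D _ hD using hle
  choose C hC h using fun e => exists_norm_latticeSum_sub_integral_le hM
    (coeff e (Q.integrand m ζ z k)) K
  refine ⟨∑ e ∈ range K, C e * L ^ K, fun s hs hsL v => ?_⟩
  have hsL0 : 0 < s * L := by positivity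
  have hs1 : s ≤ 1 := (le_mul_of_one_le_right hs.le hLR).trans hsL
  have hsum : ∀ e ∈ range K, Summable fun n : Fin N → ℤ => (s : ℂ) ^ e *
      gaussPoly (Q.gaussMat m z) (coeff e (Q.integrand m ζ z k))
        fun i => s * L * (n i + v i) := fun e _ =>
    (summable_lattice hc (hD _) hsL0 hsL v).mul_left _
  refine ⟨summable_sum hsum, ?_⟩
  have e1 : ∑' n : Fin N → ℤ, Q.rayApprox m ζ z k K s (fun i => s * L * (n i + v i)) =
      ∑ e ∈ range K, (s : ℂ) ^ e * latticeSum (gaussPoly (Q.gaussMat m z)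
        (coeff e (Q.integrand m ζ z k))) (s * L) v := by
    simp only [rayApprox]
    rw [Summable.tsum_finsetSum hsum]
    refine sum_congr rfl fun e _ => ?_
    rw [tsum_mul_left, latticeSum]
  rw [e1, mul_sum, mul_sum, ← sum_sub_distrib, sum_mul]
  refine (norm_sum_le _ _).trans (sum_le_sum fun e _ => ?_)
  have e2 : (s : ℂ) ^ N * ((s : ℂ) ^ e * latticeSum (gaussPoly (Q.gaussMat m z)
        (coeff e (Q.integrand m ζ z k))) (s * L) v) -
      ((L : ℂ) ^ N)⁻¹ * ((s : ℂ) ^ e * ∫ x, gaussPoly (Q.gaussMat m z)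
          (coeff e (Q.integrand m ζ z k)) x) =
      ((L : ℂ) ^ N)⁻¹ * (s : ℂ) ^ e * (((s * L : ℝ) : ℂ) ^ N * latticeSum (gaussPoly (Q.gaussMat m z)
        (coeff e (Q.integrand m ζ z k))) (s * L) v - ∫ x, gaussPoly (Q.gaussMat m z)
          (coeff e (Q.integrand m ζ z k)) x) := by
    push_cast
    rw [mul_pow]
    field_simp
  rw [e2, norm_mul]
  calc _ ≤ 1 * (C e * (s * L) ^ K) := by
        refine mul_le_mul ?_ (h e (s * L) hsL0 hsL v) (norm_nonneg _) zero_le_one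
        rw [norm_mul, norm_inv, norm_pow, norm_pow, Complex.norm_natCast, norm_real,
          norm_of_nonneg hs.le]
        exact mul_le_one₀ (inv_le_one_of_one_le₀ (one_le_pow₀ hLR)) (by positivity)
          (pow_le_one₀ hs.le hs1)
    _ = _ := by rw [mul_pow]; ring

theorem tsum_class_isBigO {m : ℕ} (hm : 0 < m) {ζ : ℂ} (hζ1 : ‖ζ‖ = 1)
    (hζ : ∀ i, IsPrimitiveRoot (ζ ^ Q.d i) m) {z : Fin N → ℝ} (hz : Q.IsNahmSolution z)
    {p : Fin N → ℤ} (hp : ∀ i, ζ ^ Q.d i = expi (p i / m)) (hpm : ∀ i, IsCoprime (p i) m)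
    {L : ℕ} (hL : 0 < L) (hmL : m ∣ L) (l : Fin N → ℕ) (k : Fin N → ℕ)
    (hlk : ∀ i, l i % m = k i % m) (K : ℕ) :
    (fun s : ℝ => ∑' n : Fin N → ℤ, Q.rayTermInt m ζ z s (fun i => n i * L + l i) -
      Q.rayConst m z p * Q.classFactor m ζ z k * (((L : ℂ) ^ N)⁻¹ *
        ∑ e ∈ range K, (s : ℂ) ^ e * ∫ x, gaussPoly (Q.gaussMat m z)
          (coeff e (Q.integrand m ζ z k)) x)) =O[𝓝[>] 0] fun s => s ^ K := by
  have hLR : (1 : ℝ) ≤ L := by exact_mod_cast hL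
  obtain ⟨c, C, s₀, hc, hC, hs₀, hs₀1, h⟩ :=
    Q.exists_norm_rayTerm_sub_le hm hζ1 hζ hz hp hpm k K
  obtain ⟨C', h'⟩ := Q.exists_norm_tsum_rayApprox_sub_le hm ζ hz k K hL
  obtain ⟨D, hD, hlat⟩ := exists_lattice_sum_le (N := N) hc
  set A : ℂ := Q.rayConst m z p * Q.classFactor m ζ z k with hA
  refine IsBigO.of_bound (C * D + ‖A‖ * C') ?_
  have hmem : Set.Ioc (0 : ℝ) (s₀ / L) ∈ 𝓝[>] (0 : ℝ) := Ioc_mem_nhdsGT (by positivity)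
  filter_upwards [hmem] with s ⟨hs, hss⟩
  have hsL : s * L ≤ s₀ := by rwa [le_div_iff₀ (by positivity)] at hss
  have hsL0 : 0 < s * L := by positivity
  have hss₀ : s ≤ s₀ := (le_mul_of_one_le_right hs.le hLR).trans hsL
  set v : Fin N → ℝ := fun i => (l i - Q.saddle z i / s ^ 2) / L with hv
  have hx : ∀ (n : Fin N → ℤ) i, s * ((n i * L + l i : ℤ) : ℝ) =
      s * L * (n i + v i) + Q.saddle z i / s := by
    intro n i
    simp only [hv]
    push_cast
    field_simp
    ring
  obtain ⟨hsum', hle'⟩ := h' s hs (hsL.trans hs₀1) v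
  obtain ⟨hsum, hle⟩ := hlat (s * L) hsL0 (hsL.trans hs₀1) v
  have hdiff : ∀ n : Fin N → ℤ, ‖Q.rayTermInt m ζ z s (fun i => n i * L + l i) -
      A * s ^ N * Q.rayApprox m ζ z k K s (fun i => s * L * (n i + v i))‖ ≤
      C * s ^ (N + K) * rexp (-c * ‖fun i => s * L * (n i + v i)‖ ^ 2) := by
    intro n
    have e : A * s ^ N = Q.rayConst m z p * s ^ N * Q.classFactor m ζ z k := by rw [hA]; ring
    rw [e, rayTermInt]
    obtain ⟨ha, hb⟩ := h s hs hss₀ fun i => s * L * (n i + v i)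
    split_ifs with hn
    · refine ha _ (fun i => ?_) fun i => ?_
      · rw [← hlk i]
        have h1 : ((n i * L + l i).toNat : ℤ) % m = (l i : ℤ) % m := by
          rw [Int.toNat_of_nonneg (hn i)]
          obtain ⟨q, rfl⟩ := hmL
          push_cast
          rw [mul_left_comm, add_comm, Int.add_mul_emod_self_left]
        exact_mod_cast h1
      · rw [← hx, ← Int.cast_natCast (R := ℝ), Int.toNat_of_nonneg (hn i)]
    · rw [zero_sub, norm_neg]
      refine hb ?_
      push Not at hn
      obtain ⟨i, hi⟩ := hn
      refine ⟨i, ?_⟩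
      rw [← hx]
      exact mul_neg_of_pos_of_neg hs (by exact_mod_cast hi)
  have hsd := Summable.of_norm_bounded (hsum.mul_left (C * s ^ (N + K))) hdiff
  have hmain := hsum'.mul_left (A * s ^ N)
  have htot : ∑' n : Fin N → ℤ, Q.rayTermInt m ζ z s (fun i => n i * L + l i) =
      ∑' n : Fin N → ℤ, (Q.rayTermInt m ζ z s (fun i => n i * L + l i) -
        A * s ^ N * Q.rayApprox m ζ z k K s (fun i => s * L * (n i + v i))) +
      A * ((s : ℂ) ^ N * ∑' n : Fin N → ℤ,
        Q.rayApprox m ζ z k K s (fun i => s * L * (n i + v i))) := by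
    rw [← mul_assoc, ← tsum_mul_left, ← hsd.tsum_add hmain]
    exact tsum_congr fun n => by ring
  have hbd := tsum_of_norm_bounded (hsum.mul_left (C * s ^ (N + K))).hasSum hdiff
  rw [tsum_mul_left] at hbd
  rw [htot, add_sub_assoc, ← mul_sub, norm_of_nonneg (by positivity), add_mul]
  refine (norm_add_le _ _).trans (add_le_add ?_ ?_)
  · refine hbd.trans ?_
    calc _ ≤ C * s ^ (N + K) * (D / (s * L) ^ N) := by gcongr
      _ = C * D * s ^ K / L ^ N := by rw [pow_add, mul_pow]; field_simp
      _ ≤ C * D * s ^ K := div_le_self (by positivity) (one_le_pow₀ hLR)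
  · rw [norm_mul, mul_assoc]
    exact mul_le_mul_of_nonneg_left hle' (norm_nonneg _)

end Datum

/-! ### Constants -/

theorem exp_neg_weightedLog {m : ℕ} (hm : 0 < m) {ζ : ℂ} (hζ : IsPrimitiveRoot ζ m) {z : ℝ}
    (hz : z ∈ Set.Ioo (0 : ℝ) 1) (k : ℕ) :
    cexp (-weightedLog m ζ (ζ ^ k * ((z ^ (1 / m : ℝ) : ℝ) : ℂ)) / m) =
      cyclicDilogInvRoot m ζ (ζ * ((z ^ (1 / m : ℝ) : ℝ) : ℂ)) *
        (rexp ((k - 1) * log (1 - z) / m) : ℝ) /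
        qPoch (ζ * ((z ^ (1 / m : ℝ) : ℝ) : ℂ)) ζ k := by
  have hmR : (0 : ℝ) < m := by exact_mod_cast hm
  have hmC : (m : ℂ) ≠ 0 := by exact_mod_cast hm.ne'
  have hθ0 : 0 < z ^ (1 / m : ℝ) := Real.rpow_pos_of_pos hz.1 _
  have hθ1 : z ^ (1 / m : ℝ) < 1 := Real.rpow_lt_one hz.1.le hz.2 (by positivity)
  have hθm : (z ^ (1 / m : ℝ)) ^ m = z := by
    rw [one_div, Real.rpow_inv_natCast_pow hz.1.le hm.ne']
  generalize z ^ (1 / m : ℝ) = θ at *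
  have hw : ∀ j, ‖ζ ^ j * (θ : ℂ)‖ < 1 := fun j => by
    rw [norm_mul, norm_pow, hζ.norm'_eq_one hm.ne', one_pow, one_mul, norm_real,
      norm_of_nonneg hθ0.le]
    exact hθ1
  have hne : ∀ j, 1 - ζ ^ j * (θ : ℂ) ≠ 0 := fun j => one_sub_ne_zero_of_norm_lt_one (hw j)
  set ℓ : ℕ → ℂ := fun j => Complex.log (1 - ζ ^ j * θ) with hℓ
  have hper : ∀ j, ℓ (m + j) = ℓ j := fun j => by
    simp only [hℓ, pow_add, hζ.pow_eq_one, one_mul]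
  have hf : ∀ k, weightedLog m ζ (ζ ^ k * θ) = ∑ t ∈ range m, (t + 1 : ℂ) * ℓ (t + 1 + k) := by
    intro k
    rw [weightedLog, ← Finset.Ico_add_one_right_eq_Icc, sum_Ico_eq_sum_range]
    refine sum_congr rfl fun t _ => ?_
    simp only [hℓ]
    rw [add_comm 1 t, ← mul_assoc, ← pow_add]
    push_cast; rfl
  have hsum : ∀ k, ∑ t ∈ range m, ℓ (t + 1 + k) = log (1 - z) := by
    intro k
    have h := sum_polylog_rootsOfUnity hm hζ 1 (hw k)
    have e : (ζ ^ k * (θ : ℂ)) ^ m = z := by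
      rw [mul_pow, ← pow_mul, mul_comm k, pow_mul, hζ.pow_eq_one, one_pow, one_mul,
        ← ofReal_pow, hθm]
    have hz1 : ‖(z : ℂ)‖ < 1 := by rw [norm_real, norm_of_nonneg hz.1.le]; exact hz.2
    rw [e, polylog_one hz1, ← Finset.Ico_add_one_right_eq_Icc, sum_Ico_eq_sum_range] at h
    have h2 : ∀ t ∈ range m, polylog 1 (ζ ^ (1 + t) * (ζ ^ k * (θ : ℂ))) =
        -ℓ (t + 1 + k) := fun t _ => by
      have e2 : ζ ^ (1 + t) * (ζ ^ k * (θ : ℂ)) = ζ ^ (t + 1 + k) * θ := by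
        rw [add_comm 1 t, ← mul_assoc, ← pow_add]
      rw [e2, polylog_one (hw _)]
    rw [Nat.add_sub_cancel, sum_congr rfl h2, sum_neg_distrib] at h
    simp only [sub_self, zpow_zero, one_mul, neg_inj] at h
    rw [h, ofReal_log (by linarith [hz.2])]
    push_cast; rfl
  have hstep : ∀ k, weightedLog m ζ (ζ ^ (k + 1) * θ) =
      weightedLog m ζ (ζ ^ k * θ) - log (1 - z) + m * ℓ (k + 1) := by
    intro k
    have h := Finset.sum_range_sub (fun t => (t : ℂ) * ℓ (t + (k + 1))) m
    rw [hper] at h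
    rw [hf, hf, ← hsum k]
    simp only [Nat.cast_zero, zero_mul, sub_zero] at h
    rw [← h, ← sum_sub_distrib, ← sum_add_distrib]
    refine sum_congr rfl fun t _ => ?_
    rw [show t + 1 + k = t + (k + 1) by ring]
    push_cast; ring
  have hroot : cyclicDilogInvRoot m ζ (ζ * θ) =
      cexp (-(weightedLog m ζ (ζ ^ 0 * θ) - log (1 - z)) / m) := by
    have h1 : weightedLog m ζ (ζ ^ 0 * θ) - log (1 - z) =
        ∑ t ∈ Ico 1 m, (t : ℂ) * ℓ (t + 1) := by
      have h2 : weightedLog m ζ (ζ ^ (0 + 1) * θ) =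
          ∑ t ∈ Ico 1 m, (t : ℂ) * ℓ (t + 1) + m * ℓ (m + 1) := by
        rw [weightedLog, ← Finset.Ico_add_one_right_eq_Icc, Finset.sum_Ico_succ_top hm]
        simp only [hℓ, zero_add, pow_succ, pow_zero, one_mul, mul_assoc]
      rw [hper] at h2
      linear_combination h2 - hstep 0
    rw [cyclicDilogInvRoot, h1, neg_div, sum_div, ← sum_neg_distrib, Complex.exp_sum]
    refine prod_congr rfl fun t _ => ?_
    have e : 1 - ζ ^ t * (ζ * (θ : ℂ)) = 1 - ζ ^ (t + 1) * θ := by rw [pow_succ, mul_assoc]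
    rw [e, Complex.cpow_def_of_ne_zero (hne _)]
    congr 1
    simp only [hℓ]; ring
  have hpz : ∀ k, qPoch (ζ * (θ : ℂ)) ζ k ≠ 0 := fun k => Finset.prod_ne_zero_iff.2 fun j _ => by
    rw [← mul_assoc, ← pow_succ]; exact hne _
  induction k with
  | zero =>
    rw [hroot, ofReal_exp, ← Complex.exp_add]
    simp only [qPoch, Finset.range_zero, Finset.prod_empty, div_one]
    congr 1
    push_cast
    ring
  | succ k ih =>
    have e1 : cexp (-weightedLog m ζ (ζ ^ (k + 1) * θ) / m) =
        cexp (-weightedLog m ζ (ζ ^ k * θ) / m) *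
          (rexp (log (1 - z) / m) : ℝ) / (1 - ζ ^ (k + 1) * θ) := by
      rw [← Complex.exp_log (hne (k + 1)), hstep, ofReal_exp, ← Complex.exp_add, ← exp_sub]
      congr 1
      simp only [hℓ]
      push_cast
      field_simp
      ring
    have e2 : qPoch (ζ * (θ : ℂ)) ζ (k + 1) =
        qPoch (ζ * (θ : ℂ)) ζ k * (1 - ζ ^ (k + 1) * θ) := by
      rw [qPoch, Finset.prod_range_succ, ← qPoch, pow_succ, mul_assoc]
    have e3 : rexp (((k + 1 : ℕ) - 1) * log (1 - z) / m) =
        rexp ((k - 1) * log (1 - z) / m) * rexp (log (1 - z) / m) := by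
      rw [← exp_add]
      congr 1
      push_cast; ring
    rw [e1, ih, e2, e3, ofReal_mul]
    have := hne (k + 1)
    have := hpz k
    field_simp

namespace Datum

variable {N : ℕ} (Q : Datum N)

theorem prod_exp_log_one_sub {m : ℕ} {z : Fin N → ℝ} (hz : Q.IsNahmSolution z) (k : Fin N → ℝ) :
    ∏ i, rexp (k i * log (1 - z i) / m) =
      ∏ i, (z i ^ (1 / m : ℝ)) ^ (∑ j, k j * (Q.A j i : ℝ)) := by
  have h : ∀ i, (z i ^ (1 / m : ℝ)) ^ (∑ j, k j * (Q.A j i : ℝ)) =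
      rexp (∑ j, k j * (Q.A j i : ℝ) * log (z i) / m) := fun i => by
    rw [← rpow_mul (hz.1 i).1.le, rpow_def_of_pos (hz.1 i).1, mul_sum,
      mul_sum]
    congr 1
    exact sum_congr rfl fun j _ => by ring
  rw [prod_congr rfl fun i _ => h i, ← exp_sum, ← exp_sum, sum_comm]
  congr 1
  refine sum_congr rfl fun i _ => ?_
  have h1 := Q.B_mulVec_saddle hz i
  rw [Matrix.mulVec, dotProduct] at h1
  have h2 : log (1 - z i) = ∑ j, (Q.A i j : ℝ) * log (z j) := by
    rw [← neg_inj, ← h1, ← sum_neg_distrib]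
    refine sum_congr rfl fun j _ => ?_
    rw [B_apply, saddle]
    have := (Q.d_pos' j).ne'
    field_simp
  rw [h2, mul_sum, sum_div]
  exact sum_congr rfl fun j _ => by ring

theorem classFactor_eq {m : ℕ} (hm : 0 < m) {ζ : ℂ} (hζ : ∀ i, IsPrimitiveRoot (ζ ^ Q.d i) m)
    {z : Fin N → ℝ} (hz : Q.IsNahmSolution z) (k : Fin N → ℕ) : Q.classFactor m ζ z k =
      (∏ i, cyclicDilogInvRoot m (ζ ^ Q.d i) (ζ ^ Q.d i * ((z i ^ (1 / m : ℝ) : ℝ) : ℂ))) *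
        ((∏ i, (1 - z i) ^ (-(1 / m) : ℝ) : ℝ) : ℂ) *
        ∏ i, (((z i ^ (1 / m : ℝ)) ^ (∑ j, (k j : ℝ) * (Q.A j i : ℝ)) : ℝ) : ℂ) /
          qPoch (ζ ^ Q.d i * ((z i ^ (1 / m : ℝ) : ℝ) : ℂ)) (ζ ^ Q.d i) (k i) := by
  rw [classFactor, prod_congr rfl fun i _ => exp_neg_weightedLog hm (hζ i) (hz.1 i) (k i),
    prod_div_distrib, prod_mul_distrib, prod_div_distrib,
    ← ofReal_prod (f := fun i => (z i ^ (1 / m : ℝ)) ^ (∑ j, (k j : ℝ) * (Q.A j i : ℝ))),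
    ← Q.prod_exp_log_one_sub hz (fun i => (k i : ℝ)), ← ofReal_prod]
  have : ∏ i, rexp ((k i - 1) * log (1 - z i) / m) =
      (∏ i, (1 - z i) ^ (-(1 / m) : ℝ)) * ∏ i, rexp (k i * log (1 - z i) / m) := by
    rw [← prod_mul_distrib]
    refine prod_congr rfl fun i _ => ?_
    rw [rpow_def_of_pos (by linarith [(hz.1 i).2]), ← exp_add]
    congr 1; ring
  rw [this, ofReal_mul]
  ring

theorem det_gaussMat (m : ℕ) (z : Fin N → ℝ) :
    (Q.gaussMat m z).det = (1 / m : ℝ) ^ N * ((Q.Atilde z).det * ∏ i, (Q.d i : ℝ)) := by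
  have hD : (Q.D.map fun a => (a : ℝ)) = Matrix.diagonal fun i => (Q.d i : ℝ) := by
    rw [D, Matrix.diagonal_map (by simp)]
    congr 1
  rw [gaussMat, Matrix.det_smul, Fintype.card_fin, Matrix.det_mul, hD, Matrix.det_diagonal]

theorem rayConst_mul {m δ : ℕ} (hm : 0 < m) (hδ : 0 < δ) {z : Fin N → ℝ}
    (hz : Q.IsNahmSolution z) (p : Fin N → ℤ) :
    Q.rayConst m z p * ((∏ i, (1 - z i) ^ (-(1 / m) : ℝ) : ℝ) : ℂ) *
      ((((m * δ : ℕ) : ℂ) ^ N)⁻¹ * ∫ x, gaussPoly (Q.gaussMat m z) 1 x) =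
      ((m : ℝ) ^ (-(N / 2) : ℝ) : ℝ) * (∏ i, expi ((dedekindSum (p i) m / 2 : ℚ) : ℂ)) *
        (Q.cConst m z : ℂ) * ((δ : ℂ) ^ N)⁻¹ := by
  have hmR : (0 : ℝ) < m := by exact_mod_cast hm
  have hδR : (0 : ℝ) < δ := by exact_mod_cast hδ
  have hpi := pi_pos
  have hM := (Q.gaussMat_posDef hm hz).det_pos
  have hd : 0 < ∏ i, (Q.d i : ℝ) := Finset.prod_pos fun i _ => Q.d_pos' i
  have hA : 0 < (Q.Atilde z).det := by
    rw [det_gaussMat] at hM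
    have h2 := pos_of_mul_pos_right hM (by positivity)
    exact pos_of_mul_pos_left h2 hd.le
  have h1 : rexp (-(Q.saddle z ⬝ᵥ fun i => (Q.b i : ℝ)) / m) *
      (∏ i, √(1 - z i)) * (∏ i, (1 - z i) ^ (-(1 / m) : ℝ)) =
      ∏ i, (z i ^ (1 / m : ℝ)) ^ ((Q.b i : ℝ) / Q.d i) * (1 - z i) ^ (1 / 2 - 1 / m : ℝ) := by
    rw [dotProduct, neg_div, sum_div, ← sum_neg_distrib, exp_sum,
      ← prod_mul_distrib, ← prod_mul_distrib]
    refine prod_congr rfl fun i _ => ?_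
    have hz1 : 0 < 1 - z i := by linarith [(hz.1 i).2]
    rw [sqrt_eq_rpow, mul_assoc, ← Real.rpow_add hz1, ← sub_eq_add_neg,
      ← rpow_mul (hz.1 i).1.le, rpow_def_of_pos (hz.1 i).1, saddle]
    congr 2
    ring
  have h2 : (∏ i, √(Q.d i / (2 * π))) * ((((m * δ : ℕ) : ℝ) ^ N)⁻¹ *
      (√(2 * π) ^ N / √(Q.gaussMat m z).det)) =
      (m : ℝ) ^ (-(N / 2) : ℝ) * (Q.Atilde z).det ^ (-(1 / 2) : ℝ) * ((δ : ℝ) ^ N)⁻¹ := by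
    have e1 : ∏ i, √(Q.d i / (2 * π)) = √(∏ i, (Q.d i : ℝ)) / √(2 * π) ^ N := by
      rw [prod_congr rfl fun i _ => Real.sqrt_div (Nat.cast_nonneg (Q.d i)) (2 * π),
        prod_div_distrib, Real.sqrt_prod _ fun i _ => Nat.cast_nonneg _]
      simp
    have e2 : √(Q.gaussMat m z).det = (√m ^ N)⁻¹ * (√(Q.Atilde z).det * √(∏ i, (Q.d i : ℝ))) := by
      rw [det_gaussMat, sqrt_mul (by positivity), sqrt_mul hA.le]
      congr 1
      rw [Real.sqrt_eq_iff_mul_self_eq (by positivity) (by positivity), ← mul_inv, ← mul_pow,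
        Real.mul_self_sqrt hmR.le, one_div, inv_pow]
    have e3 : (m : ℝ) ^ (-(N / 2) : ℝ) = (√m ^ N)⁻¹ := by
      rw [rpow_neg hmR.le, sqrt_eq_rpow, ← Real.rpow_natCast, ← rpow_mul hmR.le]
      congr 2; ring
    have e4 : (m : ℝ) ^ N = √m ^ N * √m ^ N := by rw [← mul_pow, Real.mul_self_sqrt hmR.le]
    have hs1 : 0 < √(∏ i, (Q.d i : ℝ)) := Real.sqrt_pos.2 hd
    have hs2 : 0 < √(Q.Atilde z).det := Real.sqrt_pos.2 hA
    have hs3 : 0 < √(m : ℝ) := Real.sqrt_pos.2 hmR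
    rw [e1, e2, e3, rpow_neg hA.le, ← sqrt_eq_rpow, Nat.cast_mul, mul_pow, e4]
    field_simp
  rw [integral_gaussPoly_one (Q.gaussMat_posDef hm hz), rayConst, prod_mul_distrib, cConst,
    ← h1, ← ofReal_prod]
  have h2' := congrArg (fun r : ℝ => (r : ℂ)) h2
  generalize ∏ i, expi ((dedekindSum (p i) m / 2 : ℚ) : ℂ) = E
  push_cast at h2' ⊢
  linear_combination (E *
    cexp (-(((Q.saddle z ⬝ᵥ fun i => (Q.b i : ℝ)) : ℝ) : ℂ) / m) *
      (∏ i, ((√(1 - z i) : ℝ) : ℂ)) * ∏ i, (((1 - z i) ^ (-(1 / m) : ℝ) : ℝ) : ℂ)) * h2'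

end Datum

/-! ### The expansion along a ray -/

theorem tsum_int_eq_sum_residues {N L : ℕ} (hL : 0 < L) {f : (Fin N → ℤ) → ℂ} (hf : Summable f) :
    ∑' n, f n = ∑ l : Fin N → Fin L, ∑' n : Fin N → ℤ, f fun i => n i * L + (l i : ℕ) := by
  have : NeZero L := ⟨hL.ne'⟩
  set e : (Fin N → Fin L) × (Fin N → ℤ) ≃ (Fin N → ℤ) :=
    ((Equiv.prodComm _ _).trans (Equiv.arrowProdEquivProdArrow (Fin N) (fun _ => ℤ)
      fun _ => Fin L).symm).trans (Equiv.piCongrRight fun _ => (Int.divModEquiv L).symm) with he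
  have h : ∀ p, f (e p) = f fun i => p.2 i * L + (p.1 i : ℕ) := fun p => by
    congr 1
  have hs : Summable fun p => f (e p) := e.summable_iff.2 hf
  rw [← e.tsum_eq f, hs.tsum_prod, tsum_fintype]
  simp only [h]

theorem sum_residues_eq_mul {N m δ : ℕ} (hm : 0 < m) (hδ : 0 < δ) (hcop : m.Coprime δ)
    (F G : (Fin N → ℕ) → ℂ) :
    ∑ l : Fin N → Fin (m * δ), F (fun i => (l i : ℕ) % m) * G (fun i => (l i : ℕ) % δ) =
      (∑ k : Fin N → Fin m, F fun i => k i) * ∑ a : Fin N → Fin δ, G fun i => a i := by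
  set e : (Fin N → Fin (m * δ)) → (Fin N → Fin m) × (Fin N → Fin δ) := fun l =>
    (fun i => ⟨(l i : ℕ) % m, Nat.mod_lt _ hm⟩, fun i => ⟨(l i : ℕ) % δ, Nat.mod_lt _ hδ⟩) with he
  have hinj : Function.Injective e := by
    intro l l' h
    rw [Prod.mk.injEq] at h
    funext i
    have h1 : (l i : ℕ) ≡ l' i [MOD m] := congrArg Fin.val (congrFun h.1 i)
    have h2 : (l i : ℕ) ≡ l' i [MOD δ] := congrArg Fin.val (congrFun h.2 i)
    have h3 := (Nat.modEq_and_modEq_iff_modEq_mul hcop).1 ⟨h1, h2⟩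
    exact Fin.ext (Nat.ModEq.eq_of_lt_of_lt h3 (l i).2 (l' i).2)
  have hbij : Function.Bijective e := (Fintype.bijective_iff_injective_and_card e).2 ⟨hinj, by
    simp [mul_pow]⟩
  rw [Fintype.sum_mul_sum, ← Fintype.sum_prod_type']
  exact Fintype.sum_bijective e hbij _ _ fun l => rfl

namespace Datum

variable {N : ℕ} (Q : Datum N)

theorem integral_gaussPoly_coeff {m : ℕ} (hm : 0 < m) (ζ : ℂ) {z : Fin N → ℝ}
    (hz : Q.IsNahmSolution z) (k : Fin N → ℕ) (j : ℕ) :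
    ∫ x, gaussPoly (Q.gaussMat m z) (coeff (2 * j) (Q.integrand m ζ z k)) x =
      coeff j (Q.gaussI m ζ z k) * ∫ x, gaussPoly (Q.gaussMat m z) 1 x := by
  have h0 : ∫ x, gaussPoly (Q.gaussMat m z) 1 x ≠ 0 := by
    have := (Q.gaussMat_posDef hm hz).det_pos
    rw [integral_gaussPoly_one (Q.gaussMat_posDef hm hz), Complex.ofReal_ne_zero]
    positivity
  rw [gaussI, coeff_mk, gaussAvg]
  simp only [gaussPoly, map_one, mul_one] at h0 ⊢
  rw [← gaussMat, div_mul_cancel₀ _ h0]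

theorem sum_range_integral {m : ℕ} (hm : 0 < m) (ζ : ℂ) {z : Fin N → ℝ}
    (hz : Q.IsNahmSolution z) (k : Fin N → ℕ) (K : ℕ) (s : ℝ) :
    ∑ e ∈ range (2 * K), (s : ℂ) ^ e * ∫ x, gaussPoly (Q.gaussMat m z)
        (coeff e (Q.integrand m ζ z k)) x =
      ∑ j ∈ range K, coeff j (Q.gaussI m ζ z k) *
        (∫ x, gaussPoly (Q.gaussMat m z) 1 x) * ((s ^ 2 : ℝ) : ℂ) ^ j := by
  induction K with
  | zero => simp
  | succ K ih =>
    have hodd := integral_gaussPoly_of_odd (Q.gaussMat m z)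
      (P := coeff (2 * K + 1) (Q.integrand m ζ z k)) fun x => by
        rw [Q.eval_neg_coeff_integrand, pow_succ, pow_mul]; simp
    rw [sum_range_succ, ← ih, show 2 * (K + 1) = 2 * K + 1 + 1 by ring,
      sum_range_succ, sum_range_succ, Q.integral_gaussPoly_coeff hm ζ hz, hodd]
    push_cast
    rw [← pow_mul]
    ring

theorem exp_mul_nahmTerm_tauOf (α : ℚ) (z : Fin N → ℝ) (s : ℝ) (n : Fin N → ℕ) :
    cexp (-(Q.Lam z : ℂ) / (α.den * (s ^ 2 : ℝ))) * Q.nahmTerm (tauOf α (s ^ 2 : ℝ)) n =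
      expi (α * Q.quad fun i => (n i : ℤ)) * Q.rayTerm α.den (expi α) z s n := by
  have hbase : ∀ i, expi α ^ Q.d i * cexp (-(Q.d i * (((s ^ 2 : ℝ) : ℂ) / α.den))) =
      Q.rayBase α.den (expi α) s i := fun i => by
    rw [rayBase, ofReal_exp]
    congr 2
    push_cast; ring
  rw [nahmTerm_tauOf, twistedTerm, rayTerm]
  simp only [hbase, one_pow, one_div]
  rw [ofReal_exp, ofReal_sub, exp_sub]
  have e1 : cexp (-(((s ^ 2 : ℝ) : ℂ) / α.den) * Q.quadR fun i => (n i : ℝ)) =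
      (cexp ((s ^ 2 * Q.quadR (fun i => (n i : ℝ)) / α.den : ℝ) : ℂ))⁻¹ := by
    rw [← Complex.exp_neg]
    congr 1
    push_cast; ring
  have e2 : -(Q.Lam z : ℂ) / (α.den * (s ^ 2 : ℝ)) =
      ((-(Q.Lam z / (α.den * s ^ 2)) : ℝ) : ℂ) := by push_cast; ring
  rw [e1, e2]
  ring

theorem exp_mul_nahmSum_eq {δ : ℕ} (hδ : Q.IsStrongDenominator δ) {α : ℚ}
    (hmδ : α.den.Coprime δ) (hmb : ∀ i, α.den.Coprime (Q.b i).den) (hmc : α.den.Coprime Q.c.den)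
    (z : Fin N → ℝ) {s : ℝ} (hs : 0 < s) :
    cexp (-(Q.Lam z : ℂ) / (α.den * (s ^ 2 : ℝ))) * Q.nahmSum (tauOf α (s ^ 2 : ℝ)) =
      ∑ l : Fin N → Fin (α.den * δ), expi (α * Q.quad fun i => ((l i : ℕ) : ℤ)) *
        ∑' n : Fin N → ℤ, Q.rayTermInt α.den (expi α) z s
          fun i => n i * (α.den * δ : ℕ) + (l i : ℕ) := by
  have hτ : 0 < (tauOf α (s ^ 2 : ℝ)).im := by
    have := pi_pos
    have : (0 : ℝ) < α.den := by exact_mod_cast α.den_pos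
    rw [tauOf_im, ofReal_re]
    positivity
  set g : (Fin N → ℕ) → Fin N → ℤ := fun n i => n i with hg
  have hinj : Function.Injective g := fun a b h => funext fun i => by
    have := congrFun h i
    simpa [hg] using this
  set f : (Fin N → ℤ) → ℂ := fun n => expi (α * Q.quad n) * Q.rayTermInt α.den (expi α) z s n
    with hf
  have hfg : ∀ n, f (g n) = cexp (-(Q.Lam z : ℂ) / (α.den * (s ^ 2 : ℝ))) *
      Q.nahmTerm (tauOf α (s ^ 2 : ℝ)) n := fun n => by
    rw [exp_mul_nahmTerm_tauOf]
    simp [hf, hg, rayTermInt]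
  have hout : ∀ n ∉ Set.range g, f n = 0 := by
    intro n hn
    simp only [hf, rayTermInt]
    rw [if_neg, mul_zero]
    intro h
    exact hn ⟨fun i => (n i).toNat, funext fun i => Int.toNat_of_nonneg (h i)⟩
  have hsum : Summable f := (hinj.summable_iff hout).1 (by
    simp only [Function.comp_def, hfg]
    exact (Q.summable_nahmTerm hτ).mul_left _)
  rw [nahmSum, ← tsum_mul_left, ← tsum_congr hfg, hinj.tsum_eq fun n hn => by
    by_contra h; exact hn (hout n h),
    tsum_int_eq_sum_residues (Nat.mul_pos α.den_pos hδ.1) hsum]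
  refine sum_congr rfl fun l _ => ?_
  rw [← tsum_mul_left]
  refine tsum_congr fun n => ?_
  simp only [hf]
  congr 1
  refine hδ.expi_mul_quad_congr hmδ hmb hmc fun i => ?_
  rw [Int.modEq_iff_dvd]
  exact ⟨-n i, by ring⟩

theorem sum_residues_main_term {δ : ℕ} (hδ : Q.IsStrongDenominator δ) {α : ℚ}
    (hmδ : α.den.Coprime δ) (hmd : ∀ i, α.den.Coprime (Q.d i))
    (hmb : ∀ i, α.den.Coprime (Q.b i).den) (hmc : α.den.Coprime Q.c.den) {z : Fin N → ℝ}
    (hz : Q.IsNahmSolution z) {p : Fin N → ℤ}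
    (hχ : Q.chi α = ∏ i, expi ((dedekindSum (p i) α.den / 2 : ℚ) : ℂ)) (j : ℕ) :
    ∑ l : Fin N → Fin (α.den * δ), expi (α * Q.quad fun i => ((l i : ℕ) : ℤ)) *
      (Q.rayConst α.den z p * Q.classFactor α.den (expi α) z (fun i => (l i : ℕ) % α.den) *
        ((((α.den * δ : ℕ) : ℂ) ^ N)⁻¹ * (coeff j
          (Q.gaussI α.den (expi α) z fun i => (l i : ℕ) % α.den) *
          ∫ x, gaussPoly (Q.gaussMat α.den z) 1 x))) =
      coeff j ((((α.den : ℝ) ^ (-(N / 2) : ℝ) : ℝ) * Q.chi α * (Q.cConst α.den z : ℂ) *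
              Q.gaussSum δ α) • Q.S α.den (expi α) z) := by
  have hm := α.den_pos
  have hm0 := α.den_nz
  set F : (Fin N → ℕ) → ℂ := fun k => expi α ^ (ratMod α.den (Q.quad fun i => (k i : ℤ))).val *
    (Q.classFactor α.den (expi α) z k * coeff j (Q.gaussI α.den (expi α) z k)) with hF
  set G : (Fin N → ℕ) → ℂ := fun a =>
    expi (((ratMod (δ ^ 2 * Q.c.den) α).val : ℂ) * Q.quad fun i => (a i : ℤ)) with hG
  set I := ∫ x, gaussPoly (Q.gaussMat α.den z) 1 x with hI
  have hterm : ∀ l : Fin N → Fin (α.den * δ), expi (α * Q.quad fun i => ((l i : ℕ) : ℤ)) *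
      (Q.rayConst α.den z p * Q.classFactor α.den (expi α) z (fun i => (l i : ℕ) % α.den) *
        ((((α.den * δ : ℕ) : ℂ) ^ N)⁻¹ * (coeff j
          (Q.gaussI α.den (expi α) z fun i => (l i : ℕ) % α.den) * I))) =
      Q.rayConst α.den z p * ((((α.den * δ : ℕ) : ℂ) ^ N)⁻¹ * I) *
        (F (fun i => (l i : ℕ) % α.den) * G fun i => (l i : ℕ) % δ) := by
    intro l
    have h1 : G (fun i => (l i : ℕ) % δ) = expi (((ratMod (δ ^ 2 * Q.c.den) α).val : ℂ) *
        Q.quad fun i => ((l i : ℕ) : ℤ)) := by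
      obtain ⟨n, hn⟩ := hδ.2 (fun i => (((l i : ℕ) % δ : ℕ) : ℤ)) (fun i => ((l i : ℕ) : ℤ))
        fun i => by push_cast; exact Int.mod_modEq _ _
      have := expi_eq_of_sub_int
        (x := (ratMod (δ ^ 2 * Q.c.den) α).val * Q.quad fun i => (((l i : ℕ) % δ : ℕ) : ℤ))
        (y := (ratMod (δ ^ 2 * Q.c.den) α).val * Q.quad fun i => ((l i : ℕ) : ℤ))
        ⟨(ratMod (δ ^ 2 * Q.c.den) α).val * n, by rw [← mul_sub, hn]; push_cast; rfl⟩
      push_cast at this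
      simpa [hG] using this
    have h2 : ratMod α.den (Q.quad fun i => (((l i : ℕ) % α.den : ℕ) : ℤ)) =
        ratMod α.den (Q.quad fun i => ((l i : ℕ) : ℤ)) :=
      hδ.ratMod_quad hmδ hmb hmc fun i => by push_cast; exact Int.mod_modEq _ _
    rw [hδ.expi_mul_quad hmδ hmc, h1]
    simp only [hF, h2]
    ring
  rw [sum_congr rfl fun l _ => hterm l, ← mul_sum,
    sum_residues_eq_mul hm hδ.1 hmδ F G]
  have hFk : ∀ k : Fin N → Fin α.den, F (fun i => k i) =
      (∏ i, cyclicDilogInvRoot α.den (expi α ^ Q.d i)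
        (expi α ^ Q.d i * ((z i ^ (1 / α.den : ℝ) : ℝ) : ℂ))) *
      ((∏ i, (1 - z i) ^ (-(1 / α.den) : ℝ) : ℝ) : ℂ) *
      (expi α ^ (ratMod α.den (Q.quad fun i => ((k i : ℕ) : ℤ))).val *
        (∏ i, (((z i ^ (1 / α.den : ℝ)) ^ (∑ j, ((k j : ℕ) : ℝ) * (Q.A j i : ℝ)) : ℝ) : ℂ) /
          qPoch (expi α ^ Q.d i * ((z i ^ (1 / α.den : ℝ) : ℝ) : ℂ)) (expi α ^ Q.d i) (k i)) *
        coeff j (Q.gaussI α.den (expi α) z fun i => (k i : ℕ))) := fun k => by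
    simp only [hF]
    rw [Q.classFactor_eq hm (fun i => isPrimitiveRoot_expi (hmd i)) hz]
    ring
  have hc := Q.rayConst_mul hm hδ.1 hz p
  rw [sum_congr rfl fun k _ => hFk k, ← mul_sum, coeff_smul, S,
    coeff_smul, map_sum, hχ, gaussSum]
  simp only [coeff_smul, smul_eq_mul]
  rw [← hI] at hc
  linear_combination ((∏ i, cyclicDilogInvRoot α.den (expi α ^ Q.d i)
        (expi α ^ Q.d i * ((z i ^ (1 / α.den : ℝ) : ℝ) : ℂ))) *
      (∑ k : Fin N → Fin α.den, (expi α ^ (ratMod α.den (Q.quad fun i => ((k i : ℕ) : ℤ))).val *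
        (∏ i, (((z i ^ (1 / α.den : ℝ)) ^ (∑ j, ((k j : ℕ) : ℝ) * (Q.A j i : ℝ)) : ℝ) : ℂ) /
          qPoch (expi α ^ Q.d i * ((z i ^ (1 / α.den : ℝ) : ℝ) : ℂ)) (expi α ^ Q.d i) (k i)) *
        coeff j (Q.gaussI α.den (expi α) z fun i => (k i : ℕ)))) *
      ∑ a : Fin N → Fin δ, G fun i => a i) * hc

theorem den_mul_natCast {α : ℚ} {d : ℕ} (h : α.den.Coprime d) : (α * d).den = α.den := by
  have h1 : α.den.Coprime (α.num * d).natAbs := by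
    rw [Int.natAbs_mul, Int.natAbs_natCast]
    exact α.reduced.symm.mul_right h
  rw [Rat.mul_den, Rat.den_natCast, mul_one, Rat.num_natCast, Nat.Coprime.gcd_eq_one h1.symm, Nat.div_one]

/-- The asymptotic expansion along the positive axis, in the variable `s = √ε`. -/
theorem ray_isBigO {δ : ℕ} (hδ : Q.IsStrongDenominator δ) {α : ℚ}
    (hmδ : α.den.Coprime δ) (hmd : ∀ i, α.den.Coprime (Q.d i))
    (hmb : ∀ i, α.den.Coprime (Q.b i).den) (hmc : α.den.Coprime Q.c.den) {z : Fin N → ℝ}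
    (hz : Q.IsNahmSolution z) (K : ℕ) :
    (fun s : ℝ => cexp (-(Q.Lam z : ℂ) / (α.den * (s ^ 2 : ℝ))) *
        Q.nahmSum (tauOf α (s ^ 2 : ℝ)) - ∑ j ∈ range K,
          coeff j ((((α.den : ℝ) ^ (-(N / 2) : ℝ) : ℝ) * Q.chi α *
            (Q.cConst α.den z : ℂ) * Q.gaussSum δ α) • Q.S α.den (expi α) z) *
          ((s ^ 2 : ℝ) : ℂ) ^ j) =O[𝓝[>] 0] fun s => s ^ (2 * K) := by
  have hm := α.den_pos
  have hden := fun i => den_mul_natCast (hmd i)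
  have hp : ∀ i, expi α ^ Q.d i = expi ((α * Q.d i).num / α.den) := fun i => by
    rw [← expi_nat_mul, ← hden i, ← Rat.cast_def, Rat.cast_mul, Rat.cast_natCast, mul_comm]
  have hpm : ∀ i, IsCoprime (α * Q.d i).num α.den := fun i => by
    rw [← hden i]; exact Rat.isCoprime_num_den _
  have hχ : Q.chi α = ∏ i, expi ((dedekindSum (α * Q.d i).num α.den / 2 : ℚ) : ℂ) :=
    prod_congr rfl fun i _ => by rw [hden i]
  have hζ1 : ‖expi α‖ = 1 := norm_expi_rat α
  have hO := IsBigO.fun_sum (s := univ) fun (l : Fin N → Fin (α.den * δ)) _ =>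
    (Q.tsum_class_isBigO hm hζ1 (fun i => isPrimitiveRoot_expi (hmd i)) hz hp hpm
      (Nat.mul_pos hm hδ.1) (dvd_mul_right _ _) (fun i => l i) (fun i => (l i : ℕ) % α.den)
      (fun i => (Nat.mod_mod _ _).symm) (2 * K)).const_mul_left
      (expi (α * Q.quad fun i => ((l i : ℕ) : ℤ)))
  refine hO.congr' ?_ EventuallyEq.rfl
  filter_upwards [self_mem_nhdsWithin] with s hs
  have hs : 0 < s := hs
  rw [Q.exp_mul_nahmSum_eq hδ hmδ hmb hmc z hs]
  simp only [mul_sub, sum_sub_distrib]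
  congr 1
  simp only [← Q.sum_residues_main_term hδ hmδ hmd hmb hmc hz hχ, Q.sum_range_integral hm _ hz]
  rw [sum_congr rfl fun j _ => sum_mul _ _ _, sum_comm]
  refine sum_congr rfl fun l _ => ?_
  simp only [mul_sum]
  exact sum_congr rfl fun j _ => by ring

theorem differentiableOn_exp_mul_nahmSum (α : ℚ) (z : Fin N → ℝ) :
    DifferentiableOn ℂ (fun ε : ℂ => cexp (-(Q.Lam z : ℂ) / (α.den * ε)) *
      Q.nahmSum (tauOf α ε)) {ε | 0 < ε.re} := by
  have hm0 : (α.den : ℂ) ≠ 0 := by exact_mod_cast α.den_nz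
  have hmap : Set.MapsTo (tauOf α) {ε : ℂ | 0 < ε.re} {τ | 0 < τ.im} := fun ε hε => by
    have hε' : 0 < ε.re := hε
    have := pi_pos
    have : (0 : ℝ) < α.den := by exact_mod_cast α.den_pos
    rw [Set.mem_ofPred_eq, tauOf_im]
    positivity
  have htau : Differentiable ℂ (tauOf α) := by unfold tauOf; fun_prop
  have hexp : DifferentiableOn ℂ (fun ε : ℂ => cexp (-(Q.Lam z : ℂ) / (α.den * ε)))
      {ε | 0 < ε.re} := fun ε hε => by
    have hε0 : ε ≠ 0 := fun h => by simp [h] at hε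
    exact ((differentiableAt_const _).div ((differentiableAt_const _).mul differentiableAt_id)
      (mul_ne_zero hm0 hε0)).cexp.differentiableWithinAt
  exact hexp.mul (Q.differentiableOn_nahmSum.comp htau.differentiableOn hmap)

theorem hasAsymptoticExpansion_nahmSum {δ : ℕ} (hδ : Q.IsStrongDenominator δ) {α : ℚ}
    (hmδ : α.den.Coprime δ) (hmd : ∀ i, α.den.Coprime (Q.d i))
    (hmb : ∀ i, α.den.Coprime (Q.b i).den) (hmc : α.den.Coprime Q.c.den) {z : Fin N → ℝ}
    (hz : Q.IsNahmSolution z) : ∃ η : ℝ, 0 < η ∧ η < π / 2 ∧ HasAsymptoticExpansion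
      (fun ε : ℂ => cexp (-(Q.Lam z : ℂ) / (α.den * ε)) * Q.nahmSum (tauOf α ε))
      (nhdsWithin 0 (sector η)) ((((α.den : ℝ) ^ (-(N / 2) : ℝ) : ℝ) * Q.chi α *
        (Q.cConst α.den z : ℂ) * Q.gaussSum δ α) • Q.S α.den (expi α) z) := by
  obtain ⟨κ, r, C, hκ, hκ1, hr, hC, hbd⟩ := hδ.exists_norm_nahmSum_le hmδ hmd hmb hmc hz
  refine ⟨κ / 16, by positivity, by linarith [Real.pi_gt_three],
    hasAsymptoticExpansion_of_ray (Q.differentiableOn_exp_mul_nahmSum α z) hκ hκ1 hr hC hbd _ fun K => ?_⟩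
  have ht : Tendsto sqrt (𝓝[>] 0) (𝓝[>] 0) := by
    refine tendsto_nhdsWithin_iff.2 ⟨?_, ?_⟩
    · have := Real.continuous_sqrt.tendsto 0
      rw [Real.sqrt_zero] at this
      exact this.mono_left nhdsWithin_le_nhds
    · filter_upwards [self_mem_nhdsWithin] with s hs using Real.sqrt_pos.2 hs
  refine ((Q.ray_isBigO hδ hmδ hmd hmb hmc hz K).comp_tendsto ht).congr' ?_ ?_
  · filter_upwards [self_mem_nhdsWithin] with s hs
    simp only [Function.comp_apply, sq_sqrt (le_of_lt hs)]
  · filter_upwards [self_mem_nhdsWithin] with s hs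
    simp only [Function.comp_apply]
    rw [pow_mul, sq_sqrt (le_of_lt hs)]

end Datum
end Nahm

theorem mainTheorem2 {N : ℕ} (Q : Nahm.Datum N) (δ : ℕ) (hδ : Q.IsStrongDenominator δ)
    (α : ℚ) (hmδ : α.den.Coprime δ) (hmd : ∀ i, α.den.Coprime (Q.d i))
    (hmb : ∀ i, α.den.Coprime (Q.b i).den) (hmc : α.den.Coprime Q.c.den) :
    (∀ τ : ℂ, 0 < τ.im → Summable (Q.nahmTerm τ)) ∧
    (∃! z : Fin N → ℝ, Q.IsNahmSolution z) ∧
    ∀ z : Fin N → ℝ, Q.IsNahmSolution z →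
      ∃ η : ℝ, 0 < η ∧ η < Real.pi / 2 ∧
        Nahm.HasAsymptoticExpansion
          (fun ε : ℂ => Complex.exp (-(Q.Lam z : ℂ) / (α.den * ε)) *
            Q.nahmSum (α + Complex.I * ε / (2 * Real.pi * α.den)))
          (nhdsWithin 0 (Nahm.sector η))
          ((((α.den : ℝ) ^ (-(N / 2) : ℝ) : ℝ) * Q.chi α * (Q.cConst α.den z : ℂ) *
              Q.gaussSum δ α) • Q.S α.den (Nahm.expi α) z) := by
  exact ⟨fun τ hτ => Q.summable_nahmTerm hτ, Q.existsUnique_isNahmSolution,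
    fun z hz => Q.hasAsymptoticExpansion_nahmSum hδ hmδ hmd hmb hmc hz⟩
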